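/- Let $n\ge 1$, $p\ge 1$, $\beta>0$. Let $B^n$ be the open unit ball of $\mathbb C^n$, $S=\partial B^n$, $\sigma$ the normalized Lebesgue measure on $S$, $z\overline\zeta=\sum_i z_i\overline{\zeta_i}$, $d(x,y)=|1-x\overline y|$, and $B(x,r)=\{y: d(x,y)<r\}$. **Dimensions and measures.** For $E\subset S$ closed, $x\in E$, $R>0$, $k\ge1$, let $N(x,R,k)$ be the maximal number of points of $E\cap B(x,kR)$ with mutual $d$-distances $\ge R$. Let $\Upsilon(E)$ be the infimum of the $\gamma\in\mathbb R$ for which there is $C$ with $N(x,R,k)\le Ck^\gamma$ for all $x\in E$, $0<R\le kR\le1$, and let $\Lambda(E)$ be the supremum of the $\gamma\in\mathbb R$ for which there is $C>0$ with $N(x,R,k)\ge Ck^\gamma$ for all such $x,R,k$. A Borel probability measure $\mu$ on $E$ lies in $U_\gamma$ if for some $C>0$, $\mu(B(x,kR))\le Ck^\gamma\mu(B(x,R))$ for all $x\in E$, $0<R\le kR\le 1$; it lies in $L_\gamma$ if it lies in some $U_\eta$ and, for some $C>0$, $\mu(B(x,kR))\ge Ck^\gamma\mu(B(x,R))$ for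 all such $x,R,k$. **Hardy–Sobolev space.** $H^p_\beta(B^n)$ is the space of holomorphic $f$ on $B^n$, with homogeneous expansion $f=\sum_k f_k$, such that $R^\beta f=\sum_k (k+1)^\beta f_k$ satisfies $\sup_{0<r<1}\int_S|R^\beta f(r\zeta)|^p\,d\sigma(\zeta)<\infty$. **Nonisotropic derivatives.** Fix, for each $\zeta\in E$, an orthonormal basis $\tau_1(\zeta),\dots,\tau_{n-1}(\zeta)$ of the complex tangent space $\{v: v\overline\zeta=0\}$, depending on $\zeta$ in a Borel way, and let $w_j(z,\zeta)=z\,\overline{\tau_j(\zeta)}$ for $j<n$ and $w_n(z,\zeta)=1-z\overline\zeta$. For a multi-index $\gamma=(\gamma_1,\dots,\gamma_n)$ put $\omega(\gamma)=\gamma_n+\frac12(\gamma_1+\dots+\gamma_{n-1})$. For $f$ holomorphic in $B^n$ and $\zeta\in E$ put $D^\gamma f(\zeta)=\lim_{r\to1^-}\frac{\partial^{|\gamma|}f}{\partial w^\gamma}(r\zeta)$, with the coordinates $w=w(\cdot,\zeta)$, where the limit exists. For a polynomial $P$ in $z$, $D^\gamma P(x)=\frac{\partial^{|\gamma|}P}{\partial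 w^\gamma}(x)$ in the coordinates $w(\cdot,x)$. **Besov space.** Let $\alpha,d\in\mathbb R$. For a family $F=(F_\gamma)_{\omega(\gamma)<\alpha}$ of functions on $E$ put $T^\alpha_yF(z)=\sum_{\omega(\gamma)<\alpha}\frac1{\gamma!}F_\gamma(y)\,w(z,y)^\gamma$. Then $F\in B^p_\alpha(\mu)$ means that the $F_\gamma$ are $\mu$-measurable and $$\sum_{\omega(\gamma)<\alpha}\|F_\gamma\|^p_{L^p(\mu)}+\sum_{\omega(\gamma)<\alpha}\iint_{E\times E}\frac{|F_\gamma(x)-D^\gamma(T^\alpha_yF)(x)|^p}{d(x,y)^{(\alpha-\omega(\gamma))p-d}}\,\frac{d\mu(x)\,d\mu(y)}{\mu(B(x,d(x,y)))^2}<\infty,$$ where the integrand is taken to be $0$ on the diagonal $x=y$, on which its numerator vanishes. **Theorem 3.** Let $E\subset S$ be closed with $\Upsilon(E)<n$, and suppose that the closed interval $\left[\beta-\frac{n-\Lambda(E)}p,\ \beta-\frac{n-\Upsilon(E)}p\right]$ contains no integer multiple of $\frac12$. Let $d\le\Lambda(E)$ and $\Upsilon(E)\le s<n$ be such that $\left[\beta-\frac{n-d}p,\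 \beta-\frac{n-s}p\right]$ also contains no integer multiple of $\frac12$, let $\mu\in U_s\cap L_d$, and let $\alpha=\beta-\frac{n-d}p$. Then for every $f\in H^p_\beta(B^n)$ and every $\gamma$ with $\omega(\gamma)<\alpha$ the limit $D^\gamma f(\zeta)$ exists for $\mu$-almost every $\zeta\in E$, and the jet $(D^\gamma f|_E)_{\omega(\gamma)<\alpha}$ lies in $B^p_\alpha(\mu)$ (with parameter $d$). -/

import Mathlib

open MeasureTheory Filter Topology
open scoped ENNReal

noncomputable section

namespace HardySobolev

/-- The space `ℂⁿ` with its Euclidean norm. In Mathlib `inner ℂ y x = ∑ i, x i * conj (y i)`. -/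
abbrev Cn (n : ℕ) : Type := EuclideanSpace ℂ (Fin n)

/-- The unit sphere `S` of `ℂⁿ`. -/
abbrev unitSphere (n : ℕ) : Set (Cn n) := Metric.sphere (0 : Cn n) 1

/-- The open unit ball of `ℂⁿ`. -/
abbrev unitBall (n : ℕ) : Set (Cn n) := Metric.ball (0 : Cn n) 1

/-! ### The nonisotropic pseudo-metric, dimensions and measures -/

/-- The nonisotropic pseudo-distance `d(x, y) = |1 - x ȳ|`. -/
def nidist {n : ℕ} (x y : Cn n) : ℝ := ‖1 - inner ℂ y x‖

/-- The nonisotropic ball `B(x, r)` in `ℂⁿ`; the ball of `(E, d)` is its trace on `E`. -/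
def niball {n : ℕ} (x : Cn n) (r : ℝ) : Set (Cn n) := {y | nidist x y < r}

/-- `N(x, R, k)`: the maximal number of points of `E ∩ B(x, kR)` with mutual distances `≥ R`. -/
def packingNumber {n : ℕ} (E : Set (Cn n)) (x : Cn n) (R k : ℝ) : ℕ∞ :=
  ⨆ (A : Finset (Cn n))
    (_ : (A : Set (Cn n)) ⊆ E ∩ niball x (k * R) ∧
      (A : Set (Cn n)).Pairwise fun a b => R ≤ nidist a b),
    (A.card : ℕ∞)

/-- The condition `(E, d) ∈ Υ_γ`. -/
def MemUpsilon {n : ℕ} (E : Set (Cn n)) (γ : ℝ) : Prop :=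
  ∃ C : ℝ, ∀ x ∈ E, ∀ R k : ℝ, 0 < R → R ≤ k * R → k * R ≤ 1 →
    (packingNumber E x R k : ℝ≥0∞) ≤ ENNReal.ofReal (C * k ^ γ)

/-- The upper dimension `Υ(E)`. -/
def upperDim {n : ℕ} (E : Set (Cn n)) : ℝ := sInf {γ : ℝ | MemUpsilon E γ}

/-- The condition `(E, d) ∈ Λ_γ`. -/
def MemLambda {n : ℕ} (E : Set (Cn n)) (γ : ℝ) : Prop :=
  ∃ C : ℝ, 0 < C ∧ ∀ x ∈ E, ∀ R k : ℝ, 0 < R → R ≤ k * R → k * R ≤ 1 →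
    ENNReal.ofReal (C * k ^ γ) ≤ (packingNumber E x R k : ℝ≥0∞)

/-- The lower dimension `Λ(E)`. -/
def lowerDim {n : ℕ} (E : Set (Cn n)) : ℝ := sSup {γ : ℝ | MemLambda E γ}

/-- `μ` is a probability measure on `E`, seen as a Borel measure on `ℂⁿ` carried by `E`. -/
structure IsProbabilityOn {n : ℕ} (E : Set (Cn n)) (μ : Measure (Cn n)) : Prop where
  isProb : IsProbabilityMeasure μ
  carried : μ Eᶜ = 0

/-- `μ ∈ U_γ(E, d)`. -/
def MemU {n : ℕ} (E : Set (Cn n)) (γ : ℝ) (μ : Measure (Cn n)) : Prop :=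
  IsProbabilityOn E μ ∧
  ∃ C : ℝ, 0 < C ∧ ∀ x ∈ E, ∀ R k : ℝ, 0 < R → R ≤ k * R → k * R ≤ 1 →
    μ.real (niball x (k * R)) ≤ C * k ^ γ * μ.real (niball x R)

/-- `μ ∈ L_γ(E, d)`: a doubling probability measure (that is, one lying in some `U_η`)
satisfying the reverse growth inequality. -/
def MemL {n : ℕ} (E : Set (Cn n)) (γ : ℝ) (μ : Measure (Cn n)) : Prop :=
  (∃ η : ℝ, MemU E η μ) ∧
  ∃ C : ℝ, 0 < C ∧ ∀ x ∈ E, ∀ R k : ℝ, 0 < R → R ≤ k * R → k * R ≤ 1 →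
    C * k ^ γ * μ.real (niball x R) ≤ μ.real (niball x (k * R))

/-! ### Hardy-Sobolev spaces -/

/-- The normalized Lebesgue measure `σ` on the unit sphere. -/
def sphereMeasure (n : ℕ) : Measure (unitSphere n) :=
  ((volume : Measure (Cn n)).toSphere Set.univ)⁻¹ • (volume : Measure (Cn n)).toSphere

/-- The `k`-homogeneous term `f_k` of the homogeneous expansion of `f` at the origin. -/
def homogPart {n : ℕ} (f : Cn n → ℂ) (k : ℕ) (z : Cn n) : ℂ :=
  ((k.factorial : ℂ))⁻¹ * iteratedFDeriv ℂ k f 0 (fun _ => z)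

/-- The fractional radial derivative `R^β f = ∑ (k+1)^β f_k`. -/
def radialDeriv {n : ℕ} (β : ℝ) (f : Cn n → ℂ) (z : Cn n) : ℂ :=
  ∑' k : ℕ, (((k : ℝ) + 1) ^ β : ℝ) * homogPart f k z

/-- The `p`-th power of the norm of `H^p_β(Bⁿ)`. -/
def hardySobolevEnergy {n : ℕ} (p β : ℝ) (f : Cn n → ℂ) : ℝ≥0∞ :=
  ⨆ r ∈ Set.Ioo (0 : ℝ) 1,
    ∫⁻ ζ : unitSphere n, ‖radialDeriv β f (r • (ζ : Cn n))‖ₑ ^ p ∂(sphereMeasure n)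

/-- `f ∈ H^p_β(Bⁿ)`. -/
def MemHardySobolev {n : ℕ} (p β : ℝ) (f : Cn n → ℂ) : Prop :=
  DifferentiableOn ℂ f (unitBall n) ∧ hardySobolevEnergy p β f < ∞

/-! ### Nonisotropic derivatives and Taylor polynomials -/

/-- Multi-indices `γ = (γ₁, …, γₙ)`, written as `((γ₁, …, γₙ₋₁), γₙ)`. -/
abbrev MultiIndex (n : ℕ) : Type := (Fin (n - 1) → ℕ) × ℕ

/-- The weight `ω(γ) = γₙ + (γ₁ + ⋯ + γₙ₋₁) / 2`. -/
def weight {n : ℕ} (γ : MultiIndex n) : ℝ := (γ.2 : ℝ) + (∑ j, (γ.1 j : ℝ)) / 2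

/-- `γ! = γ₁! ⋯ γₙ!`. -/
def multiFactorial {n : ℕ} (γ : MultiIndex n) : ℕ :=
  (∏ j, (γ.1 j).factorial) * γ.2.factorial

lemma finite_weight_lt (n : ℕ) (α : ℝ) : {γ : MultiIndex n | weight γ < α}.Finite := by
  obtain ⟨N, hN⟩ := exists_nat_gt (2 * α)
  refine Set.Finite.subset ((Set.Finite.pi' fun _ : Fin (n - 1) => Set.finite_Iic N).prod
    (Set.finite_Iic N)) ?_
  rintro ⟨a, b⟩ h
  change (b : ℝ) + (∑ j, (a j : ℝ)) / 2 < α at h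
  have h0 : (0 : ℝ) ≤ ∑ j, (a j : ℝ) := Finset.sum_nonneg fun _ _ => Nat.cast_nonneg _
  have hb : (0 : ℝ) ≤ b := Nat.cast_nonneg _
  refine Set.mem_prod.2 ⟨fun j => Set.mem_Iic.2 ?_, Set.mem_Iic.2 ?_⟩
  · have h1 : (a j : ℝ) ≤ ∑ j, (a j : ℝ) :=
      Finset.single_le_sum (f := fun j => (a j : ℝ)) (fun _ _ => Nat.cast_nonneg _)
        (Finset.mem_univ j)
    have : (a j : ℝ) ≤ N := by linarith
    exact_mod_cast this
  · have : (b : ℝ) ≤ N := by linarith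
    exact_mod_cast this

/-- The finite set of multi-indices of weight `< α`. -/
def indices (n : ℕ) (α : ℝ) : Finset (MultiIndex n) := (finite_weight_lt n α).toFinset

/-- A Borel choice, for each `ζ ∈ E`, of an orthonormal basis `τ₁(ζ), …, τₙ₋₁(ζ)` of the complex
tangent space `{v | v ζ̄ = 0}`. -/
structure IsTangentFrame {n : ℕ} (E : Set (Cn n)) (τ : Fin (n - 1) → Cn n → Cn n) : Prop where
  measurable : ∀ j, Measurable (τ j)
  orthonormal : ∀ ζ ∈ E, Orthonormal ℂ fun j => τ j ζ
  tangent : ∀ ζ ∈ E, ∀ j, inner ℂ ζ (τ j ζ) = 0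

/-- The monomial `w(z, ζ)^γ` in the coordinates `w_j(z, ζ) = z · conj (τ_j(ζ))` for `j < n` and
`w_n(z, ζ) = 1 - z ζ̄`. -/
def wMonomial {n : ℕ} (τ : Fin (n - 1) → Cn n → Cn n) (γ : MultiIndex n) (z ζ : Cn n) : ℂ :=
  (∏ j, (inner ℂ (τ j ζ) z) ^ γ.1 j) * (1 - inner ℂ ζ z) ^ γ.2

/-- The complex derivative of `g` in the direction `v`. -/
def dirDeriv {n : ℕ} (v : Cn n) (g : Cn n → ℂ) : Cn n → ℂ := fun z => fderiv ℂ g z v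

/-- `∂^{|γ|} g / ∂w^γ` in the coordinates `w(·, ζ)`. As
`z = ∑ w_j τ_j(ζ) + (1 - w_n) ζ`, one has `∂/∂w_j = ∂_{τ_j(ζ)}` for `j < n` and
`∂/∂w_n = ∂_{-ζ}`. -/
def wDeriv {n : ℕ} (τ : Fin (n - 1) → Cn n → Cn n) (ζ : Cn n) (γ : MultiIndex n)
    (g : Cn n → ℂ) : Cn n → ℂ :=
  (dirDeriv (-ζ))^[γ.2]
    ((List.finRange (n - 1)).foldr (fun j h => (dirDeriv (τ j ζ))^[γ.1 j] h) g)

/-- The nonisotropic derivative `D^γ f(ζ) = lim_{r → 1} (∂^{|γ|} f / ∂w^γ)(rζ)` at a point `ζ` of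
the sphere. -/
def boundaryDeriv {n : ℕ} (τ : Fin (n - 1) → Cn n → Cn n) (f : Cn n → ℂ) (γ : MultiIndex n)
    (ζ : Cn n) : ℂ :=
  limUnder (𝓝[<] (1 : ℝ)) fun r : ℝ => wDeriv τ ζ γ f (r • ζ)

/-- The nonisotropic Taylor polynomial `T_y^α F(z) = ∑_{ω(γ) < α} F_γ(y) w(z, y)^γ / γ!` of a jet
`F`. -/
def taylorPoly {n : ℕ} (τ : Fin (n - 1) → Cn n → Cn n) (α : ℝ) (F : MultiIndex n → Cn n → ℂ)
    (y z : Cn n) : ℂ :=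
  ∑ γ ∈ indices n α, ((multiFactorial γ : ℂ))⁻¹ * F γ y * wMonomial τ γ z y

/-! ### Besov spaces of jets -/

/-- `μ[x, y] = μ(B(x, d(x, y)))`. -/
def muBracket {n : ℕ} (μ : Measure (Cn n)) (x y : Cn n) : ℝ≥0∞ := μ (niball x (nidist x y))

/-- The `p`-th power of the norm of `B^p_α(μ)`. The integrand vanishes on the diagonal, because
`D^γ (T_x^α F)(x) = F_γ(x)` and `0 / 0 = 0` in `ℝ≥0∞`. -/
def besovEnergy {n : ℕ} (E : Set (Cn n)) (τ : Fin (n - 1) → Cn n → Cn n) (p α d : ℝ)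
    (μ : Measure (Cn n)) (F : MultiIndex n → Cn n → ℂ) : ℝ≥0∞ :=
  (∑ γ ∈ indices n α, ∫⁻ x in E, ‖F γ x‖ₑ ^ p ∂μ) +
  ∑ γ ∈ indices n α, ∫⁻ q in E ×ˢ E,
    (‖F γ q.1 - wDeriv τ q.1 γ (taylorPoly τ α F q.2) q.1‖ₑ ^ p
      / ENNReal.ofReal (nidist q.1 q.2) ^ ((α - weight γ) * p - d)
      / muBracket μ q.1 q.2 ^ 2) ∂(μ.prod μ)

/-- The jet `(F_γ)_{ω(γ) < α}` lies in `B^p_α(μ)`; only the `F_γ` with `ω(γ) < α` matter. -/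
def MemBesov {n : ℕ} (E : Set (Cn n)) (τ : Fin (n - 1) → Cn n → Cn n) (p α d : ℝ)
    (μ : Measure (Cn n)) (F : MultiIndex n → Cn n → ℂ) : Prop :=
  (∀ γ ∈ indices n α, AEStronglyMeasurable (F γ) μ) ∧ besovEnergy E τ p α d μ F < ∞

end HardySobolev

end

open HardySobolev

namespace HardySobolev

/-! ### Calculus of holomorphic functions on open subsets of ℂⁿ -/

noncomputable section

open Metric Complex

variable {n : ℕ}

/-! ### Holomorphic functions of several variables -/

/-! Put g = R^β f. Inside the ball f(z) = Γ(β)⁻¹ ∫₀^∞ t^{β-1} e^{-t} g(e^{-t}z) dt, and cutting the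
t-axis dyadically writes f as a sum of pieces f_j (`scalePiece`) coming from t ≈ 2^{-j}. The piece
f_j is holomorphic beyond the sphere, on the ball of radius 1 + 2^{-j}/4. On nonisotropic boxes of
size ≈ 2^{-j/2} centred on the radius to x it is bounded by 2^{-jβ} M_j(x), where M_j(x) (`sumMax`)
controls |g| on the approach region of x down to height ≈ 2^{-j} (`exists_enorm_scalePiece_le`).

Let m be the integer for which ω(γ) < α means 2ω(γ) ≤ m. Cauchy's estimates on boxes, and Schwarz's
lemma along curves on which the normal coordinate has degree 2 and the tangential ones degree 1,
bound the Taylor remainder of f_j between points x, y at distance ≈ 2^{-i} by a constant times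
2^{i(ω(γ)-β)} k(i,j) (M_j(x) + M_j(y)). Here k(i,j) is 2^{-(j-i)(β-m/2)} for j ≥ i and
2^{(i-j)(β-(m+1)/2)} for j < i (`exists_enorm_remainder_scalePiece_le`).

At distance ≈ 2^{-i} all powers of 2^{-i} in the Besov integrand combine into the weight v_i(x) =
2^{-in}/μ(B(x,2^{-i})), whatever γ is. Since μ ∈ U_s ∩ L_d, over e scales v decays at least like
2^{-e(n-s)} and at most like 2^{-e(n-d)}. Because the interval [β-(n-d)/p, β-(n-s)/p] contains no
half-integer, m/2 < β-(n-d)/p and β-(n-s)/p < (m+1)/2. This is exactly what makes k, conjugated by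
v^{1/p}, decay exponentially off the diagonal, so that Young's inequality gives Σ_i v_i (Σ_j k(i,j)
M_j)^p ≤ C Σ_j v_j M_j^p (`IsRegular.exists_tsum_scaleKernel_le`).

It remains to integrate the right side against μ. Subharmonicity bounds local maxima of |g| by
averages of its radial maximal function over balls of the sphere. As s < n, the points of the sphere
close to the carrier of μ are so few that the sum over all scales converges
(`IsRegular.exists_tsum_localMax_le`). The radial maximal theorem (`lintegral_radialMax_le`) is
proved on slices by complex lines, where it follows from an L² bound for Poisson kernels of variable
radius. Finiteness of these integrals also makes Σ_j D^γ f_j(x) converge absolutely for almost every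
x, which yields the radial limits (`exists_hasSum_boundaryDeriv`). -/

lemma norm_fderiv_le_of_forall_norm_le {f : Cn n → ℂ} {c : Cn n} {R M : ℝ} (hR : 0 < R)
    (hd : DifferentiableOn ℂ f (ball c R)) (hM : ∀ z ∈ ball c R, ‖f z‖ ≤ M) :
    ‖fderiv ℂ f c‖ ≤ 2 * M / R := by
  refine Complex.norm_fderiv_le_div_of_mapsTo_ball hd (fun z hz => ?_) hR
  rw [mem_closedBall, dist_eq_norm]
  calc ‖f z - f c‖ ≤ ‖f z‖ + ‖f c‖ := norm_sub_le _ _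
    _ ≤ 2 * M := by linarith [hM z hz, hM c (mem_ball_self hR)]

lemma hasDerivAt_comp_line {f : Cn n → ℂ} {z v : Cn n} {w : ℂ}
    (hf : DifferentiableAt ℂ f (z + w • v)) :
    HasDerivAt (fun w : ℂ => f (z + w • v)) (dirDeriv v f (z + w • v)) w := by
  have h : HasDerivAt (fun w : ℂ => z + w • v) v w := by
    simpa using ((hasDerivAt_id w).smul_const v).const_add z
  exact hf.hasFDerivAt.comp_hasDerivAt w h

lemma dirDeriv_eq_deriv_line {f : Cn n → ℂ} {z v : Cn n} (hf : DifferentiableAt ℂ f z) :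
    dirDeriv v f z = deriv (fun w : ℂ => f (z + w • v)) 0 := by
  have := (hasDerivAt_comp_line (f := f) (z := z) (v := v) (w := 0) (by simpa using hf)).deriv
  simpa using this.symm

lemma differentiableOn_comp_line {f : Cn n → ℂ} {U : Set (Cn n)} (hU : IsOpen U)
    (hf : DifferentiableOn ℂ f U) (z v : Cn n) :
    DifferentiableOn ℂ (fun w : ℂ => f (z + w • v)) {w | z + w • v ∈ U} := fun _ hw =>
  (hasDerivAt_comp_line (hf.differentiableAt (hU.mem_nhds hw))).differentiableAt
    |>.differentiableWithinAt

/-- Cauchy's estimate uses only the complex line through `z` in the direction `v`. Each direction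
may thus have its own radius, as the nonisotropic boxes require. -/
lemma norm_dirDeriv_le {f : Cn n → ℂ} {U : Set (Cn n)} (hU : IsOpen U)
    (hf : DifferentiableOn ℂ f U) {z v : Cn n} {r M : ℝ} (hr : 0 < r)
    (hz : ∀ w : ℂ, ‖w‖ < r → z + w • v ∈ U ∧ ‖f (z + w • v)‖ ≤ M) :
    ‖dirDeriv v f z‖ ≤ M / r := by
  have hz0 : z ∈ U := by simpa using (hz 0 (by simpa using hr)).1
  rw [dirDeriv_eq_deriv_line (hf.differentiableAt (hU.mem_nhds hz0))]
  have key : ∀ ρ ∈ Set.Ioo 0 r, ‖deriv (fun w : ℂ => f (z + w • v)) 0‖ ≤ M / ρ := by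
    intro ρ hρ
    refine Complex.norm_deriv_le_of_forall_mem_sphere_norm_le hρ.1 ?_ ?_
    · refine DifferentiableOn.diffContOnCl
        ((differentiableOn_comp_line hU hf z v).mono fun w hw => (hz w ?_).1)
      have := closure_ball_subset_closedBall hw
      rw [mem_closedBall_zero_iff] at this
      exact this.trans_lt hρ.2
    · intro w hw
      rw [mem_sphere_zero_iff_norm] at hw
      exact (hz w (hw.trans_lt hρ.2)).2
  have ht : Tendsto (fun ρ : ℝ => M / ρ) (𝓝[<] r) (𝓝 (M / r)) :=
    ((continuousAt_const.div continuousAt_id hr.ne').tendsto).mono_left nhdsWithin_le_nhds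
  exact ge_of_tendsto ht (by
    filter_upwards [Ioo_mem_nhdsLT hr] with ρ hρ using key ρ hρ)

/-- Cauchy's formula on the disc w ↦ x + w•v writes the directional derivative as a circle integral
of translates of `f` against a kernel independent of x. One may differentiate under the integral
sign, since Schwarz's lemma bounds `fderiv ℂ f` uniformly near `x₀`. -/
lemma dirDeriv_differentiableOn {f : Cn n → ℂ} {U : Set (Cn n)} (hU : IsOpen U)
    (hf : DifferentiableOn ℂ f U) (v : Cn n) : DifferentiableOn ℂ (dirDeriv v f) U := by
  intro x₀ hx₀
  obtain ⟨ρ, hρ, hball, hM⟩ : ∃ ρ > 0, ball x₀ (3 * ρ) ⊆ U ∧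
      ∀ z ∈ ball x₀ (3 * ρ), ‖f z‖ ≤ ‖f x₀‖ + 1 := by
    have h1 : ∀ᶠ z in 𝓝 x₀, ‖f z‖ < ‖f x₀‖ + 1 :=
      (hf.continuousOn.continuousAt (hU.mem_nhds hx₀)).norm.eventually_lt_const (by linarith)
    obtain ⟨ε, hε, h⟩ := Metric.eventually_nhds_iff_ball.1 (h1.and (hU.mem_nhds hx₀))
    refine ⟨ε / 3, by positivity, fun z hz => (h z ?_).2, fun z hz => (h z ?_).1.le⟩ <;>
    · convert hz using 2; ring
  set M := ‖f x₀‖ + 1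
  have hM0 : 0 ≤ M := by positivity
  set r := ρ / (‖v‖ + 1)
  have hr : 0 < r := by positivity
  have hrv : r * ‖v‖ ≤ ρ := by
    rw [div_mul_eq_mul_div, div_le_iff₀ (by positivity)]
    nlinarith [norm_nonneg v]
  have hin : ∀ x ∈ ball x₀ ρ, ∀ w : ℂ, ‖w‖ ≤ r → x + w • v ∈ ball x₀ (2 * ρ) := by
    intro x hx w hw
    rw [mem_ball_iff_norm] at hx ⊢
    calc ‖x + w • v - x₀‖ = ‖(x - x₀) + w • v‖ := by congr 1; abel
      _ ≤ ‖x - x₀‖ + ‖w‖ * ‖v‖ := (norm_add_le _ _).trans_eq (by rw [norm_smul])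
      _ ≤ ‖x - x₀‖ + r * ‖v‖ := by gcongr
      _ < 2 * ρ := by linarith
  have h23 : ball x₀ (2 * ρ) ⊆ ball x₀ (3 * ρ) := ball_subset_ball (by linarith)
  have hcm : ∀ θ : ℝ, ‖circleMap 0 r θ‖ ≤ r := fun θ => by simp [abs_of_pos hr]
  let k : ℝ → ℂ := fun θ => (2 * Real.pi * I : ℂ)⁻¹ * (circleMap 0 r θ * I *
    ((circleMap 0 r θ) ^ 2)⁻¹)
  have hcne : ∀ θ : ℝ, circleMap 0 r θ ≠ 0 := fun θ => circleMap_ne_center hr.ne'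
  have hk : Continuous k := by
    refine continuous_const.mul (((continuous_circleMap 0 r).mul continuous_const).mul
      (((continuous_circleMap 0 r).pow 2).inv₀ fun θ => pow_ne_zero _ (hcne θ)))
  have hrep : ∀ x ∈ ball x₀ ρ, dirDeriv v f x =
      ∫ θ in Set.Ioc 0 (2 * Real.pi), k θ * f (x + circleMap 0 r θ • v) := by
    intro x hx
    have hxU : x ∈ U := hball (h23 (by simpa using hin x hx 0 (by simpa using hr.le)))
    rw [dirDeriv_eq_deriv_line (hf.differentiableAt (hU.mem_nhds hxU))]
    have hopen : IsOpen {w : ℂ | x + w • v ∈ U} := hU.preimage (by fun_prop)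
    rw [← Complex.cderiv_eq_deriv hopen (differentiableOn_comp_line hU hf x v) hr
      (fun w hw => hball (h23 (hin x hx w (by simpa using hw))))]
    rw [Complex.cderiv, circleIntegral, intervalIntegral.integral_of_le (by positivity),
      smul_eq_mul, ← integral_const_mul]
    refine integral_congr_ae (Eventually.of_forall fun θ => ?_)
    simp only [k, deriv_circleMap, smul_eq_mul, sub_zero]
    ring
  have hfd : ∀ x ∈ ball x₀ ρ, ∀ θ : ℝ, ‖fderiv ℂ f (x + circleMap 0 r θ • v)‖ ≤ 2 * M / ρ := by
    intro x hx θ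
    have hb : ball (x + circleMap 0 r θ • v) ρ ⊆ ball x₀ (3 * ρ) := by
      refine ball_subset_ball' ?_
      have := hin x hx _ (hcm θ)
      rw [mem_ball] at this
      linarith
    exact norm_fderiv_le_of_forall_norm_le hρ (hf.mono (hb.trans hball)) fun z hz => hM z (hb hz)
  have hdiff : HasFDerivAt
      (fun x => ∫ θ in Set.Ioc 0 (2 * Real.pi), k θ * f (x + circleMap 0 r θ • v))
      (∫ θ in Set.Ioc 0 (2 * Real.pi), k θ • fderiv ℂ f (x₀ + circleMap 0 r θ • v)) x₀ := by
    have hcont : ∀ x ∈ ball x₀ ρ, Continuous fun θ : ℝ => k θ * f (x + circleMap 0 r θ • v) := by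
      intro x hx
      refine hk.mul (continuous_iff_continuousAt.2 fun θ => ?_)
      have : ContinuousAt f (x + circleMap 0 r θ • v) := hf.continuousOn.continuousAt
        (hU.mem_nhds (hball (h23 (hin x hx _ (hcm θ)))))
      exact ContinuousAt.comp (g := f) (f := fun θ : ℝ => x + circleMap 0 r θ • v) this
        (by have := continuous_circleMap 0 r; fun_prop)
    refine hasFDerivAt_integral_of_dominated_of_fderiv_le (𝕜 := ℂ) (s := ball x₀ ρ)
      (F' := fun x θ => k θ • fderiv ℂ f (x + circleMap 0 r θ • v))
      (bound := fun θ => ‖k θ‖ * (2 * M / ρ)) (ball_mem_nhds _ hρ) ?_ ?_ ?_ ?_ ?_ ?_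
    · filter_upwards [ball_mem_nhds x₀ hρ] with x hx using (hcont x hx).aestronglyMeasurable
    · exact (hcont x₀ (mem_ball_self hρ)).integrableOn_Ioc
    · refine (hk.aestronglyMeasurable).smul ?_
      refine ((measurable_fderiv ℂ f).comp ?_).aestronglyMeasurable
      have := (continuous_circleMap 0 r)
      exact Continuous.measurable (by fun_prop)
    · refine Eventually.of_forall fun θ x hx => ?_
      rw [norm_smul]
      gcongr
      exact hfd x hx θ
    · exact ((hk.norm).mul continuous_const).integrableOn_Ioc
    · refine Eventually.of_forall fun θ x hx => ?_
      have hfx : HasFDerivAt f (fderiv ℂ f (x + circleMap 0 r θ • v)) (x + circleMap 0 r θ • v) :=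
        (hf.differentiableAt (hU.mem_nhds (hball (h23 (hin x hx _ (hcm θ)))))).hasFDerivAt
      exact ((hasFDerivAt_comp_add_right (circleMap 0 r θ • v)).2 hfx).const_smul (k θ)
  refine DifferentiableAt.differentiableWithinAt ?_
  refine hdiff.differentiableAt.congr_of_eventuallyEq ?_
  filter_upwards [ball_mem_nhds x₀ hρ] with x hx using hrep x hx

lemma contDiffOn_of_differentiableOn {U : Set (Cn n)} (hU : IsOpen U) (k : ℕ) :
    ∀ {f : Cn n → ℂ}, DifferentiableOn ℂ f U → ContDiffOn ℂ k f U := by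
  induction k with
  | zero => intro f hf; exact contDiffOn_zero.2 hf.continuousOn
  | succ k ih =>
    intro f hf
    rw [Nat.cast_succ, contDiffOn_succ_iff_fderiv_of_isOpen hU]
    refine ⟨hf, by simp, contDiffOn_clm_apply.2 fun v => ih (dirDeriv_differentiableOn hU hf v)⟩

lemma dirDeriv_comm {f : Cn n → ℂ} {U : Set (Cn n)} (hU : IsOpen U)
    (hf : DifferentiableOn ℂ f U) (v w : Cn n) {z : Cn n} (hz : z ∈ U) :
    dirDeriv v (dirDeriv w f) z = dirDeriv w (dirDeriv v f) z := by
  have hc : ContDiffAt ℂ 2 f z :=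
    (contDiffOn_of_differentiableOn hU 2 hf).contDiffAt (hU.mem_nhds hz)
  have hs : IsSymmSndFDerivAt ℂ f z := hc.isSymmSndFDerivAt (by simp)
  have hd : DifferentiableAt ℂ (fderiv ℂ f) z :=
    (hc.fderiv_right (m := 1) (by norm_num)).differentiableAt (by norm_num)
  have e : ∀ v w : Cn n, dirDeriv v (dirDeriv w f) z = fderiv ℂ (fderiv ℂ f) z v w := by
    intro v w
    change fderiv ℂ (fun y => fderiv ℂ f y w) z v = _
    rw [fderiv_clm_apply hd (differentiableAt_const w)]
    simp
  rw [e, e]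
  exact hs v w

lemma dirDeriv_congr {f g : Cn n → ℂ} {U : Set (Cn n)} (hU : IsOpen U)
    (h : Set.EqOn f g U) (v : Cn n) : Set.EqOn (dirDeriv v f) (dirDeriv v g) U := by
  intro z hz
  simp only [dirDeriv]
  rw [(h.eventuallyEq_of_mem (hU.mem_nhds hz)).fderiv_eq]

/-! ### Iterated directional derivatives -/

/-- The iterated directional derivative along a list of directions. -/
def derivList (l : List (Cn n)) (f : Cn n → ℂ) : Cn n → ℂ := l.foldr dirDeriv f

@[simp] lemma derivList_nil (f : Cn n → ℂ) : derivList [] f = f := rfl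

@[simp] lemma derivList_cons (v : Cn n) (l : List (Cn n)) (f : Cn n → ℂ) :
    derivList (v :: l) f = dirDeriv v (derivList l f) := rfl

lemma derivList_append (l l' : List (Cn n)) (f : Cn n → ℂ) :
    derivList (l ++ l') f = derivList l (derivList l' f) := by
  simp [derivList, List.foldr_append]

lemma derivList_replicate (k : ℕ) (v : Cn n) (f : Cn n → ℂ) :
    derivList (List.replicate k v) f = (dirDeriv v)^[k] f := by
  induction k with
  | zero => rfl
  | succ k ih => rw [List.replicate_succ, derivList_cons, ih, Function.iterate_succ_apply']

lemma derivList_differentiableOn {f : Cn n → ℂ} {U : Set (Cn n)} (hU : IsOpen U)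
    (hf : DifferentiableOn ℂ f U) (l : List (Cn n)) : DifferentiableOn ℂ (derivList l f) U := by
  induction l with
  | nil => exact hf
  | cons v l ih => exact dirDeriv_differentiableOn hU ih v

lemma derivList_congr {f g : Cn n → ℂ} {U : Set (Cn n)} (hU : IsOpen U)
    (h : Set.EqOn f g U) (l : List (Cn n)) : Set.EqOn (derivList l f) (derivList l g) U := by
  induction l with
  | nil => exact h
  | cons v l ih => exact dirDeriv_congr hU ih v

lemma derivList_perm {f : Cn n → ℂ} {U : Set (Cn n)} (hU : IsOpen U)
    (hf : DifferentiableOn ℂ f U) {l l' : List (Cn n)} (h : l.Perm l') :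
    Set.EqOn (derivList l f) (derivList l' f) U := by
  induction h with
  | nil => exact fun _ _ => rfl
  | cons v _ ih => exact dirDeriv_congr hU ih v
  | swap v w l => exact fun z hz => dirDeriv_comm hU (derivList_differentiableOn hU hf l) _ _ hz
  | trans _ _ ih₁ ih₂ => exact ih₁.trans ih₂

lemma derivList_sub {f g : Cn n → ℂ} {U : Set (Cn n)} (hU : IsOpen U)
    (hf : DifferentiableOn ℂ f U) (hg : DifferentiableOn ℂ g U) (l : List (Cn n)) :
    Set.EqOn (derivList l (fun z => f z - g z))
      (fun z => derivList l f z - derivList l g z) U := by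
  induction l with
  | nil => exact fun _ _ => rfl
  | cons v l ih =>
    refine (dirDeriv_congr hU ih v).trans fun z hz => ?_
    have h1 := (derivList_differentiableOn hU hf l).differentiableAt (hU.mem_nhds hz)
    have h2 := (derivList_differentiableOn hU hg l).differentiableAt (hU.mem_nhds hz)
    simp only [derivList_cons, dirDeriv]
    rw [fderiv_fun_sub h1 h2]; rfl

lemma derivList_finset_sum {ι : Type*} (s : Finset ι) (c : ι → ℂ) {f : ι → Cn n → ℂ}
    {U : Set (Cn n)} (hU : IsOpen U)
    (hf : ∀ i ∈ s, DifferentiableOn ℂ (f i) U) (l : List (Cn n)) :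
    Set.EqOn (derivList l (fun z => ∑ i ∈ s, c i * f i z))
      (fun z => ∑ i ∈ s, c i * derivList l (f i) z) U := by
  induction l with
  | nil => exact fun _ _ => rfl
  | cons v l ih =>
    refine (dirDeriv_congr hU ih v).trans fun z hz => ?_
    have h1 : ∀ i ∈ s, DifferentiableAt ℂ (derivList l (f i)) z := fun i hi =>
      (derivList_differentiableOn hU (hf i hi) l).differentiableAt (hU.mem_nhds hz)
    simp only [derivList_cons, dirDeriv]
    rw [fderiv_fun_sum fun i hi => (h1 i hi).const_mul (c i)]
    simp only [sum_apply]
    refine Finset.sum_congr rfl fun i hi => ?_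
    rw [fderiv_const_mul (h1 i hi)]
    rfl

/-! ### Termwise differentiation -/

/-- Normal convergence on compact subsets of the ball of radius `R`. -/
def NormallySummable (u : ℕ → Cn n → ℂ) (R : ℝ) : Prop :=
  ∀ r < R, ∃ b : ℕ → ℝ, Summable b ∧ ∀ k, ∀ z ∈ ball (0 : Cn n) r, ‖u k z‖ ≤ b k

lemma NormallySummable.summable {u : ℕ → Cn n → ℂ} {R : ℝ} (h : NormallySummable u R)
    {z : Cn n} (hz : z ∈ ball (0 : Cn n) R) : Summable fun k => u k z := by
  rw [mem_ball_zero_iff] at hz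
  obtain ⟨r, hr, hrR⟩ := exists_between hz
  obtain ⟨b, hb, hub⟩ := h r hrR
  exact Summable.of_norm_bounded hb fun k => hub k z (by simpa using hr)

lemma NormallySummable.norm_fderiv_le {u : ℕ → Cn n → ℂ} {R : ℝ} (h : NormallySummable u R)
    (hu : ∀ k, DifferentiableOn ℂ (u k) (ball 0 R)) :
    ∀ r < R, ∃ b : ℕ → ℝ, Summable b ∧ ∀ k, ∀ z ∈ ball (0 : Cn n) r, ‖fderiv ℂ (u k) z‖ ≤ b k := by
  intro r hr
  obtain ⟨r', hr', hr'R⟩ := exists_between hr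
  obtain ⟨b, hb, hub⟩ := h r' hr'R
  refine ⟨fun k => 2 * b k / (r' - r), (hb.mul_left 2).div_const _, fun k z hz => ?_⟩
  have hsub : ball z (r' - r) ⊆ ball 0 r' := by
    refine ball_subset_ball' ?_
    rw [mem_ball] at hz
    linarith
  exact norm_fderiv_le_of_forall_norm_le (sub_pos.2 hr')
    ((hu k).mono (hsub.trans (ball_subset_ball hr'R.le))) fun w hw => hub k w (hsub hw)

lemma NormallySummable.dirDeriv {u : ℕ → Cn n → ℂ} {R : ℝ} (h : NormallySummable u R)
    (hu : ∀ k, DifferentiableOn ℂ (u k) (ball 0 R)) (v : Cn n) :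
    NormallySummable (fun k => dirDeriv v (u k)) R := by
  intro r hr
  obtain ⟨b, hb, hub⟩ := h.norm_fderiv_le hu r hr
  refine ⟨fun k => b k * ‖v‖, hb.mul_right _, fun k z hz => ?_⟩
  exact (ContinuousLinearMap.le_opNorm _ _).trans 
    (mul_le_mul_of_nonneg_right (hub k z hz) (norm_nonneg _))

lemma NormallySummable.hasFDerivAt_tsum {u : ℕ → Cn n → ℂ} {R : ℝ} (h : NormallySummable u R)
    (hu : ∀ k, DifferentiableOn ℂ (u k) (ball 0 R)) {z : Cn n} (hz : z ∈ ball (0 : Cn n) R) :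
    HasFDerivAt (fun z => ∑' k, u k z) (∑' k, fderiv ℂ (u k) z) z := by
  have hz' := hz
  rw [mem_ball_zero_iff] at hz'
  obtain ⟨r, hr, hrR⟩ := exists_between hz'
  obtain ⟨b, hb, hub⟩ := h.norm_fderiv_le hu r hrR
  have hzr : z ∈ ball (0 : Cn n) r := by simpa using hr
  exact hasFDerivAt_tsum_of_isPreconnected hb isOpen_ball (convex_ball _ _).isPreconnected
    (fun k y hy => ((hu k).differentiableAt (isOpen_ball.mem_nhds
      (ball_subset_ball hrR.le hy))).hasFDerivAt) hub hzr (h.summable hz) hzr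

lemma NormallySummable.differentiableOn_tsum {u : ℕ → Cn n → ℂ} {R : ℝ}
    (h : NormallySummable u R) (hu : ∀ k, DifferentiableOn ℂ (u k) (ball 0 R)) :
    DifferentiableOn ℂ (fun z => ∑' k, u k z) (ball 0 R) := fun _ hz =>
  (h.hasFDerivAt_tsum hu hz).differentiableAt.differentiableWithinAt

lemma NormallySummable.dirDeriv_tsum {u : ℕ → Cn n → ℂ} {R : ℝ} (h : NormallySummable u R)
    (hu : ∀ k, DifferentiableOn ℂ (u k) (ball 0 R)) (v : Cn n) :
    Set.EqOn (HardySobolev.dirDeriv v fun z => ∑' k, u k z)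
      (fun z => ∑' k, HardySobolev.dirDeriv v (u k) z) (ball 0 R) := by
  intro z hz
  simp only [HardySobolev.dirDeriv]
  rw [(h.hasFDerivAt_tsum hu hz).fderiv]
  have hz' := hz
  rw [mem_ball_zero_iff] at hz'
  obtain ⟨r, hr, hrR⟩ := exists_between hz'
  obtain ⟨b, hb, hub⟩ := h.norm_fderiv_le hu r hrR
  have hs : Summable fun k => fderiv ℂ (u k) z :=
    Summable.of_norm_bounded hb fun k => hub k z (by simpa using hr)
  exact ((ContinuousLinearMap.apply ℂ ℂ v).hasSum hs.hasSum).tsum_eq.symm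

lemma NormallySummable.derivList {u : ℕ → Cn n → ℂ} {R : ℝ} (h : NormallySummable u R)
    (hu : ∀ k, DifferentiableOn ℂ (u k) (ball 0 R)) (l : List (Cn n)) :
    NormallySummable (fun k => derivList l (u k)) R := by
  induction l with
  | nil => exact h
  | cons v l ih => exact ih.dirDeriv (fun k => derivList_differentiableOn isOpen_ball (hu k) l) v

lemma NormallySummable.derivList_tsum {u : ℕ → Cn n → ℂ} {R : ℝ} (h : NormallySummable u R)
    (hu : ∀ k, DifferentiableOn ℂ (u k) (ball 0 R)) (l : List (Cn n)) :
    Set.EqOn (HardySobolev.derivList l fun z => ∑' k, u k z)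
      (fun z => ∑' k, HardySobolev.derivList l (u k) z) (ball 0 R) := by
  induction l with
  | nil => exact fun _ _ => rfl
  | cons v l ih =>
    refine (dirDeriv_congr isOpen_ball ih v).trans ?_
    exact (h.derivList hu l).dirDeriv_tsum
      (fun k => derivList_differentiableOn isOpen_ball (hu k) l) v

end

/-! ### Poisson majorization of |G|^q for holomorphic G and every q > 0 -/

noncomputable section

open Metric Complex Real InnerProductSpace

/-! ### Subharmonicity of powers of the modulus of a holomorphic function -/

lemma poissonKernel_nonneg {w z : ℂ} (hw : ‖w‖ < 1) (hz : ‖z‖ = 1) :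
    0 ≤ poissonKernel 0 w z := by
  rw [poissonKernel_def]
  simp only [sub_zero, hz]
  have : ‖w‖ ^ 2 ≤ 1 := by nlinarith [norm_nonneg w]
  exact div_nonneg (by linarith) (by positivity)

lemma continuousOn_poissonKernel {w : ℂ} (hw : ‖w‖ < 1) :
    ContinuousOn (poissonKernel 0 w) (sphere 0 1) := by
  have : poissonKernel 0 w = fun z => (‖z - 0‖ ^ 2 - ‖w - 0‖ ^ 2) / ‖(z - 0) - (w - 0)‖ ^ 2 := by
    ext z; rfl
  rw [this]
  refine ContinuousOn.div (by fun_prop) (by fun_prop) fun z hz h => ?_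
  have hz' : ‖z‖ = 1 := by simpa using hz
  have : z = w := by simpa [sub_eq_zero] using h
  rw [this] at hz'
  linarith

/-- Without zeros, log‖h‖ is harmonic and equals its Poisson average, and exp is convex. Jensen's
inequality is carried out with the tangent line of exp at q·log‖h w‖, whose Poisson average is
exactly ‖h w‖^q. -/
lemma norm_rpow_le_of_forall_ne_zero {h : ℂ → ℂ} {q : ℝ}
    (hh : AnalyticOnNhd ℂ h (closedBall 0 1)) (h0 : ∀ z ∈ closedBall (0 : ℂ) 1, h z ≠ 0)
    {w : ℂ} (hw : ‖w‖ < 1) :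
    ‖h w‖ ^ q ≤ circleAverage (fun z => poissonKernel 0 w z * ‖h z‖ ^ q) 0 1 := by
  have hwb : w ∈ ball (0 : ℂ) 1 := by simpa using hw
  have hharm : HarmonicOnNhd (fun z => Real.log ‖h z‖) (closedBall 0 1) :=
    fun z hz => (hh z hz).harmonicAt_log_norm (h0 z hz)
  have h1 := hharm.circleAverage_poissonKernel_smul hwb
  have hone : HarmonicOnNhd (fun _ : ℂ => (1 : ℝ)) (closedBall 0 1) :=
    fun z _ => by simp
  have h2 := hone.circleAverage_poissonKernel_smul hwb
  have hcs : ContinuousOn (fun z => ‖h z‖) (sphere (0 : ℂ) 1) :=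
    (hh.continuousOn.mono sphere_subset_closedBall).norm
  have hne : ∀ z ∈ sphere (0 : ℂ) 1, ‖h z‖ ≠ 0 := fun z hz =>
    norm_ne_zero_iff.2 (h0 z (sphere_subset_closedBall hz))
  have hP := continuousOn_poissonKernel hw
  have hlog : ContinuousOn (fun z => Real.log ‖h z‖) (sphere (0 : ℂ) 1) := hcs.log hne
  have hpow : ContinuousOn (fun z => ‖h z‖ ^ q) (sphere (0 : ℂ) 1) :=
    hcs.rpow_const fun z hz => Or.inl (hne z hz)
  set e : ℝ := ‖h w‖ ^ q
  set c : ℝ := Real.log ‖h w‖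
  have hpos : 0 < ‖h w‖ := norm_pos_iff.2 (h0 w (ball_subset_closedBall hwb))
  have hec : e = Real.exp (q * c) := by
    rw [mul_comm]; exact Real.rpow_def_of_pos hpos q
  have hint1 : CircleIntegrable (poissonKernel 0 w • fun z => Real.log ‖h z‖) 0 1 :=
    (hP.smul hlog).circleIntegrable (by norm_num)
  have hint2 : CircleIntegrable (poissonKernel 0 w • fun _ : ℂ => (1 : ℝ)) 0 1 :=
    (hP.smul continuousOn_const).circleIntegrable (by norm_num)
  have key : circleAverage ((e * q) • (poissonKernel 0 w • fun z => Real.log ‖h z‖) +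
      (e * (1 - q * c)) • (poissonKernel 0 w • fun _ : ℂ => (1 : ℝ))) 0 1 = e := by
    rw [circleAverage_add (hint1.const_smul) (hint2.const_smul), circleAverage_smul,
      circleAverage_smul, h1, h2]
    simp only [smul_eq_mul, c]; ring
  rw [← key]
  refine circleAverage_mono ((hint1.const_smul).add (hint2.const_smul))
    ((hP.mul hpow).circleIntegrable (by norm_num)) fun z hz => ?_
  rw [abs_one] at hz
  have hPz := poissonKernel_nonneg hw (by simpa using hz)
  have hzpos : 0 < ‖h z‖ := lt_of_le_of_ne (norm_nonneg _) (hne z hz).symm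
  simp only [Pi.add_apply, Pi.smul_apply, smul_eq_mul, Pi.mul_apply]
  have hexp : e * (1 + q * Real.log ‖h z‖ - q * c) ≤ ‖h z‖ ^ q := by
    rw [Real.rpow_def_of_pos hzpos, hec, show Real.exp (Real.log ‖h z‖ * q) =
      Real.exp (q * c) * Real.exp (q * Real.log ‖h z‖ - q * c) by
        rw [← Real.exp_add]; ring_nf]
    gcongr
    linarith [Real.add_one_le_exp (q * Real.log ‖h z‖ - q * c)]
  nlinarith [mul_le_mul_of_nonneg_left hexp hPz]

/-- Zeros on the circle are admitted by applying the zero-free case to z ↦ h(rz), r < 1, and letting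
r → 1. -/
lemma norm_rpow_le_of_forall_ball_ne_zero {h : ℂ → ℂ} {q : ℝ} (hq : 0 < q)
    (hh : AnalyticOnNhd ℂ h (closedBall 0 1)) (h0 : ∀ z ∈ ball (0 : ℂ) 1, h z ≠ 0)
    {w : ℂ} (hw : ‖w‖ < 1) :
    ‖h w‖ ^ q ≤ circleAverage (fun z => poissonKernel 0 w z * ‖h z‖ ^ q) 0 1 := by
  have hsc : ∀ r ∈ Set.Icc (0 : ℝ) 1, ∀ z ∈ closedBall (0 : ℂ) 1,
      (r : ℂ) * z ∈ closedBall (0 : ℂ) 1 := by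
    intro r hr z hz
    rw [mem_closedBall_zero_iff] at hz ⊢
    rw [norm_mul, Complex.norm_real, Real.norm_of_nonneg hr.1]
    exact mul_le_one₀ hr.2 (norm_nonneg _) hz
  have hlt : ∀ r ∈ Set.Ioo (0 : ℝ) 1,
      ‖h (r * w)‖ ^ q ≤ circleAverage (fun z => poissonKernel 0 w z * ‖h (r * z)‖ ^ q) 0 1 := by
    intro r hr
    refine norm_rpow_le_of_forall_ne_zero (h := fun z => h (r * z)) ?_ ?_ hw
    · intro z hz
      exact AnalyticAt.comp (hh _ (hsc r ⟨hr.1.le, hr.2.le⟩ z hz)) (by fun_prop)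
    · intro z hz
      refine h0 _ ?_
      rw [mem_closedBall_zero_iff] at hz
      rw [mem_ball_zero_iff, norm_mul, Complex.norm_real, Real.norm_of_nonneg hr.1.le]
      exact mul_lt_one_of_nonneg_of_lt_one_left hr.1.le hr.2 hz
  have hcont : ContinuousOn (fun z => ‖h z‖ ^ q) (closedBall 0 1) :=
    hh.continuousOn.norm.rpow_const fun _ _ => Or.inr hq.le
  have hL : ContinuousOn (fun r : ℝ => ‖h (r * w)‖ ^ q) (Set.Icc 0 1) :=
    ContinuousOn.comp (g := fun z => ‖h z‖ ^ q) (f := fun r : ℝ => (r : ℂ) * w) hcont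
      (by fun_prop) fun r hr => hsc r hr w (by simpa using hw.le)
  have hR : ContinuousOn (fun r : ℝ =>
      circleAverage (fun z => poissonKernel 0 w z * ‖h (r * z)‖ ^ q) 0 1) (Set.Icc 0 1) := by
    simp only [circleAverage_def]
    refine ContinuousOn.const_smul (M := ℝ) ?_ _
    rw [continuousOn_iff_continuous_domRestrict]
    refine intervalIntegral.continuous_parametric_intervalIntegral_of_continuous' ?_ _ _
    have hm : ∀ θ : ℝ, circleMap 0 1 θ ∈ sphere (0 : ℂ) 1 := fun θ => by simp
    refine Continuous.mul ?_ ?_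
    · have : Continuous fun θ : ℝ => poissonKernel 0 w (circleMap 0 1 θ) :=
        (continuousOn_poissonKernel hw).comp_continuous (continuous_circleMap 0 1) hm
      exact this.comp continuous_snd
    · refine hcont.comp_continuous (f := fun x : Set.Icc (0 : ℝ) 1 × ℝ =>
        ((x.1 : ℝ) : ℂ) * circleMap 0 1 x.2) ?_ fun x =>
          hsc _ x.1.2 _ (sphere_subset_closedBall (hm x.2))
      have := continuous_circleMap 0 1
      fun_prop
  have hne : (𝓝[Set.Ioo (0 : ℝ) 1] 1).NeBot := by
    rw [← mem_closure_iff_nhdsWithin_neBot, closure_Ioo (by norm_num)]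
    exact ⟨by norm_num, le_rfl⟩
  have t1 := (hL 1 ⟨by norm_num, le_rfl⟩).mono_left
    (nhdsWithin_mono (1 : ℝ) Set.Ioo_subset_Icc_self)
  have t2 := (hR 1 ⟨by norm_num, le_rfl⟩).mono_left
    (nhdsWithin_mono (1 : ℝ) Set.Ioo_subset_Icc_self)
  have := le_of_tendsto_of_tendsto t1 t2
    (eventually_mem_nhdsWithin.mono fun r hr => hlt r hr)
  simpa using this

/-- Division by the Blaschke factors of the zeros. -/
lemma exists_zero_free_majorant {G : ℂ → ℂ} (hG : AnalyticOnNhd ℂ G (closedBall 0 1))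
    {w : ℂ} (hw : w ∈ closedBall (0 : ℂ) 1) (hGw : G w ≠ 0) :
    ∃ h : ℂ → ℂ, AnalyticOnNhd ℂ h (closedBall 0 1) ∧ (∀ z ∈ ball (0 : ℂ) 1, h z ≠ 0) ∧
      (∀ z ∈ closedBall (0 : ℂ) 1, ‖G z‖ ≤ ‖h z‖) ∧ ∀ z ∈ sphere (0 : ℂ) 1, ‖G z‖ = ‖h z‖ := by
  have hmer := hG.meromorphicOn
  have hconn : IsConnected (closedBall (0 : ℂ) 1) :=
    ⟨⟨0, by simp⟩, (convex_closedBall (0 : ℂ) 1).isPreconnected⟩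
  have hord : ∀ u : closedBall (0 : ℂ) 1, meromorphicOrderAt G u ≠ ⊤ := by
    refine (hmer.exists_meromorphicOrderAt_ne_top_iff_forall hconn).1 ⟨⟨w, hw⟩, ?_⟩
    rw [(hG w hw).meromorphicOrderAt_eq, (hG w hw).analyticOrderAt_eq_zero.2 hGw]
    simp
  set D := MeromorphicOn.divisor G (closedBall 0 1)
  have hfin : D.support.Finite := D.finiteSupport (isCompact_closedBall 0 1)
  obtain ⟨H, hH, hH0, heq⟩ := hmer.extract_zeros_poles hord hfin
  have hD : ∀ u, 0 ≤ D u := fun u =>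
    MeromorphicOn.AnalyticOnNhd.divisor_nonneg hG u
  set s := hfin.toFinset
  have hsb : ∀ u ∈ s, ‖u‖ ≤ 1 := fun u hu => by
    have := D.supportWithinDomain (hfin.mem_toFinset.1 hu)
    simpa using this
  let P : ℂ → ℂ := fun z => ∏ u ∈ s, (z - u) ^ (D u).toNat
  have hPeq : (∏ᶠ u, (· - u) ^ D u : ℂ → ℂ) = P := by
    rw [finprod_eq_prod_of_mulSupport_subset (s := s)]
    · ext z
      simp only [Finset.prod_apply, Pi.pow_apply, P]
      refine Finset.prod_congr rfl fun u _ => ?_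
      conv_lhs => rw [← Int.toNat_of_nonneg (hD u)]
      rw [zpow_natCast]
    · intro u hu
      rw [Finset.mem_coe, hfin.mem_toFinset]
      intro h0
      apply hu
      simp only [h0, zpow_zero]
  rw [hPeq] at heq
  -- The factorization is given only off a discrete set; continuity of both sides extends it to
  -- every point of the closed disc.
  have hGP : ∀ z ∈ closedBall (0 : ℂ) 1, G z = P z * H z := by
    intro z hz
    have hm : ∀ᶠ y in 𝓝[≠] z ⊓ 𝓟 (closedBall (0 : ℂ) 1), G y = P y * H y := by
      have := mem_codiscreteWithin.1 heq z hz
      rw [Filter.disjoint_principal_right] at this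
      rw [Filter.eventually_inf_principal]
      filter_upwards [this] with y hy hyb
      by_contra hc
      exact hy ⟨hyb, hc⟩
    have hacc : (𝓝[≠] z ⊓ 𝓟 (closedBall (0 : ℂ) 1)).NeBot := by
      have hpc : Preperfect (closedBall (0 : ℂ) 1) :=
        (convex_closedBall (0 : ℂ) 1).isPreconnected.preperfect_of_nontrivial
          ⟨0, by simp, 1, by simp, by norm_num⟩
      exact hpc z hz
    have hle : 𝓝[≠] z ⊓ 𝓟 (closedBall (0 : ℂ) 1) ≤ 𝓝[closedBall (0 : ℂ) 1] z :=
      inf_le_inf_right _ nhdsWithin_le_nhds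
    have t1 : Tendsto G (𝓝[≠] z ⊓ 𝓟 (closedBall (0 : ℂ) 1)) (𝓝 (G z)) :=
      (hG.continuousOn z hz).mono_left hle
    have hPc : Continuous P := by fun_prop
    have t2 : Tendsto (fun y => P y * H y) (𝓝[≠] z ⊓ 𝓟 (closedBall (0 : ℂ) 1))
        (𝓝 (P z * H z)) :=
      ((hPc.continuousOn.mul hH.continuousOn) z hz).mono_left hle
    exact tendsto_nhds_unique_of_eventuallyEq t1 t2 hm
  -- Each factor z - u becomes 1 - ūz. By `hsq` this does not decrease the modulus on the closed
  -- disc and keeps it on the circle. Zeros lying on the circle survive, so the new function is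
  -- zero-free only in the open disc.
  let Q : ℂ → ℂ := fun z => ∏ u ∈ s, (1 - (starRingEnd ℂ) u * z) ^ (D u).toNat
  have hsq : ∀ u z : ℂ, ‖1 - (starRingEnd ℂ) u * z‖ ^ 2 - ‖z - u‖ ^ 2 =
      (1 - ‖u‖ ^ 2) * (1 - ‖z‖ ^ 2) := by
    intro u z
    simp only [← Complex.normSq_eq_norm_sq, Complex.normSq_apply]
    simp
    ring
  refine ⟨fun z => Q z * H z, ?_, ?_, ?_, ?_⟩
  · intro z hz
    exact AnalyticAt.mul (by fun_prop) (hH z hz)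
  · intro z hz
    refine mul_ne_zero (Finset.prod_ne_zero_iff.2 fun u hu => pow_ne_zero _ fun h0 => ?_)
      (hH0 ⟨z, ball_subset_closedBall hz⟩)
    rw [sub_eq_zero] at h0
    have h1 : (1 : ℝ) = ‖u‖ * ‖z‖ := by
      have := congrArg norm h0
      simpa using this
    rw [mem_ball_zero_iff] at hz
    nlinarith [hsb u hu, norm_nonneg u, norm_nonneg z]
  · intro z hz
    rw [hGP z hz, norm_mul, norm_mul]
    refine mul_le_mul_of_nonneg_right ?_ (norm_nonneg _)
    simp only [P, Q, norm_prod, norm_pow]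
    refine Finset.prod_le_prod (fun _ _ => by positivity) fun u hu => ?_
    refine pow_le_pow_left₀ (norm_nonneg _) ?_ _
    refine abs_le_of_sq_le_sq' ?_ (norm_nonneg _) |>.2
    have := hsq u z
    rw [mem_closedBall_zero_iff] at hz
    have h1 : 0 ≤ 1 - ‖u‖ ^ 2 := by nlinarith [hsb u hu, norm_nonneg u]
    have h2 : 0 ≤ 1 - ‖z‖ ^ 2 := by nlinarith [norm_nonneg z]
    nlinarith [mul_nonneg h1 h2]
  · intro z hz
    rw [hGP z (sphere_subset_closedBall hz), norm_mul, norm_mul]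
    congr 1
    simp only [P, Q, norm_prod, norm_pow]
    refine Finset.prod_congr rfl fun u hu => ?_
    congr 1
    have := hsq u z
    rw [mem_sphere_zero_iff_norm] at hz
    rw [hz] at this
    have h2 : ‖1 - (starRingEnd ℂ) u * z‖ ^ 2 = ‖z - u‖ ^ 2 := by linarith
    exact ((sq_eq_sq₀ (norm_nonneg _) (norm_nonneg _)).1 h2).symm

lemma norm_rpow_le_poisson {G : ℂ → ℂ} {q : ℝ} (hq : 0 < q)
    (hG : AnalyticOnNhd ℂ G (closedBall 0 1)) {w : ℂ} (hw : ‖w‖ < 1) :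
    ‖G w‖ ^ q ≤ circleAverage (fun z => poissonKernel 0 w z * ‖G z‖ ^ q) 0 1 := by
  by_cases hGw : G w = 0
  · rw [hGw, norm_zero, Real.zero_rpow hq.ne']
    refine circleAverage_nonneg_of_nonneg fun z hz => ?_
    rw [abs_one] at hz
    exact mul_nonneg (poissonKernel_nonneg hw (by simpa using hz)) (by positivity)
  · have hwb : w ∈ closedBall (0 : ℂ) 1 := by simpa using hw.le
    obtain ⟨h, h1, h2, h3, h4⟩ := exists_zero_free_majorant hG hwb hGw
    calc ‖G w‖ ^ q ≤ ‖h w‖ ^ q := Real.rpow_le_rpow (norm_nonneg _) (h3 w hwb) hq.le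
      _ ≤ _ := norm_rpow_le_of_forall_ball_ne_zero hq h1 h2 hw
      _ = _ := circleAverage_congr_sphere fun z hz => by
        rw [abs_one] at hz
        simp only [h4 z hz]

lemma norm_rpow_le_circleAverage {G : ℂ → ℂ} {q : ℝ} (hq : 0 < q)
    (hG : AnalyticOnNhd ℂ G (closedBall 0 1)) :
    ‖G 0‖ ^ q ≤ circleAverage (fun z => ‖G z‖ ^ q) 0 1 := by
  refine (norm_rpow_le_poisson hq hG (w := 0) (by simp)).trans_eq ?_
  refine circleAverage_congr_sphere fun z hz => ?_
  rw [abs_one] at hz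
  have : ‖z‖ = 1 := by simpa using hz
  simp [poissonKernel_def, this]

end

/-! ### The radial maximal theorem on the disc -/

noncomputable section

open Metric Complex Real

/-! ### An `L²` bound for positive kernels -/

/-- One square root of `a` is cancelled, which is possible because `a` is finite. -/
lemma ENNReal_le_sq_mul_of_le {a b c : ℝ≥0∞} (ha : a ≠ ∞)
    (h : a ≤ c * (b ^ (1 / 2 : ℝ) * a ^ (1 / 2 : ℝ))) : a ≤ c ^ 2 * b := by
  by_cases ha0 : a = 0
  · simp [ha0]
  have hs : a ^ (1 / 2 : ℝ) ≠ 0 := by simp [ha0, ha]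
  have hs' : a ^ (1 / 2 : ℝ) ≠ ∞ := ENNReal.rpow_ne_top_of_nonneg (by norm_num) ha
  have haa : ∀ x : ℝ≥0∞, x ^ (1 / 2 : ℝ) * x ^ (1 / 2 : ℝ) = x := by
    intro x
    rw [← ENNReal.rpow_add_of_nonneg _ _ (by norm_num) (by norm_num)]; norm_num
  have h1 : a ^ (1 / 2 : ℝ) ≤ c * b ^ (1 / 2 : ℝ) := by
    rw [← ENNReal.mul_le_mul_iff_left hs hs', haa]
    rwa [mul_assoc]
  calc a = a ^ (1 / 2 : ℝ) * a ^ (1 / 2 : ℝ) := (haa a).symm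
    _ ≤ (c * b ^ (1 / 2 : ℝ)) * (c * b ^ (1 / 2 : ℝ)) := mul_le_mul' h1 h1
    _ = c ^ 2 * (b ^ (1 / 2 : ℝ) * b ^ (1 / 2 : ℝ)) := by ring
    _ = c ^ 2 * b := by rw [haa]

lemma lintegral_mul_le_sqrt {X : Type*} [MeasurableSpace X] {m : Measure X} {f g : X → ℝ≥0∞}
    (hf : AEMeasurable f m) (hg : AEMeasurable g m) :
    ∫⁻ x, f x * g x ∂m ≤ (∫⁻ x, f x ^ 2 ∂m) ^ (1 / 2 : ℝ) * (∫⁻ x, g x ^ 2 ∂m) ^ (1 / 2 : ℝ) := by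
  have := ENNReal.lintegral_mul_le_Lp_mul_Lq m (p := 2) (q := 2)
    (Real.HolderConjugate.two_two) hf hg
  simpa only [ENNReal.rpow_two, Pi.mul_apply] using this

/-- If `K K* ≤ C (K + K*)` for a bounded positive kernel `K`, then `K` is bounded on `L²`. -/
lemma lintegral_kernel_sq_le {X : Type*} [MeasurableSpace X] {m : Measure X} [IsFiniteMeasure m]
    {k : X → X → ℝ≥0∞} (hk : Measurable (Function.uncurry k)) {B C : ℝ≥0∞} (hB : B ≠ ∞)
    (hC : 1 ≤ C) (hkB : ∀ x y, k x y ≤ B)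
    (hkk : ∀ x y, ∫⁻ t, k x t * k y t ∂m ≤ C * (k x y + k y x))
    {v : X → ℝ≥0∞} (hv : Measurable v) :
    ∫⁻ x, (∫⁻ t, k x t * v t ∂m) ^ 2 ∂m ≤ (2 * C) ^ 2 * ∫⁻ t, v t ^ 2 ∂m := by
  have hk' : Measurable fun q : X × X => k q.1 q.2 := hk
  have hfin : ∀ w : X → ℝ≥0∞, Measurable w → ∫⁻ t, w t ^ 2 ∂m ≠ ∞ → ∫⁻ t, w t ∂m ≠ ∞ := by
    intro w hw h
    have := lintegral_mul_le_sqrt (m := m) hw.aemeasurable (aemeasurable_const (b := (1 : ℝ≥0∞)))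
    simp only [mul_one, one_pow, lintegral_const, one_mul] at this
    refine ne_top_of_le_ne_top ?_ this
    exact ENNReal.mul_ne_top (ENNReal.rpow_ne_top_of_nonneg (by norm_num) h)
      (ENNReal.rpow_ne_top_of_nonneg (by norm_num) (measure_ne_top _ _))
  have hbd : ∀ (w : X → ℝ≥0∞) (κ : X → X → ℝ≥0∞), (∀ x y, κ x y ≤ B) → Measurable w →
      ∫⁻ t, w t ^ 2 ∂m ≠ ∞ → ∫⁻ x, (∫⁻ t, κ x t * w t ∂m) ^ 2 ∂m ≠ ∞ := by
    intro w κ hκ hw h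
    have h1 : ∀ x, ∫⁻ t, κ x t * w t ∂m ≤ B * ∫⁻ t, w t ∂m := fun x => by
      rw [← lintegral_const_mul _ hw]
      exact lintegral_mono fun t => by dsimp only; gcongr; exact hκ x t
    have h2 : ∫⁻ x, (∫⁻ t, κ x t * w t ∂m) ^ 2 ∂m ≤
        ∫⁻ _, (B * ∫⁻ t, w t ∂m) ^ 2 ∂m :=
      lintegral_mono fun x => by dsimp only; gcongr; exact h1 x
    refine ne_top_of_le_ne_top ?_ h2
    rw [lintegral_const]
    exact ENNReal.mul_ne_top (ENNReal.pow_ne_top (ENNReal.mul_ne_top hB (hfin w hw h)))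
      (measure_ne_top _ _)
  -- Here ‖K*w‖² = ⟨KK*w, w⟩ ≤ 2C⟨K*w, w⟩ ≤ 2C‖K*w‖‖w‖. Boundedness of the kernel makes ‖K*w‖
  -- finite, hence cancellable.
  have hadj : ∀ w : X → ℝ≥0∞, Measurable w → ∫⁻ t, w t ^ 2 ∂m ≠ ∞ →
      ∫⁻ t, (∫⁻ x, k x t * w x ∂m) ^ 2 ∂m ≤ (2 * C) ^ 2 * ∫⁻ t, w t ^ 2 ∂m := by
    intro w hw h
    have hTm : Measurable fun t => ∫⁻ x, k x t * w x ∂m :=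
      Measurable.lintegral_prod_left' (f := fun q : X × X => k q.1 q.2 * w q.1)
        (hk'.mul (hw.comp measurable_fst))
    refine ENNReal_le_sq_mul_of_le (hbd w (fun t x => k x t) (fun x y => hkB y x) hw h) ?_
    have e1 : ∫⁻ t, (∫⁻ x, k x t * w x ∂m) ^ 2 ∂m =
        ∫⁻ t, ∫⁻ x, ∫⁻ y, (k x t * w x) * (k y t * w y) ∂m ∂m ∂m := by
      refine lintegral_congr fun t => ?_
      rw [sq, ← lintegral_mul_const _ (by fun_prop)]
      refine lintegral_congr fun x => ?_
      rw [lintegral_const_mul _ (by fun_prop)]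
    have e2 : ∫⁻ t, ∫⁻ x, ∫⁻ y, (k x t * w x) * (k y t * w y) ∂m ∂m ∂m =
        ∫⁻ x, ∫⁻ y, ∫⁻ t, (k x t * w x) * (k y t * w y) ∂m ∂m ∂m := by
      rw [lintegral_lintegral_swap]
      · refine lintegral_congr fun x => ?_
        rw [lintegral_lintegral_swap]
        exact Measurable.aemeasurable (by fun_prop)
      · refine Measurable.aemeasurable ?_
        exact Measurable.lintegral_prod_right'
          (f := fun q : (X × X) × X => (k q.1.2 q.1.1 * w q.1.2) * (k q.2 q.1.1 * w q.2))
          (by fun_prop)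
    have e3 : ∀ x y, ∫⁻ t, (k x t * w x) * (k y t * w y) ∂m ≤
        C * (k x y * (w x * w y) + k y x * (w x * w y)) := by
      intro x y
      have : ∀ t, (k x t * w x) * (k y t * w y) = (w x * w y) * (k x t * k y t) := fun t => by ring
      simp_rw [this]
      rw [lintegral_const_mul _ (by fun_prop)]
      calc (w x * w y) * ∫⁻ t, k x t * k y t ∂m ≤ (w x * w y) * (C * (k x y + k y x)) := by
            gcongr; exact hkk x y
        _ = _ := by ring
    have e4 : ∫⁻ x, ∫⁻ y, C * (k x y * (w x * w y) + k y x * (w x * w y)) ∂m ∂m =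
        2 * C * ∫⁻ y, w y * ∫⁻ x, k x y * w x ∂m ∂m := by
      have a1 : ∫⁻ x, ∫⁻ y, k x y * (w x * w y) ∂m ∂m =
          ∫⁻ y, w y * ∫⁻ x, k x y * w x ∂m ∂m := by
        rw [lintegral_lintegral_swap (Measurable.aemeasurable (by fun_prop))]
        refine lintegral_congr fun y => ?_
        rw [← lintegral_const_mul _ (by fun_prop)]
        exact lintegral_congr fun x => by ring
      have a2 : ∫⁻ x, ∫⁻ y, k y x * (w x * w y) ∂m ∂m =
          ∫⁻ y, w y * ∫⁻ x, k x y * w x ∂m ∂m := by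
        refine lintegral_congr fun y => ?_
        rw [← lintegral_const_mul _ (by fun_prop)]
        exact lintegral_congr fun x => by ring
      have hm1 : Measurable fun x => ∫⁻ y, k x y * (w x * w y) ∂m :=
        Measurable.lintegral_prod_right' (f := fun q : X × X => k q.1 q.2 * (w q.1 * w q.2))
          (by fun_prop)
      have hm2 : Measurable fun x => ∫⁻ y, k y x * (w x * w y) ∂m :=
        Measurable.lintegral_prod_right' (f := fun q : X × X => k q.2 q.1 * (w q.1 * w q.2))
          (by fun_prop)
      calc _ = ∫⁻ x, C * (∫⁻ y, k x y * (w x * w y) ∂m + ∫⁻ y, k y x * (w x * w y) ∂m) ∂m := by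
            refine lintegral_congr fun x => ?_
            rw [lintegral_const_mul _ (by fun_prop), lintegral_add_left (by fun_prop)]
        _ = C * (∫⁻ x, ∫⁻ y, k x y * (w x * w y) ∂m ∂m +
              ∫⁻ x, ∫⁻ y, k y x * (w x * w y) ∂m ∂m) := by
            rw [lintegral_const_mul _ (hm1.fun_add hm2), lintegral_add_left hm1]
        _ = _ := by rw [a1, a2]; ring
    calc _ = _ := e1.trans e2
      _ ≤ ∫⁻ x, ∫⁻ y, C * (k x y * (w x * w y) + k y x * (w x * w y)) ∂m ∂m :=
        lintegral_mono fun x => lintegral_mono fun y => e3 x y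
      _ = _ := e4
      _ ≤ _ := by gcongr; exact lintegral_mul_le_sqrt hw.aemeasurable hTm.aemeasurable
  by_cases hv2 : ∫⁻ t, v t ^ 2 ∂m = ∞
  · rw [hv2, ENNReal.mul_top]
    · exact le_top
    · have : C ≠ 0 := fun h => by simp [h] at hC
      simp [this]
  have hTv : Measurable fun x => ∫⁻ t, k x t * v t ∂m :=
    Measurable.lintegral_prod_right' (f := fun q : X × X => k q.1 q.2 * v q.2) (by fun_prop)
  have hJ := hbd v k hkB hv hv2
  refine ENNReal_le_sq_mul_of_le hJ ?_
  -- The bound passes from K* to K by duality: ‖Kv‖² = ⟨v, K*Kv⟩.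
  set u : X → ℝ≥0∞ := fun x => ∫⁻ t, k x t * v t ∂m
  calc ∫⁻ x, u x ^ 2 ∂m = ∫⁻ x, ∫⁻ t, u x * (k x t * v t) ∂m ∂m := by
        refine lintegral_congr fun x => ?_
        rw [lintegral_const_mul _ (by fun_prop), sq]
    _ = ∫⁻ t, v t * ∫⁻ x, k x t * u x ∂m ∂m := by
        rw [lintegral_lintegral_swap (Measurable.aemeasurable (by fun_prop))]
        refine lintegral_congr fun t => ?_
        rw [← lintegral_const_mul _ (by fun_prop)]
        exact lintegral_congr fun x => by ring
    _ ≤ (∫⁻ t, v t ^ 2 ∂m) ^ (1 / 2 : ℝ) *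
          (∫⁻ t, (∫⁻ x, k x t * u x ∂m) ^ 2 ∂m) ^ (1 / 2 : ℝ) :=
        lintegral_mul_le_sqrt hv.aemeasurable (Measurable.aemeasurable
          (Measurable.lintegral_prod_left' (f := fun q : X × X => k q.1 q.2 * u q.1)
            (by fun_prop)))
    _ ≤ (∫⁻ t, v t ^ 2 ∂m) ^ (1 / 2 : ℝ) *
          ((2 * C) ^ 2 * ∫⁻ x, u x ^ 2 ∂m) ^ (1 / 2 : ℝ) := by
        gcongr; exact hadj u hTv hJ
    _ = 2 * C * ((∫⁻ t, v t ^ 2 ∂m) ^ (1 / 2 : ℝ) * (∫⁻ x, u x ^ 2 ∂m) ^ (1 / 2 : ℝ)) := by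
        rw [ENNReal.mul_rpow_of_nonneg _ _ (by norm_num : (0 : ℝ) ≤ 1 / 2), ← ENNReal.rpow_natCast,
          ← ENNReal.rpow_mul]
        norm_num
        ring

/-! ### The radial maximal function on the circle -/

/-- A measurable selection of an index realizing the maximum of finitely many functions. -/
lemma exists_measurable_argmax {X : Type*} [MeasurableSpace X] {f : ℕ → X → ℝ≥0∞}
    (hf : ∀ i, Measurable (f i)) (N : ℕ) :
    ∃ ι : X → ℕ, Measurable ι ∧ (∀ x, ι x ≤ N) ∧ ∀ x, ∀ i ≤ N, f i x ≤ f (ι x) x := by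
  induction N with
  | zero => exact ⟨fun _ => 0, measurable_const, fun _ => le_rfl, fun x i hi => by
      rw [Nat.le_zero.1 hi]⟩
  | succ N ih =>
    obtain ⟨ι, hι, hιN, hmax⟩ := ih
    have hm : Measurable fun x => f (ι x) x :=
      (measurable_from_prod_countable_left (f := fun q : X × ℕ => f q.2 q.1)
        (fun i => hf i)).comp (measurable_id.prodMk hι)
    classical
    refine ⟨fun x => if f (ι x) x < f (N + 1) x then N + 1 else ι x,
      Measurable.ite (measurableSet_lt hm (hf _)) measurable_const hι, fun x => ?_,
      fun x i hi => ?_⟩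
    · dsimp only; split_ifs
      · exact le_rfl
      · exact (hιN x).trans (Nat.le_succ N)
    · dsimp only
      rcases Nat.le_succ_iff.1 hi with h | h
      · split_ifs with h1
        · exact (hmax x i h).trans h1.le
        · exact hmax x i h
      · subst h
        split_ifs with h1
        · exact le_rfl
        · exact not_lt.1 h1

/-- For |z| = 1 the right side is the Poisson kernel of b at z. That kernel is therefore the
boundary value of an explicit harmonic function on the disc. -/
lemma re_moebius (b z : ℂ) :
    ((1 + (starRingEnd ℂ) b * z) / (1 - (starRingEnd ℂ) b * z)).re =
      (1 - ‖b‖ ^ 2 * ‖z‖ ^ 2) / ‖1 - (starRingEnd ℂ) b * z‖ ^ 2 := by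
  set c := (starRingEnd ℂ) b * z
  have hc : ‖b‖ ^ 2 * ‖z‖ ^ 2 = ‖c‖ ^ 2 := by simp [c, mul_pow]
  rw [hc, Complex.div_re, ← add_div, ← Complex.normSq_eq_norm_sq, ← Complex.normSq_eq_norm_sq]
  congr 1
  simp [Complex.normSq_apply]
  ring

lemma norm_one_sub_conj_mul_eq {b z : ℂ} (hz : ‖z‖ = 1) :
    ‖1 - (starRingEnd ℂ) b * z‖ = ‖z - b‖ := by
  have h : z * (starRingEnd ℂ) z = 1 := by
    rw [Complex.mul_conj, Complex.normSq_eq_norm_sq, hz]; simp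
  calc ‖1 - (starRingEnd ℂ) b * z‖ = ‖z * (starRingEnd ℂ) (z - b)‖ := by
        rw [map_sub, mul_sub, h, mul_comm z]
    _ = ‖z - b‖ := by rw [norm_mul, hz, one_mul, RCLike.norm_conj]

/-- The left side is the Poisson integral, evaluated at `a`, of the boundary values of the harmonic
function of `re_moebius`. -/
lemma circleAverage_poissonKernel_mul {a b : ℂ} (ha : ‖a‖ < 1) (hb : ‖b‖ < 1) :
    circleAverage (fun z => poissonKernel 0 a z * poissonKernel 0 b z) 0 1 =
      (1 - ‖b‖ ^ 2 * ‖a‖ ^ 2) / ‖1 - (starRingEnd ℂ) b * a‖ ^ 2 := by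
  let F : ℂ → ℂ := fun z => (1 + (starRingEnd ℂ) b * z) / (1 - (starRingEnd ℂ) b * z)
  have hne : ∀ z ∈ closedBall (0 : ℂ) 1, 1 - (starRingEnd ℂ) b * z ≠ 0 := by
    intro z hz h
    rw [mem_closedBall_zero_iff] at hz
    have := congrArg norm (sub_eq_zero.1 h)
    rw [norm_one, norm_mul, RCLike.norm_conj] at this
    nlinarith [norm_nonneg b, norm_nonneg z]
  have hF : DiffContOnCl ℂ F (ball 0 1) := by
    refine DifferentiableOn.diffContOnCl fun z hz => ?_
    have := hne z (closure_ball_subset_closedBall hz)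
    exact DifferentiableAt.differentiableWithinAt (by fun_prop (disch := assumption))
  have hInt : CircleIntegrable (poissonKernel 0 a • F) 0 1 := by
    refine ContinuousOn.circleIntegrable (by norm_num) ((continuousOn_poissonKernel ha).smul ?_)
    refine hF.continuousOn.mono ?_
    rw [closure_ball _ one_ne_zero]; exact sphere_subset_closedBall
  have h := hF.circleAverage_poissonKernel_smul (w := a) (by simpa using ha)
  have h2 := Complex.reCLM.circleAverage_comp_comm hInt
  rw [h] at h2
  simp only [Complex.reCLM_apply, F, re_moebius] at h2
  rw [← h2]
  refine circleAverage_congr_sphere fun z hz => ?_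
  have hz' : ‖z‖ = 1 := by simpa using hz
  simp only [Function.comp_apply, Pi.smul_apply', Complex.reCLM_apply, Complex.real_smul,
    Complex.re_ofReal_mul, re_moebius, hz', norm_one_sub_conj_mul_eq hz']
  congr 1
  simp [poissonKernel_def, hz']

/-- The 8 is 2·4. The numerators satisfy 1 - r²|a|² ≤ 1 - |a|⁴ ≤ 2(1 - |a|²), and |c - a| ≤ |1 -
b̄a| + (1 - r)|a| ≤ 2|1 - b̄a| gives the 4 after squaring. -/
lemma poisson_comp_le {a b c : ℂ} {r : ℝ} (hc : ‖c‖ = 1) (hb : b = r * c) (har : ‖a‖ ≤ r)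
    (hr : r < 1) :
    (1 - ‖b‖ ^ 2 * ‖a‖ ^ 2) / ‖1 - (starRingEnd ℂ) b * a‖ ^ 2 ≤ 8 * poissonKernel 0 a c := by
  have h0 := norm_nonneg a
  have hr0 : 0 ≤ r := h0.trans har
  have hbn : ‖b‖ = r := by rw [hb, norm_mul, hc]; simp [abs_of_nonneg hr0]
  have hca : ‖c - a‖ ≤ 2 * ‖1 - (starRingEnd ℂ) b * a‖ := by
    have e1 : ‖c - a‖ = ‖1 - (starRingEnd ℂ) c * a‖ := by
      rw [← RCLike.norm_conj (c - a), ← one_mul ‖(starRingEnd ℂ) (c - a)‖, ← hc, ← norm_mul,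
        map_sub, mul_sub, Complex.mul_conj, Complex.normSq_eq_norm_sq, hc, ← RCLike.norm_conj]
      simp
    have e2 : 1 - (starRingEnd ℂ) c * a =
        (1 - (starRingEnd ℂ) b * a) - ((1 - r : ℝ) : ℂ) * ((starRingEnd ℂ) c * a) := by
      rw [hb]; simp; ring
    have e3 : 1 - r * ‖a‖ ≤ ‖1 - (starRingEnd ℂ) b * a‖ := by
      have := norm_sub_norm_le 1 ((starRingEnd ℂ) b * a)
      rwa [norm_one, norm_mul, RCLike.norm_conj, hbn] at this
    rw [e1, e2]
    refine (norm_sub_le _ _).trans ?_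
    rw [norm_mul, norm_mul, RCLike.norm_conj, hc, Complex.norm_real,
      Real.norm_of_nonneg (by linarith)]
    nlinarith
  have hpos : 0 < ‖c - a‖ := by
    refine norm_pos_iff.2 fun h => ?_
    rw [sub_eq_zero] at h
    rw [← h, hc] at har
    linarith
  have hpos' : 0 < ‖1 - (starRingEnd ℂ) b * a‖ := by linarith
  rw [poissonKernel_def]
  simp only [sub_zero, hc, one_pow, hbn]
  rw [mul_div_assoc', div_le_div_iff₀ (by positivity) (by positivity)]
  have hsq : ‖a‖ ^ 2 ≤ r ^ 2 := by gcongr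
  have h1 : 1 - r ^ 2 * ‖a‖ ^ 2 ≤ 2 * (1 - ‖a‖ ^ 2) := by
    nlinarith [mul_nonneg (sub_nonneg.2 hsq) (sq_nonneg ‖a‖), sq_nonneg (1 - ‖a‖ ^ 2)]
  have h2 : ‖c - a‖ ^ 2 ≤ 4 * ‖1 - (starRingEnd ℂ) b * a‖ ^ 2 := by nlinarith
  have h3 : 0 ≤ 1 - ‖a‖ ^ 2 := by nlinarith
  calc (1 - r ^ 2 * ‖a‖ ^ 2) * ‖c - a‖ ^ 2 ≤ 2 * (1 - ‖a‖ ^ 2) * ‖c - a‖ ^ 2 := by gcongr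
    _ ≤ 2 * (1 - ‖a‖ ^ 2) * (4 * ‖1 - (starRingEnd ℂ) b * a‖ ^ 2) := by gcongr
    _ = _ := by ring

lemma ofReal_circleAverage {F : ℂ → ℝ} (hF : ContinuousOn F (sphere 0 1))
    (h0 : ∀ z ∈ sphere (0 : ℂ) 1, 0 ≤ F z) :
    ENNReal.ofReal (circleAverage F 0 1) = ∫⁻ t in Set.Ioc 0 (2 * π),
      ENNReal.ofReal ((2 * π)⁻¹ * F (circleMap 0 1 t)) := by
  have hm : ∀ θ : ℝ, circleMap 0 1 θ ∈ sphere (0 : ℂ) 1 := fun θ => by simp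
  have hc : Continuous fun θ : ℝ => F (circleMap 0 1 θ) :=
    hF.comp_continuous (continuous_circleMap 0 1) hm
  rw [circleAverage_def, intervalIntegral.integral_of_le (by positivity), smul_eq_mul,
    ← integral_const_mul, ofReal_integral_eq_lintegral_ofReal]
  · exact (continuous_const.mul hc).integrableOn_Ioc
  · exact Eventually.of_forall fun t => mul_nonneg (by positivity) (h0 _ (hm t))

/-- The normalized Poisson kernel with a variable radius. -/
def radialKernel (ρ : ℝ → ℝ) (x t : ℝ) : ℝ≥0∞ :=
  ENNReal.ofReal ((2 * π)⁻¹ * poissonKernel 0 (circleMap 0 (ρ x) x) (circleMap 0 1 t))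

/-- This is KK* ≤ 8(K + K*). The product of two Poisson kernels integrates to an explicit kernel in
the two interior points, and pushing the one of larger modulus out to the circle costs a factor 8.
-/
lemma lintegral_radialKernel_mul_le {ρ : ℝ → ℝ} (hρ : ∀ x, ρ x ∈ Set.Ico (0 : ℝ) 1) (x y : ℝ) :
    ∫⁻ t in Set.Ioc 0 (2 * π), radialKernel ρ x t * radialKernel ρ y t ≤
      8 * (radialKernel ρ x y + radialKernel ρ y x) := by
  set a := circleMap 0 (ρ x) x
  set b := circleMap 0 (ρ y) y
  have hnorm : ∀ x, ‖circleMap 0 (ρ x) x‖ = ρ x := fun x => by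
    simp [abs_of_nonneg (hρ x).1]
  have ha : ‖a‖ < 1 := (hnorm x).trans_lt (hρ x).2
  have hb : ‖b‖ < 1 := (hnorm y).trans_lt (hρ y).2
  have hP : ∀ {w : ℂ}, ‖w‖ < 1 → ∀ t, 0 ≤ poissonKernel 0 w (circleMap 0 1 t) :=
    fun hw t => poissonKernel_nonneg hw (by simp)
  have e : ∀ t, radialKernel ρ x t * radialKernel ρ y t =
      ENNReal.ofReal ((2 * π)⁻¹) * ENNReal.ofReal ((2 * π)⁻¹ *
        (poissonKernel 0 a (circleMap 0 1 t) * poissonKernel 0 b (circleMap 0 1 t))) := by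
    intro t
    rw [radialKernel, radialKernel, ← ENNReal.ofReal_mul
      (mul_nonneg (by positivity) (hP ha t)), ← ENNReal.ofReal_mul (by positivity)]
    congr 1; ring
  simp_rw [e]
  rw [lintegral_const_mul' _ _ ENNReal.ofReal_ne_top,
    ← ofReal_circleAverage (F := fun z => poissonKernel 0 a z * poissonKernel 0 b z)
    ((continuousOn_poissonKernel ha).mul (continuousOn_poissonKernel hb))
    (fun z hz => mul_nonneg (poissonKernel_nonneg ha (by simpa using hz))
      (poissonKernel_nonneg hb (by simpa using hz))), circleAverage_poissonKernel_mul ha hb]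
  have hcm : ∀ (r θ : ℝ), circleMap 0 r θ = r * circleMap 0 1 θ := fun r θ => by simp [circleMap]
  have h8 : (8 : ℝ≥0∞) = ENNReal.ofReal 8 := by simp
  rcases le_total (ρ x) (ρ y) with hxy | hxy
  · have h1 := poisson_comp_le (a := a) (b := b) (c := circleMap 0 1 y) (r := ρ y) (by simp)
      (hcm _ _) ((hnorm x).trans_le hxy) (hρ y).2
    calc _ ≤ ENNReal.ofReal ((2 * π)⁻¹) *
          ENNReal.ofReal (8 * poissonKernel 0 a (circleMap 0 1 y)) := by gcongr
      _ = 8 * radialKernel ρ x y := by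
        rw [radialKernel, h8, ← ENNReal.ofReal_mul (by positivity),
          ← ENNReal.ofReal_mul (by positivity)]
        congr 1; ring
      _ ≤ _ := by gcongr; exact le_self_add
  · have h1 := poisson_comp_le (a := b) (b := a) (c := circleMap 0 1 x) (r := ρ x) (by simp)
      (hcm _ _) ((hnorm y).trans_le hxy) (hρ x).2
    have hsym : (1 - ‖b‖ ^ 2 * ‖a‖ ^ 2) / ‖1 - (starRingEnd ℂ) b * a‖ ^ 2 =
        (1 - ‖a‖ ^ 2 * ‖b‖ ^ 2) / ‖1 - (starRingEnd ℂ) a * b‖ ^ 2 := by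
      rw [mul_comm (‖b‖ ^ 2), ← RCLike.norm_conj (1 - (starRingEnd ℂ) b * a)]
      simp [mul_comm]
    rw [hsym]
    calc _ ≤ ENNReal.ofReal ((2 * π)⁻¹) *
          ENNReal.ofReal (8 * poissonKernel 0 b (circleMap 0 1 x)) := by gcongr
      _ = 8 * radialKernel ρ y x := by
        rw [radialKernel, h8, ← ENNReal.ofReal_mul (by positivity),
          ← ENNReal.ofReal_mul (by positivity)]
        congr 1; ring
      _ ≤ _ := by gcongr; exact le_add_self

lemma radialKernel_le {ρ : ℝ → ℝ} {r : ℝ} (hr : r < 1) (hρ : ∀ x, ρ x ∈ Set.Icc (0 : ℝ) r)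
    (x t : ℝ) : radialKernel ρ x t ≤ ENNReal.ofReal ((2 * π)⁻¹ * (1 / (1 - r) ^ 2)) := by
  refine ENNReal.ofReal_le_ofReal ?_
  gcongr
  rw [poissonKernel_def]
  simp only [sub_zero, norm_circleMap_zero, abs_one, one_pow, sq_abs]
  have h1 : 1 - r ≤ ‖circleMap 0 1 t - circleMap 0 (ρ x) x‖ := by
    refine le_trans ?_ (norm_sub_norm_le _ _)
    simp only [norm_circleMap_zero, abs_one, abs_of_nonneg (hρ x).1]
    linarith [(hρ x).2]
  have h2 : 0 < 1 - r := by linarith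
  gcongr
  nlinarith [sq_nonneg (ρ x)]

lemma measurable_radialKernel {ρ : ℝ → ℝ} (hρ : Measurable ρ) :
    Measurable (Function.uncurry (radialKernel ρ)) := by
  have hc : Continuous fun q : ℝ × ℝ => circleMap 0 q.1 q.2 := by fun_prop
  have h1 : Measurable fun q : ℝ × ℝ => circleMap 0 (ρ q.1) q.1 :=
    hc.measurable.comp ((hρ.comp measurable_fst).prodMk measurable_fst)
  have h2 : Measurable fun q : ℝ × ℝ => circleMap 0 1 q.2 :=
    (continuous_circleMap 0 1).measurable.comp measurable_snd
  have : Function.uncurry (radialKernel ρ) = fun q : ℝ × ℝ => ENNReal.ofReal ((2 * π)⁻¹ *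
      ((‖circleMap 0 1 q.2‖ ^ 2 - ‖circleMap 0 (ρ q.1) q.1‖ ^ 2) /
        ‖circleMap 0 1 q.2 - circleMap 0 (ρ q.1) q.1‖ ^ 2)) := by
    ext q
    simp [radialKernel, Function.uncurry, poissonKernel_def]
  rw [this]
  fun_prop

/-- The radial maximal theorem for holomorphic functions on the disc. -/
theorem lintegral_iSup_radial_le {G : ℂ → ℂ} {p : ℝ} (hp : 0 < p)
    (hG : AnalyticOnNhd ℂ G (closedBall 0 1)) {r : ℕ → ℝ} (hr : ∀ i, r i ∈ Set.Ico (0 : ℝ) 1) :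
    ∫⁻ x in Set.Ioc 0 (2 * π), ⨆ i, ‖G (circleMap 0 (r i) x)‖ₑ ^ p ≤
      256 * ∫⁻ x in Set.Ioc 0 (2 * π), ‖G (circleMap 0 1 x)‖ₑ ^ p := by
  have hin : ∀ i x, circleMap 0 (r i) x ∈ closedBall (0 : ℂ) 1 := fun i x => by
    simp [abs_of_nonneg (hr i).1, (hr i).2.le]
  have hcm : ∀ i, Continuous fun x : ℝ => G (circleMap 0 (r i) x) := fun i =>
    hG.continuousOn.comp_continuous (continuous_circleMap 0 (r i)) (hin i)
  have hcm1 : Continuous fun x : ℝ => G (circleMap 0 1 x) :=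
    hG.continuousOn.comp_continuous (continuous_circleMap 0 1) fun x => by simp
  have hm : ∀ i, Measurable fun x : ℝ => ‖G (circleMap 0 (r i) x)‖ₑ ^ p := fun i =>
    ((hcm i).measurable.enorm).pow_const p
  have hfinite : ∀ N, ∫⁻ x in Set.Ioc 0 (2 * π), ⨆ i ≤ N, ‖G (circleMap 0 (r i) x)‖ₑ ^ p ≤
      256 * ∫⁻ x in Set.Ioc 0 (2 * π), ‖G (circleMap 0 1 x)‖ₑ ^ p := by
    intro N
    -- A measurable choice of the best among finitely many radii turns the maximal operator into a
    -- linear one with kernel `radialKernel ρ`.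
    obtain ⟨ι, hι, hιN, hmax⟩ := exists_measurable_argmax hm N
    let ρ : ℝ → ℝ := fun x => r (ι x)
    have hρm : Measurable ρ := (measurable_from_nat (f := r)).comp hι
    obtain ⟨R, hR1, hR⟩ : ∃ R < 1, ∀ i ≤ N, r i ≤ R := by
      obtain ⟨j, hj, hjm⟩ := (Finset.range (N + 1)).exists_max_image r ⟨0, by simp⟩
      exact ⟨r j, (hr j).2, fun i hi => hjm i (by simpa [Nat.lt_succ_iff] using hi)⟩
    -- |G|^{p/2} has a Poisson majorization for every p > 0, so only the L² bound is needed. With C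
    -- = 8 it produces the constant (2·8)² = 256.
    let v : ℝ → ℝ≥0∞ := fun t => ‖G (circleMap 0 1 t)‖ₑ ^ (p / 2)
    have hsq : ∀ z : ℂ, (‖z‖ₑ ^ (p / 2)) ^ 2 = ‖z‖ₑ ^ p := fun z => by
      rw [← ENNReal.rpow_natCast, ← ENNReal.rpow_mul]; norm_num
    have hpt : ∀ x, ‖G (circleMap 0 (ρ x) x)‖ₑ ^ (p / 2) ≤
        ∫⁻ t in Set.Ioc 0 (2 * π), radialKernel ρ x t * v t := by
      intro x
      have hw : ‖circleMap 0 (ρ x) x‖ < 1 := by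
        simpa [abs_of_nonneg (hr (ι x)).1, ρ] using (hr (ι x)).2
      have hq : 0 < p / 2 := by positivity
      have h1 := ENNReal.ofReal_le_ofReal (norm_rpow_le_poisson hq hG hw)
      rw [ofReal_circleAverage ((continuousOn_poissonKernel hw).fun_mul
        ((hG.continuousOn.mono sphere_subset_closedBall).norm.rpow_const
          fun _ _ => Or.inr hq.le))
        (fun z hz => mul_nonneg (poissonKernel_nonneg hw (by simpa using hz))
          (by positivity))] at h1
      rw [← ENNReal.ofReal_rpow_of_nonneg (norm_nonneg _) hq.le, ofReal_norm] at h1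
      refine h1.trans (lintegral_mono fun t => ?_)
      dsimp only
      rw [radialKernel, ← mul_assoc, ENNReal.ofReal_mul (mul_nonneg (by positivity)
        (poissonKernel_nonneg hw (by simp))), ← ENNReal.ofReal_rpow_of_nonneg (norm_nonneg _) hq.le,
        ofReal_norm]
    have hvm : Measurable v := (hcm1.measurable.enorm).pow_const _
    have key := lintegral_kernel_sq_le (m := volume.restrict (Set.Ioc 0 (2 * π)))
      (measurable_radialKernel hρm) (B := ENNReal.ofReal ((2 * π)⁻¹ * (1 / (1 - R) ^ 2)))
      (C := 8) ENNReal.ofReal_ne_top (by norm_num)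
      (fun x y => radialKernel_le hR1 (fun x => ⟨(hr _).1, hR _ (hιN x)⟩) x y)
      (fun x y => lintegral_radialKernel_mul_le (fun x => hr _) x y) hvm
    calc ∫⁻ x in Set.Ioc 0 (2 * π), ⨆ i ≤ N, ‖G (circleMap 0 (r i) x)‖ₑ ^ p
        ≤ ∫⁻ x in Set.Ioc 0 (2 * π),
            (∫⁻ t in Set.Ioc 0 (2 * π), radialKernel ρ x t * v t) ^ 2 := by
          refine lintegral_mono fun x => iSup₂_le fun i hi => (hmax x i hi).trans ?_
          rw [← hsq]
          exact pow_le_pow_left' (hpt x) 2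
      _ ≤ _ := key
      _ = _ := by
          congr 1
          · norm_num
          · exact lintegral_congr fun t => hsq _
  have hsup : ∀ x, ⨆ i, ‖G (circleMap 0 (r i) x)‖ₑ ^ p =
      ⨆ N : ℕ, ⨆ i ≤ N, ‖G (circleMap 0 (r i) x)‖ₑ ^ p := fun x =>
    le_antisymm (iSup_le fun i => le_iSup_of_le i (le_iSup₂_of_le i le_rfl le_rfl))
      (iSup_le fun N => iSup₂_le fun i _ => le_iSup (fun i => ‖G (circleMap 0 (r i) x)‖ₑ ^ p) i)
  simp_rw [hsup]
  rw [lintegral_iSup (fun N => Measurable.iSup fun i => Measurable.iSup fun _ => hm i)]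
  · exact iSup_le hfinite
  · intro N M hNM x
    exact iSup₂_le fun i hi => le_iSup₂_of_le i (hi.trans hNM) le_rfl

end

/-! ### Volume and surface measure under unitary maps -/

noncomputable section

open Metric
open scoped Pointwise

variable {n : ℕ}

/-! ### Unitary invariance and volumes of nonisotropic boxes -/

/-- A complex linear isometry of `ℂⁿ` as a real one. -/
def realIsometry (L : Cn n ≃ₗᵢ[ℂ] Cn n) : Cn n ≃ₗᵢ[ℝ] Cn n :=
  { L.toLinearEquiv.restrictScalars ℝ with norm_map' := L.norm_map }

lemma measurePreserving_isometry (L : Cn n ≃ₗᵢ[ℂ] Cn n) :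
    MeasurePreserving L (volume : Measure (Cn n)) volume :=
  (realIsometry L).measurePreserving

/-- Multiplication by a complex number of modulus one. -/
def rotation (c : ℂ) (hc : ‖c‖ = 1) : Cn n ≃ₗᵢ[ℂ] Cn n :=
  { LinearEquiv.smulOfNeZero ℂ (Cn n) c (by rintro rfl; simp at hc) with
    norm_map' := fun z => by
      change ‖c • z‖ = ‖z‖
      rw [norm_smul, hc, one_mul] }

/-- What matters is that κ depends neither on the basis nor on the centre and radii. Unitary
invariance reduces to the standard coordinates, where the polydisc is a product of discs. -/
lemma exists_volume_polydisc (n : ℕ) : ∃ κ : ℝ≥0∞, κ ≠ 0 ∧ κ ≠ ∞ ∧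
    ∀ (b : OrthonormalBasis (Fin n) ℂ (Cn n)) (c : Fin n → ℂ) (r : Fin n → ℝ),
      volume {z : Cn n | ∀ i, ‖b.repr z i - c i‖ < r i} = κ * ∏ i, ENNReal.ofReal (r i) ^ 2 := by
  let e : (Fin n → ℂ) ≃L[ℝ] Cn n := (PiLp.continuousLinearEquiv 2 ℝ (fun _ : Fin n => ℂ)).symm
  let ν : Measure (Cn n) := (volume : Measure (Fin n → ℂ)).map e
  have : ν.IsAddHaarMeasure := e.isAddHaarMeasure_map volume
  have hν := Measure.isAddLeftInvariant_eq_smul (volume : Measure (Cn n)) ν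
  set s := (volume : Measure (Cn n)).addHaarScalarFactor ν
  have hs : s ≠ 0 := by
    intro h
    rw [h, zero_smul] at hν
    exact (isOpen_univ.measure_ne_zero (volume : Measure (Cn n)) Set.univ_nonempty)
      (by rw [hν]; simp)
  refine ⟨s * (NNReal.pi : ℝ≥0∞) ^ n, ?_, ?_, fun b c r => ?_⟩
  · simp [hs, NNReal.pi_ne_zero]
  · exact ENNReal.mul_ne_top ENNReal.coe_ne_top (ENNReal.pow_ne_top ENNReal.coe_ne_top)
  · have h1 : {z : Cn n | ∀ i, ‖b.repr z i - c i‖ < r i} =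
        b.repr ⁻¹' {z : Cn n | ∀ i, ‖z i - c i‖ < r i} := rfl
    have hopen : IsOpen {z : Cn n | ∀ i, ‖z i - c i‖ < r i} := by
      rw [Set.ofPred_forall]
      exact isOpen_iInter_of_finite fun i => isOpen_lt (by fun_prop) continuous_const
    rw [h1, (measurePreserving_isometry b.repr).measure_preimage
      hopen.measurableSet.nullMeasurableSet, hν]
    have h2 : ν {z : Cn n | ∀ i, ‖z i - c i‖ < r i} =
        ∏ i, (ENNReal.ofReal (r i) ^ 2 * (NNReal.pi : ℝ≥0∞)) := by
      rw [Measure.map_apply e.continuous.measurable hopen.measurableSet]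
      have : e ⁻¹' {z : Cn n | ∀ i, ‖z i - c i‖ < r i} =
          Set.univ.pi fun i => ball (c i) (r i) := by
        ext z
        simp [e, Set.mem_pi, dist_eq_norm]
      rw [this, volume_pi_pi]
      simp [Complex.volume_ball]
    rw [Measure.smul_apply, h2, Finset.prod_mul_distrib]
    simp only [Finset.prod_const, Finset.card_univ, Fintype.card_fin]
    rw [ENNReal.smul_def, smul_eq_mul]
    ring

lemma exists_orthonormalBasis_zero (hn : 1 ≤ n) {x : Cn n} (hx : ‖x‖ = 1) :
    ∃ b : OrthonormalBasis (Fin n) ℂ (Cn n), b ⟨0, hn⟩ = x := by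
  have ho : Orthonormal ℂ (({⟨0, hn⟩} : Set (Fin n)).domRestrict fun _ => x) := by
    refine ⟨fun _ => hx, fun i j hij => ?_⟩
    exact absurd (Subsingleton.elim i j) hij
  obtain ⟨b, hb⟩ := ho.exists_orthonormalBasis_extension_of_card_eq (by simp)
  exact ⟨b, hb _ rfl⟩

/-- The nonisotropic box of size `r` and centre `z₀` adapted to the direction `x`. -/
def nibox (x z₀ : Cn n) (r : ℝ) : Set (Cn n) := {z | ‖inner ℂ x (z - z₀)‖ < r ^ 2 ∧ ‖z - z₀‖ < r}

lemma isOpen_nibox (x z₀ : Cn n) (r : ℝ) : IsOpen (nibox x z₀ r) := by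
  have h1 : Continuous fun z : Cn n => ‖inner ℂ x (z - z₀)‖ := by fun_prop
  have h2 : Continuous fun z : Cn n => ‖z - z₀‖ := by fun_prop
  exact (isOpen_lt h1 continuous_const).inter (isOpen_lt h2 continuous_const)

lemma exists_le_volume_nibox (hn : 1 ≤ n) : ∃ c : ℝ≥0∞, c ≠ 0 ∧ c ≠ ∞ ∧
    ∀ x : Cn n, ‖x‖ = 1 → ∀ r : ℝ, 0 < r → r ≤ 1 →
      c * ENNReal.ofReal (r ^ 2) ^ (n + 1) ≤ volume (nibox x 0 r) := by
  obtain ⟨κ, hκ0, hκt, hκ⟩ := exists_volume_polydisc n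
  have hn0 : (0 : ℝ) < n := by exact_mod_cast hn
  refine ⟨κ * ENNReal.ofReal (((2 * n : ℝ)⁻¹ ^ 2) ^ n), ?_, ?_, fun x hx r hr hr1 => ?_⟩
  · have : 0 < ((2 * n : ℝ)⁻¹ ^ 2) ^ n := by positivity
    exact mul_ne_zero hκ0 (ENNReal.ofReal_pos.2 this).ne'
  · exact ENNReal.mul_ne_top hκt ENNReal.ofReal_ne_top
  · obtain ⟨b, hb⟩ := exists_orthonormalBasis_zero hn hx
    -- A polydisc inside the box, of radius ≈ r² along `x` and ≈ r in the other n - 1 directions.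
    -- Its volume is ≈ r⁴ r^{2(n-1)} = (r²)^{n+1}.
    let ρ : Fin n → ℝ := fun i => if i = ⟨0, hn⟩ then (2 * n : ℝ)⁻¹ * r ^ 2 else (2 * n : ℝ)⁻¹ * r
    have hρr : ∀ i, ρ i ≤ (2 * n : ℝ)⁻¹ * r := by
      intro i
      simp only [ρ]
      split_ifs
      · gcongr; nlinarith
      · exact le_rfl
    have hsub : {z : Cn n | ∀ i, ‖b.repr z i - 0‖ < ρ i} ⊆ nibox x 0 r := by
      intro z hz
      have hz' : ∀ i, ‖b.repr z i‖ < ρ i := fun i => by simpa using hz i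
      refine ⟨?_, ?_⟩
      · have h := hz' ⟨0, hn⟩
        rw [b.repr_apply_apply, hb] at h
        simp only [ρ, if_true] at h
        rw [sub_zero]
        refine h.trans_le ?_
        have : (2 * n : ℝ)⁻¹ ≤ 1 := inv_le_one_of_one_le₀ (by
          have : (1 : ℝ) ≤ n := by exact_mod_cast hn
          linarith)
        nlinarith [sq_nonneg r]
      · rw [sub_zero, ← b.repr.norm_map, EuclideanSpace.norm_eq]
        rw [Real.sqrt_lt' hr]
        calc ∑ i, ‖b.repr z i‖ ^ 2 ≤ ∑ _i : Fin n, ((2 * n : ℝ)⁻¹ * r) ^ 2 := by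
              refine Finset.sum_le_sum fun i _ => ?_
              have := (hz' i).le.trans (hρr i)
              gcongr
          _ = r ^ 2 * (4 * n : ℝ)⁻¹ := by
              rw [Finset.sum_const, Finset.card_univ, Fintype.card_fin, nsmul_eq_mul]
              field_simp; ring
          _ < r ^ 2 * 1 := by
              have : (1 : ℝ) ≤ n := by exact_mod_cast hn
              gcongr
              exact inv_lt_one_of_one_lt₀ (by linarith)
          _ = r ^ 2 := mul_one _
    refine le_trans (le_of_eq ?_) (measure_mono hsub)
    rw [hκ b (fun _ => 0) ρ, mul_assoc]
    congr 1
    have e1 : ∏ i, ENNReal.ofReal (ρ i) ^ 2 = ENNReal.ofReal (∏ i, ρ i ^ 2) := by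
      rw [ENNReal.ofReal_prod_of_nonneg (fun i _ => by positivity)]
      refine Finset.prod_congr rfl fun i _ => ?_
      rw [ENNReal.ofReal_pow]
      simp only [ρ]; split_ifs <;> positivity
    have e2 : ∏ i, ρ i ^ 2 = ((2 * n : ℝ)⁻¹ ^ 2) ^ n * (r ^ 2) ^ (n + 1) := by
      obtain ⟨m, rfl⟩ : ∃ m, n = m + 1 := ⟨n - 1, by omega⟩
      rw [Fin.prod_univ_succ]
      have h0 : ρ 0 = (2 * (m + 1 : ℕ) : ℝ)⁻¹ * r ^ 2 := by
        have : (0 : Fin (m + 1)) = ⟨0, hn⟩ := rfl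
        simp [ρ]
      have hs : ∀ i : Fin m, ρ i.succ = (2 * (m + 1 : ℕ) : ℝ)⁻¹ * r := by
        intro i
        have : i.succ ≠ ⟨0, hn⟩ := fun h => Fin.succ_ne_zero i h
        simp [ρ]
      rw [h0, Finset.prod_congr rfl (fun i _ => by rw [hs i])]
      simp only [Finset.prod_const, Finset.card_univ, Fintype.card_fin]
      ring
    rw [e1, e2, ENNReal.ofReal_mul (by positivity), ENNReal.ofReal_pow (by positivity : 0 ≤ r ^ 2)]

/-! ### The sphere measure -/

lemma toSphere_univ_ne_zero (hn : 1 ≤ n) :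
    (volume : Measure (Cn n)).toSphere Set.univ ≠ 0 := by
  have : Nonempty (Fin n) := ⟨⟨0, hn⟩⟩
  have : Nontrivial (Cn n) := inferInstance
  rw [Measure.measure_univ_ne_zero]
  exact Measure.toSphere_ne_zero _

lemma toSphere_eq_smul (hn : 1 ≤ n) : (volume : Measure (Cn n)).toSphere =
    ((volume : Measure (Cn n)).toSphere Set.univ) • sphereMeasure n := by
  rw [sphereMeasure, smul_smul, ENNReal.mul_inv_cancel (toSphere_univ_ne_zero hn)
    (measure_ne_top _ _), one_smul]

instance : IsFiniteMeasure (sphereMeasure n) := by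
  constructor
  rw [sphereMeasure, Measure.smul_apply, smul_eq_mul]
  refine lt_of_le_of_lt (ENNReal.inv_mul_le_one _) ENNReal.one_lt_top

/-- Rotation of the sphere by a complex number of modulus one. -/
def sphereRotation (c : ℂ) (hc : ‖c‖ = 1) (η : unitSphere n) : unitSphere n :=
  ⟨c • (η : Cn n), by simp [norm_smul, hc]⟩

/-- `toSphere` measures a set through the volume of the cone over it, and rotations commute with
forming cones. -/
lemma measurePreserving_sphereRotation (c : ℂ) (hc : ‖c‖ = 1) :
    MeasurePreserving (sphereRotation (n := n) c hc) (sphereMeasure n) (sphereMeasure n) := by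
  have hcont : Continuous (sphereRotation (n := n) c hc) :=
    Continuous.subtype_mk (by fun_prop) _
  suffices h : MeasurePreserving (sphereRotation (n := n) c hc)
      (volume : Measure (Cn n)).toSphere (volume : Measure (Cn n)).toSphere by
    refine ⟨h.measurable, ?_⟩
    rw [sphereMeasure, Measure.map_smul, h.map_eq]
  refine ⟨hcont.measurable, Measure.ext fun s hs => ?_⟩
  rw [Measure.map_apply hcont.measurable hs, Measure.toSphere_apply' _ (hcont.measurable hs),
    Measure.toSphere_apply' _ hs]
  congr 1
  have hc0 : c ≠ 0 := by rintro rfl; simp at hc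
  have hset : Set.Ioo (0 : ℝ) 1 • ((↑) '' (sphereRotation c hc ⁻¹' s) : Set (Cn n)) =
      (rotation (n := n) c hc).toHomeomorph ⁻¹' (Set.Ioo (0 : ℝ) 1 • ((↑) '' s : Set (Cn n))) := by
    ext z
    simp only [Set.mem_smul, Set.mem_image, Set.mem_preimage]
    constructor
    · rintro ⟨t, ht, _, ⟨η, hη, rfl⟩, rfl⟩
      refine ⟨t, ht, _, ⟨_, hη, rfl⟩, ?_⟩
      exact smul_comm t c (η : Cn n)
    · rintro ⟨t, ht, _, ⟨η, hη, rfl⟩, h⟩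
      refine ⟨t, ht, c⁻¹ • (η : Cn n), ⟨⟨c⁻¹ • (η : Cn n), by simp [norm_smul, hc]⟩, ?_, rfl⟩, ?_⟩
      · convert hη
        ext1
        simp [sphereRotation, smul_smul, hc0]
      · change _ = c • z at h
        rw [smul_comm, h, smul_smul, inv_mul_cancel₀ hc0, one_smul]
  rw [hset]
  exact ((measurePreserving_isometry (rotation (n := n) c hc)).measure_preimage_emb
    (rotation (n := n) c hc).toHomeomorph.measurableEmbedding _)

lemma lintegral_sphere_smul {F : Cn n → ℝ≥0∞} (hF : Measurable fun η : unitSphere n => F η)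
    (c : ℂ) (hc : ‖c‖ = 1) :
    ∫⁻ η : unitSphere n, F (c • (η : Cn n)) ∂(sphereMeasure n) =
      ∫⁻ η : unitSphere n, F η ∂(sphereMeasure n) :=
  (measurePreserving_sphereRotation c hc).lintegral_comp hF

/-- Integration in polar coordinates. -/
lemma lintegral_polar {F : Cn n → ℝ≥0∞} (hF : Measurable F) (hn : 1 ≤ n) :
    ∫⁻ z, F z = ∫⁻ η : unitSphere n, ∫⁻ ρ in Set.Ioi (0 : ℝ),
      ENNReal.ofReal (ρ ^ (Module.finrank ℝ (Cn n) - 1)) * F (ρ • (η : Cn n))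
        ∂volume ∂(volume : Measure (Cn n)).toSphere := by
  have : Nonempty (Fin n) := ⟨⟨0, hn⟩⟩
  have : Nontrivial (Cn n) := inferInstance
  set N := Module.finrank ℝ (Cn n) - 1
  have hmp := (volume : Measure (Cn n)).measurePreserving_homeomorphUnitSphereProd
  have h1 : ∫⁻ z, F z = ∫⁻ z : ({0}ᶜ : Set (Cn n)), F z ∂(Measure.comap Subtype.val volume) := by
    rw [lintegral_subtype_comap (measurableSet_singleton _).compl]
    rw [restrict_compl_singleton]
  have h2 : ∫⁻ z : ({0}ᶜ : Set (Cn n)), F z ∂(Measure.comap Subtype.val volume) =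
      ∫⁻ q, F ((homeomorphUnitSphereProd (Cn n)).symm q : Cn n)
        ∂((volume : Measure (Cn n)).toSphere.prod (Measure.volumeIoiPow N)) := by
    rw [← hmp.lintegral_comp_emb (homeomorphUnitSphereProd (Cn n)).measurableEmbedding]
    simp
  have hsymm : ∀ q : unitSphere n × Set.Ioi (0 : ℝ),
      ((homeomorphUnitSphereProd (Cn n)).symm q : Cn n) = (q.2 : ℝ) • (q.1 : Cn n) := by
    intro q; rfl
  rw [h1, h2]
  simp_rw [hsymm]
  rw [lintegral_prod _ (by fun_prop)]
  refine lintegral_congr fun η => ?_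
  rw [Measure.volumeIoiPow, lintegral_withDensity_eq_lintegral_mul _ (by fun_prop) (by fun_prop)]
  exact lintegral_subtype_comap measurableSet_Ioi
    (fun ρ : ℝ => ENNReal.ofReal (ρ ^ N) * F (ρ • (η : Cn n)))

end

/-! ### The pseudo-distance and the radial maximal function on the sphere -/

noncomputable section

open Metric

variable {n : ℕ}

/-! ### Elementary properties of the pseudo-distance -/

lemma nidist_comm (x y : Cn n) : nidist x y = nidist y x := by
  rw [nidist, nidist, ← Complex.norm_conj]
  simp

lemma nidist_nonneg (x y : Cn n) : 0 ≤ nidist x y := norm_nonneg _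

lemma continuous_nidist_left (z : Cn n) : Continuous fun x : Cn n => nidist z x := by
  unfold nidist; fun_prop

lemma continuous_nidist : Continuous fun q : Cn n × Cn n => nidist q.1 q.2 := by
  unfold nidist; fun_prop

lemma one_sub_norm_le_nidist {x y : Cn n} (hy : ‖y‖ ≤ 1) : 1 - ‖x‖ ≤ nidist x y := by
  have h1 : ‖(inner ℂ y x : ℂ)‖ ≤ ‖x‖ :=
    (norm_inner_le_norm y x).trans (by nlinarith [norm_nonneg x, norm_nonneg y])
  have h2 := norm_sub_norm_le (1 : ℂ) (inner ℂ y x)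
  rw [norm_one] at h2
  unfold nidist
  linarith

lemma norm_sub_sq_le_nidist {x y : Cn n} (hx : ‖x‖ ≤ 1) (hy : ‖y‖ ≤ 1) :
    ‖x - y‖ ^ 2 ≤ 2 * nidist x y := by
  have h := @norm_sub_sq ℂ _ _ _ _ y x
  have h2 : (1 - inner ℂ y x : ℂ).re ≤ nidist x y := Complex.re_le_norm _
  rw [Complex.sub_re, Complex.one_re] at h2
  rw [norm_sub_rev, h]
  have : RCLike.re (inner ℂ y x : ℂ) = (inner ℂ y x : ℂ).re := rfl
  rw [this]
  nlinarith [norm_nonneg x, norm_nonneg y]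

/-- The component of `z` orthogonal to a unit vector `y` is controlled by `d(z, y)`. -/
lemma norm_sub_inner_smul_sq_le {z y : Cn n} (hz : ‖z‖ ≤ 1) (hy : ‖y‖ = 1) :
    ‖z - (inner ℂ y z : ℂ) • y‖ ^ 2 ≤ 2 * nidist z y := by
  set a : ℂ := inner ℂ y z
  have h1 : ‖z - a • y‖ ^ 2 = ‖z‖ ^ 2 - ‖a‖ ^ 2 := by
    have h := @norm_sub_sq ℂ _ _ _ _ z (a • y)
    have h2 : (inner ℂ z (a • y) : ℂ) = (‖a‖ ^ 2 : ℝ) := by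
      rw [inner_smul_right, ← inner_conj_symm]
      change a * (starRingEnd ℂ) a = _
      rw [Complex.mul_conj, Complex.normSq_eq_norm_sq]
    rw [h, h2, norm_smul, hy, mul_one]
    have : RCLike.re (((‖a‖ ^ 2 : ℝ) : ℂ)) = ‖a‖ ^ 2 := Complex.ofReal_re _
    rw [this]; ring
  have h3 : 1 - ‖a‖ ≤ nidist z y := by
    have h2 := norm_sub_norm_le (1 : ℂ) a
    rw [norm_one] at h2
    exact h2
  have h4 : ‖a‖ ≤ 1 := (norm_inner_le_norm y z).trans (by rw [hy, one_mul]; exact hz)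
  rw [h1]
  nlinarith [norm_nonneg a, norm_nonneg z]

/-- Split `x` and `z` along `y` and orthogonally to it. The components along `y` contribute at most
d(x,y) + d(y,z). The orthogonal ones have norms at most √(2d(x,y)) and √(2d(y,z)), so their inner
product contributes at most the same amount again. -/
lemma nidist_triangle {x y z : Cn n} (hx : ‖x‖ ≤ 1) (hy : ‖y‖ = 1) (hz : ‖z‖ ≤ 1) :
    nidist x z ≤ 2 * (nidist x y + nidist y z) := by
  set a : ℂ := inner ℂ y x with ha
  set b : ℂ := inner ℂ y z with hb
  have hyy : (inner ℂ y y : ℂ) = 1 := by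
    rw [inner_self_eq_norm_sq_to_K, hy]; simp
  have hxy : (inner ℂ x y : ℂ) = (starRingEnd ℂ) a := (inner_conj_symm x y).symm
  have hzy : (inner ℂ z y : ℂ) = (starRingEnd ℂ) b := (inner_conj_symm z y).symm
  have e1 : (1 : ℂ) - inner ℂ z x = ((1 - a) + a * (1 - (starRingEnd ℂ) b)) -
      inner ℂ (z - b • y) (x - a • y) := by
    rw [inner_sub_left, inner_sub_right, inner_sub_right, inner_smul_left, inner_smul_right,
      inner_smul_left, inner_smul_right, hyy, hzy, ← ha]
    ring
  have ha1 : ‖a‖ ≤ 1 := (norm_inner_le_norm y x).trans (by rw [hy, one_mul]; exact hx)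
  have h1 : ‖1 - a‖ = nidist x y := rfl
  have h2 : ‖1 - (starRingEnd ℂ) b‖ = nidist y z := by rw [← hzy]; rfl
  have hX := norm_sub_inner_smul_sq_le hx hy
  have hZ := norm_sub_inner_smul_sq_le hz hy
  rw [nidist_comm z y] at hZ
  have h3 : ‖(inner ℂ (z - b • y) (x - a • y) : ℂ)‖ ≤ nidist x y + nidist y z := by
    refine (norm_inner_le_norm _ _).trans ?_
    nlinarith [sq_nonneg (‖z - b • y‖ - ‖x - a • y‖)]
  have h4 : ‖(1 - a) + a * (1 - (starRingEnd ℂ) b)‖ ≤ nidist x y + nidist y z := by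
    refine (norm_add_le _ _).trans ?_
    rw [norm_mul, h1, h2]
    nlinarith [nidist_nonneg y z]
  calc nidist x z = ‖(1 : ℂ) - inner ℂ z x‖ := rfl
    _ ≤ 2 * (nidist x y + nidist y z) := by
        rw [e1]
        refine (norm_sub_le _ _).trans ?_
        linarith

lemma nidist_self {x : Cn n} (hx : ‖x‖ = 1) : nidist x x = 0 := by
  rw [nidist, inner_self_eq_norm_sq_to_K, hx]; simp

lemma nidist_eq_zero {x y : Cn n} (hx : ‖x‖ ≤ 1) (hy : ‖y‖ ≤ 1) (h : nidist x y = 0) : x = y := by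
  have := norm_sub_sq_le_nidist hx hy
  rw [h, mul_zero] at this
  have h2 : ‖x - y‖ = 0 := by nlinarith [norm_nonneg (x - y)]
  exact sub_eq_zero.1 (norm_eq_zero.1 h2)

/-! ### The measure of nonisotropic balls of the sphere -/

/-- The shell {tη : d(η,x) < r, 1 - r < t < 1} lies in a polydisc of radii 2r along `x` and 2√r
across, of volume ≈ r^{n+1}; polar coordinates divide by the thickness r. The summand 2^n of the
constant covers r > 1/2. -/
lemma exists_sphereMeasure_niball_le (hn : 1 ≤ n) : ∃ C : ℝ≥0∞, C ≠ ∞ ∧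
    ∀ x : Cn n, ‖x‖ = 1 → ∀ r : ℝ, 0 < r →
      sphereMeasure n {η | nidist (η : Cn n) x < r} ≤ C * ENNReal.ofReal r ^ n := by
  obtain ⟨κ, hκ0, hκt, hκ⟩ := exists_volume_polydisc n
  set N := Module.finrank ℝ (Cn n) - 1 with hN
  set T := (volume : Measure (Cn n)).toSphere Set.univ with hT
  have hT0 : T ≠ 0 := toSphere_univ_ne_zero hn
  have hTt : T ≠ ∞ := measure_ne_top _ _
  set D : ℝ≥0∞ := T⁻¹ * (ENNReal.ofReal ((1 / 2) ^ N))⁻¹ * (κ * 4 ^ n) with hD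
  have hhalf : ENNReal.ofReal ((1 / 2 : ℝ) ^ N) ≠ 0 :=
    (ENNReal.ofReal_pos.2 (by positivity)).ne'
  have hDt : D ≠ ∞ := by
    refine ENNReal.mul_ne_top (ENNReal.mul_ne_top ?_ ?_) ?_
    · exact ENNReal.inv_ne_top.2 hT0
    · exact ENNReal.inv_ne_top.2 hhalf
    · exact ENNReal.mul_ne_top hκt (ENNReal.pow_ne_top (by simp))
  refine ⟨D + 2 ^ n, ?_, fun x hx r hr => ?_⟩
  · exact ENNReal.add_ne_top.2 ⟨hDt, ENNReal.pow_ne_top (by simp)⟩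
  rcases le_or_gt r (1 / 2) with hr2 | hr2
  swap
  · have h1 : sphereMeasure n {η | nidist (η : Cn n) x < r} ≤ 1 := by
      refine (measure_mono (Set.subset_univ _)).trans ?_
      rw [sphereMeasure, Measure.smul_apply, smul_eq_mul]
      exact ENNReal.inv_mul_le_one _
    refine h1.trans ?_
    rw [add_mul]
    refine le_add_left ?_
    rw [← mul_pow]
    refine one_le_pow₀ ?_
    have : (2 : ℝ≥0∞) = ENNReal.ofReal 2 := by simp
    rw [this, ← ENNReal.ofReal_mul (by norm_num), ← ENNReal.ofReal_one]
    exact ENNReal.ofReal_le_ofReal (by linarith)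
  refine le_trans ?_ (mul_le_mul_left (le_self_add : D ≤ D + 2 ^ n) _)
  obtain ⟨b, hb⟩ := exists_orthonormalBasis_zero hn hx
  let c : Fin n → ℂ := fun i => if i = ⟨0, hn⟩ then 1 else 0
  let ρ : Fin n → ℝ := fun i => if i = ⟨0, hn⟩ then 2 * r else 2 * √r
  set Ω : Set (Cn n) := {z | ∀ i, ‖b.repr z i - c i‖ < ρ i} with hΩ
  have hΩo : IsOpen Ω := by
    rw [hΩ, Set.ofPred_forall]
    exact isOpen_iInter_of_finite fun i => isOpen_lt (by fun_prop) continuous_const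
  have hvol : volume Ω = κ * 4 ^ n * ENNReal.ofReal r ^ (n + 1) := by
    rw [hΩ, hκ b c ρ]
    have e1 : ∏ i, ENNReal.ofReal (ρ i) ^ 2 = ENNReal.ofReal (∏ i, ρ i ^ 2) := by
      rw [ENNReal.ofReal_prod_of_nonneg (fun i _ => by positivity)]
      refine Finset.prod_congr rfl fun i _ => ?_
      rw [ENNReal.ofReal_pow]
      simp only [ρ]; split_ifs <;> positivity
    have e2 : ∏ i, ρ i ^ 2 = 4 ^ n * r ^ (n + 1) := by
      obtain ⟨m, rfl⟩ : ∃ m, n = m + 1 := ⟨n - 1, by omega⟩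
      rw [Fin.prod_univ_succ]
      have h0 : ρ 0 = 2 * r := by
        have : (0 : Fin (m + 1)) = ⟨0, hn⟩ := rfl
        simp [ρ]
      have hs : ∀ i : Fin m, ρ i.succ ^ 2 = 4 * r := by
        intro i
        have h : ρ i.succ = 2 * √r := by
          have : i.succ ≠ ⟨0, hn⟩ := fun h => Fin.succ_ne_zero i h
          simp [ρ]
        rw [h, mul_pow, Real.sq_sqrt hr.le]; norm_num
      rw [h0, Finset.prod_congr rfl (fun i _ => by rw [hs i])]
      simp only [Finset.prod_const, Finset.card_univ, Fintype.card_fin]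
      ring
    rw [e1, e2, ENNReal.ofReal_mul (by positivity), ENNReal.ofReal_pow hr.le,
      ENNReal.ofReal_pow (by norm_num)]
    norm_num
    ring
  set B : Set (unitSphere n) := {η | nidist (η : Cn n) x < r} with hB
  have hBm : MeasurableSet B := by
    refine (isOpen_lt ?_ continuous_const).measurableSet
    unfold nidist; fun_prop
  have hmem : ∀ η ∈ B, ∀ t ∈ Set.Ioo (1 - r) 1, t • (η : Cn n) ∈ Ω := by
    intro η hη t ht i
    have hη1 : ‖(η : Cn n)‖ = 1 := by simp
    have hη' : ‖1 - (inner ℂ x (η : Cn n) : ℂ)‖ < r := hη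
    have ht0 : 0 < t := by linarith [ht.1]
    have hrep : b.repr (t • (η : Cn n)) i = (t : ℂ) * b.repr (η : Cn n) i := by
      have : t • (η : Cn n) = (t : ℂ) • (η : Cn n) := rfl
      rw [this, map_smul]; rfl
    rw [hrep]
    by_cases hi : i = ⟨0, hn⟩
    · subst hi
      simp only [c, ρ, if_true, b.repr_apply_apply, hb]
      set a : ℂ := inner ℂ x (η : Cn n)
      have : (t : ℂ) * a - 1 = -(t * (1 - a) + (1 - t)) := by ring
      rw [this, norm_neg]
      refine (norm_add_le _ _).trans_lt ?_
      rw [norm_mul, Complex.norm_of_nonneg ht0.le]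
      have h1 : ‖(1 : ℂ) - t‖ = 1 - t := by
        rw [← Complex.ofReal_one, ← Complex.ofReal_sub, Complex.norm_of_nonneg (by linarith [ht.2])]
      rw [h1]
      nlinarith [ht.1, ht.2, norm_nonneg (1 - a)]
    · simp only [c, ρ, if_neg hi, sub_zero, norm_mul, Complex.norm_of_nonneg ht0.le]
      have hsum : ∑ j, ‖b.repr (η : Cn n) j‖ ^ 2 = 1 := by
        rw [← EuclideanSpace.norm_sq_eq, b.repr.norm_map, hη1, one_pow]
      have h2 : ‖b.repr (η : Cn n) ⟨0, hn⟩‖ ^ 2 + ‖b.repr (η : Cn n) i‖ ^ 2 ≤ 1 := by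
        rw [← hsum, ← Finset.sum_pair (f := fun j => ‖b.repr (η : Cn n) j‖ ^ 2) (Ne.symm hi)]
        exact Finset.sum_le_univ_sum_of_nonneg fun _ => by positivity
      rw [b.repr_apply_apply _ ⟨0, hn⟩, hb] at h2
      have h3 := norm_sub_norm_le (1 : ℂ) (inner ℂ x (η : Cn n))
      rw [norm_one] at h3
      have h4 : ‖b.repr (η : Cn n) i‖ ^ 2 ≤ 2 * r := by
        rcases le_or_gt 1 ‖(inner ℂ x (η : Cn n) : ℂ)‖ with h5 | h5
        · nlinarith
        · nlinarith [norm_nonneg (inner ℂ x (η : Cn n) : ℂ)]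
      have h6 : ‖b.repr (η : Cn n) i‖ < 2 * √r := by
        refine lt_of_pow_lt_pow_left₀ 2 (by positivity) ?_
        rw [mul_pow, Real.sq_sqrt hr.le]; linarith
      nlinarith [norm_nonneg (b.repr (η : Cn n) i), ht.2]
  have key : ENNReal.ofReal ((1 / 2) ^ N) * ENNReal.ofReal r *
      (volume : Measure (Cn n)).toSphere B ≤ volume Ω := by
    have h0 : volume Ω = ∫⁻ z, Ω.indicator 1 z := by
      rw [lintegral_indicator_one hΩo.measurableSet]
    rw [h0, lintegral_polar (measurable_one.indicator hΩo.measurableSet) hn]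
    calc _ = ∫⁻ η, B.indicator (fun _ => ENNReal.ofReal ((1 / 2) ^ N) * ENNReal.ofReal r) η
            ∂(volume : Measure (Cn n)).toSphere := by
          rw [lintegral_indicator_const hBm]
      _ ≤ _ := by
          refine lintegral_mono fun η => ?_
          by_cases hη : η ∈ B
          swap
          · simp [hη]
          rw [Set.indicator_of_mem hη]
          calc ENNReal.ofReal ((1 / 2) ^ N) * ENNReal.ofReal r
              = ∫⁻ _ in Set.Ioo (1 - r) 1, ENNReal.ofReal ((1 / 2) ^ N) := by
                rw [setLIntegral_const, Real.volume_Ioo]; congr 2; ring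
            _ ≤ ∫⁻ t in Set.Ioo (1 - r) 1, ENNReal.ofReal (t ^ N) *
                Ω.indicator 1 (t • (η : Cn n)) := by
                refine setLIntegral_mono' measurableSet_Ioo fun t ht => ?_
                rw [Set.indicator_of_mem (hmem η hη t ht), Pi.one_apply, mul_one]
                refine ENNReal.ofReal_le_ofReal (pow_le_pow_left₀ (by norm_num) ?_ _)
                linarith [ht.1]
            _ ≤ _ := lintegral_mono_set fun t ht => by
                  have := ht.1
                  simp only [Set.mem_Ioi]; linarith
  have hr0 : ENNReal.ofReal r ≠ 0 := (ENNReal.ofReal_pos.2 hr).ne'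
  have hrt : ENNReal.ofReal r ≠ ∞ := ENNReal.ofReal_ne_top
  rw [hvol, pow_succ, mul_comm (ENNReal.ofReal _) (ENNReal.ofReal r), mul_assoc, mul_comm (_ ^ n),
    mul_left_comm _ (ENNReal.ofReal r), ENNReal.mul_le_mul_iff_right hr0 hrt] at key
  have : sphereMeasure n B = T⁻¹ * (volume : Measure (Cn n)).toSphere B := rfl
  rw [this, hD, mul_assoc, mul_assoc, mul_assoc]
  refine mul_le_mul_right ?_ _
  rw [← ENNReal.div_eq_inv_mul, ENNReal.le_div_iff_mul_le (Or.inl hhalf)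
    (Or.inl ENNReal.ofReal_ne_top), mul_comm]
  refine key.trans (le_of_eq (by ring))

/-! ### The radial maximal function -/

/-- The radial maximal function, taken over a countable dense set of radii. -/
def radialMax (g : Cn n → ℂ) (η : Cn n) : ℝ≥0∞ :=
  haveI : Nonempty (Set.Ico (0 : ℝ) 1) := ⟨⟨0, by simp⟩⟩
  ⨆ i : ℕ, ‖g ((TopologicalSpace.denseSeq (Set.Ico (0 : ℝ) 1) i : ℝ) • η)‖ₑ

lemma smul_mem_unitBall {η : Cn n} (hη : ‖η‖ ≤ 1) {t : ℝ} (ht : t ∈ Set.Ico (0 : ℝ) 1) :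
    t • η ∈ unitBall n := by
  rw [mem_ball_zero_iff, norm_smul, Real.norm_of_nonneg ht.1]
  nlinarith [ht.1, ht.2]

lemma le_radialMax {g : Cn n → ℂ} (hg : ContinuousOn g (unitBall n)) {η : Cn n} (hη : ‖η‖ ≤ 1)
    {t : ℝ} (ht : t ∈ Set.Ico (0 : ℝ) 1) : ‖g (t • η)‖ₑ ≤ radialMax g η := by
  have : Nonempty (Set.Ico (0 : ℝ) 1) := ⟨⟨0, by simp⟩⟩
  have hc : Continuous fun t : Set.Ico (0 : ℝ) 1 => ‖g ((t : ℝ) • η)‖ₑ :=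
    (hg.comp_continuous (by fun_prop) fun t => smul_mem_unitBall hη t.2).enorm
  refine (TopologicalSpace.denseRange_denseSeq (Set.Ico (0 : ℝ) 1)).induction_on
    (p := fun t => ‖g ((t : ℝ) • η)‖ₑ ≤ radialMax g η) ⟨t, ht⟩
    (isClosed_le hc continuous_const) fun i => ?_
  exact le_iSup (fun i : ℕ => ‖g ((TopologicalSpace.denseSeq (Set.Ico (0 : ℝ) 1) i : ℝ) • η)‖ₑ) i

lemma iSup_rpow {ι : Sort*} (u : ι → ℝ≥0∞) {p : ℝ} (hp : 0 < p) :
    (⨆ i, u i) ^ p = ⨆ i, u i ^ p :=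
  (ENNReal.orderIsoRpow p hp).map_iSup u

lemma measurable_radialMax {g : Cn n → ℂ} (hg : ContinuousOn g (unitBall n)) :
    Measurable fun η : unitSphere n => radialMax g η := by
  refine Measurable.iSup fun i => Continuous.measurable ?_
  refine (hg.comp_continuous (by fun_prop) fun η => smul_mem_unitBall ?_ (Subtype.prop _)).enorm
  have : ‖(η : Cn n)‖ = 1 := by simp
  exact this.le

/-- Rotation invariance replaces the integral over the sphere by averages over the circles e^{iθ}η.
On each slice c ↦ g(Rcη), holomorphic across the closed unit disc because R < 1, the one-variable
maximal theorem applies. -/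
lemma lintegral_iSup_sphere_le {g : Cn n → ℂ} (hg : DifferentiableOn ℂ g (unitBall n)) {p : ℝ}
    (hp : 0 < p) {R : ℝ} (hR : R ∈ Set.Ioo (0 : ℝ) 1) (r : ℕ → ℝ)
    (hr : ∀ i, r i ∈ Set.Ico (0 : ℝ) 1) :
    ∫⁻ η : unitSphere n, ⨆ i, ‖g (R • r i • (η : Cn n))‖ₑ ^ p ∂sphereMeasure n ≤
      256 * ∫⁻ η : unitSphere n, ‖g (R • (η : Cn n))‖ₑ ^ p ∂sphereMeasure n := by
  set I := Set.Ioc 0 (2 * Real.pi)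
  set F : Cn n → ℝ≥0∞ := fun z => ⨆ i, ‖g (R • r i • z)‖ₑ ^ p with hF
  set H : Cn n → ℝ≥0∞ := fun z => ‖g (R • z)‖ₑ ^ p with hH
  have hη1 : ∀ η : unitSphere n, ‖(η : Cn n)‖ = 1 := fun η => by simp
  have hcm : ∀ x : ℝ, ‖circleMap 0 1 x‖ = 1 := fun x => by simp
  have hball : ∀ z : Cn n, ‖z‖ ≤ 1 → R • z ∈ unitBall n := fun z hz =>
    smul_mem_unitBall hz ⟨hR.1.le, hR.2⟩
  have hri : ∀ i, ∀ z : Cn n, ‖z‖ = 1 → ‖r i • z‖ ≤ 1 := fun i z hz => by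
    rw [norm_smul, hz, mul_one, Real.norm_of_nonneg (hr i).1]; exact (hr i).2.le
  have hrot : ∀ (x : ℝ) (η : unitSphere n), ‖circleMap 0 1 x • (η : Cn n)‖ = 1 := fun x η => by
    rw [norm_smul, hcm, hη1, one_mul]
  have hcirc : Continuous (circleMap 0 1) := continuous_circleMap 0 1
  have hFm : Measurable fun q : ℝ × unitSphere n => F (circleMap 0 1 q.1 • (q.2 : Cn n)) := by
    refine Measurable.iSup fun i => ?_
    refine Measurable.pow_const (Continuous.measurable ?_) p
    exact (hg.continuousOn.comp_continuous (by fun_prop) fun q =>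
      hball _ (hri i _ (hrot _ _))).enorm
  have hHm : Measurable fun q : ℝ × unitSphere n => H (circleMap 0 1 q.1 • (q.2 : Cn n)) := by
    refine Measurable.pow_const (Continuous.measurable ?_) p
    exact (hg.continuousOn.comp_continuous (by fun_prop) fun q => hball _ (hrot _ _).le).enorm
  have hFm1 : Measurable fun η : unitSphere n => F η := by
    have := hFm.comp (measurable_prodMk_left (x := (0 : ℝ)))
    simpa [Function.comp_def, circleMap] using this
  have hHm1 : Measurable fun η : unitSphere n => H η := by
    have := hHm.comp (measurable_prodMk_left (x := (0 : ℝ)))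
    simpa [Function.comp_def, circleMap] using this
  have hI0 : volume I ≠ 0 := by
    simp only [I, Real.volume_Ioc, sub_zero]
    exact (ENNReal.ofReal_pos.2 Real.two_pi_pos).ne'
  have hIt : volume I ≠ ∞ := by
    simp only [I, Real.volume_Ioc]
    exact ENNReal.ofReal_ne_top
  have avg : ∀ G : Cn n → ℝ≥0∞, Measurable (fun η : unitSphere n => G η) →
      Measurable (fun q : ℝ × unitSphere n => G (circleMap 0 1 q.1 • (q.2 : Cn n))) →
      volume I * ∫⁻ η : unitSphere n, G η ∂sphereMeasure n =
      ∫⁻ η : unitSphere n, (∫⁻ x in I, G (circleMap 0 1 x • (η : Cn n))) ∂sphereMeasure n := by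
    intro G hG1 hG2
    rw [lintegral_lintegral_swap (f := fun (η : unitSphere n) (x : ℝ) =>
      G (circleMap 0 1 x • (η : Cn n))) (hG2.comp measurable_swap).aemeasurable]
    rw [lintegral_congr fun x => lintegral_sphere_smul hG1 _ (hcm x), setLIntegral_const, mul_comm]
  rw [← ENNReal.mul_le_mul_iff_right hI0 hIt, mul_left_comm, avg F hFm1 hFm, avg H hHm1 hHm,
    ← lintegral_const_mul']
  swap
  · norm_num
  refine lintegral_mono fun η => ?_
  have han : AnalyticOnNhd ℂ (fun c : ℂ => g (R • c • (η : Cn n))) (closedBall 0 1) := by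
    have hd : DifferentiableOn ℂ (fun c : ℂ => g (R • c • (η : Cn n))) (ball 0 R⁻¹) := by
      refine hg.comp (by fun_prop) fun c hc => ?_
      rw [mem_ball_zero_iff] at hc ⊢
      rw [norm_smul, norm_smul, hη1, mul_one, Real.norm_of_nonneg hR.1.le]
      calc R * ‖c‖ < R * R⁻¹ := by gcongr; exact hR.1
        _ = 1 := mul_inv_cancel₀ hR.1.ne'
    refine (hd.analyticOnNhd isOpen_ball).mono (closedBall_subset_ball ?_)
    exact one_lt_inv_iff₀.2 ⟨hR.1, hR.2⟩
  have := lintegral_iSup_radial_le hp han hr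
  refine le_trans (le_of_eq ?_) this
  refine lintegral_congr fun x => ?_
  simp only [hF]
  congr 1 with i
  have : r i • circleMap 0 1 x • (η : Cn n) = circleMap 0 (r i) x • (η : Cn n) := by
    have h1 : r i • circleMap 0 1 x • (η : Cn n) = (r i : ℂ) • circleMap 0 1 x • (η : Cn n) := rfl
    rw [h1, smul_smul]
    simp [circleMap]
  rw [this]

lemma lintegral_radialMax_le {g : Cn n → ℂ} (hg : DifferentiableOn ℂ g (unitBall n)) {p : ℝ}
    (hp : 0 < p) : ∫⁻ η : unitSphere n, radialMax g η ^ p ∂sphereMeasure n ≤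
      256 * ⨆ r ∈ Set.Ioo (0 : ℝ) 1,
        ∫⁻ η : unitSphere n, ‖g (r • (η : Cn n))‖ₑ ^ p ∂sphereMeasure n := by
  have : Nonempty (Set.Ico (0 : ℝ) 1) := ⟨⟨0, by simp⟩⟩
  set r : ℕ → ℝ := fun i => (TopologicalSpace.denseSeq (Set.Ico (0 : ℝ) 1) i : ℝ)
  have hr : ∀ i, r i ∈ Set.Ico (0 : ℝ) 1 := fun i => Subtype.prop _
  obtain ⟨R, -, hR, hRlim⟩ := exists_seq_strictMono_tendsto' (show (0 : ℝ) < 1 by norm_num)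
  have hη1 : ∀ η : unitSphere n, ‖(η : Cn n)‖ = 1 := fun η => by simp
  have hri : ∀ i, ∀ η : unitSphere n, r i • (η : Cn n) ∈ unitBall n := fun i η =>
    smul_mem_unitBall (hη1 η).le (hr i)
  have hball : ∀ k i, ∀ η : unitSphere n, R k • r i • (η : Cn n) ∈ unitBall n := fun k i η =>
    smul_mem_unitBall (mem_ball_zero_iff.1 (hri i η)).le ⟨(hR k).1.le, (hR k).2⟩
  set F : ℕ → unitSphere n → ℝ≥0∞ := fun k η => ⨆ i, ‖g (R k • r i • (η : Cn n))‖ₑ ^ p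
  have hFm : ∀ k, Measurable (F k) := fun k => by
    refine Measurable.iSup fun i => Measurable.pow_const (Continuous.measurable ?_) p
    exact (hg.continuousOn.comp_continuous (by fun_prop) fun η => hball k i η).enorm
  -- The dilations by R_k ↑ 1 converge pointwise, so Fatou's lemma removes them with the constant
  -- unchanged.
  have hle : ∀ η : unitSphere n, radialMax g η ^ p ≤ liminf (fun k => F k η) atTop := by
    intro η
    rw [radialMax, iSup_rpow _ hp]
    refine iSup_le fun i => ?_
    have ht : Tendsto (fun k => ‖g (R k • r i • (η : Cn n))‖ₑ ^ p) atTop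
        (𝓝 (‖g (r i • (η : Cn n))‖ₑ ^ p)) := by
      refine (ENNReal.continuous_rpow_const.tendsto _).comp ?_
      refine Tendsto.enorm ?_
      have hc : ContinuousAt g (r i • (η : Cn n)) :=
        hg.continuousOn.continuousAt (isOpen_ball.mem_nhds (hri i η))
      refine hc.tendsto.comp ?_
      have := hRlim.smul_const (r i • (η : Cn n))
      rwa [one_smul] at this
    change ‖g (r i • (η : Cn n))‖ₑ ^ p ≤ _
    rw [← ht.liminf_eq]
    exact liminf_le_liminf (Eventually.of_forall fun k =>
      le_iSup (fun i => ‖g (R k • r i • (η : Cn n))‖ₑ ^ p) i)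
  calc _ ≤ ∫⁻ η, liminf (fun k => F k η) atTop ∂sphereMeasure n := lintegral_mono hle
    _ ≤ liminf (fun k => ∫⁻ η, F k η ∂sphereMeasure n) atTop := lintegral_liminf_le hFm
    _ ≤ liminf (fun _ : ℕ => 256 * ⨆ r ∈ Set.Ioo (0 : ℝ) 1,
        ∫⁻ η : unitSphere n, ‖g (r • (η : Cn n))‖ₑ ^ p ∂sphereMeasure n) atTop := by
        refine liminf_le_liminf (Eventually.of_forall fun k => ?_)
        refine (lintegral_iSup_sphere_le hg hp (hR k) r hr).trans ?_
        gcongr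
        exact le_iSup₂ (f := fun r (_ : r ∈ Set.Ioo (0 : ℝ) 1) =>
          ∫⁻ η : unitSphere n, ‖g (r • (η : Cn n))‖ₑ ^ p ∂sphereMeasure n) (R k) (hR k)
    _ = _ := by simp

end

/-! ### Local maxima dominated by averages of the radial maximal function -/

noncomputable section

open Metric

variable {n : ℕ}

/-! ### Local maxima at dyadic scales -/

/-- The dyadic scale `2⁻ʲ`. -/
def dl (j : ℕ) : ℝ := (1 / 2) ^ j

lemma dl_pos (j : ℕ) : 0 < dl j := by unfold dl; positivity

lemma dl_le_one (j : ℕ) : dl j ≤ 1 := pow_le_one₀ (by norm_num) (by norm_num)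

lemma dl_succ (j : ℕ) : dl (j + 1) = dl j / 2 := by unfold dl; rw [pow_succ]; ring

lemma dl_add (i j : ℕ) : dl (i + j) = dl i * dl j := pow_add _ _ _

lemma dl_anti {i j : ℕ} (h : i ≤ j) : dl j ≤ dl i :=
  pow_le_pow_of_le_one (by norm_num) (by norm_num) h

/-- The maximum of `|g|` over the part of the approach region of `x` at height `2⁻ʲ`. -/
def localMax (g : Cn n → ℂ) (j : ℕ) (x : Cn n) : ℝ≥0∞ :=
  ⨆ (z : Cn n) (_ : ‖z‖ < 1 - dl j / 8 ∧ nidist z x < 2 * dl j), ‖g z‖ₑ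

lemma le_localMax {g : Cn n → ℂ} {j : ℕ} {x z : Cn n} (h1 : ‖z‖ < 1 - dl j / 8)
    (h2 : nidist z x < 2 * dl j) : ‖g z‖ₑ ≤ localMax g j x :=
  le_iSup₂ (f := fun (z : Cn n) (_ : ‖z‖ < 1 - dl j / 8 ∧ nidist z x < 2 * dl j) => ‖g z‖ₑ) z
    ⟨h1, h2⟩

/-- For fixed z the condition on x is open, so the supremum is lower semicontinuous and hence
measurable. -/
lemma isOpen_lt_localMax (g : Cn n → ℂ) (j : ℕ) (t : ℝ≥0∞) :
    IsOpen {x : Cn n | t < localMax g j x} := by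
  refine isOpen_iff_mem_nhds.2 fun x hx => ?_
  rw [Set.mem_ofPred_eq, localMax, lt_iSup_iff] at hx
  obtain ⟨z, hz⟩ := hx
  rw [lt_iSup_iff] at hz
  obtain ⟨h, h3⟩ := hz
  have hc : Continuous fun x : Cn n => nidist z x := by unfold nidist; fun_prop
  have h4 : ∀ᶠ y in 𝓝 x, nidist z y < 2 * dl j := hc.continuousAt.eventually_lt_const h.2
  exact h4.mono fun y hy => h3.trans_le (le_localMax h.1 hy)

lemma measurable_localMax (g : Cn n → ℂ) (j : ℕ) : Measurable fun x : Cn n => localMax g j x :=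
  measurable_of_Ioi fun t => (isOpen_lt_localMax g j t).measurableSet

/-- The box is circled: with each point it contains the complex disc through it centred at 0. This
is what averaging over circles needs. -/
lemma smul_mem_nibox {x u : Cn n} {r : ℝ} (hu : u ∈ nibox x 0 r) {c : ℂ} (hc : ‖c‖ ≤ 1) :
    c • u ∈ nibox x 0 r := by
  obtain ⟨h1, h2⟩ := hu
  rw [sub_zero] at h1 h2
  refine ⟨?_, ?_⟩
  · rw [sub_zero, inner_smul_right, norm_mul]
    nlinarith [norm_nonneg (inner ℂ x u : ℂ), norm_nonneg c]
  · rw [sub_zero, norm_smul]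
    nlinarith [norm_nonneg u, norm_nonneg c]

lemma enorm_rpow_le_lintegral_circle {G : ℂ → ℂ} {q : ℝ} (hq : 0 < q)
    (hG : AnalyticOnNhd ℂ G (closedBall 0 1)) :
    volume (Set.Ioc 0 (2 * Real.pi)) * ‖G 0‖ₑ ^ q ≤
      ∫⁻ t in Set.Ioc 0 (2 * Real.pi), ‖G (circleMap 0 1 t)‖ₑ ^ q := by
  have h1 := ENNReal.ofReal_le_ofReal (norm_rpow_le_circleAverage hq hG)
  have hc : ContinuousOn (fun z => ‖G z‖ ^ q) (sphere 0 1) :=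
    (hG.continuousOn.mono sphere_subset_closedBall).norm.rpow_const fun _ _ => Or.inr hq.le
  rw [ofReal_circleAverage hc (fun z _ => by positivity)] at h1
  have h2 : ∀ z : ℂ, ENNReal.ofReal (‖z‖ ^ q) = ‖z‖ₑ ^ q := fun z => by
    rw [← ENNReal.ofReal_rpow_of_nonneg (norm_nonneg _) hq.le, ofReal_norm]
  have hpi : (0 : ℝ) < 2 * Real.pi := Real.two_pi_pos
  simp_rw [ENNReal.ofReal_mul (inv_nonneg.2 hpi.le), h2] at h1
  rw [lintegral_const_mul' _ _ ENNReal.ofReal_ne_top] at h1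
  rw [Real.volume_Ioc, sub_zero]
  calc _ ≤ ENNReal.ofReal (2 * Real.pi) * _ := mul_le_mul_right h1 _
    _ = _ := by
      rw [← mul_assoc, ← ENNReal.ofReal_mul hpi.le, mul_inv_cancel₀ hpi.ne', ENNReal.ofReal_one,
        one_mul]

/-- The sub-mean value property of `|g|^q` over nonisotropic boxes. -/
lemma enorm_rpow_mul_volume_nibox_le {g : Cn n → ℂ} {U : Set (Cn n)} (hU : IsOpen U)
    (hg : DifferentiableOn ℂ g U) {q : ℝ} (hq : 0 < q)
    {x z : Cn n} {r : ℝ} (hz : ∀ u ∈ nibox x 0 r, z + u ∈ U) :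
    ‖g z‖ₑ ^ q * volume (nibox x 0 r) ≤ ∫⁻ u in nibox x 0 r, ‖g (z + u)‖ₑ ^ q := by
  classical
  set D := nibox x 0 r with hD
  have hDo : IsOpen D := isOpen_nibox x 0 r
  set F : Cn n → ℝ≥0∞ := D.indicator fun u => ‖g (z + u)‖ₑ ^ q with hF
  have hgc : ContinuousOn (fun u => g (z + u)) D :=
    hg.continuousOn.comp (by fun_prop) hz
  have hFm : Measurable F := by
    rw [hF, ← Set.piecewise_eq_indicator]
    refine ContinuousOn.measurable_piecewise ?_ continuousOn_const hDo.measurableSet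
    exact ENNReal.continuous_rpow_const.comp_continuousOn hgc.enorm
  set I := Set.Ioc 0 (2 * Real.pi)
  have hI0 : volume I ≠ 0 := by
    simp only [I, Real.volume_Ioc, sub_zero]
    exact (ENNReal.ofReal_pos.2 Real.two_pi_pos).ne'
  have hIt : volume I ≠ ∞ := by
    simp only [I, Real.volume_Ioc]
    exact ENNReal.ofReal_ne_top
  have hcm : ∀ x : ℝ, ‖circleMap 0 1 x‖ = 1 := fun x => by simp
  have hcirc : Continuous (circleMap 0 1) := continuous_circleMap 0 1
  rw [← lintegral_indicator hDo.measurableSet]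
  change _ ≤ ∫⁻ u, F u
  rw [← ENNReal.mul_le_mul_iff_right hI0 hIt]
  -- The rotations u ↦ e^{it}u preserve volume, so the integral over the box becomes an average of
  -- circle means of c ↦ g(z + cu), to which the one-variable inequality applies.
  have hswap : volume I * ∫⁻ u, F u = ∫⁻ u, ∫⁻ t in I, F (circleMap 0 1 t • u) := by
    rw [lintegral_lintegral_swap (f := fun (u : Cn n) (t : ℝ) => F (circleMap 0 1 t • u))
      (hFm.comp (by fun_prop)).aemeasurable]
    have hrot : ∀ t, ∫⁻ u, F (circleMap 0 1 t • u) = ∫⁻ u, F u := fun t =>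
      (measurePreserving_isometry (rotation (n := n) (circleMap 0 1 t) (hcm t))).lintegral_comp hFm
    rw [lintegral_congr hrot, setLIntegral_const, mul_comm]
  rw [hswap, mul_left_comm]
  calc ‖g z‖ₑ ^ q * (volume I * volume D) = ∫⁻ u, D.indicator (fun _ => volume I * ‖g z‖ₑ ^ q) u := by
        rw [lintegral_indicator_const hDo.measurableSet]; ring
    _ ≤ _ := by
        refine lintegral_mono fun u => ?_
        by_cases hu : u ∈ D
        swap
        · simp [hu]
        rw [Set.indicator_of_mem hu]
        have han : AnalyticOnNhd ℂ (fun c : ℂ => g (z + c • u)) (closedBall 0 1) := by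
          have hd : DifferentiableOn ℂ (fun c : ℂ => g (z + c • u))
              ((fun c : ℂ => z + c • u) ⁻¹' U) :=
            hg.comp (by fun_prop) fun c hc => hc
          refine (hd.analyticOnNhd (hU.preimage (by fun_prop))).mono fun c hc => ?_
          exact hz _ (smul_mem_nibox hu (mem_closedBall_zero_iff.1 hc))
        have := enorm_rpow_le_lintegral_circle hq han
        simp only [zero_smul, add_zero] at this
        refine this.trans (le_of_eq (lintegral_congr fun t => ?_))
        rw [hF, Set.indicator_of_mem (smul_mem_nibox hu (hcm t).le)]

/-- Split `z` along `x` and orthogonally; the orthogonal part is at most √(2d(z,x)). This controls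
the cross term when ‖z + u‖ is expanded. -/
lemma norm_inner_le_nibox {x z u : Cn n} (hx : ‖x‖ = 1) (hz : ‖z‖ ≤ 1) {r : ℝ}
    (hu : u ∈ nibox x 0 r) :
    ‖(inner ℂ z u : ℂ)‖ ≤ r ^ 2 + √(2 * nidist z x) * r := by
  obtain ⟨h1, h2⟩ := hu
  rw [sub_zero] at h1 h2
  set a : ℂ := inner ℂ x z
  have ha1 : ‖a‖ ≤ 1 := (norm_inner_le_norm x z).trans (by rw [hx, one_mul]; exact hz)
  have e : (inner ℂ z u : ℂ) = (starRingEnd ℂ) a * inner ℂ x u + inner ℂ (z - a • x) u := by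
    rw [inner_sub_left, inner_smul_left]; ring
  have h3 : ‖z - a • x‖ ≤ √(2 * nidist z x) :=
    Real.le_sqrt_of_sq_le (norm_sub_inner_smul_sq_le hz hx)
  rw [e]
  refine (norm_add_le _ _).trans (add_le_add ?_ ?_)
  · rw [norm_mul, RCLike.norm_conj]
    nlinarith [norm_nonneg a, norm_nonneg (inner ℂ x u : ℂ)]
  · refine (norm_inner_le_norm _ _).trans ?_
    gcongr

/-- By the sub-mean value property |g(z)|^q is at most its mean over a box about z of volume ≈
δ^{n+1}, where δ = 2^{-j}. In polar coordinates this box lies over the ball B(x,6δ) of the sphere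
and in a radial interval of length 3δ, on which |g| is at most the radial maximal function. Dividing
by δ leaves δ^n. -/
lemma exists_localMax_rpow_le (hn : 1 ≤ n) : ∃ C : ℝ≥0∞, C ≠ ∞ ∧
    ∀ (g : Cn n → ℂ), DifferentiableOn ℂ g (unitBall n) → ∀ q : ℝ, 0 < q →
      ∀ x : Cn n, ‖x‖ = 1 → ∀ j : ℕ,
      ENNReal.ofReal (dl j) ^ n * localMax g j x ^ q ≤
        C * ∫⁻ η in {η : unitSphere n | nidist (η : Cn n) x < 6 * dl j},
          radialMax g η ^ q ∂sphereMeasure n := by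
  obtain ⟨c, hc0, hct, hc⟩ := exists_le_volume_nibox hn
  set T := (volume : Measure (Cn n)).toSphere Set.univ with hT
  have hTt : T ≠ ∞ := measure_ne_top _ _
  set c' : ℝ≥0∞ := c * ENNReal.ofReal (1 / 1024) ^ (n + 1) with hc'
  have hc'0 : c' ≠ 0 := mul_ne_zero hc0 (pow_ne_zero _ (ENNReal.ofReal_pos.2 (by norm_num)).ne')
  have hc't : c' ≠ ∞ := ENNReal.mul_ne_top hct (ENNReal.pow_ne_top ENNReal.ofReal_ne_top)
  refine ⟨c'⁻¹ * (3 * T), ENNReal.mul_ne_top (ENNReal.inv_ne_top.2 hc'0)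
    (ENNReal.mul_ne_top (by norm_num) hTt), fun g hg q hq x hx j => ?_⟩
  set δ := dl j with hδ
  have hδ0 : 0 < δ := dl_pos j
  have hδ1 : δ ≤ 1 := dl_le_one j
  set B : Set (unitSphere n) := {η | nidist (η : Cn n) x < 6 * δ} with hB
  have hBm : MeasurableSet B := by
    refine (isOpen_lt ?_ continuous_const).measurableSet
    unfold nidist; fun_prop
  set M := ∫⁻ η in B, radialMax g η ^ q ∂sphereMeasure n with hM
  have hδe0 : ENNReal.ofReal δ ≠ 0 := (ENNReal.ofReal_pos.2 hδ0).ne'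
  have hδet : ENNReal.ofReal δ ≠ ∞ := ENNReal.ofReal_ne_top
  rw [localMax, iSup_rpow _ hq, ENNReal.mul_iSup]
  refine iSup_le fun z => ?_
  rw [iSup_rpow _ hq, ENNReal.mul_iSup]
  refine iSup_le fun ⟨hz1, hz2⟩ => ?_
  rw [← hδ] at hz1 hz2
  -- With this size the cross term ⟨z,u⟩ is at most δ/1024 + δ/16 and ‖u‖² ≤ δ/1024. The gap ‖z‖ < 1
  -- - δ/8 then keeps the whole box inside the unit ball.
  set r := √(δ / 1024) with hr
  have hr2 : r ^ 2 = δ / 1024 := Real.sq_sqrt (by positivity)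
  have hr0 : 0 < r := Real.sqrt_pos.2 (by positivity)
  have hr1 : r ≤ 1 := by
    rw [hr]; exact Real.sqrt_le_one.2 (by linarith)
  have hzl : ‖z‖ ≤ 1 := by linarith
  have hbox : ∀ u ∈ nibox x 0 r, z + u ∈ unitBall n ∧ nidist (z + u) x < 5 / 2 * δ := by
    intro u hu
    have h1 := norm_inner_le_nibox hx hzl hu
    have h2 : √(2 * nidist z x) * r ≤ δ / 16 := by
      rw [hr, ← Real.sqrt_mul (by have := nidist_nonneg z x; positivity)]
      refine Real.sqrt_le_iff.2 ⟨by positivity, ?_⟩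
      nlinarith
    obtain ⟨h3, h4⟩ := hu
    rw [sub_zero] at h3 h4
    constructor
    · rw [mem_ball_zero_iff]
      have h5 := @norm_add_sq ℂ _ _ _ _ z u
      have h6 : RCLike.re (inner ℂ z u : ℂ) ≤ ‖(inner ℂ z u : ℂ)‖ := RCLike.re_le_norm _
      have h7 : ‖z‖ ^ 2 ≤ (1 - δ / 8) ^ 2 := by gcongr
      have h8 : ‖u‖ ^ 2 ≤ r ^ 2 := by gcongr
      have : ‖z + u‖ ^ 2 < 1 := by nlinarith
      nlinarith [norm_nonneg (z + u)]
    · have : nidist (z + u) x = ‖(1 - inner ℂ x z) - (inner ℂ x u : ℂ)‖ := by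
        rw [nidist, inner_add_right]; congr 1; ring
      rw [this]
      refine (norm_sub_le _ _).trans_lt ?_
      have h9 : ‖(1 : ℂ) - inner ℂ x z‖ < 2 * δ := hz2
      linarith
  have hsub := enorm_rpow_mul_volume_nibox_le isOpen_ball hg hq (fun u hu => (hbox u hu).1)
  classical
  set Ω : Set (Cn n) := unitBall n ∩ {w | nidist w x < 5 / 2 * δ} with hΩ
  have hΩo : IsOpen Ω := by
    refine isOpen_ball.inter (isOpen_lt ?_ continuous_const)
    unfold nidist; fun_prop
  set F : Cn n → ℝ≥0∞ := Ω.indicator fun w => ‖g w‖ₑ ^ q with hF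
  have hFm : Measurable F := by
    rw [hF, ← Set.piecewise_eq_indicator]
    refine ContinuousOn.measurable_piecewise ?_ continuousOn_const hΩo.measurableSet
    exact ENNReal.continuous_rpow_const.comp_continuousOn
      (hg.continuousOn.mono Set.inter_subset_left).enorm
  -- A point tη of Ω has 1 - t < 5δ/2 and d(tη,x) < 5δ/2, hence d(η,x) < 5δ < 6δ. The factor `T`
  -- passes from `toSphere` to the normalized measure.
  have hpolar : ∫⁻ w, F w ≤ 3 * ENNReal.ofReal δ * (T * M) := by
    rw [lintegral_polar hFm hn, toSphere_eq_smul hn, lintegral_smul_measure, smul_eq_mul, ← hT,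
      mul_left_comm]
    refine mul_le_mul_right ?_ _
    rw [hM, ← lintegral_indicator hBm, ← lintegral_const_mul' _ _ (by finiteness)]
    refine lintegral_mono fun η => ?_
    have hη1 : ‖(η : Cn n)‖ = 1 := by simp
    have hpt : ∀ t ∈ Set.Ioi (0 : ℝ), ENNReal.ofReal (t ^ (Module.finrank ℝ (Cn n) - 1)) *
        F (t • (η : Cn n)) ≤ (Set.Ioo (1 - 3 * δ) 1).indicator
          (fun _ => B.indicator (fun η => radialMax g η ^ q) η) t := by
      intro t ht
      by_cases hmem : t • (η : Cn n) ∈ Ω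
      swap
      · rw [hF, Set.indicator_of_notMem hmem, mul_zero]; exact zero_le
      rw [hF, Set.indicator_of_mem hmem]
      obtain ⟨hm1, hm2⟩ := hmem
      have ht0 : 0 < t := ht
      have hnorm : ‖t • (η : Cn n)‖ = t := by
        rw [norm_smul, hη1, mul_one, Real.norm_of_nonneg ht0.le]
      rw [mem_ball_zero_iff, hnorm] at hm1
      have hm3 : nidist (t • (η : Cn n)) x < 5 / 2 * δ := hm2
      have hm4 := one_sub_norm_le_nidist (x := t • (η : Cn n)) hx.le
      rw [hnorm] at hm4
      have hηB : η ∈ B := by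
        change nidist (η : Cn n) x < 6 * δ
        have e : (1 : ℂ) - inner ℂ x (η : Cn n) =
            (1 - inner ℂ x (t • (η : Cn n))) - (1 - t) * inner ℂ x (η : Cn n) := by
          have : t • (η : Cn n) = (t : ℂ) • (η : Cn n) := rfl
          rw [this, inner_smul_right]; ring
        rw [nidist, e]
        refine (norm_sub_le _ _).trans_lt ?_
        have h1 : ‖(1 : ℂ) - t‖ = 1 - t := by
          rw [← Complex.ofReal_one, ← Complex.ofReal_sub, Complex.norm_of_nonneg (by linarith)]
        have h2 : ‖(inner ℂ x (η : Cn n) : ℂ)‖ ≤ 1 :=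
          (norm_inner_le_norm _ _).trans (by rw [hx, hη1, one_mul])
        rw [norm_mul, h1]
        have h3 : ‖(1 : ℂ) - inner ℂ x (t • (η : Cn n))‖ < 5 / 2 * δ := hm3
        nlinarith [norm_nonneg (inner ℂ x (η : Cn n) : ℂ)]
      rw [Set.indicator_of_mem (show t ∈ Set.Ioo (1 - 3 * δ) 1 from ⟨by linarith, hm1⟩),
        Set.indicator_of_mem hηB]
      calc _ ≤ 1 * ‖g (t • (η : Cn n))‖ₑ ^ q := by
            refine mul_le_mul_left ?_ _
            rw [← ENNReal.ofReal_one]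
            exact ENNReal.ofReal_le_ofReal (pow_le_one₀ ht0.le hm1.le)
        _ ≤ _ := by
            rw [one_mul]
            exact ENNReal.rpow_le_rpow (le_radialMax hg.continuousOn hη1.le ⟨ht0.le, hm1⟩) hq.le
    calc _ ≤ ∫⁻ t in Set.Ioi (0 : ℝ), (Set.Ioo (1 - 3 * δ) 1).indicator
          (fun _ => B.indicator (fun η => radialMax g η ^ q) η) t :=
          setLIntegral_mono' measurableSet_Ioi hpt
      _ ≤ ∫⁻ t, (Set.Ioo (1 - 3 * δ) 1).indicator
          (fun _ => B.indicator (fun η => radialMax g η ^ q) η) t := setLIntegral_le_lintegral _ _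
      _ = _ := by
          rw [lintegral_indicator_const measurableSet_Ioo, Real.volume_Ioo, mul_comm]
          congr 1
          rw [show 1 - (1 - 3 * δ) = 3 * δ by ring, ENNReal.ofReal_mul (by norm_num)]
          norm_num
  have hInt : ∫⁻ u in nibox x 0 r, ‖g (z + u)‖ₑ ^ q ≤ ∫⁻ w, F w := by
    rw [← lintegral_add_left_eq_self F z, ← lintegral_indicator (isOpen_nibox x 0 r).measurableSet]
    refine lintegral_mono fun u => ?_
    by_cases hu : u ∈ nibox x 0 r
    swap
    · simp [hu]
    rw [Set.indicator_of_mem hu, hF, Set.indicator_of_mem (show z + u ∈ Ω from hbox u hu)]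
  have hvol := hc x hx r hr0 hr1
  rw [hr2] at hvol
  have e1 : c * ENNReal.ofReal (δ / 1024) ^ (n + 1) = c' * ENNReal.ofReal δ ^ n * ENNReal.ofReal δ := by
    rw [hc', div_eq_mul_one_div, ENNReal.ofReal_mul hδ0.le, mul_pow, pow_succ (ENNReal.ofReal δ)]
    ring
  rw [e1] at hvol
  have key : ‖g z‖ₑ ^ q * (c' * ENNReal.ofReal δ ^ n) * ENNReal.ofReal δ ≤
      3 * (T * M) * ENNReal.ofReal δ := by
    calc _ = ‖g z‖ₑ ^ q * (c' * ENNReal.ofReal δ ^ n * ENNReal.ofReal δ) := by ring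
      _ ≤ _ := mul_le_mul_right hvol _
      _ ≤ _ := hsub
      _ ≤ _ := hInt
      _ ≤ _ := hpolar
      _ = _ := by ring
  rw [ENNReal.mul_le_mul_iff_left hδe0 hδet] at key
  rw [mul_assoc, ← ENNReal.div_eq_inv_mul, ENNReal.le_div_iff_mul_le (Or.inl hc'0) (Or.inl hc't)]
  calc _ = ‖g z‖ₑ ^ q * (c' * ENNReal.ofReal δ ^ n) := by ring
    _ ≤ _ := key
    _ = _ := by ring

end

/-! ### Schur's test and the reduction to regular measures -/

noncomputable section

open Metric

variable {n : ℕ}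

/-! ### Powers of two and the Schur test -/

/-- `2 ^ a` as an extended nonnegative real. -/
def twoPow (a : ℝ) : ℝ≥0∞ := ENNReal.ofReal (2 ^ a)

lemma twoPow_ne_top (a : ℝ) : twoPow a ≠ ∞ := ENNReal.ofReal_ne_top

lemma twoPow_add (a b : ℝ) : twoPow (a + b) = twoPow a * twoPow b := by
  rw [twoPow, Real.rpow_add (by norm_num), ENNReal.ofReal_mul (by positivity)]; rfl

@[simp] lemma twoPow_zero : twoPow 0 = 1 := by simp [twoPow]

lemma twoPow_mono {a b : ℝ} (h : a ≤ b) : twoPow a ≤ twoPow b :=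
  ENNReal.ofReal_le_ofReal (Real.rpow_le_rpow_of_exponent_le (by norm_num) h)

lemma twoPow_rpow (a b : ℝ) : twoPow a ^ b = twoPow (a * b) := by
  rw [twoPow, ENNReal.ofReal_rpow_of_pos (by positivity), ← Real.rpow_mul (by norm_num)]; rfl

lemma twoPow_pow (a : ℝ) (k : ℕ) : twoPow a ^ k = twoPow (a * k) := by
  rw [← ENNReal.rpow_natCast, twoPow_rpow]

lemma twoPow_inv (a : ℝ) : (twoPow a)⁻¹ = twoPow (-a) := by
  rw [← ENNReal.rpow_neg_one, twoPow_rpow, mul_neg_one]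

lemma twoPow_lt_one {a : ℝ} (h : a < 0) : twoPow a < 1 := by
  rw [twoPow, ENNReal.ofReal_lt_one]
  exact Real.rpow_lt_one_of_one_lt_of_neg (by norm_num) h

lemma dl_eq_rpow (j : ℕ) : dl j = 2 ^ (-(j : ℝ)) := by
  rw [dl, Real.rpow_neg (by norm_num), Real.rpow_natCast]; simp

lemma ofReal_dl (j : ℕ) : ENNReal.ofReal (dl j) = twoPow (-(j : ℝ)) := by
  rw [dl_eq_rpow]; rfl

lemma tsum_twoPow_ne_top {a : ℝ} (h : 0 < a) : ∑' k : ℕ, twoPow (-(a * k)) ≠ ∞ := by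
  have : ∀ k : ℕ, twoPow (-(a * k)) = twoPow (-a) ^ k := fun k => by rw [twoPow_pow]; ring_nf
  simp_rw [this, ENNReal.tsum_geometric]
  exact ENNReal.inv_ne_top.2 (tsub_pos_of_lt (twoPow_lt_one (by linarith))).ne'

/-- Hölder's inequality for the measure with weights `k`. -/
lemma tsum_mul_rpow_le {ι : Type*} (k u : ι → ℝ≥0∞) {p : ℝ} (hp : 1 ≤ p) :
    (∑' j, k j * u j) ^ p ≤ (∑' j, k j) ^ (p - 1) * ∑' j, k j * u j ^ p := by
  have hp0 : 0 < p := by linarith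
  have h1 : ∑' j, k j * u j ≤
      (∑' j, k j) ^ (1 - p⁻¹) * (∑' j, k j * u j ^ p) ^ p⁻¹ := by
    rw [ENNReal.tsum_eq_iSup_sum]
    refine iSup_le fun S => (ENNReal.inner_le_weight_mul_Lp_of_nonneg S hp k u).trans ?_
    have : 0 ≤ 1 - p⁻¹ := sub_nonneg.2 (inv_le_one_of_one_le₀ hp)
    gcongr
    · exact ENNReal.sum_le_tsum S
    · exact ENNReal.sum_le_tsum (f := fun j => k j * u j ^ p) S
  refine (ENNReal.rpow_le_rpow h1 hp0.le).trans (le_of_eq ?_)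
  rw [ENNReal.mul_rpow_of_nonneg _ _ hp0.le, ← ENNReal.rpow_mul, ← ENNReal.rpow_mul,
    inv_mul_cancel₀ hp0.ne', ENNReal.rpow_one, sub_mul, one_mul, inv_mul_cancel₀ hp0.ne']

/-- The Schur test for nonnegative kernels on `ℓ^p`. -/
lemma tsum_schur_le {ι κ : Type*} (k : ι → κ → ℝ≥0∞) {A : ℝ≥0∞} (hA1 : ∀ i, ∑' j, k i j ≤ A)
    (hA2 : ∀ j, ∑' i, k i j ≤ A) (u : κ → ℝ≥0∞) {p : ℝ} (hp : 1 ≤ p) :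
    ∑' i, (∑' j, k i j * u j) ^ p ≤ A ^ (p - 1) * A * ∑' j, u j ^ p := by
  calc _ ≤ ∑' i, A ^ (p - 1) * ∑' j, k i j * u j ^ p := by
        refine ENNReal.tsum_le_tsum fun i => (tsum_mul_rpow_le (k i) u hp).trans ?_
        gcongr
        exact hA1 i
    _ = A ^ (p - 1) * ∑' j, ∑' i, k i j * u j ^ p := by
        rw [ENNReal.tsum_mul_left, ENNReal.tsum_comm]
    _ ≤ A ^ (p - 1) * ∑' j, A * u j ^ p := by
        refine mul_le_mul_right (ENNReal.tsum_le_tsum fun j => ?_) _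
        rw [ENNReal.tsum_mul_right]
        exact mul_le_mul_left (hA2 j) _
    _ = _ := by rw [ENNReal.tsum_mul_left, mul_assoc]

/-! ### Regular measures -/

/-- A probability measure carried by a subset `K` of the sphere, whose nonisotropic balls centred
on `K` have comparable measures at comparable scales, with growth exponents between `d` and `s`. -/
structure IsRegular (μ : Measure (Cn n)) (K : Set (Cn n)) (s d : ℝ) : Prop where
  prob : IsProbabilityMeasure μ
  measurableSet : MeasurableSet K
  subset : K ⊆ unitSphere n
  full : μ Kᶜ = 0
  pos : ∀ x ∈ K, ∀ r : ℝ, 0 < r → μ (niball x r) ≠ 0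
  doubling : ∀ κ : ℝ, 1 ≤ κ → ∃ D : ℝ≥0∞, D ≠ ∞ ∧ ∀ x ∈ K, ∀ y ∈ K, ∀ r : ℝ, 0 < r →
    nidist x y ≤ κ * r → μ (niball x (κ * r)) ≤ D * μ (niball y r)
  upper : ∃ C : ℝ≥0∞, C ≠ ∞ ∧ ∀ x ∈ K, ∀ i j : ℕ,
    μ (niball x (dl i)) ≤ C * twoPow (j * s) * μ (niball x (dl (i + j)))
  lower : ∃ C : ℝ≥0∞, C ≠ ∞ ∧ ∀ x ∈ K, ∀ i j : ℕ,
    twoPow (j * d) * μ (niball x (dl (i + j))) ≤ C * μ (niball x (dl i))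

lemma isOpen_niball (x : Cn n) (r : ℝ) : IsOpen (niball x r) :=
  isOpen_lt (continuous_nidist_left x) continuous_const

lemma niball_mono (x : Cn n) {r r' : ℝ} (h : r ≤ r') : niball x r ⊆ niball x r' :=
  fun _ hy => lt_of_lt_of_le hy h

lemma niball_inter_subset {x y : Cn n} (hx : ‖x‖ = 1) (hy : ‖y‖ = 1) {r t : ℝ}
    (h : nidist x y ≤ t) : niball x r ∩ unitSphere n ⊆ niball y (2 * (t + r)) := by
  rintro z ⟨hz, hz1⟩
  have hz' : nidist x z < r := hz
  have hz2 : ‖z‖ = 1 := mem_sphere_zero_iff_norm.1 hz1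
  have := nidist_triangle hy.le hx hz2.le
  change nidist y z < _
  rw [nidist_comm y x] at this
  linarith

lemma measure_le_of_inter_subset {μ : Measure (Cn n)} {S A B : Set (Cn n)} (hS : μ Sᶜ = 0)
    (h : A ∩ S ⊆ B) : μ A ≤ μ B := by
  rw [← measure_inter_conull hS]
  exact measure_mono h

/-- Around a point where μ(B(x,1)) = 0 the growth inequalities carry no information. Cover the
sphere by finitely many balls of radius 1/4 and discard the null ones. A point of a remaining ball
B(y,1/4) has B(y,1/4) inside its own unit ball on the sphere, so the least of finitely many positive
masses is a uniform lower bound. -/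
lemma exists_subset_full_measure {E : Set (Cn n)} (hE : MeasurableSet E) (hES : E ⊆ unitSphere n)
    {μ : Measure (Cn n)} (hμ : μ Eᶜ = 0) :
    ∃ K, MeasurableSet K ∧ K ⊆ E ∧ μ Kᶜ = 0 ∧ ∃ c : ℝ≥0∞, c ≠ 0 ∧ ∀ x ∈ K, c ≤ μ (niball x 1) := by
  classical
  obtain ⟨t, ht1, ht2⟩ := (isCompact_sphere (0 : Cn n) 1).elim_nhds_subcover
    (fun x => niball x (1 / 4)) fun x hx => (isOpen_niball x _).mem_nhds (by
      change nidist x x < _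
      rw [nidist_self (mem_sphere_zero_iff_norm.1 hx)]; norm_num)
  set N : Set (Cn n) := ⋃ y ∈ t.filter (fun y => μ (niball y (1 / 4)) = 0), niball y (1 / 4)
  have hN : μ N = 0 := by
    refine (measure_biUnion_null_iff (Finset.countable_toSet _)).2 fun y hy => ?_
    exact (Finset.mem_filter.1 hy).2
  have hNo : IsOpen N := isOpen_biUnion fun y _ => isOpen_niball y _
  have hsph : μ (unitSphere n)ᶜ = 0 := measure_mono_null (Set.compl_subset_compl.2 hES) hμ
  refine ⟨E \ N, hE.diff hNo.measurableSet, Set.sdiff_subset, ?_, ?_⟩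
  · rw [Set.sdiff_eq, Set.compl_inter, compl_compl]
    exact measure_union_null hμ hN
  set T := t.filter (fun y => μ (niball y (1 / 4)) ≠ 0)
  refine ⟨T.inf fun y => μ (niball y (1 / 4)), ?_, fun x hx => ?_⟩
  · have : 0 < T.inf fun y => μ (niball y (1 / 4)) :=
      (Finset.lt_inf_iff ENNReal.zero_lt_top).2 fun y hy =>
        pos_iff_ne_zero.2 (Finset.mem_filter.1 hy).2
    exact this.ne'
  · obtain ⟨y, hyt, hy⟩ := Set.mem_iUnion₂.1 (ht2 (hES hx.1))
    have hy0 : μ (niball y (1 / 4)) ≠ 0 := fun h =>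
      hx.2 (Set.mem_biUnion (Finset.mem_coe.2 (Finset.mem_filter.2 ⟨hyt, h⟩)) hy)
    have hxn : ‖x‖ = 1 := mem_sphere_zero_iff_norm.1 (hES hx.1)
    have hyn : ‖y‖ = 1 := mem_sphere_zero_iff_norm.1 (ht1 y hyt)
    refine (Finset.inf_le (Finset.mem_filter.2 ⟨hyt, hy0⟩)).trans ?_
    refine measure_le_of_inter_subset hsph ?_
    have := niball_inter_subset hyn hxn (r := 1 / 4) (t := 1 / 4) (le_of_lt hy)
    norm_num at this
    simpa using this

/-- The defining inequalities concern radii at most 1 and a single centre. The uniform lower bound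
for μ(B(x,1)) on K extends doubling to all radii, and the quasi-triangle inequality to different
centres. -/
lemma exists_isRegular {E : Set (Cn n)} (hE : IsClosed E) (hES : E ⊆ unitSphere n)
    {s d : ℝ} {μ : Measure (Cn n)} (hU : MemU E s μ) (hL : MemL E d μ) :
    ∃ K ⊆ E, IsRegular μ K s d := by
  obtain ⟨⟨hprob, hcar⟩, C, hC0, hC⟩ := hU
  obtain ⟨-, C', hC'0, hC'⟩ := hL
  obtain ⟨K, hKm, hKE, hKf, c, hc0, hc⟩ := exists_subset_full_measure hE.measurableSet hES hcar
  have hsph : μ (unitSphere n)ᶜ = 0 := measure_mono_null (Set.compl_subset_compl.2 hES) hcar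
  have hnorm : ∀ x ∈ K, ‖x‖ = 1 := fun x hx => mem_sphere_zero_iff_norm.1 (hES (hKE hx))
  have up : ∀ x ∈ K, ∀ r R : ℝ, 0 < r → r ≤ R → R ≤ 1 →
      μ (niball x R) ≤ ENNReal.ofReal (C * (R / r) ^ s) * μ (niball x r) := by
    intro x hx r R hr hrR hR
    have h := hC x (hKE hx) r (R / r) hr (by rwa [div_mul_cancel₀ _ hr.ne'])
      (by rwa [div_mul_cancel₀ _ hr.ne'])
    rw [div_mul_cancel₀ _ hr.ne'] at h
    have h2 := ENNReal.ofReal_le_ofReal h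
    have : 0 ≤ R / r := div_nonneg (hr.le.trans hrR) hr.le
    rwa [ENNReal.ofReal_mul (by positivity), ofReal_measureReal, ofReal_measureReal] at h2
  have low : ∀ x ∈ K, ∀ r R : ℝ, 0 < r → r ≤ R → R ≤ 1 →
      ENNReal.ofReal (C' * (R / r) ^ d) * μ (niball x r) ≤ μ (niball x R) := by
    intro x hx r R hr hrR hR
    have h := hC' x (hKE hx) r (R / r) hr (by rwa [div_mul_cancel₀ _ hr.ne'])
      (by rwa [div_mul_cancel₀ _ hr.ne'])
    rw [div_mul_cancel₀ _ hr.ne'] at h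
    have h2 := ENNReal.ofReal_le_ofReal h
    have : 0 ≤ R / r := div_nonneg (hr.le.trans hrR) hr.le
    rwa [ENNReal.ofReal_mul (by positivity), ofReal_measureReal, ofReal_measureReal] at h2
  have hpos : ∀ x ∈ K, ∀ r : ℝ, 0 < r → μ (niball x r) ≠ 0 := by
    intro x hx r hr h0
    have h1 : μ (niball x (min r 1)) = 0 :=
      measure_mono_null (niball_mono x (min_le_left _ _)) h0
    have h2 := up x hx (min r 1) 1 (lt_min hr one_pos) (min_le_right _ _) le_rfl
    rw [h1, mul_zero] at h2
    exact hc0 (le_zero_iff.1 ((hc x hx).trans h2))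
  have hdlratio : ∀ i j : ℕ, dl i / dl (i + j) = 2 ^ (j : ℝ) := by
    intro i j
    rw [dl_add, Real.rpow_natCast, dl, dl]
    field_simp
    rw [← mul_pow]; norm_num
  have hself : ∀ κ : ℝ, 1 ≤ κ → ∃ D : ℝ≥0∞, D ≠ ∞ ∧ ∀ y ∈ K, ∀ r : ℝ, 0 < r →
      μ (niball y (κ * r)) ≤ D * μ (niball y r) := by
    intro κ hκ
    have hκ0 : 0 < κ := by linarith
    -- The exponent |s| gives a bound for t^s that is uniform in 1 ≤ t ≤ κ whatever the sign of s.
    have hk : 0 < κ ^ |s| := Real.rpow_pos_of_pos hκ0 _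
    have hk1 : ∀ t, 1 ≤ t → t ≤ κ → t ^ s ≤ κ ^ |s| := fun t ht1 ht2 =>
      (Real.rpow_le_rpow_of_exponent_le ht1 (le_abs_self s)).trans
        (Real.rpow_le_rpow (by linarith) ht2 (abs_nonneg s))
    refine ⟨ENNReal.ofReal (C * κ ^ |s|) + c⁻¹ * (ENNReal.ofReal (C * κ ^ |s|) + 1), ?_,
      fun y hy r hr => ?_⟩
    · have := ENNReal.inv_ne_top.2 hc0
      finiteness
    rw [add_mul]
    rcases le_or_gt (κ * r) 1 with h1 | h1
    · refine le_add_right ((up y hy r (κ * r) hr (by nlinarith) h1).trans ?_)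
      refine mul_le_mul_left (ENNReal.ofReal_le_ofReal ?_) _
      rw [mul_div_cancel_right₀ _ hr.ne']
      exact mul_le_mul_of_nonneg_left (hk1 κ hκ le_rfl) hC0.le
    · refine le_add_left ?_
      have h2 : μ (niball y 1) ≤ (ENNReal.ofReal (C * κ ^ |s|) + 1) * μ (niball y r) := by
        rw [add_mul, one_mul]
        rcases le_or_gt r 1 with h3 | h3
        · refine le_add_right ((up y hy r 1 hr h3 le_rfl).trans ?_)
          refine mul_le_mul_left (ENNReal.ofReal_le_ofReal ?_) _
          refine mul_le_mul_of_nonneg_left (hk1 _ ?_ ?_) hC0.le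
          · rw [le_div_iff₀ hr]; linarith
          · rw [div_le_iff₀ hr]; exact h1.le
        · exact le_add_left (measure_mono (niball_mono y h3.le))
      calc μ (niball y (κ * r)) ≤ 1 := prob_le_one
        _ ≤ c⁻¹ * μ (niball y 1) := by
            rw [← ENNReal.div_eq_inv_mul]
            have hct : c ≠ ∞ := ne_top_of_le_ne_top ENNReal.one_ne_top ((hc y hy).trans prob_le_one)
            rw [ENNReal.le_div_iff_mul_le (Or.inl hc0) (Or.inl hct), one_mul]
            exact hc y hy
        _ ≤ _ := by rw [mul_assoc]; exact mul_le_mul_right h2 _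
  refine ⟨K, hKE, hprob, hKm, hKE.trans hES, hKf, hpos, ?_, ?_, ?_⟩
  · intro κ hκ
    -- By the quasi-triangle inequality B(x,κr) lies on the sphere in B(y,2(κr + κr)) = B(y,4κr).
    obtain ⟨D, hD, hD'⟩ := hself (4 * κ) (by linarith)
    refine ⟨D, hD, fun x hx y hy r hr hxy => ?_⟩
    refine le_trans (measure_le_of_inter_subset hsph ?_) (hD' y hy r hr)
    have := niball_inter_subset (hnorm x hx) (hnorm y hy) (r := κ * r) hxy
    rwa [show 2 * (κ * r + κ * r) = 4 * κ * r by ring] at this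
  · refine ⟨ENNReal.ofReal C, ENNReal.ofReal_ne_top, fun x hx i j => ?_⟩
    have := up x hx (dl (i + j)) (dl i) (dl_pos _) (dl_anti (by omega)) (dl_le_one _)
    rwa [hdlratio, ← Real.rpow_mul (by norm_num), ENNReal.ofReal_mul hC0.le] at this
  · refine ⟨(ENNReal.ofReal C')⁻¹, ENNReal.inv_ne_top.2 (ENNReal.ofReal_pos.2 hC'0).ne',
      fun x hx i j => ?_⟩
    have := low x hx (dl (i + j)) (dl i) (dl_pos _) (dl_anti (by omega)) (dl_le_one _)
    rw [hdlratio, ← Real.rpow_mul (by norm_num), ENNReal.ofReal_mul hC'0.le] at this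
    rw [← ENNReal.div_eq_inv_mul, ENNReal.le_div_iff_mul_le
      (Or.inl (ENNReal.ofReal_pos.2 hC'0).ne') (Or.inl ENNReal.ofReal_ne_top)]
    calc _ = _ := by rw [mul_comm, ← mul_assoc]; rfl
      _ ≤ _ := this

end

/-! ### A Carleson-type embedding for regular measures -/

noncomputable section

open Metric

variable {n : ℕ}

/-! ### Carleson-type estimates for regular measures -/

lemma measurable_measure_niball (μ : Measure (Cn n)) [SFinite μ] (r : ℝ) :
    Measurable fun y => μ (niball y r) := by
  have h : MeasurableSet {q : Cn n × Cn n | nidist q.1 q.2 < r} :=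
    (isOpen_lt continuous_nidist continuous_const).measurableSet
  exact measurable_measure_prodMk_left h

/-- The points of `ℂⁿ` at pseudo-distance less than `t` from `K`. -/
def nearSet (K : Set (Cn n)) (t : ℝ) : Set (Cn n) := {η | ∃ y ∈ K, nidist y η < t}

lemma isOpen_nearSet (K : Set (Cn n)) (t : ℝ) : IsOpen (nearSet K t) := by
  have : nearSet K t = ⋃ y ∈ K, niball y t := by
    ext η; simp [nearSet, niball]
  rw [this]
  exact isOpen_biUnion fun y _ => isOpen_niball y t

/-- The trace on the sphere of a nonisotropic ball. -/
def sphereBall (x : Cn n) (r : ℝ) : Set (unitSphere n) := {η | nidist (η : Cn n) x < r}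

lemma measurableSet_sphereBall (x : Cn n) (r : ℝ) : MeasurableSet (sphereBall x r) := by
  refine (isOpen_lt ?_ continuous_const).measurableSet
  unfold nidist; fun_prop

variable {μ : Measure (Cn n)} {K : Set (Cn n)} {s d : ℝ}

lemma IsRegular.norm_eq (h : IsRegular μ K s d) {x : Cn n} (hx : x ∈ K) : ‖x‖ = 1 :=
  mem_sphere_zero_iff_norm.1 (h.subset hx)

lemma IsRegular.doubling_pos (h : IsRegular μ K s d) {κ : ℝ} (hκ : 1 ≤ κ) :
    ∃ D : ℝ≥0∞, D ≠ 0 ∧ D ≠ ∞ ∧ ∀ x ∈ K, ∀ y ∈ K, ∀ r : ℝ, 0 < r →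
      nidist x y ≤ κ * r → μ (niball x (κ * r)) ≤ D * μ (niball y r) := by
  obtain ⟨D, hD, hD'⟩ := h.doubling κ hκ
  refine ⟨D + 1, by simp, by finiteness, fun x hx y hy r hr hxy => ?_⟩
  refine (hD' x hx y hy r hr hxy).trans ?_
  gcongr
  exact le_self_add

/-- By doubling, μ(B(y,r)) is at least a constant times μ(B(x,κr)) for y in that ball. The integrand
is thus at most a constant over the measure of the domain. -/
lemma IsRegular.setLIntegral_inv_le (h : IsRegular μ K s d) {κ : ℝ} (hκ : 1 ≤ κ) :
    ∃ D : ℝ≥0∞, D ≠ ∞ ∧ ∀ x ∈ K, ∀ r : ℝ, 0 < r →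
      ∫⁻ y in K, (niball x (κ * r)).indicator (fun y => (μ (niball y r))⁻¹) y ∂μ ≤ D := by
  have := h.prob
  obtain ⟨D, hD0, hD, hD'⟩ := h.doubling_pos hκ
  refine ⟨D, hD, fun x hx r hr => ?_⟩
  have hκr : 0 < κ * r := by positivity
  set m := μ (niball x (κ * r))
  have hm0 : m ≠ 0 := h.pos x hx _ hκr
  have hmt : m ≠ ∞ := measure_ne_top _ _
  calc _ ≤ ∫⁻ y in K, (niball x (κ * r)).indicator (fun _ => D * m⁻¹) y ∂μ := by
        refine setLIntegral_mono' h.measurableSet fun y hy => ?_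
        by_cases hyx : y ∈ niball x (κ * r)
        swap
        · simp [hyx]
        rw [Set.indicator_of_mem hyx, Set.indicator_of_mem hyx]
        have h1 := hD' x hx y hy r hr (le_of_lt hyx)
        rw [← div_eq_mul_inv, ENNReal.le_div_iff_mul_le (Or.inl hm0) (Or.inl hmt), mul_comm,
          ← div_eq_mul_inv]
        exact ENNReal.div_le_of_le_mul h1
    _ ≤ ∫⁻ y, (niball x (κ * r)).indicator (fun _ => D * m⁻¹) y ∂μ := setLIntegral_le_lintegral _ _
    _ = D := by
        rw [lintegral_indicator_const (isOpen_niball _ _).measurableSet, mul_assoc,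
          ENNReal.inv_mul_cancel hm0 hmt, mul_one]

/-- A covering count in integral form. About 2^{is} balls of radius 2^{-(j+i)} are needed to cover K
inside a ball of radius 2^{-j}, and each has σ-measure ≈ 2^{-(j+i)n}. The count is replaced by
integration of 1/μ(B(y,t)) in y, with t ≈ 2^{-(j+i)}, followed by Fubini. -/
lemma IsRegular.exists_sphereMeasure_near_le (h : IsRegular μ K s d) (hn : 1 ≤ n) :
    ∃ C : ℝ≥0∞, C ≠ ∞ ∧ ∀ x ∈ K, ∀ i j : ℕ,
      sphereMeasure n (sphereBall x (6 * dl j) ∩ (↑) ⁻¹' nearSet K (8 * dl (j + i))) ≤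
        C * ENNReal.ofReal (dl j) ^ n * twoPow (-(i * (n - s))) := by
  have := h.prob
  obtain ⟨D, hD0, hDt, hD⟩ := h.doubling_pos le_rfl
  obtain ⟨D', hD't, hD'⟩ := h.setLIntegral_inv_le (κ := 76) (by norm_num)
  obtain ⟨Cσ, hCσt, hCσ⟩ := exists_sphereMeasure_niball_le hn
  obtain ⟨Cu, hCut, hCu⟩ := h.upper
  refine ⟨D * (Cσ * 32 ^ n * Cu * D'), by finiteness, fun x hx i j => ?_⟩
  set t := 8 * dl (j + i) with ht
  have ht0 : 0 < t := by have := dl_pos (j + i); positivity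
  have hdij : dl (j + i) ≤ dl j := dl_anti (by omega)
  set k : Cn n → unitSphere n → ℝ≥0∞ := fun y η =>
    {q : Cn n × unitSphere n | nidist q.1 q.2 < 4 * t}.indicator
      (fun q => (μ (niball q.1 t))⁻¹) (y, η) with hk
  have hkm : Measurable fun q : Cn n × unitSphere n => k q.1 q.2 := by
    refine Measurable.indicator ((measurable_measure_niball μ t).comp measurable_fst).inv ?_
    refine (isOpen_lt ?_ continuous_const).measurableSet
    unfold nidist; fun_prop
  set A := sphereBall x (6 * dl j) ∩ (↑) ⁻¹' nearSet K t with hA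
  have hAm : MeasurableSet A := (measurableSet_sphereBall _ _).inter
    ((isOpen_nearSet K t).measurableSet.preimage measurable_subtype_coe)
  -- If y₀ ∈ K is within t of η, all y ∈ B(y₀,t) ∩ K are within 4t of η and have μ(B(y,t)) ≤
  -- Dμ(B(y₀,t)). These y alone contribute at least 1/D.
  have hone : ∀ η ∈ A, 1 ≤ D * ∫⁻ y in K, k y η ∂μ := by
    rintro η ⟨hη1, y₀, hy₀, hy₀η⟩
    set m := μ (niball y₀ t)
    have hm0 : m ≠ 0 := h.pos y₀ hy₀ _ ht0
    have hmt : m ≠ ∞ := measure_ne_top _ _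
    have hle : ∫⁻ y in K, (niball y₀ t).indicator (fun _ => (D * m)⁻¹) y ∂μ ≤
        ∫⁻ y in K, k y η ∂μ := by
      refine setLIntegral_mono' h.measurableSet fun y hy => ?_
      by_cases hy1 : y ∈ niball y₀ t
      swap
      · simp [hy1]
      have hy1' : nidist y₀ y < t := hy1
      have h1 : nidist y (η : Cn n) < 4 * t := by
        have := nidist_triangle (h.norm_eq hy).le (h.norm_eq hy₀)
          (show ‖(η : Cn n)‖ ≤ 1 by simp)
        rw [nidist_comm y y₀] at this
        linarith
      rw [Set.indicator_of_mem hy1, hk]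
      dsimp only
      rw [Set.indicator_of_mem (by exact h1)]
      refine ENNReal.inv_le_inv.2 ?_
      have := hD y hy y₀ hy₀ t ht0 (by rw [nidist_comm, one_mul]; exact hy1'.le)
      rwa [one_mul] at this
    rw [lintegral_indicator_const (isOpen_niball _ _).measurableSet,
      Measure.restrict_apply (isOpen_niball _ _).measurableSet,
      measure_inter_conull h.full] at hle
    calc (1 : ℝ≥0∞) = D * ((D * m)⁻¹ * m) := by
          rw [mul_comm _ m, ← mul_assoc, ENNReal.mul_inv_cancel (mul_ne_zero hD0 hm0) (by finiteness)]
      _ ≤ _ := mul_le_mul_right hle _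
  have hinner : ∀ y ∈ K, ∫⁻ η in sphereBall x (6 * dl j), k y η ∂sphereMeasure n ≤
      Cσ * 32 ^ n * Cu * ENNReal.ofReal (dl j) ^ n * twoPow (-(i * (n - s))) *
        (niball x (76 * dl j)).indicator (fun y => (μ (niball y (dl j)))⁻¹) y := by
    intro y hy
    -- 76 = 2(32 + 6): d(y,η) < 4t = 32·2^{-(j+i)} and d(η,x) < 6·2^{-j} force d(x,y) < 76·2^{-j}.
    by_cases hyx : y ∈ niball x (76 * dl j)
    swap
    · refine le_of_eq_of_le ?_ zero_le
      rw [setLIntegral_congr_fun (g := 0) (measurableSet_sphereBall _ _)]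
      · simp
      intro η hη
      have hη' : nidist (η : Cn n) x < 6 * dl j := hη
      refine Set.indicator_of_notMem (fun hq => hyx ?_) _
      have hq' : nidist y (η : Cn n) < 4 * t := hq
      have := nidist_triangle (h.norm_eq hy).le (show ‖(η : Cn n)‖ = 1 by simp) (h.norm_eq hx).le
      change nidist x y < _
      rw [nidist_comm]
      linarith
    rw [Set.indicator_of_mem hyx]
    have h1 : ∀ η, k y η ≤ (sphereBall y (32 * dl (j + i))).indicator
        (fun _ => (μ (niball y (dl (j + i))))⁻¹) η := by
      intro η
      by_cases hη : nidist y (η : Cn n) < 4 * t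
      swap
      · rw [hk]; dsimp only
        rw [Set.indicator_of_notMem (by exact hη)]; exact zero_le
      have h2 : η ∈ sphereBall y (32 * dl (j + i)) := by
        change nidist (η : Cn n) y < _
        rw [nidist_comm]
        linarith
      rw [Set.indicator_of_mem h2, hk]
      dsimp only
      rw [Set.indicator_of_mem (by exact hη)]
      refine ENNReal.inv_le_inv.2 (measure_mono (niball_mono y ?_))
      have := dl_pos (j + i); linarith
    have h2 : (μ (niball y (dl (j + i))))⁻¹ ≤ Cu * twoPow (i * s) * (μ (niball y (dl j)))⁻¹ := by
      have := hCu y hy j i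
      rw [← div_eq_mul_inv, ENNReal.le_div_iff_mul_le (Or.inl (h.pos y hy _ (dl_pos _)))
        (Or.inl (measure_ne_top _ _)), mul_comm, ← div_eq_mul_inv]
      exact ENNReal.div_le_of_le_mul this
    have h3 := hCσ y (h.norm_eq hy) (32 * dl (j + i)) (by have := dl_pos (j + i); positivity)
    calc _ ≤ ∫⁻ η, (sphereBall y (32 * dl (j + i))).indicator
          (fun _ => (μ (niball y (dl (j + i))))⁻¹) η ∂sphereMeasure n :=
          (setLIntegral_le_lintegral _ _).trans (lintegral_mono h1)
      _ = (μ (niball y (dl (j + i))))⁻¹ * sphereMeasure n (sphereBall y (32 * dl (j + i))) :=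
          lintegral_indicator_const (measurableSet_sphereBall _ _) _
      _ ≤ (Cu * twoPow (i * s) * (μ (niball y (dl j)))⁻¹) *
          (Cσ * ENNReal.ofReal (32 * dl (j + i)) ^ n) := mul_le_mul' h2 h3
      _ = _ := by
          have e1 : ENNReal.ofReal (32 * dl (j + i)) ^ n =
              32 ^ n * ENNReal.ofReal (dl j) ^ n * twoPow (-(i * n)) := by
            rw [dl_add, ← mul_assoc, ENNReal.ofReal_mul (by have := dl_pos j; positivity),
              ENNReal.ofReal_mul (by norm_num), mul_pow, mul_pow, ofReal_dl i, twoPow_pow]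
            norm_num
          have e2 : twoPow (-(i * (n - s))) = twoPow (i * s) * twoPow (-(i * n)) := by
            rw [← twoPow_add]; congr 1; ring
          rw [e1, e2]; ring
  calc sphereMeasure n A = ∫⁻ η in sphereBall x (6 * dl j), A.indicator 1 η ∂sphereMeasure n := by
        rw [lintegral_indicator_one hAm, Measure.restrict_apply hAm,
          Set.inter_eq_left.2 Set.inter_subset_left]
    _ ≤ ∫⁻ η in sphereBall x (6 * dl j), D * ∫⁻ y in K, k y η ∂μ ∂sphereMeasure n := by
        refine lintegral_mono fun η => ?_
        by_cases hη : η ∈ A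
        · rw [Set.indicator_of_mem hη]; exact hone η hη
        · simp [hη]
    _ = D * ∫⁻ y in K, ∫⁻ η in sphereBall x (6 * dl j), k y η ∂sphereMeasure n ∂μ := by
        rw [lintegral_const_mul' _ _ hDt, lintegral_lintegral_swap]
        exact (hkm.comp measurable_swap).aemeasurable
    _ ≤ D * ∫⁻ y in K, Cσ * 32 ^ n * Cu * ENNReal.ofReal (dl j) ^ n * twoPow (-(i * (n - s))) *
        (niball x (76 * dl j)).indicator (fun y => (μ (niball y (dl j)))⁻¹) y ∂μ :=
        mul_le_mul_right (setLIntegral_mono' h.measurableSet hinner) _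
    _ ≤ D * (Cσ * 32 ^ n * Cu * ENNReal.ofReal (dl j) ^ n * twoPow (-(i * (n - s))) * D') := by
        have := twoPow_ne_top (-(i * (n - s)))
        rw [lintegral_const_mul' _ _ (by finiteness)]
        gcongr
        exact hD' x hx (dl j) (dl_pos j)
    _ = _ := by ring

/-- Two points within 6·2^{-j} of η are within 24·2^{-j} of each other, so all relevant x lie in one
ball of radius 25·2^{-j} about any of them. If no such point exists the integral is 0, which the
indicator permits. -/
lemma IsRegular.exists_setLIntegral_inv_near_le (h : IsRegular μ K s d) :
    ∃ C : ℝ≥0∞, C ≠ ∞ ∧ ∀ (η : unitSphere n) (j : ℕ),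
      ∫⁻ x in K, {x | nidist (η : Cn n) x < 6 * dl j}.indicator
        (fun x => (μ (niball x (dl j)))⁻¹) x ∂μ ≤
          C * (nearSet K (8 * dl j)).indicator 1 (η : Cn n) := by
  obtain ⟨D, hDt, hD⟩ := h.setLIntegral_inv_le (κ := 25) (by norm_num)
  refine ⟨D, hDt, fun η j => ?_⟩
  have hj := dl_pos j
  by_cases hex : ∃ x₀ ∈ K, nidist (η : Cn n) x₀ < 6 * dl j
  · obtain ⟨x₀, hx₀, hx₀η⟩ := hex
    have hmem : (η : Cn n) ∈ nearSet K (8 * dl j) :=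
      ⟨x₀, hx₀, by rw [nidist_comm]; linarith⟩
    rw [Set.indicator_of_mem hmem, Pi.one_apply, mul_one]
    refine le_trans (setLIntegral_mono' h.measurableSet fun x hx => ?_) (hD x₀ hx₀ (dl j) hj)
    by_cases hxη : nidist (η : Cn n) x < 6 * dl j
    swap
    · rw [Set.indicator_of_notMem (by exact hxη)]; exact zero_le
    have h1 : x ∈ niball x₀ (25 * dl j) := by
      have := nidist_triangle (h.norm_eq hx₀).le (show ‖(η : Cn n)‖ = 1 by simp) (h.norm_eq hx).le
      change nidist x₀ x < _
      rw [nidist_comm x₀ (η : Cn n)] at this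
      linarith
    rw [Set.indicator_of_mem (by exact hxη), Set.indicator_of_mem h1]
  · refine le_of_eq_of_le ?_ zero_le
    rw [setLIntegral_congr_fun (g := 0) h.measurableSet]
    · simp
    intro x hx
    exact Set.indicator_of_notMem (s := {x | nidist (η : Cn n) x < 6 * dl j})
      (fun hq => hex ⟨x, hx, hq⟩) _

/-- An auxiliary weight on the sphere that becomes large near `K`. -/
def nearWeight (K : Set (Cn n)) (ε : ℝ) (j : ℕ) (η : Cn n) : ℝ≥0∞ :=
  ∑' i : ℕ, twoPow (ε * i) * (nearSet K (8 * dl (j + i))).indicator 1 η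

lemma measurable_nearWeight (K : Set (Cn n)) (ε : ℝ) (j : ℕ) : Measurable (nearWeight K ε j) :=
  Measurable.tsum fun _ =>
    (measurable_one.indicator (isOpen_nearSet K _).measurableSet).const_mul _

lemma le_nearWeight (K : Set (Cn n)) (ε : ℝ) (j i : ℕ) {η : Cn n}
    (hη : η ∈ nearSet K (8 * dl (j + i))) : twoPow (ε * i) ≤ nearWeight K ε j η := by
  refine le_trans (le_of_eq ?_) (ENNReal.le_tsum i)
  rw [Set.indicator_of_mem hη, Pi.one_apply, mul_one]

/-- The part of the ball near K at scale j + i is at most a constant times 2^{-i(n-s)} of the bound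
2^{-jn}. The weight 2^{iε} with ε = (n-s)/2 uses half of this gain, and the other half sums over i.
-/
lemma IsRegular.exists_setLIntegral_nearWeight_le (h : IsRegular μ K s d) (hn : 1 ≤ n)
    (hs : s < n) : ∃ C : ℝ≥0∞, C ≠ ∞ ∧ ∀ x ∈ K, ∀ j : ℕ,
      ∫⁻ η in sphereBall x (6 * dl j), nearWeight K ((n - s) / 2) j (η : Cn n) ∂sphereMeasure n ≤
        C * ENNReal.ofReal (dl j) ^ n := by
  obtain ⟨C, hCt, hC⟩ := h.exists_sphereMeasure_near_le hn
  set ε := (n - s) / 2 with hε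
  have hε0 : 0 < ε := by rw [hε]; linarith
  refine ⟨C * ∑' i : ℕ, twoPow (-(ε * i)), ENNReal.mul_ne_top hCt (tsum_twoPow_ne_top hε0),
    fun x hx j => ?_⟩
  have hm : ∀ i, MeasurableSet ((↑) ⁻¹' nearSet K (8 * dl (j + i)) : Set (unitSphere n)) :=
    fun i => (isOpen_nearSet K _).measurableSet.preimage measurable_subtype_coe
  have hmeas : ∀ i, Measurable fun η : unitSphere n =>
      (nearSet K (8 * dl (j + i))).indicator (1 : Cn n → ℝ≥0∞) (η : Cn n) := fun i =>
    (measurable_one.indicator (isOpen_nearSet K _).measurableSet).comp measurable_subtype_coe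
  simp only [nearWeight]
  rw [lintegral_tsum fun i => ((hmeas i).const_mul _).aemeasurable]
  rw [mul_right_comm, ← ENNReal.tsum_mul_left]
  refine ENNReal.tsum_le_tsum fun i => ?_
  rw [lintegral_const_mul _ (hmeas i)]
  have e : ∫⁻ η in sphereBall x (6 * dl j),
      (nearSet K (8 * dl (j + i))).indicator (1 : Cn n → ℝ≥0∞) (η : Cn n) ∂sphereMeasure n =
      sphereMeasure n (sphereBall x (6 * dl j) ∩ (↑) ⁻¹' nearSet K (8 * dl (j + i))) := by
    have : (fun η : unitSphere n => (nearSet K (8 * dl (j + i))).indicator (1 : Cn n → ℝ≥0∞)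
        (η : Cn n)) = ((↑) ⁻¹' nearSet K (8 * dl (j + i)) : Set (unitSphere n)).indicator 1 := by
      rfl
    rw [this, lintegral_indicator_one (hm i), Measure.restrict_apply (hm i), Set.inter_comm]
  rw [e]
  calc _ ≤ twoPow (ε * i) * (C * ENNReal.ofReal (dl j) ^ n * twoPow (-(i * (n - s)))) :=
        mul_le_mul_right (hC x hx i j) _
    _ = C * ENNReal.ofReal (dl j) ^ n * (twoPow (ε * i) * twoPow (-(i * (n - s)))) := by ring
    _ = _ := by
        rw [← twoPow_add]
        congr 2
        rw [hε]; ring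

/-- If J is the finest scale in a finite range at which η is near K, then for each such scale j the
weight is at least 2^{ε(J-j)}. The reciprocals are dominated by a geometric series independent of
the range. This is what lets one sum over infinitely many scales. -/
lemma tsum_indicator_mul_inv_nearWeight_le (K : Set (Cn n)) {ε : ℝ} (η : Cn n) :
    ∑' j : ℕ, (nearSet K (8 * dl j)).indicator 1 η * (nearWeight K ε j η)⁻¹ ≤
      ∑' k : ℕ, twoPow (-(ε * k)) := by
  classical
  refine ENNReal.tsum_le_of_sum_range_le fun N => ?_
  set S := (Finset.range N).filter fun j => η ∈ nearSet K (8 * dl j) with hS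
  have e1 : ∑ j ∈ Finset.range N, (nearSet K (8 * dl j)).indicator 1 η * (nearWeight K ε j η)⁻¹ =
      ∑ j ∈ S, (nearWeight K ε j η)⁻¹ := by
    rw [hS, Finset.sum_filter]
    refine Finset.sum_congr rfl fun j _ => ?_
    by_cases hj : η ∈ nearSet K (8 * dl j) <;> simp [hj]
  rw [e1]
  rcases S.eq_empty_or_nonempty with hemp | hne
  · rw [hemp]; simp
  set J := S.max' hne with hJ
  have hJm : η ∈ nearSet K (8 * dl J) := (Finset.mem_filter.1 (S.max'_mem hne)).2
  calc ∑ j ∈ S, (nearWeight K ε j η)⁻¹ ≤ ∑ j ∈ S, twoPow (-(ε * (J - j : ℕ))) := by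
        refine Finset.sum_le_sum fun j hj => ?_
        have hjJ : j ≤ J := S.le_max' j hj
        rw [← twoPow_inv]
        refine ENNReal.inv_le_inv.2 (le_nearWeight K ε j (J - j) ?_)
        rwa [Nat.add_sub_cancel' hjJ]
    _ = ∑ k ∈ S.image (J - ·), twoPow (-(ε * k)) := by
        rw [Finset.sum_image]
        intro a ha b hb hab
        have h1 : a ≤ J := S.le_max' a ha
        have h2 : b ≤ J := S.le_max' b hb
        simp only at hab
        omega
    _ ≤ _ := ENNReal.sum_le_tsum _

lemma le_of_le_sqrt_mul {X Y Z a b c : ℝ≥0∞} (h1 : a * b ≤ c * X)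
    (h2 : X ≤ Y ^ (1 / 2 : ℝ) * Z ^ (1 / 2 : ℝ)) : a ^ 2 * b ^ 2 ≤ c ^ 2 * (Y * Z) := by
  have hs : ∀ y : ℝ≥0∞, (y ^ (1 / 2 : ℝ)) ^ 2 = y := fun y => by
    rw [← ENNReal.rpow_natCast, ← ENNReal.rpow_mul]; norm_num
  have h3 : X ^ 2 ≤ Y * Z := by
    calc X ^ 2 ≤ _ := pow_le_pow_left' h2 2
      _ = _ := by rw [mul_pow, hs, hs]
  calc _ = (a * b) ^ 2 := (mul_pow _ _ _).symm
    _ ≤ (c * X) ^ 2 := pow_le_pow_left' h1 2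
    _ = c ^ 2 * X ^ 2 := mul_pow _ _ _
    _ ≤ _ := mul_le_mul_right h3 _

/-- Start from the mean value inequality for |g|^{p/2} and insert W^{-1/2}W^{1/2}, with W the near
weight. In the Cauchy–Schwarz inequality the factor ∫W is of order 2^{-jn}, no larger than without
the weight, while the other factor gains W⁻¹. -/
lemma IsRegular.exists_localMax_rpow_le_weighted (h : IsRegular μ K s d) (hn : 1 ≤ n)
    (hs : s < n) : ∃ C : ℝ≥0∞, C ≠ ∞ ∧ ∀ (g : Cn n → ℂ), DifferentiableOn ℂ g (unitBall n) →
      ∀ p : ℝ, 0 < p → ∀ x ∈ K, ∀ j, ENNReal.ofReal (dl j) ^ n * localMax g j x ^ p ≤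
        C * ∫⁻ η in sphereBall x (6 * dl j), radialMax g η ^ p *
          (nearWeight K ((n - s) / 2) j (η : Cn n))⁻¹ ∂sphereMeasure n := by
  obtain ⟨C₁, hC₁t, hC₁⟩ := exists_localMax_rpow_le hn
  obtain ⟨C₂, hC₂t, hC₂⟩ := h.exists_setLIntegral_nearWeight_le hn hs
  set ε := (n - s) / 2 with hε
  refine ⟨C₁ ^ 2 * C₂, by finiteness, fun g hg p hp x hx j => ?_⟩
  obtain ⟨M, hM⟩ : ∃ M : unitSphere n → ℝ≥0∞, ∀ η : unitSphere n, radialMax g η = M η :=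
    ⟨fun η => radialMax g η, fun _ => rfl⟩
  obtain ⟨W, hW⟩ : ∃ W : unitSphere n → ℝ≥0∞, ∀ η : unitSphere n, nearWeight K ε j η = W η :=
    ⟨fun η => nearWeight K ε j η, fun _ => rfl⟩
  have hMm : Measurable M := by
    have := measurable_radialMax (n := n) hg.continuousOn
    simpa only [hM] using this
  have hWm : Measurable W := by
    have := (measurable_nearWeight K ε j).comp (measurable_subtype_coe (p := (· ∈ unitSphere n)))
    simpa only [Function.comp_def, hW] using this
  have hδ0 : ENNReal.ofReal (dl j) ^ n ≠ 0 :=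
    pow_ne_zero _ (ENNReal.ofReal_pos.2 (dl_pos j)).ne'
  have hδt : ENNReal.ofReal (dl j) ^ n ≠ ∞ := by finiteness
  have h1 := hC₁ g hg (p / 2) (by positivity) x (h.norm_eq hx) j
  have hWint := hC₂ x hx j
  simp only [hM] at h1 ⊢
  simp only [hW] at hWint ⊢
  have hWfin : ∀ᵐ η ∂(sphereMeasure n).restrict (sphereBall x (6 * dl j)), W η < ∞ :=
    ae_lt_top (hWm) (ne_top_of_le_ne_top (by finiteness) hWint)
  have h2 : ∫⁻ η in sphereBall x (6 * dl j), M η ^ (p / 2) ∂sphereMeasure n ≤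
      ∫⁻ η in sphereBall x (6 * dl j), (M η ^ (p / 2) * (W η)⁻¹ ^ (1 / 2 : ℝ)) *
        (W η) ^ (1 / 2 : ℝ) ∂sphereMeasure n := by
    refine lintegral_mono_ae ?_
    filter_upwards [hWfin, ae_restrict_mem (measurableSet_sphereBall _ _)] with η hη1 hη2
    -- Since 6 < 8, η is near K at scale j itself, and the term i = 0 gives W ≥ 1. Together with W <
    -- ∞ this allows W⁻¹W to be replaced by 1.
    have hW1 : 1 ≤ W η := by
      have := le_nearWeight K ε j 0 (η := (η : Cn n)) ⟨x, hx, by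
        have hη2' : nidist (η : Cn n) x < 6 * dl j := hη2
        have := dl_pos j
        rw [nidist_comm, add_zero]; linarith⟩
      simpa [hW] using this
    rw [mul_assoc, ← ENNReal.mul_rpow_of_nonneg _ _ (by norm_num), ENNReal.inv_mul_cancel
      (by positivity) hη1.ne, ENNReal.one_rpow, mul_one]
  have h3 := h2.trans (lintegral_mul_le_sqrt
    ((hMm.pow_const _).mul ((hWm).inv.pow_const _)).aemeasurable
    ((hWm).pow_const _).aemeasurable)
  have e1 : ∀ η, (M η ^ (p / 2) * (W η)⁻¹ ^ (1 / 2 : ℝ)) ^ 2 = M η ^ p * (W η)⁻¹ := by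
    intro η
    rw [mul_pow, ← ENNReal.rpow_natCast, ← ENNReal.rpow_mul, ← ENNReal.rpow_natCast,
      ← ENNReal.rpow_mul]
    norm_num
  have e2 : ∀ η, (W η ^ (1 / 2 : ℝ)) ^ 2 = W η := by
    intro η
    rw [← ENNReal.rpow_natCast, ← ENNReal.rpow_mul]; norm_num
  simp_rw [e1, e2] at h3
  have h4 := le_of_le_sqrt_mul h1 h3
  have e3 : (localMax g j x ^ (p / 2)) ^ 2 = localMax g j x ^ p := by
    rw [← ENNReal.rpow_natCast, ← ENNReal.rpow_mul]; norm_num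
  rw [e3] at h4
  rw [← ENNReal.mul_le_mul_iff_right hδ0 hδt, ← mul_assoc, ← sq]
  refine h4.trans ?_
  calc _ ≤ C₁ ^ 2 * ((∫⁻ η in sphereBall x (6 * dl j), M η ^ p * (W η)⁻¹ ∂sphereMeasure n) *
        (C₂ * ENNReal.ofReal (dl j) ^ n)) := by gcongr
    _ = _ := by ring
/-- The local maxima of a function whose radial maximal function is in `L^p` are
`p`-summable along the scales, with the natural weights. -/
lemma IsRegular.exists_tsum_localMax_le (h : IsRegular μ K s d) (hn : 1 ≤ n) (hs : s < n) :
    ∃ C : ℝ≥0∞, C ≠ ∞ ∧ ∀ (g : Cn n → ℂ), DifferentiableOn ℂ g (unitBall n) → ∀ p : ℝ, 0 < p →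
      ∫⁻ x in K, ∑' j : ℕ, ENNReal.ofReal (dl j) ^ n * (μ (niball x (dl j)))⁻¹ *
        localMax g j x ^ p ∂μ ≤ C * ∫⁻ η : unitSphere n, radialMax g η ^ p ∂sphereMeasure n := by
  have := h.prob
  obtain ⟨C₁, hC₁t, hC₁⟩ := h.exists_localMax_rpow_le_weighted hn hs
  obtain ⟨C₃, hC₃t, hC₃⟩ := h.exists_setLIntegral_inv_near_le
  set ε := (n - s) / 2 with hε
  have hε0 : 0 < ε := by rw [hε]; linarith
  set C₄ := ∑' k : ℕ, twoPow (-(ε * k)) with hC₄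
  have hC₄t : C₄ ≠ ∞ := tsum_twoPow_ne_top hε0
  refine ⟨C₁ * (C₃ * C₄), by finiteness, fun g hg p hp => ?_⟩
  obtain ⟨M, hM⟩ : ∃ M : unitSphere n → ℝ≥0∞, ∀ η : unitSphere n, radialMax g η = M η :=
    ⟨fun η => radialMax g η, fun _ => rfl⟩
  obtain ⟨W, hW⟩ : ∃ W : ℕ → unitSphere n → ℝ≥0∞, ∀ j, ∀ η : unitSphere n,
      nearWeight K ε j η = W j η := ⟨fun j η => nearWeight K ε j η, fun _ _ => rfl⟩
  have hMm : Measurable M := by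
    have := measurable_radialMax (n := n) hg.continuousOn
    simpa only [hM] using this
  have hWm : ∀ j, Measurable (W j) := fun j => by
    have := (measurable_nearWeight K ε j).comp (measurable_subtype_coe (p := (· ∈ unitSphere n)))
    simpa only [Function.comp_def, hW] using this
  have hptw : ∀ x ∈ K, ∀ j, ENNReal.ofReal (dl j) ^ n * localMax g j x ^ p ≤
      C₁ * ∫⁻ η in sphereBall x (6 * dl j), M η ^ p * (W j η)⁻¹ ∂sphereMeasure n := by
    intro x hx j
    have := hC₁ g hg p hp x hx j
    simpa only [hM, hW] using this
  simp only [hM]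
  have hVm : ∀ j, Measurable fun x => (μ (niball x (dl j)))⁻¹ := fun j =>
    (measurable_measure_niball μ (dl j)).inv
  have hterm : ∀ j, Measurable fun x : Cn n => ENNReal.ofReal (dl j) ^ n *
      (μ (niball x (dl j)))⁻¹ * localMax g j x ^ p := fun j =>
    ((hVm j).const_mul _).mul ((measurable_localMax g j).pow_const p)
  rw [lintegral_tsum fun j => (hterm j).aemeasurable]
  obtain ⟨Φ, hΦ⟩ : ∃ Φ : ℕ → Cn n → unitSphere n → ℝ≥0∞, ∀ j x η, Φ j x η =
    {q : Cn n × unitSphere n | nidist (q.2 : Cn n) q.1 < 6 * dl j}.indicator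
      (fun q => (μ (niball q.1 (dl j)))⁻¹) (x, η) := ⟨_, fun _ _ _ => rfl⟩
  have hΦm : ∀ j, Measurable fun q : Cn n × unitSphere n => Φ j q.1 q.2 := by
    intro j
    simp only [hΦ]
    refine Measurable.indicator ((hVm j).comp measurable_fst) ?_
    refine (isOpen_lt ?_ continuous_const).measurableSet
    unfold nidist; fun_prop
  -- By Fubini, for fixed η the integral of 1/μ(B(x,2^{-j})) over the x with d(η,x) < 6·2^{-j} is
  -- bounded, and it vanishes unless η is near K.
  have hj : ∀ j, ∫⁻ x in K, ENNReal.ofReal (dl j) ^ n * (μ (niball x (dl j)))⁻¹ *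
      localMax g j x ^ p ∂μ ≤ C₁ * C₃ * ∫⁻ η : unitSphere n, M η ^ p *
        ((nearSet K (8 * dl j)).indicator 1 (η : Cn n) * (W j η)⁻¹) ∂sphereMeasure n := by
    intro j
    have hMW : Measurable fun η => M η ^ p * (W j η)⁻¹ := (hMm.pow_const p).mul (hWm j).inv
    calc _ ≤ ∫⁻ x in K, C₁ * ∫⁻ η, Φ j x η * (M η ^ p * (W j η)⁻¹) ∂sphereMeasure n ∂μ := by
          refine setLIntegral_mono' h.measurableSet fun x hx => ?_
          have h1 := mul_le_mul_right (hptw x hx j) (μ (niball x (dl j)))⁻¹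
          calc _ = (μ (niball x (dl j)))⁻¹ * (ENNReal.ofReal (dl j) ^ n * localMax g j x ^ p) := by
                ring
            _ ≤ _ := h1
            _ = C₁ * ((μ (niball x (dl j)))⁻¹ * ∫⁻ η in sphereBall x (6 * dl j),
                M η ^ p * (W j η)⁻¹ ∂sphereMeasure n) := by ring
            _ = _ := by
                congr 1
                rw [← lintegral_indicator (measurableSet_sphereBall _ _),
                  ← lintegral_const_mul _ (hMW.indicator (measurableSet_sphereBall _ _))]
                refine lintegral_congr fun η => ?_
                by_cases hη : nidist (η : Cn n) x < 6 * dl j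
                · rw [hΦ, Set.indicator_of_mem (by exact hη), Set.indicator_of_mem (by exact hη)]
                · rw [hΦ, Set.indicator_of_notMem (by exact hη), Set.indicator_of_notMem (by exact hη)]
                  simp
      _ = C₁ * ∫⁻ η, (M η ^ p * (W j η)⁻¹) * ∫⁻ x in K, Φ j x η ∂μ ∂sphereMeasure n := by
          rw [lintegral_const_mul' _ _ (by finiteness), lintegral_lintegral_swap]
          · congr 1
            refine lintegral_congr fun η => ?_
            have hm : Measurable fun x => Φ j x η := (hΦm j).comp measurable_prodMk_right
            rw [lintegral_mul_const _ hm, mul_comm]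
          · exact ((hΦm j).mul (hMW.comp measurable_snd)).aemeasurable
      _ ≤ C₁ * ∫⁻ η, C₃ * (M η ^ p *
          ((nearSet K (8 * dl j)).indicator 1 (η : Cn n) * (W j η)⁻¹)) ∂sphereMeasure n := by
          refine mul_le_mul_right (lintegral_mono fun η => ?_) _
          have h3 : ∫⁻ x in K, Φ j x η ∂μ ≤
              C₃ * (nearSet K (8 * dl j)).indicator 1 (η : Cn n) := by
            simp only [hΦ]
            exact hC₃ η j
          calc _ ≤ (M η ^ p * (W j η)⁻¹) * (C₃ * (nearSet K (8 * dl j)).indicator 1 (η : Cn n)) :=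
                mul_le_mul_right h3 _
            _ = _ := by ring
      _ = _ := by rw [lintegral_const_mul' _ _ hC₃t]; ring
  calc _ ≤ ∑' j, C₁ * C₃ * ∫⁻ η : unitSphere n, M η ^ p *
        ((nearSet K (8 * dl j)).indicator 1 (η : Cn n) * (W j η)⁻¹) ∂sphereMeasure n :=
        ENNReal.tsum_le_tsum hj
    _ = C₁ * C₃ * ∫⁻ η : unitSphere n, ∑' j, M η ^ p *
        ((nearSet K (8 * dl j)).indicator 1 (η : Cn n) * (W j η)⁻¹) ∂sphereMeasure n := by
        rw [ENNReal.tsum_mul_left, lintegral_tsum fun j => ?_]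
        refine ((hMm.pow_const p).mul (Measurable.mul ?_ (hWm j).inv)).aemeasurable
        exact (measurable_one.indicator (isOpen_nearSet K _).measurableSet).comp
          measurable_subtype_coe
    _ ≤ C₁ * C₃ * ∫⁻ η : unitSphere n, C₄ * M η ^ p ∂sphereMeasure n := by
        refine mul_le_mul_right (lintegral_mono fun η => ?_) _
        rw [ENNReal.tsum_mul_left, mul_comm]
        have h4 := tsum_indicator_mul_inv_nearWeight_le K (ε := ε) (η : Cn n)
        simp only [hW] at h4
        exact mul_le_mul_left h4 _
    _ = _ := by rw [lintegral_const_mul' _ _ hC₄t]; ring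

end

/-! ### Expansion of f and its dyadic decomposition -/

noncomputable section

open Metric

variable {n : ℕ}

/-! ### Homogeneous expansions -/

lemma homogPart_smul (f : Cn n → ℂ) (k : ℕ) (c : ℂ) (z : Cn n) :
    homogPart f k (c • z) = c ^ k * homogPart f k z := by
  rw [homogPart, homogPart, ContinuousMultilinearMap.map_smul_univ _ (fun _ => c)]
  simp only [Finset.prod_const, Finset.card_univ, Fintype.card_fin, smul_eq_mul]
  ring

lemma differentiable_homogPart (f : Cn n → ℂ) (k : ℕ) : Differentiable ℂ (homogPart f k) := by
  unfold homogPart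
  have h1 : Differentiable ℂ (iteratedFDeriv ℂ k f 0) :=
    (ContinuousMultilinearMap.contDiff (iteratedFDeriv ℂ k f 0) (n := 1)).differentiable
      (by norm_num)
  have h2 : Differentiable ℂ fun z : Cn n => (fun _ : Fin k => z) :=
    differentiable_pi.2 fun _ => differentiable_id
  exact (h1.comp h2).const_mul _

/-- Facts about homogeneous expansions are thereby read off from one-variable Taylor series of the
slices c ↦ f(cz). -/
lemma homogPart_eq_iteratedDeriv {f : Cn n → ℂ} (hf : DifferentiableOn ℂ f (unitBall n)) (k : ℕ)
    (z : Cn n) : homogPart f k z =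
      ((k.factorial : ℂ))⁻¹ * iteratedDeriv k (fun c : ℂ => f (c • z)) 0 := by
  rw [homogPart, iteratedDeriv_eq_iteratedFDeriv]
  congr 1
  set L : ℂ →L[ℂ] Cn n := (ContinuousLinearMap.id ℂ ℂ).smulRight z
  have hL : ∀ c, L c = c • z := fun c => by simp [L]
  have hopen : IsOpen (L ⁻¹' unitBall n) := isOpen_ball.preimage L.continuous
  have h0 : L 0 ∈ unitBall n := by simp
  have h := L.iteratedFDerivWithin_comp_right (contDiffOn_of_differentiableOn isOpen_ball k hf)
    isOpen_ball.uniqueDiffOn hopen.uniqueDiffOn h0 le_rfl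
  rw [iteratedFDerivWithin_of_isOpen k hopen h0, iteratedFDerivWithin_of_isOpen k isOpen_ball h0]
    at h
  have h2 : (f ∘ L) = fun c : ℂ => f (c • z) := by ext c; simp [hL]
  rw [h2] at h
  rw [h]
  simp [hL]

lemma hasSum_homogPart {f : Cn n → ℂ} (hf : DifferentiableOn ℂ f (unitBall n)) {z : Cn n}
    (hz : z ∈ unitBall n) : HasSum (fun k => homogPart f k z) (f z) := by
  rw [mem_ball_zero_iff] at hz
  obtain ⟨r, hr1, hr⟩ : ∃ r : ℝ, 1 < r ∧ r * ‖z‖ < 1 := by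
    rcases (norm_nonneg z).eq_or_lt with h | h
    · exact ⟨2, by norm_num, by rw [← h]; norm_num⟩
    · obtain ⟨r, hr1, hr2⟩ := exists_between ((one_lt_inv_iff₀).2 ⟨h, hz⟩)
      refine ⟨r, hr1, ?_⟩
      calc r * ‖z‖ < ‖z‖⁻¹ * ‖z‖ := by gcongr
        _ = 1 := inv_mul_cancel₀ h.ne'
  have hd : DifferentiableOn ℂ (fun c : ℂ => f (c • z)) (ball 0 r) := by
    refine hf.comp (by fun_prop) fun c hc => ?_
    rw [mem_ball_zero_iff] at hc ⊢
    rw [norm_smul]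
    nlinarith [norm_nonneg z]
  have := Complex.hasSum_taylorSeries_on_ball hd (z := 1) (by simpa using hr1)
  simp only [sub_zero, one_pow, one_smul] at this
  have e : (fun k => homogPart f k z) = fun k : ℕ => ((k.factorial : ℂ))⁻¹ •
      iteratedDeriv k (fun c : ℂ => f (c • z)) 0 :=
    funext fun k => by rw [homogPart_eq_iteratedDeriv hf, smul_eq_mul]
  rw [e]
  exact this

/-- Cauchy's estimate on slices through points of norm ρ, extended to all z by homogeneity. -/
lemma norm_homogPart_le {f : Cn n → ℂ} (hf : DifferentiableOn ℂ f (unitBall n)) {ρ : ℝ}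
    (hρ : ρ ∈ Set.Ioo (0 : ℝ) 1) : ∃ M : ℝ, 0 ≤ M ∧ ∀ k, ∀ z : Cn n,
      ‖homogPart f k z‖ ≤ M * (‖z‖ / ρ) ^ k := by
  have hsub : closedBall (0 : Cn n) ρ ⊆ unitBall n := closedBall_subset_ball hρ.2
  obtain ⟨M, hM⟩ := (isCompact_closedBall (0 : Cn n) ρ).exists_bound_of_continuousOn
    (hf.continuousOn.mono hsub)
  have hM0 : 0 ≤ M := (norm_nonneg _).trans (hM 0 (by simpa using hρ.1.le))
  have h1 : ∀ k, ∀ z : Cn n, ‖z‖ = ρ → ‖homogPart f k z‖ ≤ M := by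
    intro k z hz
    have hd : DiffContOnCl ℂ (fun c : ℂ => f (c • z)) (ball 0 1) := by
      have hcl : DifferentiableOn ℂ (fun c : ℂ => f (c • z)) (closedBall 0 1) := by
        refine (hf.mono hsub).comp (by fun_prop) fun c hc => ?_
        rw [mem_closedBall_zero_iff] at hc ⊢
        rw [norm_smul, hz]
        nlinarith [hρ.1]
      exact hcl.diffContOnCl_ball subset_rfl
    have := Complex.norm_iteratedDeriv_le_of_forall_mem_sphere_norm_le k one_pos hd (C := M)
      fun c hc => hM _ (by
        rw [mem_closedBall_zero_iff, norm_smul, mem_sphere_zero_iff_norm.1 hc, hz, one_mul])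
    rw [homogPart_eq_iteratedDeriv hf, norm_mul, norm_inv, Complex.norm_natCast]
    rw [one_pow, div_one] at this
    rw [inv_mul_le_iff₀ (by positivity)]
    exact this
  refine ⟨M, hM0, fun k z => ?_⟩
  rcases eq_or_ne z 0 with rfl | hz
  · rcases k with _ | k
    · obtain ⟨v⟩ : Nonempty (Cn n) := inferInstance
      have e : homogPart f 0 (0 : Cn n) = f 0 := by simp [homogPart]
      rw [e]
      simpa using hM 0 (by simpa using hρ.1.le)
    · have := homogPart_smul f (k + 1) 0 (0 : Cn n)
      rw [smul_zero] at this
      rw [this]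
      simp
  · have hz0 : 0 < ‖z‖ := norm_pos_iff.2 hz
    have e : z = ((‖z‖ / ρ : ℝ) : ℂ) • (((ρ / ‖z‖ : ℝ) : ℂ) • z) := by
      rw [smul_smul, ← Complex.ofReal_mul]
      have : ‖z‖ / ρ * (ρ / ‖z‖) = 1 := by have := hρ.1; field_simp
      rw [this]; simp
    have h2 := h1 k (((ρ / ‖z‖ : ℝ) : ℂ) • z) (by
      rw [norm_smul, Complex.norm_of_nonneg (div_nonneg hρ.1.le hz0.le)]; field_simp)
    have e2 : homogPart f k z = ((‖z‖ / ρ : ℝ) : ℂ) ^ k *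
        homogPart f k (((ρ / ‖z‖ : ℝ) : ℂ) • z) := by rw [← homogPart_smul, ← e]
    rw [e2, norm_mul, norm_pow, Complex.norm_of_nonneg (div_nonneg hz0.le hρ.1.le), mul_comm]
    have := hρ.1
    gcongr

lemma exists_homogPart_bound {f : Cn n → ℂ} (hf : DifferentiableOn ℂ f (unitBall n)) {r R : ℝ}
    (hr : 0 ≤ r) (hrR : r < R) : ∃ M r' : ℝ, 0 ≤ M ∧ 0 ≤ r' ∧ r' < R ∧ ∀ k, ∀ z : Cn n, ‖z‖ ≤ r →
      ‖homogPart f k z‖ ≤ M * r' ^ k := by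
  have hR : 0 < R := hr.trans_lt hrR
  obtain ⟨ρ, hρ1, hρ2⟩ := exists_between (show r / R < 1 from (div_lt_one hR).2 hrR)
  have hρ0 : 0 < ρ := (div_nonneg hr hR.le).trans_lt hρ1
  obtain ⟨M, hM, h⟩ := norm_homogPart_le hf ⟨hρ0, hρ2⟩
  refine ⟨M, r / ρ, hM, by positivity, ?_, fun k z hz => (h k z).trans ?_⟩
  · rw [div_lt_iff₀ hρ0]; rwa [div_lt_iff₀ hR, mul_comm] at hρ1
  · gcongr

lemma normallySummable_homogPart {f : Cn n → ℂ} (hf : DifferentiableOn ℂ f (unitBall n))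
    {c : ℕ → ℂ} {R : ℝ} (hc : ∀ r, 0 ≤ r → r < R → Summable fun k => ‖c k‖ * r ^ k) :
    NormallySummable (fun k z => c k * homogPart f k z) R := by
  intro r hr
  rcases lt_or_ge r 0 with h0 | h0
  · exact ⟨0, summable_zero, fun k z hz => by
      rw [mem_ball_zero_iff] at hz; linarith [norm_nonneg z]⟩
  obtain ⟨M, r', hM, hr'0, hr'R, h⟩ := exists_homogPart_bound hf h0 hr
  refine ⟨fun k => M * (‖c k‖ * r' ^ k), (hc r' hr'0 hr'R).mul_left M, fun k z hz => ?_⟩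
  rw [mem_ball_zero_iff] at hz
  rw [norm_mul]
  calc ‖c k‖ * ‖homogPart f k z‖ ≤ ‖c k‖ * (M * r' ^ k) := by gcongr; exact h k z hz.le
    _ = _ := by ring

lemma summable_rpow_mul_pow (β : ℝ) {r : ℝ} (hr0 : 0 ≤ r) (hr1 : r < 1) :
    Summable fun k : ℕ => ((k : ℝ) + 1) ^ β * r ^ k := by
  obtain ⟨N, hN⟩ := exists_nat_ge β
  rcases hr0.eq_or_lt with rfl | hr0
  · refine summable_of_ne_finset_zero (s := {0}) fun k hk => ?_
    rw [zero_pow (by simpa using hk), mul_zero]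
  have h1 : Summable fun k : ℕ => ((k + 1 : ℕ) : ℝ) ^ N * r ^ (k + 1) :=
    (summable_nat_add_iff (f := fun k : ℕ => (k : ℝ) ^ N * r ^ k) 1).2 (summable_pow_mul_geometric_of_norm_lt_one N
      (by rwa [Real.norm_of_nonneg hr0.le]))
  refine Summable.of_nonneg_of_le (fun k => by positivity) (fun k => ?_) (h1.mul_left r⁻¹)
  have h2 : ((k : ℝ) + 1) ^ β ≤ ((k : ℝ) + 1) ^ N := by
    rw [← Real.rpow_natCast]
    exact Real.rpow_le_rpow_of_exponent_le (by linarith [Nat.cast_nonneg (α := ℝ) k]) hN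
  calc ((k : ℝ) + 1) ^ β * r ^ k ≤ ((k : ℝ) + 1) ^ N * r ^ k := by gcongr
    _ = _ := by
        push_cast
        rw [pow_succ r]; field_simp

lemma normallySummable_radialDeriv (β : ℝ) {f : Cn n → ℂ}
    (hf : DifferentiableOn ℂ f (unitBall n)) :
    NormallySummable (fun k z => ((((k : ℝ) + 1) ^ β : ℝ) : ℂ) * homogPart f k z) 1 := by
  refine normallySummable_homogPart hf fun r hr0 hr1 => ?_
  refine (summable_rpow_mul_pow β hr0 hr1).congr fun k => ?_
  rw [Complex.norm_of_nonneg (by positivity)]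

lemma differentiableOn_radialDeriv (β : ℝ) {f : Cn n → ℂ}
    (hf : DifferentiableOn ℂ f (unitBall n)) :
    DifferentiableOn ℂ (radialDeriv β f) (unitBall n) :=
  (normallySummable_radialDeriv β hf).differentiableOn_tsum fun k =>
    ((differentiable_homogPart f k).const_mul _).differentiableOn

/-! ### Decomposition of a function into pieces at dyadic scales -/

/-- A dyadic partition of `(0, ∞)`. -/
def scaleSet : ℕ → Set ℝ
  | 0 => Set.Ioi (1 / 2)
  | j + 1 => Set.Ioc (dl (j + 2)) (dl (j + 1))

lemma measurableSet_scaleSet (j : ℕ) : MeasurableSet (scaleSet j) := by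
  cases j with
  | zero => exact measurableSet_Ioi
  | succ j => exact measurableSet_Ioc

lemma lt_of_mem_scaleSet {j : ℕ} {t : ℝ} (h : t ∈ scaleSet j) : dl (j + 1) < t := by
  cases j with
  | zero =>
    have h' : (1 / 2 : ℝ) < t := h
    simpa [dl] using h'
  | succ j => exact h.1

lemma scaleSet_subset (j : ℕ) : scaleSet j ⊆ Set.Ioi 0 := fun _ ht =>
  (dl_pos _).trans (lt_of_mem_scaleSet ht)

lemma iUnion_scaleSet : ⋃ j, scaleSet j = Set.Ioi 0 := by
  refine Set.Subset.antisymm (Set.iUnion_subset scaleSet_subset) fun t ht => ?_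
  rcases lt_or_ge (1 / 2) t with h | h
  · exact Set.mem_iUnion.2 ⟨0, h⟩
  · obtain ⟨i, h1, h2⟩ := exists_nat_pow_near_of_lt_one ht (by linarith : t ≤ 1)
      (by norm_num : (0 : ℝ) < 1 / 2) (by norm_num)
    cases i with
    | zero => norm_num at h1; linarith
    | succ i => exact Set.mem_iUnion.2 ⟨i + 1, h1, h2⟩

lemma pairwise_disjoint_scaleSet : Pairwise (Function.onFun Disjoint scaleSet) := by
  have key : ∀ i j, i < j → Disjoint (scaleSet i) (scaleSet j) := by
    intro i j hij
    refine Set.disjoint_left.2 fun t hi hj => ?_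
    obtain ⟨j, rfl⟩ : ∃ j', j = j' + 1 := ⟨j - 1, by omega⟩
    have h1 := lt_of_mem_scaleSet hi
    have h2 : t ≤ dl (j + 1) := hj.2
    have h3 : dl (j + 1) ≤ dl (i + 1) := dl_anti (by omega)
    linarith
  intro i j hij
  rcases lt_or_gt_of_ne hij with h | h
  · exact key i j h
  · exact (key j i h).symm

/-- The part of the coefficient `1 = Γ(β)⁻¹ (k+1)^β ∫ t^{β-1} e^{-(k+1)t} dt` at scale `j`. -/
def scaleCoeff (β : ℝ) (j k : ℕ) : ℝ :=
  (Real.Gamma β)⁻¹ * ((k : ℝ) + 1) ^ β *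
    ∫ t in scaleSet j, t ^ (β - 1) * Real.exp (-(((k : ℝ) + 1) * t))

/-- The part of `f` at scale `j`. -/
def scalePiece (β : ℝ) (f : Cn n → ℂ) (j : ℕ) (z : Cn n) : ℂ :=
  ∑' k : ℕ, (scaleCoeff β j k : ℂ) * homogPart f k z

lemma integrableOn_gamma {β : ℝ} (hβ : 0 < β) (k : ℕ) :
    IntegrableOn (fun t : ℝ => t ^ (β - 1) * Real.exp (-(((k : ℝ) + 1) * t))) (Set.Ioi 0) := by
  have h := integrableOn_rpow_mul_exp_neg_mul_rpow (p := 1) (s := β - 1) (b := (k : ℝ) + 1)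
    (by linarith) one_pos (by positivity)
  simpa only [Real.rpow_one, neg_mul] using h

lemma scaleCoeff_nonneg {β : ℝ} (hβ : 0 < β) (j k : ℕ) : 0 ≤ scaleCoeff β j k := by
  have := Real.Gamma_pos_of_pos hβ
  refine mul_nonneg (by positivity) (setIntegral_nonneg (measurableSet_scaleSet j) fun t ht => ?_)
  have : (0 : ℝ) < t := scaleSet_subset j ht
  positivity

lemma hasSum_scaleCoeff {β : ℝ} (hβ : 0 < β) (k : ℕ) :
    HasSum (fun j => scaleCoeff β j k) 1 := by
  have hk : (0 : ℝ) < (k : ℝ) + 1 := by positivity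
  have h := hasSum_integral_iUnion measurableSet_scaleSet pairwise_disjoint_scaleSet
    (f := fun t : ℝ => t ^ (β - 1) * Real.exp (-(((k : ℝ) + 1) * t))) (μ := volume)
    (by rw [iUnion_scaleSet]; exact integrableOn_gamma hβ k)
  rw [iUnion_scaleSet, Real.integral_rpow_mul_exp_neg_mul_Ioi hβ hk] at h
  have h2 := h.mul_left ((Real.Gamma β)⁻¹ * ((k : ℝ) + 1) ^ β)
  have hG := Real.Gamma_pos_of_pos hβ
  have e : (Real.Gamma β)⁻¹ * ((k : ℝ) + 1) ^ β * ((1 / ((k : ℝ) + 1)) ^ β * Real.Gamma β) = 1 := by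
    rw [one_div, Real.inv_rpow hk.le]
    have : ((k : ℝ) + 1) ^ β ≠ 0 := (Real.rpow_pos_of_pos hk _).ne'
    field_simp
  rwa [e] at h2

/-- On the j-th scale t exceeds 2^{-(j+1)}, so e^{-kt} can be taken out of the integral and what
remains is at most Γ(β). This decay in k lets the piece extend beyond the sphere. -/
lemma scaleCoeff_le {β : ℝ} (hβ : 0 < β) (j k : ℕ) :
    scaleCoeff β j k ≤ ((k : ℝ) + 1) ^ β * Real.exp (-dl (j + 1)) ^ k := by
  have hG := Real.Gamma_pos_of_pos hβ
  have h1 : ∫ t in scaleSet j, t ^ (β - 1) * Real.exp (-(((k : ℝ) + 1) * t)) ≤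
      Real.exp (-dl (j + 1)) ^ k * Real.Gamma β := by
    have hInt := integrableOn_gamma hβ 0
    have hG' : Real.Gamma β = ∫ t in Set.Ioi 0, t ^ (β - 1) * Real.exp (-(((0 : ℕ) : ℝ) + 1) * t) := by
      rw [Real.Gamma_eq_integral hβ]
      refine setIntegral_congr_fun measurableSet_Ioi fun t _ => ?_
      simp [mul_comm]
    calc _ ≤ ∫ t in scaleSet j, Real.exp (-dl (j + 1)) ^ k *
          (t ^ (β - 1) * Real.exp (-((((0 : ℕ) : ℝ) + 1) * t))) := by
          refine setIntegral_mono_on ((integrableOn_gamma hβ k).mono_set (scaleSet_subset j))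
            ((hInt.mono_set (scaleSet_subset j)).const_mul _) (measurableSet_scaleSet j)
            fun t ht => ?_
          have ht0 : (0 : ℝ) < t := scaleSet_subset j ht
          have ht1 := lt_of_mem_scaleSet ht
          rw [mul_left_comm]
          gcongr
          rw [← Real.exp_nat_mul, ← Real.exp_add]
          refine Real.exp_le_exp.2 ?_
          push_cast
          nlinarith [Nat.cast_nonneg (α := ℝ) k]
      _ = Real.exp (-dl (j + 1)) ^ k *
          ∫ t in scaleSet j, t ^ (β - 1) * Real.exp (-((((0 : ℕ) : ℝ) + 1) * t)) :=
          integral_const_mul _ _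
      _ ≤ _ := by
          rw [hG']
          simp only [neg_mul]
          refine mul_le_mul_of_nonneg_left (setIntegral_mono_set hInt ?_
            (scaleSet_subset j).eventuallyLE) (by positivity)
          filter_upwards [ae_restrict_mem measurableSet_Ioi] with t ht
          have : (0 : ℝ) < t := ht
          simp only [Pi.zero_apply]
          positivity
  calc scaleCoeff β j k ≤ (Real.Gamma β)⁻¹ * ((k : ℝ) + 1) ^ β *
        (Real.exp (-dl (j + 1)) ^ k * Real.Gamma β) := by
        unfold scaleCoeff; gcongr
    _ = _ := by field_simp

lemma normallySummable_scaleCoeff {β : ℝ} (hβ : 0 < β) {f : Cn n → ℂ}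
    (hf : DifferentiableOn ℂ f (unitBall n)) (j : ℕ) :
    NormallySummable (fun k z => (scaleCoeff β j k : ℂ) * homogPart f k z) (1 + dl j / 4) := by
  refine normallySummable_homogPart hf fun r hr0 hr1 => ?_
  -- The radius of convergence is at least e^{2^{-(j+1)}} ≥ 1 + 2^{-j}/2, which exceeds 1 +
  -- 2^{-j}/4.
  have he : r * Real.exp (-dl (j + 1)) < 1 := by
    have h1 := Real.add_one_le_exp (dl (j + 1))
    have h2 := dl_pos j
    rw [dl_succ] at h1 ⊢
    rw [Real.exp_neg, ← div_eq_mul_inv, div_lt_one (Real.exp_pos _)]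
    linarith
  refine Summable.of_nonneg_of_le (fun k => by positivity) (fun k => ?_)
    (summable_rpow_mul_pow β (r := r * Real.exp (-dl (j + 1))) (by positivity) he)
  rw [Complex.norm_of_nonneg (scaleCoeff_nonneg hβ j k), mul_pow, mul_comm (r ^ k), ← mul_assoc]
  gcongr
  exact scaleCoeff_le hβ j k

lemma differentiableOn_scalePiece {β : ℝ} (hβ : 0 < β) {f : Cn n → ℂ}
    (hf : DifferentiableOn ℂ f (unitBall n)) (j : ℕ) :
    DifferentiableOn ℂ (scalePiece β f j) (ball 0 (1 + dl j / 4)) :=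
  (normallySummable_scaleCoeff hβ hf j).differentiableOn_tsum fun k =>
    ((differentiable_homogPart f k).const_mul _).differentiableOn

/-- The coefficients are nonnegative and sum to 1 over j, so the double series is dominated on
smaller balls by the geometric majorant of the expansion of f. -/
lemma normallySummable_scalePiece {β : ℝ} (hβ : 0 < β) {f : Cn n → ℂ}
    (hf : DifferentiableOn ℂ f (unitBall n)) : NormallySummable (scalePiece β f) 1 := by
  intro r hr
  rcases lt_or_ge r 0 with h0 | h0
  · exact ⟨0, summable_zero, fun k z hz => by
      rw [mem_ball_zero_iff] at hz; linarith [norm_nonneg z]⟩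
  obtain ⟨M, r', hM, hr'0, hr'R, h⟩ := exists_homogPart_bound hf h0 hr
  have hm : Summable fun k : ℕ => M * r' ^ k :=
    (summable_geometric_of_lt_one hr'0 hr'R).mul_left M
  have hprod : Summable fun q : ℕ × ℕ => scaleCoeff β q.2 q.1 * (M * r' ^ q.1) := by
    refine (summable_prod_of_nonneg fun q =>
      mul_nonneg (scaleCoeff_nonneg hβ _ _) (by positivity)).2 ⟨fun k => ?_, ?_⟩
    · exact (hasSum_scaleCoeff hβ k).summable.mul_right (M * r' ^ k)
    · refine hm.congr fun k => ?_
      simp only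
      rw [tsum_mul_right, (hasSum_scaleCoeff hβ k).tsum_eq, one_mul]
  have hprod' := hprod.prod_symm
  refine ⟨fun j => ∑' k, scaleCoeff β j k * (M * r' ^ k), hprod'.prod, fun j z hz => ?_⟩
  rw [mem_ball_zero_iff] at hz
  refine tsum_of_norm_bounded (hprod'.prod_factor j).hasSum fun k => ?_
  rw [norm_mul, Complex.norm_of_nonneg (scaleCoeff_nonneg hβ j k)]
  exact mul_le_mul_of_nonneg_left (h k z hz.le) (scaleCoeff_nonneg hβ j k)

lemma tsum_scalePiece {β : ℝ} (hβ : 0 < β) {f : Cn n → ℂ}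
    (hf : DifferentiableOn ℂ f (unitBall n)) {z : Cn n} (hz : z ∈ unitBall n) :
    f z = ∑' j, scalePiece β f j z := by
  have hz' := mem_ball_zero_iff.1 hz
  obtain ⟨M, r', hM, hr'0, hr'R, h⟩ := exists_homogPart_bound hf (norm_nonneg z) hz'
  have hm : Summable fun k : ℕ => M * r' ^ k :=
    (summable_geometric_of_lt_one hr'0 hr'R).mul_left M
  have hprod : Summable fun q : ℕ × ℕ => scaleCoeff β q.2 q.1 * (M * r' ^ q.1) := by
    refine (summable_prod_of_nonneg fun q =>
      mul_nonneg (scaleCoeff_nonneg hβ _ _) (by positivity)).2 ⟨fun k => ?_, ?_⟩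
    · exact (hasSum_scaleCoeff hβ k).summable.mul_right (M * r' ^ k)
    · refine hm.congr fun k => ?_
      simp only
      rw [tsum_mul_right, (hasSum_scaleCoeff hβ k).tsum_eq, one_mul]
  have hs : Summable fun q : ℕ × ℕ => (scaleCoeff β q.2 q.1 : ℂ) * homogPart f q.1 z := by
    refine Summable.of_norm_bounded hprod fun q => ?_
    rw [norm_mul, Complex.norm_of_nonneg (scaleCoeff_nonneg hβ _ _)]
    exact mul_le_mul_of_nonneg_left (h _ z le_rfl) (scaleCoeff_nonneg hβ _ _)
  have hcomm := Summable.tsum_comm (f := fun k j => (scaleCoeff β j k : ℂ) * homogPart f k z) hs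
  simp only [scalePiece]
  rw [hcomm, ← (hasSum_homogPart hf hz).tsum_eq]
  refine tsum_congr fun k => ?_
  rw [tsum_mul_right]
  have : ∑' j, (scaleCoeff β j k : ℂ) = 1 := by
    have := (Complex.hasSum_ofReal.2 (hasSum_scaleCoeff hβ k)).tsum_eq
    simpa using this
  rw [this, one_mul]

/-- Insert the integral defining the coefficients and exchange it with the sum over k; homogeneity
turns the factors e^{-kt} into the argument e^{-t}z. The norms of the terms integrate to multiples
of those of an absolutely convergent series, which also justifies the formula slightly outside the
ball. -/
lemma scalePiece_eq_integral {β : ℝ} (hβ : 0 < β) {f : Cn n → ℂ}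
    (hf : DifferentiableOn ℂ f (unitBall n)) (j : ℕ) {z : Cn n} (hz : ‖z‖ < 1 + dl j / 4) :
    scalePiece β f j z = ((Real.Gamma β)⁻¹ : ℝ) * ∫ t in scaleSet j,
      ((t ^ (β - 1) * Real.exp (-t) : ℝ) : ℂ) * radialDeriv β f (Real.exp (-t) • z) := by
  set F : ℕ → ℝ → ℂ := fun k t =>
    ((t ^ (β - 1) * Real.exp (-(((k : ℝ) + 1) * t)) : ℝ) : ℂ) *
      (((((k : ℝ) + 1) ^ β : ℝ) : ℂ) * homogPart f k z) with hF
  have hG := Real.Gamma_pos_of_pos hβ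
  have hInt : ∀ k : ℕ, IntegrableOn (fun t : ℝ => t ^ (β - 1) * Real.exp (-(((k : ℝ) + 1) * t)))
      (scaleSet j) := fun k => (integrableOn_gamma hβ k).mono_set (scaleSet_subset j)
  have hFint : ∀ k, Integrable (F k) (volume.restrict (scaleSet j)) := fun k =>
    (hInt k).ofReal.mul_const _
  have hval : ∀ k, ∫ t in scaleSet j, F k t =
      (Real.Gamma β : ℂ) * ((scaleCoeff β j k : ℂ) * homogPart f k z) := by
    intro k
    simp only [hF]
    rw [integral_mul_const, integral_complex_ofReal, scaleCoeff]
    push_cast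
    have : (Real.Gamma β : ℂ) ≠ 0 := by exact_mod_cast hG.ne'
    field_simp
  have hvaln : ∀ k, ∫ t in scaleSet j, ‖F k t‖ =
      Real.Gamma β * ‖(scaleCoeff β j k : ℂ) * homogPart f k z‖ := by
    intro k
    have e1 : ∀ t ∈ scaleSet j, ‖F k t‖ = (t ^ (β - 1) * Real.exp (-(((k : ℝ) + 1) * t))) *
        (((k : ℝ) + 1) ^ β * ‖homogPart f k z‖) := by
      intro t ht
      have : (0 : ℝ) < t := scaleSet_subset j ht
      rw [hF]
      simp only [norm_mul, Complex.norm_real]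
      rw [Real.norm_of_nonneg (by positivity), Real.norm_of_nonneg (by positivity),
        Real.norm_of_nonneg (by positivity)]
    rw [setIntegral_congr_fun (measurableSet_scaleSet j) e1, integral_mul_const, norm_mul,
      Complex.norm_of_nonneg (scaleCoeff_nonneg hβ j k), scaleCoeff]
    field_simp
  have hsum : Summable fun k => ∫ t in scaleSet j, ‖F k t‖ := by
    simp_rw [hvaln]
    exact ((normallySummable_scaleCoeff hβ hf j).summable
      (mem_ball_zero_iff.2 hz)).norm.mul_left _
  have h := (hasSum_integral_of_summable_integral_norm hFint hsum).tsum_eq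
  simp_rw [hval] at h
  rw [tsum_mul_left] at h
  have hGc : (Real.Gamma β : ℂ) ≠ 0 := by exact_mod_cast hG.ne'
  have h2 : scalePiece β f j z = ((Real.Gamma β)⁻¹ : ℝ) * ∫ t in scaleSet j, ∑' k, F k t := by
    rw [← h, scalePiece]
    push_cast
    rw [← mul_assoc, inv_mul_cancel₀ hGc, one_mul]
  rw [h2]
  congr 1
  refine setIntegral_congr_fun (measurableSet_scaleSet j) fun t _ => ?_
  simp only [radialDeriv]
  rw [← tsum_mul_left]
  refine tsum_congr fun k => ?_
  have e : Real.exp (-t) • z = (Real.exp (-t) : ℂ) • z := by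
    ext i; simp
  rw [e, homogPart_smul, hF]
  have e2 : Real.exp (-(((k : ℝ) + 1) * t)) = Real.exp (-t) * Real.exp (-t) ^ k := by
    rw [← Real.exp_nat_mul, ← Real.exp_add]; congr 1; ring
  simp only [e2]
  push_cast
  ring

end

/-! ### Size of the pieces and weighted discrete inequalities -/

noncomputable section

open Metric

variable {n : ℕ}

/-! ### Pointwise bounds for the pieces -/

/-- The maximum over the approach region of `x` up to scale `j`, in summed form. -/
def sumMax (g : Cn n → ℂ) (j : ℕ) (x : Cn n) : ℝ≥0∞ := ∑ i ∈ Finset.range (j + 1), localMax g i x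

lemma measurable_sumMax (g : Cn n → ℂ) (j : ℕ) : Measurable fun x : Cn n => sumMax g j x :=
  Finset.measurable_fun_sum _ fun i _ => measurable_localMax g i

lemma exists_lintegral_scaleSet_le {β : ℝ} (hβ : 0 < β) : ∃ C : ℝ≥0∞, C ≠ ∞ ∧ ∀ j : ℕ,
    ∫⁻ t in scaleSet j, ENNReal.ofReal (t ^ (β - 1) * Real.exp (-t)) ≤ C * twoPow (-(j * β)) := by
  have hInt := integrableOn_gamma hβ 0
  have hfin : ∫⁻ t in Set.Ioi (0 : ℝ), ENNReal.ofReal (t ^ (β - 1) * Real.exp (-t)) ≠ ∞ := by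
    have h := hInt.2
    rw [hasFiniteIntegral_iff_ofReal] at h
    · simpa using h.ne
    · filter_upwards [ae_restrict_mem measurableSet_Ioi] with t ht
      have : (0 : ℝ) < t := ht
      simp only [Pi.zero_apply]
      positivity
  refine ⟨(∫⁻ t in Set.Ioi (0 : ℝ), ENNReal.ofReal (t ^ (β - 1) * Real.exp (-t))) + 1, by finiteness,
    fun j => ?_⟩
  cases j with
  | zero =>
    simp only [Nat.cast_zero, zero_mul, neg_zero, twoPow_zero, mul_one]
    exact le_add_right (lintegral_mono_set (scaleSet_subset 0))
  | succ j =>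
    rw [add_mul, one_mul]
    refine le_add_left ?_
    have hpt : ∀ t ∈ scaleSet (j + 1), ENNReal.ofReal (t ^ (β - 1) * Real.exp (-t)) ≤
        ENNReal.ofReal (dl (j + 1) ^ β * (dl (j + 2))⁻¹) := by
      intro t ht
      have ht0 : (0 : ℝ) < t := scaleSet_subset _ ht
      have ht1 : dl (j + 2) < t := lt_of_mem_scaleSet ht
      have ht2 : t ≤ dl (j + 1) := ht.2
      refine ENNReal.ofReal_le_ofReal ?_
      have h1 : Real.exp (-t) ≤ 1 := Real.exp_le_one_iff.2 (by linarith)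
      calc t ^ (β - 1) * Real.exp (-t) ≤ t ^ (β - 1) * 1 := by gcongr
        _ = t ^ β * t⁻¹ := by rw [mul_one, Real.rpow_sub_one ht0.ne', div_eq_mul_inv]
        _ ≤ dl (j + 1) ^ β * (dl (j + 2))⁻¹ := by
            have := dl_pos (j + 2)
            have := dl_pos (j + 1)
            gcongr
    calc _ ≤ ∫⁻ t in scaleSet (j + 1), ENNReal.ofReal (dl (j + 1) ^ β * (dl (j + 2))⁻¹) :=
          setLIntegral_mono' (measurableSet_scaleSet _) hpt
      _ = ENNReal.ofReal (dl (j + 1) ^ β * (dl (j + 2))⁻¹) * ENNReal.ofReal (dl (j + 2)) := by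
          rw [setLIntegral_const]
          congr 1
          change volume (Set.Ioc _ _) = _
          rw [Real.volume_Ioc, dl_succ (j + 1)]
          congr 1; ring
      _ = _ := by
          have h1 := dl_pos (j + 1)
          have h2 := dl_pos (j + 2)
          rw [← ENNReal.ofReal_mul (by positivity), mul_assoc, inv_mul_cancel₀ h2.ne', mul_one,
            ← ENNReal.ofReal_rpow_of_pos h1, ofReal_dl, twoPow_rpow]
          congr 1
          ring

lemma exp_neg_le_of_mem_scaleSet {j : ℕ} {t : ℝ} (ht : t ∈ scaleSet j) :
    Real.exp (-t) ≤ 1 - dl j / 4 := by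
  have h1 := lt_of_mem_scaleSet ht
  rw [dl_succ] at h1
  have h2 := dl_le_one j
  have h3 := dl_pos j
  have h4 := Real.add_one_le_exp (dl j / 2)
  calc Real.exp (-t) ≤ Real.exp (-(dl j / 2)) := Real.exp_le_exp.2 (by linarith)
    _ = (Real.exp (dl j / 2))⁻¹ := Real.exp_neg _
    _ ≤ (dl j / 2 + 1)⁻¹ := by gcongr
    _ ≤ 1 - dl j / 4 := by
        rw [inv_le_iff_one_le_mul₀ (by positivity)]
        nlinarith

lemma norm_sq_le_of_mem_nibox {x z : Cn n} (hx : ‖x‖ = 1) {ρ r : ℝ} (hρ : ρ ∈ Set.Icc (0 : ℝ) 1)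
    (hz : z ∈ nibox x (ρ • x) r) : ‖z‖ ^ 2 ≤ ρ ^ 2 + 3 * r ^ 2 := by
  obtain ⟨h1, h2⟩ := hz
  set u := z - ρ • x with hu
  have e : z = ρ • x + u := by rw [hu]; abel
  have h3 := @norm_add_sq ℂ _ _ _ _ (ρ • x) u
  rw [← e] at h3
  have h4 : (inner ℂ (ρ • x) u : ℂ) = ρ * inner ℂ x u := by
    have : ρ • x = (ρ : ℂ) • x := rfl
    rw [this, inner_smul_left]; simp
  have h5 : RCLike.re (inner ℂ (ρ • x) u : ℂ) ≤ r ^ 2 := by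
    refine (RCLike.re_le_norm _).trans ?_
    rw [h4, norm_mul, Complex.norm_of_nonneg hρ.1]
    nlinarith [hρ.1, hρ.2, norm_nonneg (inner ℂ x u : ℂ)]
  have h6 : ‖ρ • x‖ = ρ := by rw [norm_smul, hx, mul_one, Real.norm_of_nonneg hρ.1]
  rw [h3, h6]
  nlinarith [norm_nonneg u]

lemma mem_ball_of_mem_nibox {x z : Cn n} (hx : ‖x‖ = 1) {ρ r : ℝ} (hρ : ρ ∈ Set.Icc (0 : ℝ) 1)
    {j : ℕ} (hr : r ^ 2 ≤ dl j / 64) (hz : z ∈ nibox x (ρ • x) r) :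
    z ∈ ball (0 : Cn n) (1 + dl j / 4) := by
  have h := norm_sq_le_of_mem_nibox hx hρ hz
  have hj := dl_pos j
  rw [mem_ball_zero_iff]
  have h2 : ρ ^ 2 ≤ 1 := by nlinarith [hρ.1, hρ.2]
  nlinarith [norm_nonneg z]

/-- The height of t•z is essentially h = 1 - tρ, which lies between 2^{-j}/4 and 1. Choosing i ≤ j
with 2^{-i}/4 ≤ h ≤ 2^{-i} puts the point in the part of the approach region seen by `localMax g i
x`; the size of the box is too small to spoil this. -/
lemma enorm_le_sumMax {g : Cn n → ℂ} {x z : Cn n} (hx : ‖x‖ = 1) {ρ r t : ℝ}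
    (hρ : ρ ∈ Set.Icc (0 : ℝ) 1) {j : ℕ} (hr : r ^ 2 ≤ dl j / 64) (hz : z ∈ nibox x (ρ • x) r)
    (ht0 : 0 ≤ t) (ht : t ≤ 1 - dl j / 4) : ‖g (t • z)‖ₑ ≤ sumMax g j x := by
  have hj := dl_pos j
  have ht1 : t ≤ 1 := by linarith
  set h := 1 - t * ρ with hh
  have htρ : t * ρ ≤ t := by nlinarith [hρ.1, hρ.2]
  have htρ0 : 0 ≤ t * ρ := mul_nonneg ht0 hρ.1
  have hh1 : dl j / 4 ≤ h := by rw [hh]; linarith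
  have hh2 : h ≤ 1 := by rw [hh]; linarith
  obtain ⟨i, hij, hi1, hi2⟩ : ∃ i ≤ j, dl i / 4 ≤ h ∧ h ≤ dl i := by
    rcases le_or_gt h (dl j) with h1 | h1
    · exact ⟨j, le_rfl, hh1, h1⟩
    · obtain ⟨i, hi1, hi2⟩ := exists_nat_pow_near_of_lt_one (lt_trans (by linarith) h1) hh2
        (by norm_num : (0 : ℝ) < 1 / 2) (by norm_num)
      have hi1' : dl (i + 1) < h := hi1
      have hi2' : h ≤ dl i := hi2
      refine ⟨i, ?_, ?_, hi2'⟩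
      · by_contra! hlt
        have := dl_anti hlt.le
        linarith
      · rw [dl_succ] at hi1'
        have := dl_pos i
        linarith
  have hdi := dl_pos i
  have hdi1 := dl_le_one i
  have hdij := dl_anti hij
  have hnorm := norm_sq_le_of_mem_nibox hx hρ hz
  have hregion1 : ‖t • z‖ < 1 - dl i / 8 := by
    rw [norm_smul, Real.norm_of_nonneg ht0]
    have h1 : (t * ‖z‖) ^ 2 ≤ (1 - h) ^ 2 + 3 * dl j / 64 := by
      have e1 : (t * ρ) = 1 - h := by rw [hh]; ring
      rw [← e1, mul_pow, mul_pow]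
      have h5 : t ^ 2 ≤ 1 := by nlinarith
      nlinarith [sq_nonneg t, mul_le_mul_of_nonneg_left hnorm (sq_nonneg t)]
    have h2 : (1 - h) ^ 2 ≤ (1 - dl i / 4) ^ 2 := by
      refine pow_le_pow_left₀ (by linarith) (by linarith) 2
    have h3 : (t * ‖z‖) ^ 2 < (1 - dl i / 8) ^ 2 := by nlinarith
    exact lt_of_pow_lt_pow_left₀ 2 (by linarith) h3
  have hregion2 : nidist (t • z) x < 2 * dl i := by
    have e : (1 : ℂ) - inner ℂ x (t • z) = (h : ℂ) - t * inner ℂ x (z - ρ • x) := by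
      have e1 : t • z = (t : ℂ) • z := rfl
      have e2 : ρ • x = (ρ : ℂ) • x := rfl
      have e3 : (inner ℂ x x : ℂ) = 1 := by rw [inner_self_eq_norm_sq_to_K, hx]; simp
      rw [e1, e2, inner_smul_right, inner_sub_right, inner_smul_right, e3, hh]
      push_cast
      ring
    rw [nidist, e]
    refine (norm_sub_le _ _).trans_lt ?_
    rw [norm_mul, Complex.norm_of_nonneg ht0, Complex.norm_of_nonneg (by linarith : 0 ≤ h)]
    have h1 := hz.1
    nlinarith [norm_nonneg (inner ℂ x (z - ρ • x) : ℂ)]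
  refine (le_localMax hregion1 hregion2).trans ?_
  exact Finset.single_le_sum (f := fun i => localMax g i x) (fun _ _ => zero_le)
    (Finset.mem_range.2 (by omega))

/-- In the integral formula e^{-t} ≤ 1 - 2^{-j}/4 on the j-th scale, so the integrand is controlled
by `sumMax`, and the mass of t^{β-1}e^{-t} on that scale is of order 2^{-jβ}. -/
lemma exists_enorm_scalePiece_le {β : ℝ} (hβ : 0 < β) : ∃ C : ℝ≥0∞, C ≠ ∞ ∧
    ∀ (f : Cn n → ℂ), DifferentiableOn ℂ f (unitBall n) → ∀ x : Cn n, ‖x‖ = 1 →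
      ∀ (j : ℕ) (ρ r : ℝ), ρ ∈ Set.Icc (0 : ℝ) 1 → r ^ 2 ≤ dl j / 64 →
      ∀ z ∈ nibox x (ρ • x) r,
        ‖scalePiece β f j z‖ₑ ≤ C * twoPow (-(j * β)) * sumMax (radialDeriv β f) j x := by
  obtain ⟨C, hCt, hC⟩ := exists_lintegral_scaleSet_le hβ
  refine ⟨‖((Real.Gamma β)⁻¹ : ℝ)‖ₑ * C, by finiteness, fun f hf x hx j ρ r hρ hr z hz => ?_⟩
  have hball := mem_ball_of_mem_nibox hx hρ hr hz
  rw [scalePiece_eq_integral hβ hf j (mem_ball_zero_iff.1 hball), enorm_mul]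
  have e1 : ‖(((Real.Gamma β)⁻¹ : ℝ) : ℂ)‖ₑ = ‖((Real.Gamma β)⁻¹ : ℝ)‖ₑ := by
    rw [← ofReal_norm, ← ofReal_norm, Complex.norm_real]
  rw [e1, mul_assoc, mul_assoc]
  refine mul_le_mul_right ?_ _
  set A := sumMax (radialDeriv β f) j x
  calc _ ≤ ∫⁻ t in scaleSet j, ‖((t ^ (β - 1) * Real.exp (-t) : ℝ) : ℂ) *
        radialDeriv β f (Real.exp (-t) • z)‖ₑ := enorm_integral_le_lintegral_enorm _
    _ ≤ ∫⁻ t in scaleSet j, ENNReal.ofReal (t ^ (β - 1) * Real.exp (-t)) * A := by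
        refine setLIntegral_mono' (measurableSet_scaleSet j) fun t ht => ?_
        have ht0 : (0 : ℝ) < t := scaleSet_subset j ht
        rw [enorm_mul]
        refine mul_le_mul' (le_of_eq ?_) ?_
        · rw [← ofReal_norm, Complex.norm_of_nonneg (by positivity)]
        · exact enorm_le_sumMax hx hρ hr hz (Real.exp_pos _).le (exp_neg_le_of_mem_scaleSet ht)
    _ = (∫⁻ t in scaleSet j, ENNReal.ofReal (t ^ (β - 1) * Real.exp (-t))) * A := by
        rw [lintegral_mul_const]
        fun_prop
    _ ≤ (C * twoPow (-(j * β))) * A := mul_le_mul_left (hC j) _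
    _ = _ := by ring

/-! ### Discrete convolution inequalities -/

lemma tsum_twoPow_abs_le (θ : ℝ) (i : ℕ) :
    ∑' j : ℕ, twoPow (-(θ * |(i : ℝ) - j|)) ≤ 2 * ∑' m : ℕ, twoPow (-(θ * m)) := by
  rw [← ENNReal.summable.sum_add_tsum_nat_add' (k := i), two_mul]
  refine add_le_add ?_ ?_
  · rw [← Finset.sum_range_reflect]
    calc _ ≤ ∑ m ∈ Finset.range i, twoPow (-(θ * (m + 1 : ℕ))) := by
          refine Finset.sum_le_sum fun m hm => le_of_eq ?_
          have hm' := Finset.mem_range.1 hm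
          have : ((i - 1 - m : ℕ) : ℝ) = (i : ℝ) - 1 - m := by
            rw [Nat.cast_sub (by omega), Nat.cast_sub (by omega)]; simp
          rw [this]
          congr 3
          push_cast
          rw [abs_of_nonneg (by linarith [Nat.cast_nonneg (α := ℝ) m])]
          ring
      _ ≤ ∑' m : ℕ, twoPow (-(θ * (m + 1 : ℕ))) := ENNReal.sum_le_tsum _
      _ ≤ _ := ENNReal.tsum_comp_le_tsum_of_injective (f := fun m : ℕ => m + 1)
          (fun a b h => by simpa using h) (fun m : ℕ => twoPow (-(θ * m)))
  · refine ENNReal.tsum_le_tsum fun m => le_of_eq ?_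
    congr 3
    push_cast
    rw [show (i : ℝ) - (m + i) = -m by ring, abs_neg, abs_of_nonneg (Nat.cast_nonneg _)]

/-- Young's inequality for exponentially decaying kernels. -/
lemma exists_tsum_kernel_le {θ p : ℝ} (hθ : 0 < θ) (hp : 1 ≤ p) {C : ℝ≥0∞} (hC : C ≠ ∞) :
    ∃ C' : ℝ≥0∞, C' ≠ ∞ ∧ ∀ (k : ℕ → ℕ → ℝ≥0∞), (∀ i j, k i j ≤ C * twoPow (-(θ * |(i : ℝ) - j|))) →
      ∀ u : ℕ → ℝ≥0∞, ∑' i, (∑' j, k i j * u j) ^ p ≤ C' * ∑' j, u j ^ p := by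
  set G := ∑' m : ℕ, twoPow (-(θ * m))
  have hG : G ≠ ∞ := tsum_twoPow_ne_top hθ
  set A := C * (2 * G)
  have hA : A ≠ ∞ := by finiteness
  refine ⟨A ^ (p - 1) * A, ENNReal.mul_ne_top
    (ENNReal.rpow_ne_top_of_nonneg (by linarith) hA) hA, fun k hk u => ?_⟩
  refine tsum_schur_le k (fun i => ?_) (fun j => ?_) u hp
  · calc _ ≤ ∑' j : ℕ, C * twoPow (-(θ * |(i : ℝ) - j|)) := ENNReal.tsum_le_tsum fun j => hk i j
      _ ≤ _ := by
        rw [ENNReal.tsum_mul_left]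
        exact mul_le_mul_right (tsum_twoPow_abs_le θ i) _
  · calc _ ≤ ∑' i : ℕ, C * twoPow (-(θ * |(j : ℝ) - i|)) :=
          ENNReal.tsum_le_tsum fun i => by rw [abs_sub_comm]; exact hk i j
      _ ≤ _ := by
        rw [ENNReal.tsum_mul_left]
        exact mul_le_mul_right (tsum_twoPow_abs_le θ j) _

/-- The natural weight at scale `i`. -/
def ballWeight (μ : Measure (Cn n)) (i : ℕ) (x : Cn n) : ℝ≥0∞ :=
  ENNReal.ofReal (dl i) ^ n * (μ (niball x (dl i)))⁻¹

variable {μ : Measure (Cn n)} {K : Set (Cn n)} {s d : ℝ}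

lemma measurable_ballWeight (μ : Measure (Cn n)) [SFinite μ] (i : ℕ) :
    Measurable fun x : Cn n => ballWeight μ i x :=
  (measurable_measure_niball μ (dl i)).inv.const_mul _

lemma ofReal_dl_pow (i m : ℕ) :
    ENNReal.ofReal (dl (i + m)) ^ n = twoPow (-(m * n)) * ENNReal.ofReal (dl i) ^ n := by
  rw [dl_add, ENNReal.ofReal_mul (dl_pos i).le, mul_pow, ofReal_dl m, twoPow_pow, mul_comm]
  congr 2
  ring

lemma IsRegular.exists_ballWeight_le (h : IsRegular μ K s d) : ∃ C : ℝ≥0∞, C ≠ ∞ ∧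
    ∀ x ∈ K, ∀ i m : ℕ, ballWeight μ (i + m) x ≤ C * twoPow (-(m * (n - s))) * ballWeight μ i x := by
  have := h.prob
  obtain ⟨C, hCt, hC⟩ := h.upper
  refine ⟨C, hCt, fun x hx i m => ?_⟩
  have h2 : (μ (niball x (dl (i + m))))⁻¹ ≤ C * twoPow (m * s) * (μ (niball x (dl i)))⁻¹ := by
    rw [← div_eq_mul_inv, ENNReal.le_div_iff_mul_le (Or.inl (h.pos x hx _ (dl_pos _)))
      (Or.inl (measure_ne_top _ _)), mul_comm, ← div_eq_mul_inv]
    exact ENNReal.div_le_of_le_mul (hC x hx i m)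
  rw [ballWeight, ballWeight, ofReal_dl_pow]
  calc _ ≤ twoPow (-(m * n)) * ENNReal.ofReal (dl i) ^ n *
        (C * twoPow (m * s) * (μ (niball x (dl i)))⁻¹) := mul_le_mul_right h2 _
    _ = C * (twoPow (-(m * n)) * twoPow (m * s)) *
        (ENNReal.ofReal (dl i) ^ n * (μ (niball x (dl i)))⁻¹) := by ring
    _ = _ := by rw [← twoPow_add]; congr 3; ring

lemma IsRegular.exists_ballWeight_ge (h : IsRegular μ K s d) : ∃ C : ℝ≥0∞, C ≠ ∞ ∧
    ∀ x ∈ K, ∀ i m : ℕ, ballWeight μ i x ≤ C * twoPow (m * (n - d)) * ballWeight μ (i + m) x := by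
  have := h.prob
  obtain ⟨C, hCt, hC⟩ := h.lower
  refine ⟨C, hCt, fun x hx i m => ?_⟩
  have h2 : (μ (niball x (dl i)))⁻¹ ≤
      C * twoPow (-(m * d)) * (μ (niball x (dl (i + m))))⁻¹ := by
    rw [← div_eq_mul_inv, ENNReal.le_div_iff_mul_le (Or.inl (h.pos x hx _ (dl_pos _)))
      (Or.inl (measure_ne_top _ _)), mul_comm, ← div_eq_mul_inv]
    refine ENNReal.div_le_of_le_mul ?_
    have h3 := mul_le_mul_right (hC x hx i m) (twoPow (-(m * d)))
    rw [← mul_assoc, ← twoPow_add, neg_add_cancel, twoPow_zero, one_mul] at h3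
    refine h3.trans (le_of_eq (by ring))
  rw [ballWeight, ballWeight, ofReal_dl_pow]
  calc _ ≤ ENNReal.ofReal (dl i) ^ n *
        (C * twoPow (-(m * d)) * (μ (niball x (dl (i + m))))⁻¹) := mul_le_mul_right h2 _
    _ = _ := by
        have e : twoPow (-(m * d)) = twoPow (m * (n - d)) * twoPow (-(m * n)) := by
          rw [← twoPow_add]; congr 1; ring
        rw [e]; ring

lemma IsRegular.ballWeight_ne_zero (h : IsRegular μ K s d) (i : ℕ) (x : Cn n) :
    ballWeight μ i x ≠ 0 := by
  have := h.prob
  exact mul_ne_zero (pow_ne_zero _ (ENNReal.ofReal_pos.2 (dl_pos i)).ne')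
    (ENNReal.inv_ne_zero.2 (measure_ne_top _ _))

lemma IsRegular.ballWeight_ne_top (h : IsRegular μ K s d) (i : ℕ) {x : Cn n} (hx : x ∈ K) :
    ballWeight μ i x ≠ ∞ :=
  ENNReal.mul_ne_top (by finiteness) (ENNReal.inv_ne_top.2 (h.pos x hx _ (dl_pos i)))

/-- The weighted form of Young's inequality. -/
lemma exists_tsum_weight_kernel_le {θ p : ℝ} (hθ : 0 < θ) (hp : 1 ≤ p) {C : ℝ≥0∞} (hC : C ≠ ∞) :
    ∃ C' : ℝ≥0∞, C' ≠ ∞ ∧ ∀ (v : ℕ → ℝ≥0∞), (∀ i, v i ≠ 0) → (∀ i, v i ≠ ∞) →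
      ∀ k : ℕ → ℕ → ℝ≥0∞,
      (∀ i j, v i ^ p⁻¹ * k i j ≤ C * twoPow (-(θ * |(i : ℝ) - j|)) * v j ^ p⁻¹) →
      ∀ u : ℕ → ℝ≥0∞, ∑' i, v i * (∑' j, k i j * u j) ^ p ≤ C' * ∑' j, v j * u j ^ p := by
  obtain ⟨C', hC't, hC'⟩ := exists_tsum_kernel_le hθ hp hC
  have hp0 : 0 < p := by linarith
  refine ⟨C', hC't, fun v hv0 hvt k hk u => ?_⟩
  have hvp0 : ∀ i, v i ^ p⁻¹ ≠ 0 := fun i => by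
    rw [Ne, ENNReal.rpow_eq_zero_iff]
    simp [hv0 i, hvt i]
  have hvpt : ∀ i, v i ^ p⁻¹ ≠ ∞ := fun i =>
    ENNReal.rpow_ne_top_of_nonneg (by positivity) (hvt i)
  have hvp : ∀ i, (v i ^ p⁻¹) ^ p = v i := fun i => by
    rw [← ENNReal.rpow_mul, inv_mul_cancel₀ hp0.ne', ENNReal.rpow_one]
  -- Conjugating the kernel by v^{1/p} reduces the weighted inequality to the unweighted one.
  have h := hC' (fun i j => v i ^ p⁻¹ * k i j * (v j ^ p⁻¹)⁻¹) (fun i j => ?_)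
    (fun j => v j ^ p⁻¹ * u j)
  · calc _ = ∑' i, (∑' j, v i ^ p⁻¹ * k i j * (v j ^ p⁻¹)⁻¹ * (v j ^ p⁻¹ * u j)) ^ p := by
          refine tsum_congr fun i => ?_
          have e : ∀ j, v i ^ p⁻¹ * k i j * (v j ^ p⁻¹)⁻¹ * (v j ^ p⁻¹ * u j) =
              v i ^ p⁻¹ * (k i j * u j) := fun j => by
            rw [mul_assoc (v i ^ p⁻¹ * k i j), ← mul_assoc (v j ^ p⁻¹)⁻¹,
              ENNReal.inv_mul_cancel (hvp0 j) (hvpt j), one_mul, mul_assoc]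
          simp_rw [e]
          rw [ENNReal.tsum_mul_left, ENNReal.mul_rpow_of_nonneg _ _ hp0.le, hvp]
      _ ≤ _ := h
      _ = _ := by
          congr 1
          refine tsum_congr fun j => ?_
          rw [ENNReal.mul_rpow_of_nonneg _ _ hp0.le, hvp]
  · rw [← div_eq_mul_inv]
    exact ENNReal.div_le_of_le_mul (hk i j)

/-- A discrete Hardy inequality: the kernel is the indicator of i ≤ j, and its decay comes entirely
from the weights, which fall like 2^{-(j-i)(n-s)} because s < n. -/
lemma IsRegular.exists_tsum_sumMax_le (h : IsRegular μ K s d) (hs : s < n) {p : ℝ} (hp : 1 ≤ p) :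
    ∃ C : ℝ≥0∞, C ≠ ∞ ∧ ∀ (g : Cn n → ℂ), ∀ x ∈ K,
      ∑' j, ballWeight μ j x * sumMax g j x ^ p ≤
        C * ∑' j, ballWeight μ j x * localMax g j x ^ p := by
  obtain ⟨C, hCt, hC⟩ := h.exists_ballWeight_le
  have hp0 : 0 < p := by linarith
  have hθ : 0 < (n - s) / p := div_pos (by linarith) hp0
  obtain ⟨C', hC't, hC'⟩ := exists_tsum_weight_kernel_le hθ hp
    (ENNReal.rpow_ne_top_of_nonneg (by positivity : 0 ≤ p⁻¹) hCt)
  refine ⟨C', hC't, fun g x hx => ?_⟩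
  have := hC' (fun j => ballWeight μ j x) (fun j => h.ballWeight_ne_zero j x)
    (fun j => h.ballWeight_ne_top j hx) (fun j i => if i ≤ j then 1 else 0) (fun j i => ?_)
    (fun j => localMax g j x)
  · refine le_trans (ENNReal.tsum_le_tsum fun j => ?_) this
    gcongr
    rw [sumMax]
    refine le_trans (Finset.sum_le_sum fun i hi => ?_) (ENNReal.sum_le_tsum (Finset.range (j + 1)))
    have : i ≤ j := by have := Finset.mem_range.1 hi; omega
    simp [this]
  · split_ifs with hij
    · obtain ⟨m, rfl⟩ := Nat.exists_eq_add_of_le hij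
      rw [mul_one]
      refine (ENNReal.rpow_le_rpow (hC x hx i m) (by positivity : 0 ≤ p⁻¹)).trans (le_of_eq ?_)
      rw [ENNReal.mul_rpow_of_nonneg _ _ (by positivity), ENNReal.mul_rpow_of_nonneg _ _
        (by positivity), twoPow_rpow]
      congr 3
      push_cast
      rw [show (i : ℝ) + m - i = m by ring, abs_of_nonneg (Nat.cast_nonneg _)]
      field_simp
    · simp

end

/-! ### Derivatives and monomials in adapted frames -/

noncomputable section

open Metric

variable {n : ℕ}

/-! ### Monomials in an orthonormal frame -/

/-- The monomial `∏ ⟨z - y, D_o⟩ ^ a_o`. -/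
def frameMonomial {ι : Type*} [Fintype ι] (D : ι → Cn n) (y : Cn n) (a : ι → ℕ) (z : Cn n) : ℂ :=
  ∏ o, (inner ℂ (D o) (z - y)) ^ a o

lemma differentiable_frameMonomial {ι : Type*} [Fintype ι] (D : ι → Cn n) (y : Cn n) (a : ι → ℕ) :
    Differentiable ℂ (frameMonomial D y a) := by
  unfold frameMonomial
  have h : ∀ o, ContDiff ℂ 1 fun z : Cn n => (inner ℂ (D o) (z - y) : ℂ) := fun o =>
    (innerSL ℂ (D o)).contDiff.comp (contDiff_id.sub contDiff_const)
  exact (contDiff_prod fun o _ => (h o).pow (a o)).differentiable (by norm_num)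

lemma dirDeriv_frameMonomial {ι : Type*} [Fintype ι] [DecidableEq ι] {D : ι → Cn n}
    (hD : Orthonormal ℂ D) (y : Cn n) (a : ι → ℕ) (o : ι) (z : Cn n) :
    dirDeriv (D o) (frameMonomial D y a) z =
      a o * frameMonomial D y (a - Pi.single o 1) z := by
  rw [dirDeriv_eq_deriv_line (differentiable_frameMonomial D y a z)]
  have e : (fun w : ℂ => frameMonomial D y a (z + w • D o)) = fun w : ℂ =>
      (inner ℂ (D o) (z - y) + w) ^ a o *
        ∏ o' ∈ Finset.univ.erase o, (inner ℂ (D o') (z - y)) ^ a o' := by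
    funext w
    rw [frameMonomial, ← Finset.mul_prod_erase _ _ (Finset.mem_univ o)]
    congr 1
    · congr 1
      rw [show z + w • D o - y = (z - y) + w • D o by abel, inner_add_right, inner_smul_right,
        inner_self_eq_norm_sq_to_K, hD.1 o, RCLike.ofReal_one, one_pow, mul_one]
    · refine Finset.prod_congr rfl fun o' ho' => ?_
      congr 1
      rw [show z + w • D o - y = (z - y) + w • D o by abel, inner_add_right, inner_smul_right,
        hD.2 (Finset.ne_of_mem_erase ho'), mul_zero, add_zero]
  rw [e]
  have hd : HasDerivAt (fun w : ℂ => (inner ℂ (D o) (z - y) + w) ^ a o)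
      (a o * (inner ℂ (D o) (z - y)) ^ (a o - 1)) 0 := by
    generalize (inner ℂ (D o) (z - y) : ℂ) = c
    have := ((hasDerivAt_id (0 : ℂ)).const_add c).fun_pow (a o)
    simpa using this
  rw [(hd.mul_const _).deriv, frameMonomial, ← Finset.mul_prod_erase _ _ (Finset.mem_univ o)]
  rw [mul_assoc]
  congr 2
  · simp
  · refine Finset.prod_congr rfl fun o' ho' => ?_
    simp [Finset.ne_of_mem_erase ho']

lemma derivList_frameMonomial {ι : Type*} [Fintype ι] [DecidableEq ι] {D : ι → Cn n}
    (hD : Orthonormal ℂ D) (y : Cn n) (a : ι → ℕ) (l : List ι) :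
    derivList (l.map D) (frameMonomial D y a) = fun z =>
      ((∏ o, (a o).descFactorial (l.count o) : ℕ) : ℂ) *
        frameMonomial D y (a - fun o => l.count o) z := by
  induction l with
  | nil =>
    funext z
    have : (a - fun o => List.count o ([] : List ι)) = a := by funext o; simp
    rw [this]
    simp
  | cons o l ih =>
    rw [List.map_cons, derivList_cons, ih]
    funext z
    have h1 : dirDeriv (D o) (fun z => ((∏ o, (a o).descFactorial (l.count o) : ℕ) : ℂ) *
        frameMonomial D y (a - fun o => l.count o) z) z =
        ((∏ o, (a o).descFactorial (l.count o) : ℕ) : ℂ) *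
          dirDeriv (D o) (frameMonomial D y (a - fun o => l.count o)) z := by
      simp only [dirDeriv]
      rw [fderiv_const_mul (differentiable_frameMonomial D y _ z)]
      rfl
    rw [h1, dirDeriv_frameMonomial hD, ← mul_assoc]
    congr 1
    · rw [← Finset.mul_prod_erase _ _ (Finset.mem_univ o),
        ← Finset.mul_prod_erase Finset.univ (fun o' => (a o').descFactorial ((o :: l).count o'))
        (Finset.mem_univ o), List.count_cons_self, Nat.descFactorial_succ]
      have : ∏ o' ∈ Finset.univ.erase o, (a o').descFactorial ((o :: l).count o') =
          ∏ o' ∈ Finset.univ.erase o, (a o').descFactorial (l.count o') := by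
        refine Finset.prod_congr rfl fun o' ho' => ?_
        rw [List.count_cons_of_ne (Finset.ne_of_mem_erase ho').symm]
      rw [this]
      push_cast [Pi.sub_apply]
      ring
    · congr 1
      funext o'
      by_cases h : o' = o
      · subst h; simp [Nat.sub_sub]
      · simp [h, List.count_cons_of_ne (Ne.symm h)]

/-- If some direction is differentiated more often than its exponent the coefficient vanishes; if
some exponent is not exhausted the monomial vanishes at `y`. Only an exact match survives. -/
lemma derivList_frameMonomial_self {ι : Type*} [Fintype ι] [DecidableEq ι] {D : ι → Cn n}
    (hD : Orthonormal ℂ D) (y : Cn n) (a : ι → ℕ) (l : List ι) :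
    derivList (l.map D) (frameMonomial D y a) y =
      if (fun o => l.count o) = a then ((∏ o, (a o).factorial : ℕ) : ℂ) else 0 := by
  rw [derivList_frameMonomial hD]
  split_ifs with h
  · subst h
    have e : ((fun o => l.count o) - fun o => l.count o) = (0 : ι → ℕ) := by simp
    simp only [e]
    simp [frameMonomial, Nat.descFactorial_self]
  · by_cases hle : ∀ o, a o ≤ l.count o
    · obtain ⟨o, ho⟩ : ∃ o, l.count o ≠ a o := by
        by_contra! hh; exact h (funext hh)
      have hlt : a o < l.count o := lt_of_le_of_ne (hle o) (Ne.symm ho)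
      rw [Finset.prod_eq_zero (Finset.mem_univ o) (Nat.descFactorial_eq_zero_iff_lt.2 hlt)]
      simp
    · push Not at hle
      obtain ⟨o, ho⟩ := hle
      have h0 : frameMonomial D y (a - fun o => l.count o) y = 0 := by
        refine Finset.prod_eq_zero (Finset.mem_univ o) ?_
        rw [sub_self, inner_zero_right, zero_pow]
        simp only [Pi.sub_apply]
        omega
      simp only [h0, mul_zero]

/-! ### Frames adapted to points of the sphere -/

/-- The index set of a frame: `none` stands for the complex normal direction. -/
abbrev FrameIndex (n : ℕ) : Type := Option (Fin (n - 1))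

/-- The directions `∂/∂w_o`. -/
def frameDir (τ : Fin (n - 1) → Cn n → Cn n) (ζ : Cn n) : FrameIndex n → Cn n
  | none => -ζ
  | some j => τ j ζ

/-- A multi-index as a function on the index set of the frame. -/
def MultiIndex.toFun (γ : MultiIndex n) : FrameIndex n → ℕ
  | none => γ.2
  | some j => γ.1 j

/-- The inverse of `MultiIndex.toFun`. -/
def MultiIndex.ofFun (a : FrameIndex n → ℕ) : MultiIndex n := (fun j => a (some j), a none)

lemma MultiIndex.ofFun_toFun (γ : MultiIndex n) : MultiIndex.ofFun γ.toFun = γ := rfl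

lemma MultiIndex.toFun_ofFun (a : FrameIndex n → ℕ) : (MultiIndex.ofFun a).toFun = a := by
  funext o; cases o <;> rfl

/-- The list of directions with multiplicities given by `γ`. -/
def indexList (γ : MultiIndex n) : List (FrameIndex n) :=
  List.replicate γ.2 none ++
    (List.finRange (n - 1)).flatMap fun j => List.replicate (γ.1 j) (some j)

lemma count_indexList (γ : MultiIndex n) (o : FrameIndex n) :
    (indexList γ).count o = γ.toFun o := by
  classical
  rw [indexList, List.count_append, List.count_flatMap]
  cases o with
  | none =>
    have : (List.map (List.count (none : FrameIndex n) ∘ fun j =>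
        List.replicate (γ.1 j) (some j)) (List.finRange (n - 1))).sum = 0 := by
      refine List.sum_eq_zero fun x hx => ?_
      obtain ⟨j, -, rfl⟩ := List.mem_map.1 hx
      simp [List.count_replicate]
    rw [this]
    simp [MultiIndex.toFun]
  | some i =>
    have : (List.map (List.count (some i : FrameIndex n) ∘ fun j =>
        List.replicate (γ.1 j) (some j)) (List.finRange (n - 1))).sum = γ.1 i := by
      have e : (List.count (some i : FrameIndex n) ∘ fun j => List.replicate (γ.1 j) (some j)) =
          fun j => if j = i then γ.1 j else 0 := by
        funext j; simp [List.count_replicate]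
      rw [e, ← List.ofFn_eq_map, List.sum_ofFn]
      simp
    rw [this]
    simp [MultiIndex.toFun, List.count_replicate]

lemma wDeriv_eq_derivList (τ : Fin (n - 1) → Cn n → Cn n) (ζ : Cn n) (γ : MultiIndex n)
    (g : Cn n → ℂ) : wDeriv τ ζ γ g = derivList ((indexList γ).map (frameDir τ ζ)) g := by
  have h : ∀ L : List (Fin (n - 1)), derivList ((L.flatMap fun j =>
      List.replicate (γ.1 j) (some j)).map (frameDir τ ζ)) g =
      L.foldr (fun j h => (dirDeriv (τ j ζ))^[γ.1 j] h) g := by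
    intro L
    induction L with
    | nil => rfl
    | cons j L ih =>
      rw [List.flatMap_cons, List.map_append, derivList_append, ih, List.map_replicate,
        derivList_replicate]
      rfl
  rw [indexList, List.map_append, derivList_append, h, List.map_replicate, derivList_replicate]
  rfl

/-- The nonisotropic order of a list of directions. -/
def frameOrder (l : List (FrameIndex n)) : ℕ := (l.map fun o => if o = none then 2 else 1).sum

/-- `2 ω(γ)` as a natural number. -/
def MultiIndex.order (γ : MultiIndex n) : ℕ := frameOrder (indexList γ)

lemma frameOrder_eq_count (l : List (FrameIndex n)) :
    frameOrder l = ∑ o, l.count o * if o = none then 2 else 1 := by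
  induction l with
  | nil => simp [frameOrder]
  | cons o l ih =>
    have e : frameOrder (o :: l) = (if o = none then 2 else 1) + frameOrder l := by
      simp [frameOrder]
    rw [e, ih]
    simp only [List.count_cons]
    simp only [add_mul, Finset.sum_add_distrib]
    rw [add_comm]
    congr 1
    rw [Finset.sum_eq_single o]
    · simp
    · intro b _ hb
      simp [Ne.symm hb]
    · simp

lemma order_eq_weight (γ : MultiIndex n) : (γ.order : ℝ) = 2 * weight γ := by
  rw [MultiIndex.order, frameOrder_eq_count]
  simp only [count_indexList, Fintype.sum_option]
  simp only [MultiIndex.toFun, if_true, weight]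
  push_cast
  simp
  ring

lemma order_ofFun_count (l : List (FrameIndex n)) :
    (MultiIndex.ofFun fun o => l.count o).order = frameOrder l := by
  rw [MultiIndex.order, frameOrder_eq_count, frameOrder_eq_count]
  simp only [count_indexList, MultiIndex.toFun_ofFun]

/-- Derivatives of a holomorphic function commute, so only the multiplicities of the directions
matter. -/
lemma derivList_eq_wDeriv {τ : Fin (n - 1) → Cn n → Cn n} {ζ : Cn n} {g : Cn n → ℂ}
    {U : Set (Cn n)} (hU : IsOpen U) (hg : DifferentiableOn ℂ g U) (l : List (FrameIndex n))
    {z : Cn n} (hz : z ∈ U) : derivList (l.map (frameDir τ ζ)) g z =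
      wDeriv τ ζ (MultiIndex.ofFun fun o => l.count o) g z := by
  rw [wDeriv_eq_derivList]
  refine derivList_perm hU hg (List.Perm.map _ ?_) hz
  rw [List.perm_iff_count]
  intro o
  rw [count_indexList, MultiIndex.toFun_ofFun]

lemma orthonormal_frameDir {E : Set (Cn n)} {τ : Fin (n - 1) → Cn n → Cn n}
    (hτ : IsTangentFrame E τ) {ζ : Cn n} (hζ : ζ ∈ E) (hζ1 : ‖ζ‖ = 1) :
    Orthonormal ℂ (frameDir τ ζ) := by
  have ho := hτ.orthonormal ζ hζ
  refine ⟨fun o => ?_, fun o o' hoo' => ?_⟩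
  · cases o with
    | none => simpa [frameDir] using hζ1
    | some j => exact ho.1 j
  · cases o with
    | none =>
      cases o' with
      | none => exact absurd rfl hoo'
      | some j => simp [frameDir, hτ.tangent ζ hζ j]
    | some i =>
      cases o' with
      | none =>
        have := hτ.tangent ζ hζ i
        rw [← inner_conj_symm, map_eq_zero] at this
        simpa [frameDir] using this
      | some j => exact ho.2 (fun h => hoo' (by rw [h]))

lemma wMonomial_eq_frameMonomial {E : Set (Cn n)} {τ : Fin (n - 1) → Cn n → Cn n}
    (hτ : IsTangentFrame E τ) {ζ : Cn n} (hζ : ζ ∈ E) (hζ1 : ‖ζ‖ = 1) (γ : MultiIndex n)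
    (z : Cn n) : wMonomial τ γ z ζ = frameMonomial (frameDir τ ζ) ζ γ.toFun z := by
  rw [wMonomial, frameMonomial, Fintype.prod_option, mul_comm]
  congr 1
  · simp only [MultiIndex.toFun, frameDir]
    rw [inner_neg_left, inner_sub_right, inner_self_eq_norm_sq_to_K, hζ1]
    simp
  · refine Finset.prod_congr rfl fun j _ => ?_
    simp only [MultiIndex.toFun, frameDir]
    have := hτ.tangent ζ hζ j
    rw [← inner_conj_symm, map_eq_zero] at this
    rw [inner_sub_right, this, sub_zero]

lemma sum_inner_frameDir (hn : 1 ≤ n) {D : FrameIndex n → Cn n} (hD : Orthonormal ℂ D)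
    (v : Cn n) : ∑ o, (inner ℂ (D o) v : ℂ) • D o = v := by
  -- The index set has n - 1 + 1 elements, which equals n because n ≥ 1.
  have hcard : Fintype.card (FrameIndex n) = Module.finrank ℂ (Cn n) := by
    simp only [Fintype.card_option, Fintype.card_fin, finrank_euclideanSpace]
    omega
  have hne : Nonempty (FrameIndex n) := ⟨none⟩
  let B := basisOfOrthonormalOfCardEqFinrank hD hcard
  have hB : (B : FrameIndex n → Cn n) = D := coe_basisOfOrthonormalOfCardEqFinrank hD hcard
  let b := B.toOrthonormalBasis (by rw [hB]; exact hD)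
  have hb : ∀ o, b o = D o := fun o => by
    rw [Module.Basis.coe_toOrthonormalBasis, hB]
  have := b.sum_repr' v
  simpa only [hb] using this

end

/-! ### Cauchy estimates and Schwarz's lemma on nonisotropic boxes -/

noncomputable section

open Metric Asymptotics

variable {n : ℕ}

/-! ### Cauchy estimates on nonisotropic boxes -/

/-- The nonisotropic order of a direction. -/
def dirOrder (o : FrameIndex n) : ℕ := if o = none then 2 else 1

lemma frameOrder_nil : frameOrder ([] : List (FrameIndex n)) = 0 := rfl

lemma frameOrder_cons (o : FrameIndex n) (l : List (FrameIndex n)) :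
    frameOrder (o :: l) = dirOrder o + frameOrder l := by
  simp [frameOrder, dirOrder]

lemma frameOrder_append (l l' : List (FrameIndex n)) :
    frameOrder (l ++ l') = frameOrder l + frameOrder l' := by
  simp [frameOrder]

lemma one_le_dirOrder (o : FrameIndex n) : 1 ≤ dirOrder o := by
  unfold dirOrder; split_ifs <;> norm_num

/-- An orthonormal frame whose normal direction is `-x`. -/
structure IsFrameAt (x : Cn n) (D : FrameIndex n → Cn n) : Prop where
  orthonormal : Orthonormal ℂ D
  normal : D none = -x

lemma isFrameAt_frameDir {E : Set (Cn n)} {τ : Fin (n - 1) → Cn n → Cn n}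
    (hτ : IsTangentFrame E τ) {ζ : Cn n} (hζ : ζ ∈ E) (hζ1 : ‖ζ‖ = 1) :
    IsFrameAt ζ (frameDir τ ζ) := ⟨orthonormal_frameDir hτ hζ hζ1, rfl⟩

lemma IsFrameAt.inner_some {x : Cn n} {D : FrameIndex n → Cn n} (h : IsFrameAt x D)
    (j : Fin (n - 1)) : (inner ℂ x (D (some j)) : ℂ) = 0 := by
  have : (inner ℂ (D none) (D (some j)) : ℂ) = 0 :=
    h.orthonormal.2 (show (none : FrameIndex n) ≠ some j by simp)
  rw [h.normal, inner_neg_left, neg_eq_zero] at this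
  exact this

lemma IsFrameAt.norm_eq {x : Cn n} {D : FrameIndex n → Cn n} (h : IsFrameAt x D) : ‖x‖ = 1 := by
  have := h.orthonormal.1 none
  rwa [h.normal, norm_neg] at this

lemma nibox_mono (x z₀ : Cn n) {r r' : ℝ} (hr : 0 ≤ r) (h : r ≤ r') :
    nibox x z₀ r ⊆ nibox x z₀ r' := fun _ hz =>
  ⟨hz.1.trans_le (pow_le_pow_left₀ hr h 2), hz.2.trans_le h⟩

lemma self_mem_nibox (x z₀ : Cn n) {r : ℝ} (hr : 0 < r) : z₀ ∈ nibox x z₀ r := by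
  refine ⟨?_, ?_⟩
  · simp only [sub_self, inner_zero_right, norm_zero]; positivity
  · simpa using hr

/-- A tangential step does not change the normal coordinate, and for a normal step r² + ε² ≤ (r +
ε)². So a step of size ε, or ε² in the normal direction, enlarges the box by at most ε. -/
lemma IsFrameAt.add_smul_mem_nibox {x : Cn n} {D : FrameIndex n → Cn n} (h : IsFrameAt x D)
    {z₀ z : Cn n} {r ε : ℝ} (hε0 : 0 < ε) (hε1 : ε ≤ 1) (hz : z ∈ nibox x z₀ r) (o : FrameIndex n)
    {w : ℂ} (hw : ‖w‖ < ε ^ dirOrder o) : z + w • D o ∈ nibox x z₀ (r + ε) := by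
  obtain ⟨h1, h2⟩ := hz
  have hr : 0 < r := (norm_nonneg _).trans_lt h2
  have e : z + w • D o - z₀ = (z - z₀) + w • D o := by abel
  have hwε : ‖w‖ < ε := hw.trans_le (by
    calc ε ^ dirOrder o ≤ ε ^ 1 := pow_le_pow_of_le_one hε0.le hε1 (one_le_dirOrder o)
      _ = ε := pow_one ε)
  refine ⟨?_, ?_⟩
  · rw [e, inner_add_right, inner_smul_right]
    cases o with
    | none =>
      refine (norm_add_le _ _).trans_lt ?_
      have h3 : ‖(inner ℂ x (D none) : ℂ)‖ ≤ 1 := by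
        refine (norm_inner_le_norm _ _).trans ?_
        rw [h.norm_eq, h.orthonormal.1, one_mul]
      rw [norm_mul]
      have h4 : ‖w‖ < ε ^ 2 := hw
      nlinarith [norm_nonneg w, norm_nonneg (inner ℂ x (D none) : ℂ)]
    | some j =>
      rw [h.inner_some, mul_zero, add_zero]
      nlinarith
  · rw [e]
    refine (norm_add_le _ _).trans_lt ?_
    rw [norm_smul, h.orthonormal.1, mul_one]
    linarith

/-- Each derivative along D_o is a one-variable Cauchy estimate on a disc of radius ε to the order
of o, paid for by shrinking the box by ε. -/
lemma IsFrameAt.norm_derivList_le_of_mem {x : Cn n} {D : FrameIndex n → Cn n} (h : IsFrameAt x D)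
    {z₀ : Cn n} {u : Cn n → ℂ} {r M ε : ℝ} (hu : DifferentiableOn ℂ u (nibox x z₀ r))
    (hM : ∀ z ∈ nibox x z₀ r, ‖u z‖ ≤ M) (hε0 : 0 < ε) (hε1 : ε ≤ 1) (l : List (FrameIndex n)) :
    ∀ r' : ℝ, r' + l.length * ε ≤ r → ∀ z ∈ nibox x z₀ r',
      ‖derivList (l.map D) u z‖ ≤ M * ε⁻¹ ^ frameOrder l := by
  induction l with
  | nil =>
    intro r' hr' z hz
    have : 0 < r' := (norm_nonneg _).trans_lt hz.2
    simp only [List.length_nil, Nat.cast_zero, zero_mul, add_zero] at hr'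
    simpa [frameOrder_nil] using hM z (nibox_mono x z₀ this.le hr' hz)
  | cons o l ih =>
    intro r' hr' z hz
    have hr'0 : 0 < r' := (norm_nonneg _).trans_lt hz.2
    rw [List.length_cons] at hr'
    push_cast at hr'
    have h0 : 0 ≤ (l.length : ℝ) * ε := by positivity
    have key := norm_dirDeriv_le (isOpen_nibox x z₀ r)
      (derivList_differentiableOn (isOpen_nibox x z₀ r) hu (l.map D)) (z := z) (v := D o)
      (r := ε ^ dirOrder o) (M := M * ε⁻¹ ^ frameOrder l) (by positivity) fun w hw => by
        have hmem := h.add_smul_mem_nibox hε0 hε1 hz o hw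
        exact ⟨nibox_mono x z₀ (by positivity) (by nlinarith) hmem,
          ih (r' + ε) (by linarith) _ hmem⟩
    rw [List.map_cons, derivList_cons]
    refine key.trans (le_of_eq ?_)
    rw [frameOrder_cons, pow_add, inv_pow, div_eq_mul_inv]
    ring

/-- Cauchy's estimate at the centre of a nonisotropic box. -/
lemma IsFrameAt.norm_derivList_le {x : Cn n} {D : FrameIndex n → Cn n} (h : IsFrameAt x D)
    {z₀ : Cn n} {u : Cn n → ℂ} {r M : ℝ} (hr0 : 0 < r) (hr1 : r ≤ 1)
    (hu : DifferentiableOn ℂ u (nibox x z₀ r))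
    (hM : ∀ z ∈ nibox x z₀ r, ‖u z‖ ≤ M) (l : List (FrameIndex n)) :
    ‖derivList (l.map D) u z₀‖ ≤ M * ((l.length + 1) / r) ^ frameOrder l := by
  have hl : (0 : ℝ) < l.length + 1 := by positivity
  -- There is room for one shrinking by ε per derivative and for a last box of size ε.
  set ε := r / (l.length + 1) with hε
  have hε0 : 0 < ε := by positivity
  have hεr : ε ≤ r := div_le_self hr0.le (by linarith [Nat.cast_nonneg (α := ℝ) l.length])
  have := h.norm_derivList_le_of_mem hu hM hε0 (hεr.trans hr1) l ε (by
    rw [hε]; field_simp; linarith) z₀ (self_mem_nibox x z₀ hε0)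
  rwa [hε, inv_div] at this

/-! ### Vanishing order along nonisotropic curves -/

/-- The curve `y + ∑ λ^{e_o} w_o D_o`, with `e_o` the order of the direction `o`. -/
def frameCurve (D : FrameIndex n → Cn n) (w : FrameIndex n → ℂ) (y : Cn n) (c : ℂ) : Cn n :=
  y + ∑ o, (c ^ dirOrder o * w o) • D o

lemma frameCurve_zero (D : FrameIndex n → Cn n) (w : FrameIndex n → ℂ) (y : Cn n) :
    frameCurve D w y 0 = y := by
  rw [frameCurve, Finset.sum_eq_zero, add_zero]
  intro o _
  rw [zero_pow (by have := one_le_dirOrder o; omega), zero_mul, zero_smul]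

lemma hasDerivAt_frameCurve (D : FrameIndex n → Cn n) (w : FrameIndex n → ℂ) (y : Cn n) (c : ℂ) :
    HasDerivAt (frameCurve D w y) (∑ o, (dirOrder o * c ^ (dirOrder o - 1) * w o) • D o) c := by
  unfold frameCurve
  refine HasDerivAt.const_add y (HasDerivAt.fun_sum fun o _ => ?_)
  exact ((hasDerivAt_pow (dirOrder o) c).mul_const (w o)).smul_const (D o)

lemma isBigO_of_deriv_isBigO {h h' : ℂ → ℂ} {K : ℕ} (hh : ∀ᶠ c in 𝓝 (0 : ℂ), HasDerivAt h (h' c) c)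
    (h0 : h 0 = 0) (hO : h' =O[𝓝 0] fun c : ℂ => c ^ K) : h =O[𝓝 0] fun c : ℂ => c ^ (K + 1) := by
  obtain ⟨C, hC0, hC⟩ := hO.exists_nonneg
  rw [isBigOWith_iff] at hC
  obtain ⟨ε, hε, hball⟩ := Metric.eventually_nhds_iff_ball.1 (hh.and hC)
  refine IsBigO.of_bound C ?_
  filter_upwards [ball_mem_nhds (0 : ℂ) hε] with c hc
  rw [mem_ball_zero_iff] at hc
  have hsub : ∀ x ∈ closedBall (0 : ℂ) ‖c‖, x ∈ ball (0 : ℂ) ε := fun x hx => by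
    rw [mem_closedBall_zero_iff] at hx
    rw [mem_ball_zero_iff]
    exact hx.trans_lt hc
  have := (convex_closedBall (0 : ℂ) ‖c‖).norm_image_sub_le_of_norm_hasDerivWithin_le
    (f := h) (f' := h') (C := C * ‖c‖ ^ K)
    (fun x hx => ((hball x (hsub x hx)).1).hasDerivWithinAt)
    (fun x hx => ((hball x (hsub x hx)).2).trans (by
      rw [mem_closedBall_zero_iff] at hx
      rw [norm_pow]
      gcongr)) (x := 0) (y := c) (by simp) (by simp)
  rw [h0, sub_zero, sub_zero] at this
  rw [norm_pow, pow_succ, ← mul_assoc]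
  exact this

/-- By the chain rule the derivative along the curve is a sum of terms c^{e_o-1} (D_o G)(curve),
where e_o is the order of o. The function D_o G vanishes to order lowered by e_o, so induction
applies, and integrating back gains one power of c. -/
lemma isBigO_comp_frameCurve (D : FrameIndex n → Cn n) (w : FrameIndex n → ℂ) {y : Cn n}
    {U : Set (Cn n)} (hU : IsOpen U) (hy : y ∈ U) (K : ℕ) :
    ∀ G : Cn n → ℂ, DifferentiableOn ℂ G U →
      (∀ l : List (FrameIndex n), frameOrder l < K → derivList (l.map D) G y = 0) →
      (fun c => G (frameCurve D w y c)) =O[𝓝 0] fun c : ℂ => c ^ K := by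
  have hcont : ContinuousAt (frameCurve D w y) 0 := (hasDerivAt_frameCurve D w y 0).continuousAt
  have hmem : ∀ᶠ c in 𝓝 (0 : ℂ), frameCurve D w y c ∈ U :=
    hcont.eventually_mem (by rw [frameCurve_zero]; exact hU.mem_nhds hy)
  induction K using Nat.strong_induction_on with
  | _ K ih =>
    intro G hG hvan
    rcases K with _ | K
    · have hc : ContinuousAt (fun c => G (frameCurve D w y c)) 0 := by
        refine ContinuousAt.comp (g := G) ?_ hcont
        rw [frameCurve_zero]
        exact hG.continuousOn.continuousAt (hU.mem_nhds hy)
      simpa using hc.isBigO_one ℂ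
    refine isBigO_of_deriv_isBigO (h' := fun c => ∑ o, (dirOrder o * c ^ (dirOrder o - 1) * w o) *
      dirDeriv (D o) G (frameCurve D w y c)) ?_ ?_ ?_
    · filter_upwards [hmem] with c hc
      have h1 := ((hG.differentiableAt (hU.mem_nhds hc)).hasFDerivAt).comp_hasDerivAt c
        (hasDerivAt_frameCurve D w y c)
      refine h1.congr_deriv ?_
      rw [map_sum]
      exact Finset.sum_congr rfl fun o _ => by rw [map_smul]; rfl
    · rw [frameCurve_zero]
      exact hvan [] (by rw [frameOrder_nil]; omega)
    · refine IsBigO.fun_sum fun o _ => ?_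
      have ho := one_le_dirOrder o
      have hterm := ih (K + 1 - dirOrder o) (by omega) (dirDeriv (D o) G)
        (dirDeriv_differentiableOn hU hG (D o)) fun l hl => by
          have := hvan (l ++ [o]) (by
            rw [frameOrder_append, frameOrder_cons, frameOrder_nil]; omega)
          rwa [List.map_append, derivList_append] at this
      have h2 : (fun c : ℂ => (dirOrder o * c ^ (dirOrder o - 1) * w o) *
          dirDeriv (D o) G (frameCurve D w y c)) =O[𝓝 0]
          fun c : ℂ => c ^ (dirOrder o - 1) * c ^ (K + 1 - dirOrder o) := by
        refine IsBigO.mul ?_ hterm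
        refine IsBigO.of_bound (dirOrder o * ‖w o‖) (Eventually.of_forall fun c => ?_)
        rw [norm_mul, norm_mul, Complex.norm_natCast]
        exact le_of_eq (by ring)
      -- The total exponent is K, or larger when `K + 1 - dirOrder o` is a truncated subtraction. A
      -- larger power is still O(c^K) near 0.
      refine h2.trans ?_
      simp_rw [← pow_add]
      refine IsBigO.of_bound 1 ?_
      filter_upwards [ball_mem_nhds (0 : ℂ) one_pos] with c hc
      rw [mem_ball_zero_iff] at hc
      rw [norm_pow, norm_pow, one_mul]
      exact pow_le_pow_of_le_one (norm_nonneg c) hc.le (by omega)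

/-- Along the curve the tangential part of z - y, of norm at most 2η, is multiplied by c and the
normal part, of norm at most η², by c². Both fit into the box of size r when 4η|c| < r. -/
lemma IsFrameAt.frameCurve_mem_nibox (hn : 1 ≤ n) {y : Cn n} {D : FrameIndex n → Cn n}
    (h : IsFrameAt y D) {z : Cn n} {η r : ℝ} (hη : 4 * η < r) (hr1 : r ≤ 1)
    (hz : z ∈ nibox y y η) {c : ℂ} (hc : ‖c‖ < r / (4 * η)) :
    frameCurve D (fun o => inner ℂ (D o) (z - y)) y c ∈ nibox y y r := by
  set v := z - y with hv
  obtain ⟨h1, h2⟩ := hz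
  rw [← hv] at h1 h2
  have hη0 : 0 < η := (norm_nonneg _).trans_lt h2
  have hr0 : 0 < r := by linarith
  have hcη : ‖c‖ * (4 * η) < r := (lt_div_iff₀ (by positivity)).1 hc
  set w₀ : ℂ := inner ℂ (D none) v with hw₀
  have hw₀n : ‖w₀‖ < η ^ 2 := by
    rw [hw₀, h.normal, inner_neg_left, norm_neg]; exact h1
  have e1 : frameCurve D (fun o => inner ℂ (D o) v) y c - y =
      c • (v - w₀ • D none) + (c ^ 2 * w₀) • D none := by
    rw [frameCurve, add_sub_cancel_left, Fintype.sum_option]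
    have e2 : v - w₀ • D none = ∑ j, (inner ℂ (D (some j)) v : ℂ) • D (some j) := by
      conv_lhs => rw [← sum_inner_frameDir hn h.orthonormal v, Fintype.sum_option]
      rw [hw₀]
      abel_nf
    rw [e2, Finset.smul_sum, add_comm]
    congr 1
    refine Finset.sum_congr rfl fun j _ => ?_
    rw [smul_smul]
    simp [dirOrder]
  have hDn : ‖D none‖ = 1 := h.orthonormal.1 none
  have hDD : (inner ℂ (D none) (D none) : ℂ) = 1 := by
    rw [inner_self_eq_norm_sq_to_K, hDn]; simp
  have hc2 : ‖c‖ ^ 2 * η ^ 2 < r ^ 2 / 16 := by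
    have : (‖c‖ * (4 * η)) ^ 2 < r ^ 2 := by gcongr
    nlinarith
  have hcw : ‖c‖ ^ 2 * ‖w₀‖ ≤ ‖c‖ ^ 2 * η ^ 2 := by gcongr
  refine ⟨?_, ?_⟩
  · have e3 : (inner ℂ y (frameCurve D (fun o => inner ℂ (D o) v) y c - y) : ℂ) = -(c ^ 2 * w₀) := by
      have : y = -D none := by rw [h.normal, neg_neg]
      rw [e1]
      conv_lhs => rw [this]
      rw [inner_neg_left, inner_add_right, inner_smul_right, inner_smul_right, inner_sub_right,
        inner_smul_right, hDD, ← hw₀]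
      ring
    rw [e3, norm_neg, norm_mul, norm_pow]
    nlinarith
  · rw [e1]
    refine (norm_add_le _ _).trans_lt ?_
    rw [norm_smul, norm_smul, hDn, mul_one, norm_mul, norm_pow]
    have h5 : ‖v - w₀ • D none‖ ≤ 2 * η := by
      refine (norm_sub_le _ _).trans ?_
      rw [norm_smul, hDn, mul_one]
      nlinarith
    nlinarith [norm_nonneg c, norm_nonneg (v - w₀ • D none)]

/-- A function vanishing to nonisotropic order `m + 1` at the centre of a box is small near it. -/
lemma IsFrameAt.norm_le_of_vanishing (hn : 1 ≤ n) {y : Cn n} {D : FrameIndex n → Cn n}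
    (h : IsFrameAt y D) {R : Cn n → ℂ} {r M : ℝ} (hr1 : r ≤ 1)
    (hR : DifferentiableOn ℂ R (nibox y y r)) (hM : ∀ z ∈ nibox y y r, ‖R z‖ ≤ M) {m : ℕ}
    (hvan : ∀ l : List (FrameIndex n), frameOrder l < m + 1 → derivList (l.map D) R y = 0)
    {η : ℝ} (hη : 4 * η < r) {z : Cn n} (hz : z ∈ nibox y y η) :
    ‖R z‖ ≤ M * (4 * η / r) ^ (m + 1) := by
  have hη0 : 0 < η := (norm_nonneg _).trans_lt hz.2
  have hr0 : 0 < r := by linarith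
  set w : FrameIndex n → ℂ := fun o => inner ℂ (D o) (z - y)
  have hy : y ∈ nibox y y r := self_mem_nibox y y hr0
  have hmem : ∀ c ∈ ball (0 : ℂ) (r / (4 * η)), frameCurve D w y c ∈ nibox y y r := fun c hc =>
    h.frameCurve_mem_nibox hn hη hr1 hz (mem_ball_zero_iff.1 hc)
  have hR0 : R y = 0 := hvan [] (by rw [frameOrder_nil]; omega)
  have hO := isBigO_comp_frameCurve D w (isOpen_nibox y y r) hy (m + 1) R hR hvan
  have hd : DifferentiableOn ℂ (fun c => R (frameCurve D w y c)) (ball 0 (r / (4 * η))) :=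
    hR.comp (fun c _ => (hasDerivAt_frameCurve D w y c).differentiableAt.differentiableWithinAt)
      hmem
  have hlt : 1 < r / (4 * η) := (one_lt_div (by positivity)).2 hη
  have hc0 : R (frameCurve D w y 0) = 0 := by rw [frameCurve_zero, hR0]
  have hmaps : Set.MapsTo (fun c => R (frameCurve D w y c)) (ball 0 (r / (4 * η)))
      (closedBall (R (frameCurve D w y 0)) M) := fun c hc => by
    rw [hc0, mem_closedBall_zero_iff]
    exact hM _ (hmem c hc)
  have hlit : (fun c => R (frameCurve D w y c) - R (frameCurve D w y 0)) =o[𝓝 0]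
      fun c : ℂ => ‖c - 0‖ ^ m := by
    simp only [hc0, sub_zero]
    refine hO.trans_isLittleO ?_
    have h1 : (fun c : ℂ => c ^ (m + 1)) =o[𝓝 0] fun c : ℂ => c ^ m :=
      isLittleO_pow_pow (Nat.lt_succ_self m)
    simpa only [norm_pow] using h1.norm_right
  -- Schwarz's lemma with zero of order m + 1 on the disc |c| < r/(4η), evaluated at c = 1, where
  -- the curve passes through `z`.
  have key := Complex.dist_le_mul_div_pow_of_mapsTo_ball_of_isLittleO (z := 1) hd hmaps hlit
    (mem_ball_zero_iff.2 (by simpa using hlt))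
  have hc1 : frameCurve D w y 1 = z := by
    have := sum_inner_frameDir hn h.orthonormal (z - y)
    simp only [frameCurve, one_pow, one_mul, w]
    rw [this]
    abel
  rw [hc0, hc1, dist_zero_right, dist_zero_right, norm_one, one_div_div] at key
  exact key

/-! ### Taylor polynomials -/

lemma mem_indices {α : ℝ} {γ : MultiIndex n} : γ ∈ indices n α ↔ weight γ < α := by
  rw [indices, Set.Finite.mem_toFinset]; rfl

lemma multiFactorial_eq (γ : MultiIndex n) : multiFactorial γ = ∏ o, (γ.toFun o).factorial := by
  rw [multiFactorial, Fintype.prod_option, mul_comm]; rfl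

variable {E : Set (Cn n)} {τ : Fin (n - 1) → Cn n → Cn n}

lemma differentiable_wMonomial (hτ : IsTangentFrame E τ) {y : Cn n} (hy : y ∈ E) (hy1 : ‖y‖ = 1)
    (γ : MultiIndex n) : Differentiable ℂ fun z => wMonomial τ γ z y := by
  simp_rw [wMonomial_eq_frameMonomial hτ hy hy1]
  exact differentiable_frameMonomial _ _ _

lemma differentiable_taylorPoly (hτ : IsTangentFrame E τ) {y : Cn n} (hy : y ∈ E)
    (hy1 : ‖y‖ = 1) (α : ℝ) (F : MultiIndex n → Cn n → ℂ) :
    Differentiable ℂ (taylorPoly τ α F y) := by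
  unfold taylorPoly
  exact Differentiable.fun_sum fun γ _ => (differentiable_wMonomial hτ hy hy1 γ).const_mul _

lemma derivList_taylorPoly (hτ : IsTangentFrame E τ) {y : Cn n} (hy : y ∈ E) (hy1 : ‖y‖ = 1)
    (α : ℝ) (F : MultiIndex n → Cn n → ℂ) (l : List (Cn n)) (z : Cn n) :
    derivList l (taylorPoly τ α F y) z = ∑ γ ∈ indices n α,
      ((multiFactorial γ : ℂ))⁻¹ * F γ y * derivList l (fun z => wMonomial τ γ z y) z :=
  derivList_finset_sum (indices n α) (fun γ => ((multiFactorial γ : ℂ))⁻¹ * F γ y) isOpen_univ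
    (fun γ _ => (differentiable_wMonomial hτ hy hy1 γ).differentiableOn) l (Set.mem_univ z)

/-- The Taylor polynomial has the prescribed jet at its centre, because the normalized monomials are
dual to the derivatives there. -/
lemma derivList_taylorPoly_self (hτ : IsTangentFrame E τ) {y : Cn n} (hy : y ∈ E) (hy1 : ‖y‖ = 1)
    {α : ℝ} (F : MultiIndex n → Cn n → ℂ) (l : List (FrameIndex n))
    (hl : weight (MultiIndex.ofFun fun o => l.count o) < α) :
    derivList (l.map (frameDir τ y)) (taylorPoly τ α F y) y =
      F (MultiIndex.ofFun fun o => l.count o) y := by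
  rw [derivList_taylorPoly hτ hy hy1]
  have hval : ∀ γ : MultiIndex n, derivList (l.map (frameDir τ y)) (fun z => wMonomial τ γ z y) y =
      if (fun o => l.count o) = γ.toFun then (multiFactorial γ : ℂ) else 0 := by
    intro γ
    simp_rw [wMonomial_eq_frameMonomial hτ hy hy1]
    rw [multiFactorial_eq]
    have e : ∀ o, @List.count _ instBEqOfDecidableEq o l = l.count o := fun o => by
      congr 1; exact lawful_beq_subsingleton _ _
    have := derivList_frameMonomial_self (orthonormal_frameDir hτ hy hy1) y γ.toFun l
    simp only [e] at this
    convert this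
  simp_rw [hval]
  rw [Finset.sum_eq_single (MultiIndex.ofFun fun o => l.count o)]
  · rw [if_pos (MultiIndex.toFun_ofFun _).symm]
    have : (multiFactorial (MultiIndex.ofFun (n := n) fun o => l.count o) : ℂ) ≠ 0 := by
      rw [multiFactorial_eq]
      exact_mod_cast (Finset.prod_pos fun o _ => Nat.factorial_pos _).ne'
    field_simp
  · intro γ _ hγ
    rw [if_neg, mul_zero]
    intro hh
    apply hγ
    rw [hh]
    rfl
  · intro hnot
    exact absurd (mem_indices.2 hl) hnot

lemma IsFrameAt.norm_frameMonomial_le {y : Cn n} {D : FrameIndex n → Cn n} (h : IsFrameAt y D)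
    {z : Cn n} {r : ℝ} (hz : z ∈ nibox y y r) (γ : MultiIndex n) :
    ‖frameMonomial D y γ.toFun z‖ ≤ r ^ γ.order := by
  have hr0 : 0 < r := (norm_nonneg _).trans_lt hz.2
  have h1 : ∀ o, ‖(inner ℂ (D o) (z - y) : ℂ)‖ ≤ r ^ dirOrder o := by
    intro o
    cases o with
    | none =>
      rw [h.normal, inner_neg_left, norm_neg]
      exact hz.1.le
    | some j =>
      refine (norm_inner_le_norm _ _).trans ?_
      rw [h.orthonormal.1, one_mul]
      simpa [dirOrder] using hz.2.le
  rw [frameMonomial, norm_prod, MultiIndex.order, frameOrder_eq_count, ← Finset.prod_pow_eq_pow_sum]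
  refine Finset.prod_le_prod (fun _ _ => norm_nonneg _) fun o _ => ?_
  rw [norm_pow, count_indexList, mul_comm, pow_mul]
  exact pow_le_pow_left₀ (norm_nonneg _) (h1 o) _

end

/-! ### Taylor remainders of one function between two points -/

noncomputable section

open Metric

variable {n : ℕ}

/-! ### Remainder estimates for a single function -/

/-- The points differ by at most 2η in norm. The change of normal direction therefore adds at most
2η·η to the normal coordinate and the shift of the base point at most 2η², giving η² + 2η² + 2η² <
(3η)². -/
lemma nibox_subset_nibox {x y : Cn n} {η : ℝ} (hx : ‖x‖ = 1) (hy : ‖y‖ = 1)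
    (hη0 : 0 < η) (hxy : nidist x y ≤ 2 * η ^ 2) :
    nibox x x η ⊆ nibox y y (3 * η) := by
  rintro z ⟨h1, h2⟩
  have hd : ‖x - y‖ ≤ 2 * η := by
    have h3 : ‖x - y‖ ^ 2 ≤ (2 * η) ^ 2 :=
      (norm_sub_sq_le_nidist hx.le hy.le).trans (by nlinarith)
    exact le_of_sq_le_sq h3 (by positivity)
  have hz : z - y = (z - x) + (x - y) := by abel
  refine ⟨?_, ?_⟩
  · have e : (inner ℂ y (z - y) : ℂ) =
        inner ℂ x (z - x) + inner ℂ (y - x) (z - x) + -(1 - inner ℂ y x) := by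
      have hyy : (inner ℂ y y : ℂ) = 1 := by rw [inner_self_eq_norm_sq_to_K, hy]; simp
      rw [inner_sub_left, hz, inner_add_right, inner_sub_right y x y, hyy]
      ring
    rw [e]
    refine (norm_add_le _ _).trans_lt ?_
    rw [norm_neg]
    have h4 := norm_add_le (inner ℂ x (z - x) : ℂ) (inner ℂ (y - x) (z - x))
    have h5 := norm_inner_le_norm (𝕜 := ℂ) (y - x) (z - x)
    rw [norm_sub_rev y x] at h5
    have h6 : ‖x - y‖ * ‖z - x‖ ≤ 2 * η * η := by gcongr
    have h7 : ‖(1 : ℂ) - inner ℂ y x‖ ≤ 2 * η ^ 2 := hxy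
    nlinarith
  · rw [hz]
    refine (norm_add_le _ _).trans_lt ?_
    linarith

variable {E : Set (Cn n)} {τ : Fin (n - 1) → Cn n → Cn n}

/-- Cauchy's estimate for the derivatives `∂/∂w^γ`. -/
lemma exists_norm_wDeriv_le (hES : E ⊆ unitSphere n) (hτ : IsTangentFrame E τ) (α : ℝ) :
    ∃ C : ℝ, 1 ≤ C ∧ ∀ x ∈ E, ∀ γ ∈ indices n α, ∀ (z₀ : Cn n) (u : Cn n → ℂ) (r M : ℝ),
      0 < r → r ≤ 1 → DifferentiableOn ℂ u (nibox x z₀ r) → (∀ z ∈ nibox x z₀ r, ‖u z‖ ≤ M) →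
      ‖wDeriv τ x γ u z₀‖ ≤ C * M * (r ^ γ.order)⁻¹ := by
  obtain ⟨B, hB⟩ := Finset.exists_le
    ((indices n α).image fun γ => (((indexList γ).length : ℝ) + 1) ^ γ.order)
  refine ⟨max 1 B, le_max_left _ _, fun x hx γ hγ z₀ u r M hr0 hr1 hu hM => ?_⟩
  have hx1 : ‖x‖ = 1 := by simpa using hES hx
  have hM0 : 0 ≤ M := (norm_nonneg _).trans (hM z₀ (self_mem_nibox x z₀ hr0))
  rw [wDeriv_eq_derivList]
  refine ((isFrameAt_frameDir hτ hx hx1).norm_derivList_le hr0 hr1 hu hM _).trans ?_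
  rw [div_pow, div_eq_mul_inv, ← mul_assoc, mul_comm M]
  have h1 := hB _ (Finset.mem_image_of_mem _ hγ)
  have h2 := h1.trans (le_max_right 1 B)
  change (((indexList γ).length : ℝ) + 1) ^ γ.order * M * (r ^ γ.order)⁻¹ ≤ _
  gcongr

lemma norm_wMonomial_le (hES : E ⊆ unitSphere n) (hτ : IsTangentFrame E τ) {y z : Cn n}
    (hy : y ∈ E) {r : ℝ} (hz : z ∈ nibox y y r) (γ : MultiIndex n) :
    ‖wMonomial τ γ z y‖ ≤ r ^ γ.order := by
  have hy1 : ‖y‖ = 1 := by simpa using hES hy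
  rw [wMonomial_eq_frameMonomial hτ hy hy1]
  exact (isFrameAt_frameDir hτ hy hy1).norm_frameMonomial_le hz γ

lemma norm_inv_multiFactorial_le (γ : MultiIndex n) : ‖((multiFactorial γ : ℂ))⁻¹‖ ≤ 1 := by
  rw [norm_inv, Complex.norm_natCast]
  refine inv_le_one_of_one_le₀ ?_
  have : 1 ≤ multiFactorial γ := by
    rw [multiFactorial_eq]
    exact Finset.prod_pos fun o _ => Nat.factorial_pos _
  exact_mod_cast this

/-- The Taylor polynomial is small to high order: bound for the difference of derivatives when the
box on which `u` is controlled is much larger than the distance of the points. -/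
lemma exists_norm_remainder_near_le (hn : 1 ≤ n) (hES : E ⊆ unitSphere n)
    (hτ : IsTangentFrame E τ) {α : ℝ} {m : ℕ}
    (hm : ∀ γ : MultiIndex n, weight γ < α ↔ γ.order ≤ m) :
    ∃ C : ℝ, 1 ≤ C ∧ ∀ x ∈ E, ∀ y ∈ E, ∀ γ ∈ indices n α, ∀ (u : Cn n → ℂ) (η r M : ℝ),
      0 < η → 12 * η < r → r ≤ 1 → nidist x y ≤ 2 * η ^ 2 → DifferentiableOn ℂ u (nibox y y r) →
      (∀ z ∈ nibox y y r, ‖u z‖ ≤ M) →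
      ‖wDeriv τ x γ u x - wDeriv τ x γ (taylorPoly τ α (fun γ y => wDeriv τ y γ u y) y) x‖ ≤
        C * M * (η ^ γ.order)⁻¹ * (η / r) ^ (m + 1) := by
  obtain ⟨C, hC1, hC⟩ := exists_norm_wDeriv_le hES hτ α
  have hC0 : 0 ≤ C := by linarith
  set N : ℝ := ((indices n α).card : ℝ) with hN
  have hN0 : 0 ≤ N := Nat.cast_nonneg _
  refine ⟨max 1 (C * (1 + N * C) * 12 ^ (m + 1)), le_max_left _ _, ?_⟩
  intro x hx y hy γ hγ u η r M hη0 hηr hr1 hxy hu hM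
  have hx1 : ‖x‖ = 1 := by simpa using hES hx
  have hy1 : ‖y‖ = 1 := by simpa using hES hy
  have hr0 : 0 < r := by linarith
  have hM0 : 0 ≤ M := (norm_nonneg _).trans (hM y (self_mem_nibox y y hr0))
  have hTd := differentiable_taylorPoly hτ hy hy1 α (fun γ y => wDeriv τ y γ u y)
  obtain ⟨T, hT⟩ : ∃ T, T = taylorPoly τ α (fun γ y => wDeriv τ y γ u y) y := ⟨_, rfl⟩
  rw [← hT] at hTd ⊢
  -- The coefficient of order k is at most CM r^{-k} and the monomial at most r^k, so the polynomial
  -- is bounded by a multiple of M on the same box.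
  have hTM : ∀ z ∈ nibox y y r, ‖T z‖ ≤ N * C * M := by
    intro z hz
    rw [hT, taylorPoly]
    refine (norm_sum_le _ _).trans ?_
    have : ∀ γ' ∈ indices n α,
        ‖((multiFactorial γ' : ℂ))⁻¹ * wDeriv τ y γ' u y * wMonomial τ γ' z y‖ ≤ C * M := by
      intro γ' hγ'
      rw [norm_mul, norm_mul]
      have h1 := hC y hy γ' hγ' y u r M hr0 hr1 hu hM
      have h2 := norm_wMonomial_le hES hτ hy hz γ'
      have h3 := norm_inv_multiFactorial_le γ'
      calc _ ≤ 1 * (C * M * (r ^ γ'.order)⁻¹) * r ^ γ'.order := by gcongr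
        _ = C * M := by
          have : r ^ γ'.order ≠ 0 := by positivity
          field_simp
    refine (Finset.sum_le_sum this).trans ?_
    rw [Finset.sum_const, nsmul_eq_mul, ← hN, mul_assoc]
  have hRd : DifferentiableOn ℂ (u - T) (nibox y y r) := hu.sub hTd.differentiableOn
  have hRM : ∀ z ∈ nibox y y r, ‖(u - T) z‖ ≤ (1 + N * C) * M := fun z hz => by
    refine (norm_sub_le _ _).trans ?_
    linarith [hM z hz, hTM z hz]
  have hvan : ∀ l : List (FrameIndex n), frameOrder l < m + 1 →
      derivList (l.map (frameDir τ y)) (u - T) y = 0 := by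
    intro l hl
    have h1 := derivList_sub (isOpen_nibox y y r) hu hTd.differentiableOn (l.map (frameDir τ y))
      (self_mem_nibox y y hr0)
    have h2 : weight (MultiIndex.ofFun (n := n) fun o => l.count o) < α := by
      rw [hm, order_ofFun_count]; omega
    have h3 := derivList_eq_wDeriv (τ := τ) (ζ := y) (isOpen_nibox y y r) hu l
      (self_mem_nibox y y hr0)
    have h4 := derivList_taylorPoly_self hτ hy hy1 (fun γ y => wDeriv τ y γ u y) l h2
    rw [← hT] at h4
    refine h1.trans ?_
    simp only [h3, h4, sub_self]
  have hη1 : η ≤ 1 := by linarith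
  have hsub := nibox_subset_nibox hx1 hy1 hη0 hxy
  have hsub' : nibox x x η ⊆ nibox y y r :=
    hsub.trans (nibox_mono y y (by positivity) (by linarith))
  -- The box of size η at x sits in the box of size 3η at y, where vanishing at y gives the factor
  -- (4·3η/r)^{m+1}. Cauchy's estimate at x then passes to derivatives.
  have hsmall : ∀ z ∈ nibox x x η, ‖(u - T) z‖ ≤ (1 + N * C) * M * (4 * (3 * η) / r) ^ (m + 1) :=
    fun z hz => (isFrameAt_frameDir hτ hy hy1).norm_le_of_vanishing hn hr1 hRd hRM hvan
      (by linarith) (hsub hz)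
  have key := hC x hx γ hγ x (u - T) η _ hη0 hη1 (hRd.mono hsub') hsmall
  have e : wDeriv τ x γ (u - T) x = wDeriv τ x γ u x - wDeriv τ x γ T x := by
    simp only [wDeriv_eq_derivList]
    exact derivList_sub (isOpen_nibox y y r) hu hTd.differentiableOn _
      (hsub' (self_mem_nibox x x hη0))
  rw [← e]
  refine key.trans ?_
  rw [show 4 * (3 * η) / r = 12 * (η / r) by ring, mul_pow]
  calc C * ((1 + N * C) * M * (12 ^ (m + 1) * (η / r) ^ (m + 1))) * (η ^ γ.order)⁻¹
      = (C * (1 + N * C) * 12 ^ (m + 1)) * M * (η ^ γ.order)⁻¹ * (η / r) ^ (m + 1) := by ring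
    _ ≤ _ := by
      gcongr
      exact le_max_right _ _

/-- Bound for the derivatives of the Taylor polynomial of a jet. -/
lemma exists_norm_wDeriv_taylorPoly_le (hES : E ⊆ unitSphere n)
    (hτ : IsTangentFrame E τ) (α : ℝ) :
    ∃ C : ℝ, 1 ≤ C ∧ ∀ x ∈ E, ∀ y ∈ E, ∀ γ ∈ indices n α, ∀ (F : MultiIndex n → Cn n → ℂ) (η : ℝ),
      0 < η → η ≤ 1 → nidist x y ≤ 2 * η ^ 2 →
      ‖wDeriv τ x γ (taylorPoly τ α F y) x‖ ≤
        C * (η ^ γ.order)⁻¹ * ∑ γ' ∈ indices n α, ‖F γ' y‖ * η ^ γ'.order := by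
  obtain ⟨C, hC1, hC⟩ := exists_norm_wDeriv_le hES hτ α
  obtain ⟨B, hB⟩ := Finset.exists_le ((indices n α).image fun γ => (3 : ℝ) ^ γ.order)
  have hC0 : 0 ≤ C := by linarith
  refine ⟨C * max 1 B, one_le_mul_of_one_le_of_one_le hC1 (le_max_left _ _), ?_⟩
  intro x hx y hy γ hγ F η hη0 hη1 hxy
  have hx1 : ‖x‖ = 1 := by simpa using hES hx
  have hy1 : ‖y‖ = 1 := by simpa using hES hy
  have hsub := nibox_subset_nibox hx1 hy1 hη0 hxy
  rw [mul_assoc, Finset.mul_sum, Finset.mul_sum, wDeriv_eq_derivList,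
    derivList_taylorPoly hτ hy hy1]
  refine (norm_sum_le _ _).trans (Finset.sum_le_sum fun γ' hγ' => ?_)
  rw [norm_mul, norm_mul, ← wDeriv_eq_derivList]
  have h1 := hC x hx γ hγ x (fun z => wMonomial τ γ' z y) η _ hη0 hη1
    (differentiable_wMonomial hτ hy hy1 γ').differentiableOn
    fun z hz => norm_wMonomial_le hES hτ hy (hsub hz) γ'
  have h2 := norm_inv_multiFactorial_le γ'
  have h3 := (hB _ (Finset.mem_image_of_mem _ hγ')).trans (le_max_right 1 B)
  rw [mul_pow] at h1
  calc _ ≤ 1 * ‖F γ' y‖ * (C * (3 ^ γ'.order * η ^ γ'.order) * (η ^ γ.order)⁻¹) := by gcongr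
    _ ≤ 1 * ‖F γ' y‖ * (C * (max 1 B * η ^ γ'.order) * (η ^ γ.order)⁻¹) := by gcongr
    _ = _ := by ring

/-- Remainder estimate valid for every ratio of the scale of `u` to the distance of the points. -/
lemma exists_norm_remainder_le (hn : 1 ≤ n) (hES : E ⊆ unitSphere n)
    (hτ : IsTangentFrame E τ) {α : ℝ} {m : ℕ}
    (hm : ∀ γ : MultiIndex n, weight γ < α ↔ γ.order ≤ m) :
    ∃ C : ℝ, 1 ≤ C ∧ ∀ x ∈ E, ∀ y ∈ E, ∀ γ ∈ indices n α, ∀ (u : Cn n → ℂ) (η r M : ℝ),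
      0 < η → η ≤ 1 → 0 < r → r ≤ 1 → nidist x y ≤ 2 * η ^ 2 →
      DifferentiableOn ℂ u (nibox x x r) → (∀ z ∈ nibox x x r, ‖u z‖ ≤ M) →
      DifferentiableOn ℂ u (nibox y y r) → (∀ z ∈ nibox y y r, ‖u z‖ ≤ M) →
      ‖wDeriv τ x γ u x - wDeriv τ x γ (taylorPoly τ α (fun γ y => wDeriv τ y γ u y) y) x‖ ≤
        C * M * (η ^ γ.order)⁻¹ * ((η / r) ^ m * min 1 (η / r)) := by
  obtain ⟨C₁, hC₁1, hC₁⟩ := exists_norm_remainder_near_le hn hES hτ hm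
  obtain ⟨C₂, hC₂1, hC₂⟩ := exists_norm_wDeriv_taylorPoly_le hES hτ α
  obtain ⟨C₃, hC₃1, hC₃⟩ := exists_norm_wDeriv_le hES hτ α
  set N : ℝ := ((indices n α).card : ℝ) with hN
  have hN0 : 0 ≤ N := Nat.cast_nonneg _
  refine ⟨max C₁ ((C₃ + C₂ * (N * C₃)) * 12 ^ (m + 1)), hC₁1.trans (le_max_left _ _), ?_⟩
  intro x hx y hy γ hγ u η r M hη0 hη1 hr0 hr1 hxy hux hMx huy hMy
  have hM0 : 0 ≤ M := (norm_nonneg _).trans (hMx x (self_mem_nibox x x hr0))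
  have ht0 : 0 < η / r := by positivity
  -- If r ≤ 12η there is no cancellation to use: `u` and its Taylor polynomial are estimated
  -- separately. All orders are at most m, so each r^{-k} is at most η^{-k}(12η/r)^m, and min(1,
  -- η/r) is at least 1/12.
  rcases lt_or_ge (12 * η) r with hlt | hge
  · have h1 := hC₁ x hx y hy γ hγ u η r M hη0 hlt hr1 hxy huy hMy
    have hle : η / r ≤ 1 := (div_le_one hr0).2 (by linarith)
    rw [min_eq_right hle, ← pow_succ]
    refine h1.trans ?_
    gcongr
    exact le_max_left _ _
  · have ht : 1 ≤ 12 * (η / r) := by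
      rw [← mul_div_assoc]; exact (one_le_div hr0).2 hge
    have hord : ∀ γ' ∈ indices n α, (r ^ γ'.order)⁻¹ ≤ (η ^ γ'.order)⁻¹ * (12 * (η / r)) ^ m := by
      intro γ' hγ'
      have h1 : γ'.order ≤ m := (hm γ').1 (mem_indices.1 hγ')
      have h2 : (12 * (η / r)) ^ γ'.order ≤ (12 * (η / r)) ^ m := pow_le_pow_right₀ ht h1
      have h3 : (1 : ℝ) ≤ 12 ^ γ'.order := one_le_pow₀ (by norm_num)
      calc (r ^ γ'.order)⁻¹ = (η ^ γ'.order)⁻¹ * (1 * (η / r) ^ γ'.order) := by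
            rw [div_pow]; field_simp
        _ ≤ (η ^ γ'.order)⁻¹ * (12 ^ γ'.order * (η / r) ^ γ'.order) := by gcongr
        _ ≤ _ := by rw [← mul_pow]; gcongr
    have hmin : (1 : ℝ) ≤ 12 * min 1 (η / r) := by
      rcases min_cases 1 (η / r) with h | h <;> rw [h.1] <;> linarith
    have ha : ‖wDeriv τ x γ u x‖ ≤ C₃ * M * ((η ^ γ.order)⁻¹ * (12 * (η / r)) ^ m) := by
      refine (hC₃ x hx γ hγ x u r M hr0 hr1 hux hMx).trans ?_
      have := hord γ hγ
      gcongr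
    have hb : ‖wDeriv τ x γ (taylorPoly τ α (fun γ y => wDeriv τ y γ u y) y) x‖ ≤
        C₂ * (η ^ γ.order)⁻¹ * (N * (C₃ * M * (12 * (η / r)) ^ m)) := by
      refine (hC₂ x hx y hy γ hγ _ η hη0 hη1 hxy).trans ?_
      have hsum : ∑ γ' ∈ indices n α, ‖wDeriv τ y γ' u y‖ * η ^ γ'.order ≤
          N * (C₃ * M * (12 * (η / r)) ^ m) := by
        rw [hN, ← nsmul_eq_mul, ← Finset.sum_const]
        refine Finset.sum_le_sum fun γ' hγ' => ?_
        have h1 := hC₃ y hy γ' hγ' y u r M hr0 hr1 huy hMy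
        have h2 := hord γ' hγ'
        calc _ ≤ C₃ * M * ((η ^ γ'.order)⁻¹ * (12 * (η / r)) ^ m) * η ^ γ'.order := by
              refine mul_le_mul_of_nonneg_right (h1.trans ?_) (by positivity)
              gcongr
          _ = _ := by field_simp
      gcongr
    refine (norm_sub_le _ _).trans ((add_le_add ha hb).trans ?_)
    calc _ = (C₃ + C₂ * (N * C₃)) * M * (η ^ γ.order)⁻¹ * (12 ^ m * (η / r) ^ m * 1) := by
          rw [mul_pow]; ring
      _ ≤ (C₃ + C₂ * (N * C₃)) * M * (η ^ γ.order)⁻¹ *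
          (12 ^ m * (η / r) ^ m * (12 * min 1 (η / r))) := by gcongr
      _ = ((C₃ + C₂ * (N * C₃)) * 12 ^ (m + 1)) * M * (η ^ γ.order)⁻¹ *
          ((η / r) ^ m * min 1 (η / r)) := by ring
      _ ≤ _ := by
          gcongr
          exact le_max_right _ _

end

/-! ### The pieces measured against the kernel `scaleKernel` -/

noncomputable section

open Metric

variable {n : ℕ}

/-! ### Estimates for the pieces in terms of the local maximal functions -/

/-- The kernel relating the piece at scale `j` to the remainders at distance `2 ^ (-i)`. -/
def scaleKernel (β : ℝ) (m i j : ℕ) : ℝ≥0∞ :=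
  twoPow (((i : ℝ) - j) * β + ((j : ℝ) - i) / 2 * m + min 0 (((j : ℝ) - i) / 2))

lemma sqrt_dl (j : ℕ) : √(dl j) = 2 ^ (-(j : ℝ) / 2) := by
  rw [dl_eq_rpow, Real.sqrt_eq_rpow, ← Real.rpow_mul (by norm_num)]
  congr 1; ring

lemma ofReal_inv_sqrt_dl_pow (j : ℕ) (γ : MultiIndex n) :
    ENNReal.ofReal ((√(dl j) ^ γ.order)⁻¹) = twoPow (j * weight γ) := by
  rw [sqrt_dl, ← Real.rpow_natCast, ← Real.rpow_mul (by norm_num), order_eq_weight,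
    ← Real.rpow_neg (by norm_num), twoPow]
  congr 2; ring

lemma sqrt_dl_le_one (j : ℕ) : √(dl j) ≤ 1 := by
  rw [Real.sqrt_le_one]
  exact dl_le_one j

/-- The bound M is a supremum that may be infinite; the real-valued estimates are needed only when
it is finite. -/
lemma enorm_le_of_norm_le {X : ℂ} {a b : ℝ} {M : ℝ≥0∞} (ha : 0 < a) (hb : 0 < b)
    (h : M ≠ ∞ → ‖X‖ ≤ a * M.toReal * b) :
    ‖X‖ₑ ≤ ENNReal.ofReal a * M * ENNReal.ofReal b := by
  by_cases hM : M = ∞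
  · rw [hM, ENNReal.mul_top (ENNReal.ofReal_pos.2 ha).ne',
      ENNReal.top_mul (ENNReal.ofReal_pos.2 hb).ne']
    exact le_top
  · rw [← ofReal_norm]
    refine (ENNReal.ofReal_le_ofReal (h hM)).trans (le_of_eq ?_)
    rw [ENNReal.ofReal_mul (by positivity), ENNReal.ofReal_mul ha.le, ENNReal.ofReal_toReal hM]

lemma norm_le_toReal_of_enorm_le {X : ℂ} {M : ℝ≥0∞} (hM : M ≠ ∞) (h : ‖X‖ₑ ≤ M) :
    ‖X‖ ≤ M.toReal := by
  rw [← toReal_enorm]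
  exact ENNReal.toReal_mono hM h

variable {E : Set (Cn n)} {τ : Fin (n - 1) → Cn n → Cn n}

/-- Cauchy's estimate on boxes of size 2^{-j/2}/8 costs 2^{jω(γ)} ≤ 2^{jm/2}, up to a constant.
Uniformity in ρ up to 1 provides the domination used for the radial limits. -/
lemma exists_enorm_wDeriv_scalePiece_le (hES : E ⊆ unitSphere n) (hτ : IsTangentFrame E τ)
    {α β : ℝ} (hβ : 0 < β) {m : ℕ} (hm : ∀ γ : MultiIndex n, weight γ < α ↔ γ.order ≤ m) :
    ∃ C : ℝ≥0∞, C ≠ ∞ ∧ ∀ (f : Cn n → ℂ), DifferentiableOn ℂ f (unitBall n) → ∀ x ∈ E,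
      ∀ γ ∈ indices n α, ∀ (j : ℕ), ∀ ρ ∈ Set.Icc (0 : ℝ) 1,
        ‖wDeriv τ x γ (scalePiece β f j) (ρ • x)‖ₑ ≤
          C * (scaleKernel β m 0 j * sumMax (radialDeriv β f) j x) := by
  obtain ⟨C₀, hC₀t, hC₀⟩ := exists_enorm_scalePiece_le (n := n) hβ
  obtain ⟨C₁, hC₁1, hC₁⟩ := exists_norm_wDeriv_le hES hτ α
  refine ⟨ENNReal.ofReal (C₁ * 8 ^ m) * C₀, by finiteness, ?_⟩
  intro f hf x hx γ hγ j ρ hρ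
  have hx1 : ‖x‖ = 1 := by simpa using hES hx
  have hdl := dl_pos j
  have hr0 : 0 < √(dl j) := Real.sqrt_pos.2 hdl
  have hr : (√(dl j) / 8) ^ 2 ≤ dl j / 64 := by
    rw [div_pow, Real.sq_sqrt hdl.le]; norm_num
  have hord : γ.order ≤ m := (hm γ).1 (mem_indices.1 hγ)
  have key : ‖wDeriv τ x γ (scalePiece β f j) (ρ • x)‖ₑ ≤ ENNReal.ofReal (C₁ * 8 ^ m) *
      (C₀ * twoPow (-(j * β)) * sumMax (radialDeriv β f) j x) *
      ENNReal.ofReal ((√(dl j) ^ γ.order)⁻¹) := by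
    refine enorm_le_of_norm_le (by positivity) (by positivity) fun hM => ?_
    refine (hC₁ x hx γ hγ (ρ • x) (scalePiece β f j) (√(dl j) / 8) _ (by positivity)
      (by linarith [sqrt_dl_le_one j])
      ((differentiableOn_scalePiece hβ hf j).mono fun z hz => mem_ball_of_mem_nibox hx1 hρ hr hz)
      (fun z hz => norm_le_toReal_of_enorm_le hM (hC₀ f hf x hx1 j ρ _ hρ hr z hz))).trans ?_
    have h8 : (8 : ℝ) ^ γ.order ≤ 8 ^ m := pow_le_pow_right₀ (by norm_num) hord
    rw [div_pow, inv_div, div_eq_mul_inv]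
    calc _ = C₁ * 8 ^ γ.order * ENNReal.toReal _ * (√(dl j) ^ γ.order)⁻¹ := by ring
      _ ≤ _ := by gcongr
  refine key.trans ?_
  rw [ofReal_inv_sqrt_dl_pow]
  have hle : twoPow (-(j * β)) * twoPow (j * weight γ) ≤ scaleKernel β m 0 j := by
    rw [← twoPow_add]
    refine twoPow_mono ?_
    have h1 : weight γ ≤ m / 2 := by
      have h2 : (γ.order : ℝ) ≤ m := by exact_mod_cast hord
      rw [order_eq_weight] at h2
      linarith
    have hj : (0 : ℝ) ≤ j := Nat.cast_nonneg _
    rw [Nat.cast_zero, min_eq_left (by linarith)]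
    nlinarith [mul_le_mul_of_nonneg_left h1 hj]
  calc _ = ENNReal.ofReal (C₁ * 8 ^ m) * C₀ * ((twoPow (-(j * β)) * twoPow (j * weight γ)) *
        sumMax (radialDeriv β f) j x) := by ring
    _ ≤ _ := by gcongr

lemma pow_mul_min_sqrt_dl_le (m i j : ℕ) :
    (√(dl i) / (√(dl j) / 8)) ^ m * min 1 (√(dl i) / (√(dl j) / 8)) ≤
      8 ^ (m + 1) * 2 ^ (((j : ℝ) - i) / 2 * m + min 0 (((j : ℝ) - i) / 2)) := by
  have e : √(dl i) / (√(dl j) / 8) = 8 * 2 ^ (((j : ℝ) - i) / 2) := by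
    rw [sqrt_dl, sqrt_dl, div_div_eq_mul_div, mul_comm, mul_div_assoc,
      ← Real.rpow_sub (by norm_num)]
    congr 2; ring
  have e2 : (2 : ℝ) ^ min 0 (((j : ℝ) - i) / 2) = min 1 (2 ^ (((j : ℝ) - i) / 2)) := by
    have : Monotone fun t : ℝ => (2 : ℝ) ^ t := fun a b hab =>
      Real.rpow_le_rpow_of_exponent_le (by norm_num) hab
    rw [this.map_min, Real.rpow_zero]
  rw [e, Real.rpow_add (by norm_num), e2, Real.rpow_mul (by norm_num), Real.rpow_natCast, mul_pow,
    pow_succ]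
  have hs : (0 : ℝ) < 2 ^ (((j : ℝ) - i) / 2) := by positivity
  generalize (2 : ℝ) ^ (((j : ℝ) - i) / 2) = s at hs ⊢
  have hmin : min 1 (8 * s) ≤ 8 * min 1 s := by
    rcases min_cases 1 s with h | h <;> rw [h.1]
    · exact (min_le_left _ _).trans (by norm_num)
    · exact min_le_right _ _
  calc 8 ^ m * s ^ m * min 1 (8 * s) ≤ 8 ^ m * s ^ m * (8 * min 1 s) := by gcongr
    _ = _ := by ring

/-- The remainder estimate is applied with η = 2^{-i/2} and r = 2^{-j/2}/8, so η/r = 8·2^{(j-i)/2}.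
The size 2^{-jβ} of the piece is rewritten as 2^{-iβ}2^{(i-j)β}, which leaves exactly the kernel. -/
lemma exists_enorm_remainder_scalePiece_le (hn : 1 ≤ n) (hES : E ⊆ unitSphere n)
    (hτ : IsTangentFrame E τ) {α β : ℝ} (hβ : 0 < β) {m : ℕ}
    (hm : ∀ γ : MultiIndex n, weight γ < α ↔ γ.order ≤ m) :
    ∃ C : ℝ≥0∞, C ≠ ∞ ∧ ∀ (f : Cn n → ℂ), DifferentiableOn ℂ f (unitBall n) → ∀ x ∈ E, ∀ y ∈ E,
      ∀ γ ∈ indices n α, ∀ i j : ℕ, nidist x y ≤ 2 * dl i →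
        ‖wDeriv τ x γ (scalePiece β f j) x - wDeriv τ x γ
            (taylorPoly τ α (fun γ y => wDeriv τ y γ (scalePiece β f j) y) y) x‖ₑ ≤
          C * twoPow (i * (weight γ - β)) * (scaleKernel β m i j *
            (sumMax (radialDeriv β f) j x + sumMax (radialDeriv β f) j y)) := by
  obtain ⟨C₀, hC₀t, hC₀⟩ := exists_enorm_scalePiece_le (n := n) hβ
  obtain ⟨C₁, hC₁1, hC₁⟩ := exists_norm_remainder_le hn hES hτ hm
  refine ⟨ENNReal.ofReal (C₁ * 8 ^ (m + 1)) * C₀, by finiteness, ?_⟩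
  intro f hf x hx y hy γ hγ i j hxy
  have hx1 : ‖x‖ = 1 := by simpa using hES hx
  have hy1 : ‖y‖ = 1 := by simpa using hES hy
  have hdl := dl_pos j
  have hdi := dl_pos i
  have hr0 : 0 < √(dl j) := Real.sqrt_pos.2 hdl
  have hη0 : 0 < √(dl i) := Real.sqrt_pos.2 hdi
  have hr : (√(dl j) / 8) ^ 2 ≤ dl j / 64 := by
    rw [div_pow, Real.sq_sqrt hdl.le]; norm_num
  have hone : (1 : ℝ) ∈ Set.Icc (0 : ℝ) 1 := by simp
  have hmem : ∀ z : Cn n, ‖z‖ = 1 → ∀ z' ∈ nibox z z (√(dl j) / 8), z' ∈ ball 0 (1 + dl j / 4) :=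
    fun z hz z' hz' => mem_ball_of_mem_nibox hz hone hr (by rwa [one_smul])
  have hbd : ∀ z : Cn n, ‖z‖ = 1 → ∀ z' ∈ nibox z z (√(dl j) / 8), ‖scalePiece β f j z'‖ₑ ≤
      C₀ * twoPow (-(j * β)) * sumMax (radialDeriv β f) j z :=
    fun z hz z' hz' => hC₀ f hf z hz j 1 _ hone hr z' (by rwa [one_smul])
  have key : ‖wDeriv τ x γ (scalePiece β f j) x - wDeriv τ x γ
      (taylorPoly τ α (fun γ y => wDeriv τ y γ (scalePiece β f j) y) y) x‖ₑ ≤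
      ENNReal.ofReal (C₁ * 8 ^ (m + 1)) * (C₀ * twoPow (-(j * β)) *
        (sumMax (radialDeriv β f) j x + sumMax (radialDeriv β f) j y)) *
      ENNReal.ofReal ((√(dl i) ^ γ.order)⁻¹ *
        2 ^ (((j : ℝ) - i) / 2 * m + min 0 (((j : ℝ) - i) / 2))) := by
    refine enorm_le_of_norm_le (by positivity) (by positivity) fun hM => ?_
    refine (hC₁ x hx y hy γ hγ (scalePiece β f j) (√(dl i)) (√(dl j) / 8) _ hη0
      (sqrt_dl_le_one i) (by positivity) (by linarith [sqrt_dl_le_one j])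
      (by rwa [Real.sq_sqrt hdi.le])
      ((differentiableOn_scalePiece hβ hf j).mono (hmem x hx1))
      (fun z hz => norm_le_toReal_of_enorm_le hM ((hbd x hx1 z hz).trans
        (mul_le_mul_right le_self_add _)))
      ((differentiableOn_scalePiece hβ hf j).mono (hmem y hy1))
      (fun z hz => norm_le_toReal_of_enorm_le hM ((hbd y hy1 z hz).trans
        (mul_le_mul_right le_add_self _)))).trans ?_
    have h1 := pow_mul_min_sqrt_dl_le m i j
    calc _ ≤ C₁ * ENNReal.toReal _ * (√(dl i) ^ γ.order)⁻¹ * (8 ^ (m + 1) *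
          2 ^ (((j : ℝ) - i) / 2 * m + min 0 (((j : ℝ) - i) / 2))) := by gcongr
      _ = _ := by ring
  refine key.trans (le_of_eq ?_)
  have e1 : ENNReal.ofReal ((√(dl i) ^ γ.order)⁻¹ *
      2 ^ (((j : ℝ) - i) / 2 * m + min 0 (((j : ℝ) - i) / 2))) = twoPow (i * weight γ) *
      twoPow (((j : ℝ) - i) / 2 * m + min 0 (((j : ℝ) - i) / 2)) := by
    rw [ENNReal.ofReal_mul (by positivity), ofReal_inv_sqrt_dl_pow]
    rfl
  have e2 : twoPow (-(j * β)) * (twoPow (i * weight γ) *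
      twoPow (((j : ℝ) - i) / 2 * m + min 0 (((j : ℝ) - i) / 2))) =
      twoPow (i * (weight γ - β)) * scaleKernel β m i j := by
    simp only [scaleKernel, ← twoPow_add]
    congr 1; ring
  rw [e1]
  generalize sumMax (radialDeriv β f) j x + sumMax (radialDeriv β f) j y = A
  calc _ = ENNReal.ofReal (C₁ * 8 ^ (m + 1)) * C₀ * (twoPow (-(j * β)) * (twoPow (i * weight γ) *
      twoPow (((j : ℝ) - i) / 2 * m + min 0 (((j : ℝ) - i) / 2)))) * A := by ring
    _ = _ := by rw [e2]; ring

variable {μ : Measure (Cn n)} {K : Set (Cn n)} {s d : ℝ}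

/-- For j = i + e the kernel is 2^{-e(β-m/2)}, while v_i^{1/p} is at most a constant times
2^{e(n-d)/p} v_j^{1/p}. For i = j + e the kernel is 2^{e(β-(m+1)/2)} and v_i^{1/p} is at most a
constant times 2^{-e(n-s)/p} v_j^{1/p}. The two strict inequalities are precisely the condition that
both products decay exponentially, and θ is the smaller rate. -/
lemma IsRegular.exists_tsum_scaleKernel_le (h : IsRegular μ K s d) {p β : ℝ} (hp : 1 ≤ p) {m : ℕ}
    (hmd : (m : ℝ) / 2 < β - (n - d) / p) (hms : β - (n - s) / p < ((m : ℝ) + 1) / 2) :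
    ∃ C : ℝ≥0∞, C ≠ ∞ ∧ ∀ x ∈ K, ∀ u : ℕ → ℝ≥0∞,
      ∑' i, ballWeight μ i x * (∑' j, scaleKernel β m i j * u j) ^ p ≤
        C * ∑' j, ballWeight μ j x * u j ^ p := by
  have hp0 : 0 < p := by linarith
  have hpi : 0 ≤ p⁻¹ := by positivity
  obtain ⟨C₁, hC₁t, hC₁⟩ := h.exists_ballWeight_le
  obtain ⟨C₂, hC₂t, hC₂⟩ := h.exists_ballWeight_ge
  obtain ⟨θ, hθ0, hθ1, hθ2⟩ : ∃ θ : ℝ, 0 < θ ∧ θ ≤ β - (n - d) / p - m / 2 ∧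
      θ ≤ ((m : ℝ) + 1) / 2 - (β - (n - s) / p) :=
    ⟨min _ _, lt_min (sub_pos.2 hmd) (sub_pos.2 hms), min_le_left _ _, min_le_right _ _⟩
  have hCt : C₁ ^ p⁻¹ + C₂ ^ p⁻¹ ≠ ∞ := ENNReal.add_ne_top.2
    ⟨ENNReal.rpow_ne_top_of_nonneg hpi hC₁t, ENNReal.rpow_ne_top_of_nonneg hpi hC₂t⟩
  obtain ⟨C', hC't, hC'⟩ := exists_tsum_weight_kernel_le hθ0 hp hCt
  refine ⟨C', hC't, fun x hx u => hC' (fun i => ballWeight μ i x)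
    (fun i => h.ballWeight_ne_zero i x) (fun i => h.ballWeight_ne_top i hx)
    (scaleKernel β m) (fun i j => ?_) u⟩
  rcases le_total i j with hij | hij
  · obtain ⟨e, rfl⟩ := Nat.exists_eq_add_of_le hij
    have he : (0 : ℝ) ≤ e := Nat.cast_nonneg _
    have h1 := ENNReal.rpow_le_rpow (hC₂ x hx i e) hpi
    rw [ENNReal.mul_rpow_of_nonneg _ _ hpi, ENNReal.mul_rpow_of_nonneg _ _ hpi, twoPow_rpow] at h1
    have h2 : twoPow (e * (n - d) * p⁻¹) * scaleKernel β m i (i + e) ≤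
        twoPow (-(θ * |(i : ℝ) - ((i + e : ℕ) : ℝ)|)) := by
      rw [scaleKernel, ← twoPow_add]
      refine twoPow_mono ?_
      push_cast
      rw [show (i : ℝ) - (i + e) = -e by ring, show (i : ℝ) + e - i = e by ring, abs_neg,
        abs_of_nonneg he, min_eq_left (by positivity)]
      have h3 := mul_le_mul_of_nonneg_left hθ1 he
      rw [div_eq_mul_inv ((n : ℝ) - d) p] at h3
      nlinarith
    calc _ ≤ C₂ ^ p⁻¹ * twoPow (e * (n - d) * p⁻¹) * ballWeight μ (i + e) x ^ p⁻¹ *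
          scaleKernel β m i (i + e) := mul_le_mul_left h1 _
      _ = C₂ ^ p⁻¹ * (twoPow (e * (n - d) * p⁻¹) * scaleKernel β m i (i + e)) *
          ballWeight μ (i + e) x ^ p⁻¹ := by ring
      _ ≤ _ := by
          gcongr
          exact le_add_self
  · obtain ⟨e, rfl⟩ := Nat.exists_eq_add_of_le hij
    have he : (0 : ℝ) ≤ e := Nat.cast_nonneg _
    have h1 := ENNReal.rpow_le_rpow (hC₁ x hx j e) hpi
    rw [ENNReal.mul_rpow_of_nonneg _ _ hpi, ENNReal.mul_rpow_of_nonneg _ _ hpi, twoPow_rpow] at h1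
    have h2 : twoPow (-(e * (n - s)) * p⁻¹) * scaleKernel β m (j + e) j ≤
        twoPow (-(θ * |((j + e : ℕ) : ℝ) - j|)) := by
      rw [scaleKernel, ← twoPow_add]
      refine twoPow_mono ?_
      push_cast
      rw [show (j : ℝ) + e - j = e by ring, show (j : ℝ) - (j + e) = -e by ring,
        abs_of_nonneg he, min_eq_right (by linarith)]
      have h3 := mul_le_mul_of_nonneg_left hθ2 he
      rw [div_eq_mul_inv ((n : ℝ) - s) p] at h3
      nlinarith
    calc _ ≤ C₁ ^ p⁻¹ * twoPow (-(e * (n - s)) * p⁻¹) * ballWeight μ j x ^ p⁻¹ *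
          scaleKernel β m (j + e) j := mul_le_mul_left h1 _
      _ = C₁ ^ p⁻¹ * (twoPow (-(e * (n - s)) * p⁻¹) * scaleKernel β m (j + e) j) *
          ballWeight μ j x ^ p⁻¹ := by ring
      _ ≤ _ := by
          gcongr
          exact le_self_add

end

/-! ### Existence, remainders and measurability of the boundary jet -/

noncomputable section

open Metric

variable {n : ℕ}

/-! ### Boundary values -/

/-- The sum over all scales of the kernel against the local maximal functions. -/
def scaleSum (β : ℝ) (m : ℕ) (f : Cn n → ℂ) (i : ℕ) (x : Cn n) : ℝ≥0∞ :=
  ∑' j, scaleKernel β m i j * sumMax (radialDeriv β f) j x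

lemma measurable_scaleSum (β : ℝ) (m : ℕ) (f : Cn n → ℂ) (i : ℕ) :
    Measurable fun x => scaleSum β m f i x :=
  Measurable.tsum fun j => (measurable_sumMax _ j).const_mul _

lemma tendsto_smul_nhdsLT (x : Cn n) : Tendsto (fun r : ℝ => r • x) (𝓝[<] 1) (𝓝 x) := by
  have h : Tendsto (fun r : ℝ => r • x) (𝓝 1) (𝓝 ((1 : ℝ) • x)) :=
    (continuous_id.smul continuous_const).tendsto 1
  rw [one_smul] at h
  exact h.mono_left nhdsWithin_le_nhds

lemma wDeriv_eq_tsum_scalePiece {τ : Fin (n - 1) → Cn n → Cn n} {β : ℝ} (hβ : 0 < β)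
    {f : Cn n → ℂ} (hf : DifferentiableOn ℂ f (unitBall n)) (x : Cn n) (γ : MultiIndex n)
    {z : Cn n} (hz : z ∈ unitBall n) :
    wDeriv τ x γ f z = ∑' j, wDeriv τ x γ (scalePiece β f j) z := by
  simp only [wDeriv_eq_derivList]
  rw [derivList_congr isOpen_ball (fun z hz => tsum_scalePiece hβ hf hz) _ hz]
  refine (normallySummable_scalePiece hβ hf).derivList_tsum (fun j => ?_) _ hz
  exact (differentiableOn_scalePiece hβ hf j).mono (ball_subset_ball (by linarith [dl_pos j]))

variable {E : Set (Cn n)} {τ : Fin (n - 1) → Cn n → Cn n}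

/-- Each derivative of each piece is continuous across the sphere, and its values on the whole
radius to x are bounded by the j-th term of a convergent series. Dominated convergence therefore
allows r → 1 inside the sum over j. -/
lemma exists_hasSum_boundaryDeriv (hES : E ⊆ unitSphere n) (hτ : IsTangentFrame E τ)
    {α β : ℝ} (hβ : 0 < β) {m : ℕ} (hm : ∀ γ : MultiIndex n, weight γ < α ↔ γ.order ≤ m) :
    ∃ C : ℝ≥0∞, C ≠ ∞ ∧ ∀ (f : Cn n → ℂ), DifferentiableOn ℂ f (unitBall n) → ∀ x ∈ E,
      scaleSum β m f 0 x ≠ ∞ → ∀ γ ∈ indices n α,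
        Tendsto (fun r : ℝ => wDeriv τ x γ f (r • x)) (𝓝[<] (1 : ℝ))
          (𝓝 (boundaryDeriv τ f γ x)) ∧
        HasSum (fun j => wDeriv τ x γ (scalePiece β f j) x) (boundaryDeriv τ f γ x) ∧
        ‖boundaryDeriv τ f γ x‖ₑ ≤ C * scaleSum β m f 0 x := by
  obtain ⟨C, hCt, hC⟩ := exists_enorm_wDeriv_scalePiece_le hES hτ hβ hm
  refine ⟨C, hCt, fun f hf x hx hfin γ hγ => ?_⟩
  have hx1 : ‖x‖ = 1 := by simpa using hES hx
  obtain ⟨b, hb⟩ : ∃ b : ℕ → ℝ≥0∞,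
      ∀ j, b j = C * (scaleKernel β m 0 j * sumMax (radialDeriv β f) j x) := ⟨_, fun _ => rfl⟩
  have hbsum : ∑' j, b j = C * scaleSum β m f 0 x := by
    simp_rw [hb]; rw [ENNReal.tsum_mul_left]; rfl
  have hbt : ∑' j, b j ≠ ∞ := by rw [hbsum]; exact ENNReal.mul_ne_top hCt hfin
  have hle : ∀ ρ ∈ Set.Icc (0 : ℝ) 1, ∀ j, ‖wDeriv τ x γ (scalePiece β f j) (ρ • x)‖ₑ ≤ b j :=
    fun ρ hρ j => by rw [hb]; exact hC f hf x hx γ hγ j ρ hρ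
  have hle1 : ∀ j, ‖wDeriv τ x γ (scalePiece β f j) x‖ₑ ≤ b j := fun j => by
    simpa using hle 1 (by simp) j
  have hbj : ∀ j, b j ≠ ∞ := fun j => ENNReal.ne_top_of_tsum_ne_top hbt j
  have hsum : Summable fun j => wDeriv τ x γ (scalePiece β f j) x :=
    Summable.of_enorm (ne_top_of_le_ne_top hbt (ENNReal.tsum_le_tsum hle1))
  have hIoo : ∀ᶠ r : ℝ in 𝓝[<] 1, r ∈ Set.Ioo (0 : ℝ) 1 :=
    Ioo_mem_nhdsLT one_pos
  have hlim : Tendsto (fun r : ℝ => ∑' j, wDeriv τ x γ (scalePiece β f j) (r • x)) (𝓝[<] (1 : ℝ))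
      (𝓝 (∑' j, wDeriv τ x γ (scalePiece β f j) x)) := by
    refine tendsto_tsum_of_dominated_convergence (bound := fun j => (b j).toReal)
      (ENNReal.summable_toReal hbt) (fun j => ?_) ?_
    · have hd : DifferentiableOn ℂ (wDeriv τ x γ (scalePiece β f j)) (ball 0 (1 + dl j / 4)) := by
        rw [wDeriv_eq_derivList]
        exact derivList_differentiableOn isOpen_ball (differentiableOn_scalePiece hβ hf j) _
      have hxb : x ∈ ball (0 : Cn n) (1 + dl j / 4) := by
        rw [mem_ball_zero_iff, hx1]; linarith [dl_pos j]
      exact (hd.continuousOn.continuousAt (isOpen_ball.mem_nhds hxb)).tendsto.comp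
        (tendsto_smul_nhdsLT x)
    · filter_upwards [hIoo] with r hr j
      exact norm_le_toReal_of_enorm_le (hbj j) (hle r ⟨hr.1.le, hr.2.le⟩ j)
  have hlim' : Tendsto (fun r : ℝ => wDeriv τ x γ f (r • x)) (𝓝[<] (1 : ℝ))
      (𝓝 (∑' j, wDeriv τ x γ (scalePiece β f j) x)) := by
    refine hlim.congr' ?_
    filter_upwards [hIoo] with r hr
    refine (wDeriv_eq_tsum_scalePiece hβ hf x γ ?_).symm
    rw [mem_ball_zero_iff, norm_smul, hx1, mul_one, Real.norm_of_nonneg hr.1.le]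
    exact hr.2
  have heq : boundaryDeriv τ f γ x = ∑' j, wDeriv τ x γ (scalePiece β f j) x := hlim'.limUnder_eq
  refine ⟨by rwa [heq], by rw [heq]; exact hsum.hasSum, ?_⟩
  rw [heq, ← hbsum]
  exact enorm_tsum_le_tsum_enorm.trans (ENNReal.tsum_le_tsum hle1)

/-- Taylor polynomials depend linearly on the jet, and the jet of `f` is the sum of those of the
pieces, so the remainders add up. -/
lemma exists_enorm_remainder_boundaryDeriv_le (hn : 1 ≤ n) (hES : E ⊆ unitSphere n)
    (hτ : IsTangentFrame E τ) {α β : ℝ} (hβ : 0 < β) {m : ℕ}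
    (hm : ∀ γ : MultiIndex n, weight γ < α ↔ γ.order ≤ m) :
    ∃ C : ℝ≥0∞, C ≠ ∞ ∧ ∀ (f : Cn n → ℂ), DifferentiableOn ℂ f (unitBall n) → ∀ x ∈ E, ∀ y ∈ E,
      scaleSum β m f 0 x ≠ ∞ → scaleSum β m f 0 y ≠ ∞ → ∀ γ ∈ indices n α, ∀ i : ℕ,
      nidist x y ≤ 2 * dl i →
        ‖boundaryDeriv τ f γ x - wDeriv τ x γ (taylorPoly τ α (boundaryDeriv τ f) y) x‖ₑ ≤
          C * twoPow (i * (weight γ - β)) * (scaleSum β m f i x + scaleSum β m f i y) := by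
  obtain ⟨C₀, -, hC₀⟩ := exists_hasSum_boundaryDeriv hES hτ hβ hm
  obtain ⟨C, hCt, hC⟩ := exists_enorm_remainder_scalePiece_le hn hES hτ hβ hm
  refine ⟨C, hCt, fun f hf x hx y hy hfx hfy γ hγ i hxy => ?_⟩
  have hy1 : ‖y‖ = 1 := by simpa using hES hy
  have hT : HasSum (fun j => wDeriv τ x γ
      (taylorPoly τ α (fun γ y => wDeriv τ y γ (scalePiece β f j) y) y) x)
      (wDeriv τ x γ (taylorPoly τ α (boundaryDeriv τ f) y) x) := by
    simp only [wDeriv_eq_derivList τ x γ, derivList_taylorPoly hτ hy hy1]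
    exact hasSum_sum fun γ' hγ' => ((hC₀ f hf y hy hfy γ' hγ').2.1.mul_left _).mul_right _
  have hS := ((hC₀ f hf x hx hfx γ hγ).2.1.sub hT).tsum_eq
  rw [← hS]
  refine enorm_tsum_le_tsum_enorm.trans
    ((ENNReal.tsum_le_tsum fun j => hC f hf x hx y hy γ hγ i j hxy).trans (le_of_eq ?_))
  rw [ENNReal.tsum_mul_left]
  congr 1
  rw [scaleSum, scaleSum, ← ENNReal.tsum_add]
  simp_rw [mul_add]

lemma wDeriv_taylorPoly_self (hτ : IsTangentFrame E τ) {y : Cn n} (hy : y ∈ E) (hy1 : ‖y‖ = 1)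
    {α : ℝ} (F : MultiIndex n → Cn n → ℂ) {γ : MultiIndex n} (hγ : γ ∈ indices n α) :
    wDeriv τ y γ (taylorPoly τ α F y) y = F γ y := by
  have e : (MultiIndex.ofFun fun o => (indexList γ).count o) = γ := by
    simp only [count_indexList]; exact MultiIndex.ofFun_toFun γ
  have := derivList_taylorPoly_self hτ hy hy1 F (indexList γ) (by
    rw [e]; exact mem_indices.1 hγ)
  rw [e] at this
  rw [wDeriv_eq_derivList]
  exact this

/-! ### Measurability of the derivatives -/

/-- The directions depend on x only measurably. At each x the innermost derivative is expanded in
the standard coordinate directions, which leaves measurable coefficients and shorter lists of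
derivatives applied to fixed holomorphic functions. -/
lemma aestronglyMeasurable_derivList {μ : Measure (Cn n)} (hμ : ∀ᵐ x ∂μ, ‖x‖ = 1) {r : ℝ}
    (hr : r ∈ Set.Ioo (0 : ℝ) 1) (l : List (Cn n → Cn n)) (hl : ∀ v ∈ l, Measurable v) :
    ∀ g : Cn n → ℂ, DifferentiableOn ℂ g (unitBall n) →
      AEStronglyMeasurable (fun x => derivList (l.map fun v => v x) g (r • x)) μ := by
  have hball : ∀ x : Cn n, ‖x‖ = 1 → r • x ∈ unitBall n := fun x hx => by
    rw [mem_ball_zero_iff, norm_smul, hx, mul_one, Real.norm_of_nonneg hr.1.le]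
    exact hr.2
  induction l using List.reverseRecOn with
  | nil =>
    intro g hg
    have h1 : ContinuousOn (fun x : Cn n => g (r • x)) (unitSphere n) :=
      hg.continuousOn.comp (continuous_const_smul r).continuousOn
        fun x hx => hball x (mem_sphere_zero_iff_norm.1 hx)
    have h2 := h1.aestronglyMeasurable (μ := μ) isClosed_sphere.measurableSet
    rwa [Measure.restrict_eq_self_of_ae_mem
      (hμ.mono fun x hx => mem_sphere_zero_iff_norm.2 hx)] at h2
  | append_singleton l v ih =>
    intro g hg
    have hv : Measurable v := hl v (by simp)
    have hsum : AEStronglyMeasurable (fun x => ∑ i : Fin n, v x i *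
        derivList (l.map fun v => v x) (dirDeriv (EuclideanSpace.single i 1) g) (r • x)) μ := by
      refine Finset.aestronglyMeasurable_fun_sum _ fun i _ => ?_
      refine AEStronglyMeasurable.mul ?_ (ih (fun w hw => hl w (by simp [hw])) _
        (dirDeriv_differentiableOn isOpen_ball hg _))
      have : Measurable fun x => v x i := (EuclideanSpace.proj (𝕜 := ℂ) i).measurable.comp hv
      exact this.aestronglyMeasurable
    refine hsum.congr (hμ.mono fun x hx => ?_)
    have hdir : dirDeriv (v x) g = fun z => ∑ i : Fin n, v x i *
        dirDeriv (EuclideanSpace.single i 1) g z := by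
      funext z
      simp only [dirDeriv]
      have e : v x = ∑ i : Fin n, v x i • (EuclideanSpace.single i (1 : ℂ) : Cn n) := by
        have := (EuclideanSpace.basisFun (Fin n) ℂ).sum_repr (v x)
        simpa using this.symm
      conv_lhs => rw [e, map_sum]
      simp
    simp only [List.map_append, List.map_cons, List.map_nil]
    rw [derivList_append, derivList_cons, derivList_nil, hdir]
    exact (derivList_finset_sum Finset.univ (fun i => v x i) isOpen_ball
      (fun i _ => dirDeriv_differentiableOn isOpen_ball hg _) _ (hball x hx)).symm

lemma measurable_frameDir (hτ : IsTangentFrame E τ) (o : FrameIndex n) :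
    Measurable fun x => frameDir τ x o := by
  cases o with
  | none => exact measurable_neg
  | some j => exact hτ.measurable j

lemma aestronglyMeasurable_boundaryDeriv (hτ : IsTangentFrame E τ) {μ : Measure (Cn n)}
    (hμ : ∀ᵐ x ∂μ, ‖x‖ = 1) {f : Cn n → ℂ} (hf : DifferentiableOn ℂ f (unitBall n))
    {γ : MultiIndex n} (hlim : ∀ᵐ x ∂μ, Tendsto (fun r : ℝ => wDeriv τ x γ f (r • x))
      (𝓝[<] (1 : ℝ)) (𝓝 (boundaryDeriv τ f γ x))) :
    AEStronglyMeasurable (boundaryDeriv τ f γ) μ := by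
  obtain ⟨r, -, hr, hrlim⟩ := exists_seq_strictMono_tendsto' (zero_lt_one (α := ℝ))
  have hr1 : Tendsto r atTop (𝓝[<] (1 : ℝ)) :=
    tendsto_nhdsWithin_of_tendsto_nhds_of_eventually_within _ hrlim
      (Eventually.of_forall fun k => (hr k).2)
  refine aestronglyMeasurable_of_tendsto_ae atTop (f := fun k x => wDeriv τ x γ f (r k • x))
    (fun k => ?_) (hlim.mono fun x hx => hx.comp hr1)
  have := aestronglyMeasurable_derivList hμ (hr k)
    ((indexList γ).map fun o x => frameDir τ x o) (fun v hv => by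
      obtain ⟨o, -, rfl⟩ := List.mem_map.1 hv
      exact measurable_frameDir hτ o) f hf
  simp only [List.map_map] at this
  simp only [wDeriv_eq_derivList]
  exact this

end

/-! ### Integral estimates and the Besov integrand -/

noncomputable section

open Metric

variable {n : ℕ} {μ : Measure (Cn n)} {K : Set (Cn n)} {s d : ℝ}

/-! ### Integral estimates -/

lemma IsRegular.ae_mem (h : IsRegular μ K s d) : ∀ᵐ x ∂μ, x ∈ K := by
  rw [ae_iff]
  exact h.full

lemma IsRegular.lintegral_scaleSum_ne_top (h : IsRegular μ K s d) (hn : 1 ≤ n) (hs : s < n)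
    {p β : ℝ} (hp : 1 ≤ p) {m : ℕ} (hmd : (m : ℝ) / 2 < β - (n - d) / p)
    (hms : β - (n - s) / p < ((m : ℝ) + 1) / 2) {f : Cn n → ℂ} (hf : MemHardySobolev p β f) :
    ∫⁻ x, ∑' i, ballWeight μ i x * scaleSum β m f i x ^ p ∂μ ≠ ∞ := by
  have hp0 : 0 < p := by linarith
  obtain ⟨C₁, hC₁t, hC₁⟩ := h.exists_tsum_scaleKernel_le hp hmd hms
  obtain ⟨C₂, hC₂t, hC₂⟩ := h.exists_tsum_sumMax_le hs hp
  obtain ⟨C₃, hC₃t, hC₃⟩ := h.exists_tsum_localMax_le hn hs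
  have hg := differentiableOn_radialDeriv β hf.1
  have hen : ∫⁻ η : unitSphere n, radialMax (radialDeriv β f) η ^ p ∂sphereMeasure n ≠ ∞ :=
    ne_top_of_le_ne_top (ENNReal.mul_ne_top (by norm_num) hf.2.ne) (lintegral_radialMax_le hg hp0)
  have hloc := hC₃ _ hg p hp0
  rw [Measure.restrict_eq_self_of_ae_mem h.ae_mem] at hloc
  refine ne_top_of_le_ne_top (b := C₁ * C₂ * (C₃ *
    ∫⁻ η : unitSphere n, radialMax (radialDeriv β f) η ^ p ∂sphereMeasure n)) (by finiteness) ?_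
  calc _ ≤ ∫⁻ x, C₁ * C₂ * ∑' j, ENNReal.ofReal (dl j) ^ n * (μ (niball x (dl j)))⁻¹ *
        localMax (radialDeriv β f) j x ^ p ∂μ := by
        refine lintegral_mono_ae (h.ae_mem.mono fun x hx => ?_)
        rw [mul_assoc]
        exact (hC₁ x hx _).trans (mul_le_mul_right (hC₂ _ x hx) _)
    _ = C₁ * C₂ * ∫⁻ x, ∑' j, ENNReal.ofReal (dl j) ^ n * (μ (niball x (dl j)))⁻¹ *
        localMax (radialDeriv β f) j x ^ p ∂μ := lintegral_const_mul' _ _ (by finiteness)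
    _ ≤ _ := by gcongr

/-- Sum over the scales of `F i x / μ(B(x, 2^(-i)))` near the diagonal. -/
def diagSum (μ : Measure (Cn n)) (F : ℕ → Cn n → ℝ≥0∞) (q : Cn n × Cn n) : ℝ≥0∞ :=
  ∑' i, {q : Cn n × Cn n | nidist q.1 q.2 ≤ 2 * dl i}.indicator
    (fun q => F i q.1 * (μ (niball q.1 (dl i)))⁻¹) q

lemma le_diagSum (μ : Measure (Cn n)) (F : ℕ → Cn n → ℝ≥0∞) {x y : Cn n} {i : ℕ}
    (h : nidist x y ≤ 2 * dl i) : F i x * (μ (niball x (dl i)))⁻¹ ≤ diagSum μ F (x, y) := by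
  refine le_trans (le_of_eq ?_) (ENNReal.le_tsum i)
  rw [Set.indicator_of_mem (show (x, y) ∈ {q : Cn n × Cn n | nidist q.1 q.2 ≤ 2 * dl i} from h)]

lemma measurable_diagSum (μ : Measure (Cn n)) [SFinite μ] {F : ℕ → Cn n → ℝ≥0∞}
    (hF : ∀ i, Measurable (F i)) : Measurable (diagSum μ F) := by
  refine Measurable.tsum fun i => Measurable.indicator ?_ ?_
  · exact ((hF i).mul (measurable_measure_niball μ (dl i)).inv).comp measurable_fst
  · refine (isClosed_le ?_ continuous_const).measurableSet
    unfold nidist; fun_prop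

/-- Integrating first in y, the set d(x,y) ≤ 2·2^{-i} has measure at most Dμ(B(x,2^{-i})), which
cancels the reciprocal. -/
lemma IsRegular.exists_lintegral_diagSum_le (h : IsRegular μ K s d) : ∃ D : ℝ≥0∞, D ≠ ∞ ∧
    ∀ F : ℕ → Cn n → ℝ≥0∞,
      ∫⁻ q, diagSum μ F q ∂(μ.prod μ) ≤ D * ∫⁻ x, ∑' i, F i x ∂μ := by
  have := h.prob
  obtain ⟨D, hDt, hD⟩ := h.doubling 3 (by norm_num)
  refine ⟨D, hDt, fun F => (lintegral_prod_le _).trans ?_⟩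
  rw [← lintegral_const_mul' _ _ hDt]
  refine lintegral_mono_ae (h.ae_mem.mono fun x hx => ?_)
  have hx1 := h.norm_eq hx
  simp only [diagSum]
  have hclosed : ∀ i, MeasurableSet {y | nidist x y ≤ 2 * dl i} := fun i =>
    (isClosed_le (continuous_nidist_left x) continuous_const).measurableSet
  have e : ∀ i y, {q : Cn n × Cn n | nidist q.1 q.2 ≤ 2 * dl i}.indicator
      (fun q => F i q.1 * (μ (niball q.1 (dl i)))⁻¹) (x, y) =
      {y | nidist x y ≤ 2 * dl i}.indicator (fun _ => F i x * (μ (niball x (dl i)))⁻¹) y :=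
    fun i y => rfl
  simp_rw [e]
  rw [lintegral_tsum fun i => (measurable_const.indicator (hclosed i)).aemeasurable,
    ← ENNReal.tsum_mul_left]
  refine ENNReal.tsum_le_tsum fun i => ?_
  rw [lintegral_indicator_const (hclosed i)]
  have hdl := dl_pos i
  have h1 : μ {y | nidist x y ≤ 2 * dl i} ≤ D * μ (niball x (dl i)) := by
    refine (measure_mono fun y hy => ?_).trans
      (hD x hx x hx (dl i) hdl (by rw [nidist_self hx1]; positivity))
    have : nidist x y ≤ 2 * dl i := hy
    change nidist x y < 3 * dl i
    linarith
  calc _ ≤ F i x * (μ (niball x (dl i)))⁻¹ * (D * μ (niball x (dl i))) := mul_le_mul_right h1 _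
    _ = D * F i x * ((μ (niball x (dl i)))⁻¹ * μ (niball x (dl i))) := by ring
    _ ≤ _ := by
      rw [ENNReal.inv_mul_cancel (h.pos x hx _ hdl) (measure_ne_top _ _), mul_one]

lemma exists_dl_lt_le {t : ℝ} (h0 : 0 < t) (h2 : t ≤ 2) : ∃ i : ℕ, dl i < t ∧ t ≤ 2 * dl i := by
  have hex : ∃ i : ℕ, dl i < t := by
    obtain ⟨i, hi⟩ := exists_pow_lt_of_lt_one h0 (by norm_num : (1 / 2 : ℝ) < 1)
    exact ⟨i, hi⟩
  classical
  refine ⟨Nat.find hex, Nat.find_spec hex, ?_⟩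
  rcases hk : Nat.find hex with _ | k
  · simpa [dl] using h2
  · have := Nat.find_min hex (m := k) (by omega)
    rw [dl_succ]
    linarith [not_lt.1 this]

/-- The exponent may have either sign; the factor 2^{|e|} absorbs the ratio of at most 2 between t
and 2^{-i}. -/
lemma inv_ofReal_rpow_le {t : ℝ} {i : ℕ} (h1 : dl i < t) (h2 : t ≤ 2 * dl i) (e : ℝ) :
    (ENNReal.ofReal t ^ e)⁻¹ ≤ twoPow |e| * twoPow (i * e) := by
  rw [← twoPow_add]
  have hlow : twoPow (-(i : ℝ)) ≤ ENNReal.ofReal t := by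
    rw [← ofReal_dl]; exact ENNReal.ofReal_le_ofReal h1.le
  have hup : ENNReal.ofReal t ≤ twoPow (1 - i) := by
    refine (ENNReal.ofReal_le_ofReal h2).trans (le_of_eq ?_)
    rw [dl_eq_rpow, twoPow, Real.rpow_sub (by norm_num), Real.rpow_neg (by norm_num), Real.rpow_one,
      div_eq_mul_inv]
  rcases le_total 0 e with he | he
  · refine (ENNReal.inv_le_inv.2 (ENNReal.rpow_le_rpow hlow he)).trans ?_
    rw [twoPow_rpow, twoPow_inv]
    exact twoPow_mono (by nlinarith [abs_nonneg e])
  · rw [← ENNReal.rpow_neg]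
    refine (ENNReal.rpow_le_rpow hup (by linarith : 0 ≤ -e)).trans ?_
    rw [twoPow_rpow]
    exact twoPow_mono (by rw [abs_of_nonpos he]; nlinarith)

variable {E : Set (Cn n)} {τ : Fin (n - 1) → Cn n → Cn n}

lemma IsRegular.exists_besov_integrand_le (h : IsRegular μ K s d) (hKE : K ⊆ E) (hn : 1 ≤ n)
    (hES : E ⊆ unitSphere n) (hτ : IsTangentFrame E τ) {α β p : ℝ} (hβ : 0 < β) (hp : 1 ≤ p)
    (hα : α = β - (n - d) / p) {m : ℕ} (hm : ∀ γ : MultiIndex n, weight γ < α ↔ γ.order ≤ m)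
    {γ : MultiIndex n} (hγ : γ ∈ indices n α) :
    ∃ C : ℝ≥0∞, C ≠ ∞ ∧ ∀ (f : Cn n → ℂ), DifferentiableOn ℂ f (unitBall n) → ∀ x ∈ K, ∀ y ∈ K,
      scaleSum β m f 0 x ≠ ∞ → scaleSum β m f 0 y ≠ ∞ →
      ‖boundaryDeriv τ f γ x - wDeriv τ x γ (taylorPoly τ α (boundaryDeriv τ f) y) x‖ₑ ^ p
        / ENNReal.ofReal (nidist x y) ^ ((α - weight γ) * p - d) / muBracket μ x y ^ 2 ≤
      C * (diagSum μ (fun i x => ballWeight μ i x * scaleSum β m f i x ^ p) (x, y) +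
        diagSum μ (fun i x => ballWeight μ i x * scaleSum β m f i x ^ p) (y, x)) := by
  have := h.prob
  have hp0 : 0 < p := by linarith
  obtain ⟨C, hCt, hC⟩ := exists_enorm_remainder_boundaryDeriv_le hn hES hτ hβ hm
  obtain ⟨D, hDt, hD⟩ := h.doubling 2 (by norm_num)
  set e := (α - weight γ) * p - d with he
  have hct : C ^ p * 2 ^ (p - 1) * twoPow |e| ≠ ∞ :=
    ENNReal.mul_ne_top (ENNReal.mul_ne_top (ENNReal.rpow_ne_top_of_nonneg hp0.le hCt)
      (ENNReal.rpow_ne_top_of_nonneg (by linarith) (by norm_num))) (twoPow_ne_top _)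
  refine ⟨C ^ p * 2 ^ (p - 1) * twoPow |e| * (1 + D ^ 2), by finiteness, ?_⟩
  intro f hf x hx y hy hfx hfy
  have hx1 := h.norm_eq hx
  have hy1 := h.norm_eq hy
  -- On the diagonal the Taylor polynomial reproduces the jet at its own centre, so the numerator is
  -- 0.
  rcases (nidist_nonneg x y).eq_or_lt with h0 | h0
  · obtain rfl := nidist_eq_zero hx1.le hy1.le h0.symm
    rw [wDeriv_taylorPoly_self hτ (hKE hx) hx1 _ hγ, sub_self, enorm_zero,
      ENNReal.zero_rpow_of_pos hp0]
    simp
  have h2 : nidist x y ≤ 2 := by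
    refine (norm_sub_le _ _).trans ?_
    have := norm_inner_le_norm (𝕜 := ℂ) y x
    rw [hx1, hy1] at this
    rw [norm_one]
    linarith
  obtain ⟨i, hi1, hi2⟩ := exists_dl_lt_le h0 h2
  have hnum := hC f hf x (hKE hx) y (hKE hy) hfx hfy γ hγ i hi2
  have hinv := inv_ofReal_rpow_le hi1 hi2 e
  have hi2' : nidist y x ≤ 2 * dl i := by rwa [nidist_comm]
  have hdx := le_diagSum μ (fun i x => ballWeight μ i x * scaleSum β m f i x ^ p) hi2
  have hdy := le_diagSum μ (fun i x => ballWeight μ i x * scaleSum β m f i x ^ p) hi2'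
  -- The bracket μ[x,y] is centred at x; doubling moves the term containing y to balls centred at y,
  -- so that it becomes a `diagSum` at the swapped pair.
  have hdoub : μ (niball y (dl i)) ≤ D * μ (niball x (dl i)) :=
    (measure_mono (niball_mono y (by linarith [dl_pos i]))).trans (hD y hy x hx _ (dl_pos i) hi2')
  have hV : (μ (niball x (dl i)))⁻¹ ≤ D * (μ (niball y (dl i)))⁻¹ := by
    rw [← div_eq_mul_inv, ENNReal.le_div_iff_mul_le (Or.inl (h.pos y hy _ (dl_pos i)))
      (Or.inl (measure_ne_top _ _)), mul_comm, ← div_eq_mul_inv]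
    exact ENNReal.div_le_of_le_mul hdoub
  have hbr : (muBracket μ x y)⁻¹ ≤ (μ (niball x (dl i)))⁻¹ :=
    ENNReal.inv_le_inv.2 (measure_mono (niball_mono x hi1.le))
  -- The exponent of 2^i is (ω(γ)-β)p + (α-ω(γ))p - d = (α-β)p - d = -n by the choice of α. The
  -- order of γ drops out, and the natural weight appears.
  have hexp : twoPow (i * (weight γ - β)) ^ p * twoPow (i * e) = ENNReal.ofReal (dl i) ^ n := by
    rw [twoPow_rpow, ← twoPow_add, ofReal_dl, twoPow_pow, he, hα]
    congr 1
    field_simp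
    ring
  have hsum := ENNReal.rpow_add_le_mul_rpow_add_rpow (scaleSum β m f i x) (scaleSum β m f i y) hp
  simp only [ballWeight] at hdx hdy ⊢
  generalize scaleSum β m f i x = a at *
  generalize scaleSum β m f i y = b at *
  generalize diagSum μ _ (x, y) = Φ at *
  generalize diagSum μ _ (y, x) = Ψ at *
  generalize (μ (niball x (dl i)))⁻¹ = V at *
  generalize (μ (niball y (dl i)))⁻¹ = W at *
  rw [div_eq_mul_inv, div_eq_mul_inv, ENNReal.inv_pow]
  calc _ ≤ (C * twoPow (i * (weight γ - β)) * (a + b)) ^ p * (twoPow |e| * twoPow (i * e)) *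
        V ^ 2 := by gcongr
    _ = C ^ p * twoPow |e| * (twoPow (i * (weight γ - β)) ^ p * twoPow (i * e)) * (a + b) ^ p *
        V ^ 2 := by
      rw [ENNReal.mul_rpow_of_nonneg _ _ hp0.le, ENNReal.mul_rpow_of_nonneg _ _ hp0.le]
      ring
    _ ≤ C ^ p * twoPow |e| * ENNReal.ofReal (dl i) ^ n * (2 ^ (p - 1) * (a ^ p + b ^ p)) *
        V ^ 2 := by
      rw [hexp]; gcongr
    _ = C ^ p * 2 ^ (p - 1) * twoPow |e| * (ENNReal.ofReal (dl i) ^ n * V * a ^ p * V +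
        ENNReal.ofReal (dl i) ^ n * V * b ^ p * V) := by ring
    _ ≤ C ^ p * 2 ^ (p - 1) * twoPow |e| * (Φ + ENNReal.ofReal (dl i) ^ n * (D * W) * b ^ p *
        (D * W)) := by gcongr
    _ = C ^ p * 2 ^ (p - 1) * twoPow |e| * (Φ + D ^ 2 * (ENNReal.ofReal (dl i) ^ n * W * b ^ p *
        W)) := by ring
    _ ≤ C ^ p * 2 ^ (p - 1) * twoPow |e| * ((1 + D ^ 2) * Φ + (1 + D ^ 2) * Ψ) := by
      gcongr
      · exact le_mul_of_one_le_left (zero_le) le_self_add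
      · exact le_add_self
    _ = _ := by ring

/-- Since 2ω(γ) is an integer, the condition ω(γ) < α is 2ω(γ) ≤ m with m = ⌈2α⌉ - 1. -/
lemma exists_order_le_iff {α : ℝ} (hα : 0 < α) : ∃ m : ℕ,
    (∀ γ : MultiIndex n, weight γ < α ↔ γ.order ≤ m) ∧ (m : ℝ) / 2 < α ∧ α ≤ ((m : ℝ) + 1) / 2 := by
  have h1 : 0 < ⌈2 * α⌉₊ := Nat.ceil_pos.2 (by linarith)
  obtain ⟨m, hm⟩ : ∃ m, ⌈2 * α⌉₊ = m + 1 := ⟨⌈2 * α⌉₊ - 1, by omega⟩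
  refine ⟨m, fun γ => ?_, ?_, ?_⟩
  · have h2 : γ.order < ⌈2 * α⌉₊ ↔ (γ.order : ℝ) < 2 * α := Nat.lt_ceil
    rw [order_eq_weight, hm, Nat.lt_succ_iff] at h2
    rw [h2]
    constructor <;> intro h <;> linarith
  · have : (m : ℝ) < 2 * α := Nat.lt_ceil.1 (by omega)
    linarith
  · have := Nat.le_ceil (2 * α)
    rw [hm] at this
    push_cast at this
    linarith

lemma weight_nonneg (γ : MultiIndex n) : 0 ≤ weight γ := by
  unfold weight
  positivity

end

end HardySobolev

/-! ### Assembly of the estimates -/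

theorem theorem3 {n : ℕ} (hn : 1 ≤ n) (p β : ℝ) (hp : 1 ≤ p) (hβ : 0 < β)
    (E : Set (Cn n)) (hE : IsClosed E) (hES : E ⊆ unitSphere n) (hEn : upperDim E < n)
    (hhalf : ∀ k : ℤ, (k : ℝ) / 2 ∉
      Set.Icc (β - (n - lowerDim E) / p) (β - (n - upperDim E) / p))
    (s d : ℝ) (hsn : s < n) (hs : upperDim E ≤ s) (hd : d ≤ lowerDim E)
    (hhalf' : ∀ k : ℤ, (k : ℝ) / 2 ∉ Set.Icc (β - (n - d) / p) (β - (n - s) / p))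
    (μ : Measure (Cn n)) (hU : MemU E s μ) (hL : MemL E d μ)
    (τ : Fin (n - 1) → Cn n → Cn n) (hτ : IsTangentFrame E τ)
    (α : ℝ) (hα : α = β - (n - d) / p)
    (f : Cn n → ℂ) (hf : MemHardySobolev p β f) :
    (∀ γ : MultiIndex n, weight γ < α → ∀ᵐ ζ ∂μ,
      Tendsto (fun r : ℝ => wDeriv τ ζ γ f (r • ζ)) (𝓝[<] (1 : ℝ))
        (𝓝 (boundaryDeriv τ f γ ζ))) ∧
    MemBesov E τ p α d μ (boundaryDeriv τ f) := by
  -- For α ≤ 0 no multi-index has weight below α and every claim is vacuous.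
  rcases le_or_gt α 0 with hα0 | hα0
  · have hnone : ∀ γ : MultiIndex n, ¬ weight γ < α := fun γ h =>
      absurd (weight_nonneg γ) (by linarith)
    have hempty : indices n α = ∅ := Finset.eq_empty_of_forall_notMem fun γ hγ =>
      hnone γ (mem_indices.1 hγ)
    refine ⟨fun γ hγ => absurd hγ (hnone γ), ?_, ?_⟩
    · simp [hempty]
    · simp [besovEnergy, hempty]
  have hp0 : 0 < p := by linarith
  obtain ⟨K, hKE, h⟩ := exists_isRegular hE hES hU hL
  have := h.prob
  obtain ⟨m, hm, hmα, hαm⟩ := exists_order_le_iff (n := n) hα0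
  have hmd : (m : ℝ) / 2 < β - (n - d) / p := hα ▸ hmα
  -- Otherwise (m+1)/2, which is at least α, would be a half-integer in the forbidden interval.
  have hms : β - (n - s) / p < ((m : ℝ) + 1) / 2 := by
    by_contra hle
    refine hhalf' (m + 1) ⟨?_, ?_⟩ <;> push_cast
    · rw [← hα]; exact hαm
    · exact not_lt.1 hle
  have hInt := h.lintegral_scaleSum_ne_top hn hsn hp hmd hms hf
  have hmeas : ∀ i, Measurable fun x => ballWeight μ i x * scaleSum β m f i x ^ p := fun i =>
    (measurable_ballWeight μ i).mul ((measurable_scaleSum β m f i).pow_const p)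
  -- The term i = 0 of the integrable sum carries a nonzero weight, so the sum `scaleSum` at scale 0
  -- is finite almost everywhere.
  have hgood : ∀ᵐ x ∂μ, x ∈ K ∧ scaleSum β m f 0 x ≠ ∞ := by
    filter_upwards [h.ae_mem, ae_lt_top (Measurable.tsum hmeas) hInt] with x hx hlt
    refine ⟨hx, fun htop => ?_⟩
    have h1 := (ENNReal.le_tsum (f := fun i => ballWeight μ i x * scaleSum β m f i x ^ p) 0).trans_lt
      hlt
    simp only [htop, ENNReal.top_rpow_of_pos hp0,
      ENNReal.mul_top (h.ballWeight_ne_zero 0 x), lt_self_iff_false] at h1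
  obtain ⟨C, hCt, hC⟩ := exists_hasSum_boundaryDeriv hES hτ hβ hm
  have hlim : ∀ γ ∈ indices n α, ∀ᵐ ζ ∂μ,
      Tendsto (fun r : ℝ => wDeriv τ ζ γ f (r • ζ)) (𝓝[<] (1 : ℝ))
        (𝓝 (boundaryDeriv τ f γ ζ)) := fun γ hγ =>
    hgood.mono fun x hx => (hC f hf.1 x (hKE hx.1) hx.2 γ hγ).1
  refine ⟨fun γ hγ => hlim γ (mem_indices.2 hγ), fun γ hγ =>
    aestronglyMeasurable_boundaryDeriv hτ (h.ae_mem.mono fun x hx => h.norm_eq hx) hf.1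
      (hlim γ hγ), ?_⟩
  refine ENNReal.add_lt_top.2 ⟨ENNReal.sum_lt_top.2 fun γ hγ => ?_,
    ENNReal.sum_lt_top.2 fun γ hγ => ?_⟩
  · refine (setLIntegral_le_lintegral _ _).trans_lt ?_
    refine (lintegral_mono_ae (g := fun x => C ^ p *
      ∑' i, ballWeight μ i x * scaleSum β m f i x ^ p) (hgood.mono fun x hx => ?_)).trans_lt ?_
    · refine (ENNReal.rpow_le_rpow (hC f hf.1 x (hKE hx.1) hx.2 γ hγ).2.2 hp0.le).trans ?_
      rw [ENNReal.mul_rpow_of_nonneg _ _ hp0.le]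
      refine mul_le_mul_right (le_trans ?_ (ENNReal.le_tsum 0)) _
      -- The weight at scale 0 is 1/μ(B(x,1)) ≥ 1, since μ is a probability measure.
      refine le_mul_of_one_le_left zero_le ?_
      simp only [ballWeight, dl, pow_zero, ENNReal.ofReal_one, one_pow, one_mul]
      exact ENNReal.one_le_inv.2 prob_le_one
    · have hCp : C ^ p ≠ ∞ := ENNReal.rpow_ne_top_of_nonneg hp0.le hCt
      rw [lintegral_const_mul' _ _ hCp]
      exact ENNReal.mul_lt_top hCp.lt_top hInt.lt_top
  · obtain ⟨C', hC't, hC'⟩ := h.exists_besov_integrand_le hKE hn hES hτ hβ hp hα hm hγ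
    obtain ⟨D, hDt, hD⟩ := h.exists_lintegral_diagSum_le
    refine (setLIntegral_le_lintegral _ _).trans_lt ?_
    obtain ⟨Φ, hΦ⟩ : ∃ Φ, Φ = diagSum μ fun i x => ballWeight μ i x * scaleSum β m f i x ^ p :=
      ⟨_, rfl⟩
    have hΦm : Measurable Φ := hΦ ▸ measurable_diagSum μ hmeas
    have hΦt : ∫⁻ q, Φ q ∂(μ.prod μ) ≠ ∞ := by
      rw [hΦ]
      exact ne_top_of_le_ne_top (ENNReal.mul_ne_top hDt hInt) (hD _)
    have hgood2 : ∀ᵐ q ∂(μ.prod μ), (q.1 ∈ K ∧ scaleSum β m f 0 q.1 ≠ ∞) ∧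
        (q.2 ∈ K ∧ scaleSum β m f 0 q.2 ≠ ∞) :=
      (Measure.quasiMeasurePreserving_fst.ae hgood).and
        (Measure.quasiMeasurePreserving_snd.ae hgood)
    -- The bound is symmetric under exchange of the two points, and so is μ × μ; both terms
    -- therefore have the same integral.
    refine (lintegral_mono_ae (g := fun q => C' * (Φ q + Φ q.swap))
      (hgood2.mono fun q hq => ?_)).trans_lt ?_
    · rw [hΦ]
      exact hC' f hf.1 q.1 hq.1.1 q.2 hq.2.1 hq.1.2 hq.2.2
    · rw [lintegral_const_mul' _ _ hC't, lintegral_add_left hΦm, lintegral_prod_swap]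
      exact ENNReal.mul_lt_top hC't.lt_top (ENNReal.add_lt_top.2 ⟨hΦt.lt_top, hΦt.lt_top⟩)
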